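/- **Setting.** Let $q\in\mathbb C$ be transcendental (over $\mathbb Q$), and let $G_q$ be one of the quantum groups $GL_q(N)$, $SL_q(N)$ ($N\ge 2$), $O_q(N)$, $SO_q(N)$, $Sp_q(N)$ ($N\ge 3$, $N$ even for $Sp$). Let $\mathcal A=\mathcal O(G_q)$ be its coordinate Hopf algebra in the sense of Faddeev–Reshetikhin–Takhtajan, with fundamental matrix $u=(u^i_j)_{i,j=1}^N$, matrix $\hat R$ (so $\hat R\,u_1u_2=u_1u_2\,\hat R$), coproduct $\Delta$, counit $\varepsilon$ and antipode $S$; in the orthogonal and symplectic cases let $C$ be the matrix with $uCu^tC^{-1}=1=Cu^tC^{-1}u$. Assume that $\mathcal A$ is cosemisimple. Let $D=\mathrm{diag}(d_i)$ with $d_i=q^{N+1-2i}$ for $GL,SL$ and $D=C^tC^{-1}$ otherwise, and let $\mathfrak s=\operatorname{tr}D$. A number $x\in\mathbb C$ is *admissible* if $x\neq0$ ($GL$), $x^N=q$ ($SL$), $x^2=1$ ($O$, $Sp$, and $SO$ with $N$ even), $x=1$ ($SO$ with $N$ odd). For admissible $x$ let $r_x$ be the universal $r$-form on $\mathcal A$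 with $r_x(u^i_j,u^k_l)=x^{-1}\hat R^{ki}_{jl}$. Repeated indices are summed, and $a_{(1)}\otimes a_{(2)}=\Delta(a)$. Fix admissible $x,y$ and put $z=xy$. For a Hopf bimodule write $\Delta_L(\rho)=\rho_{(-1)}\otimes\rho_{(0)}$ and $\Delta_R(\rho)=\rho_{(0)}\otimes\rho_{(1)}$ for its coactions, and $\omega\triangleleft a=S(a_{(1)})\,\omega\,a_{(2)}$. Let $\Gamma_\tau=\Gamma_{\tau,z}$, $\tau\in\{+,-\}$, be the Hopf bimodule over $\mathcal A$ whose space of left-coinvariant elements has the basis $\{\omega^\tau_{ij}\}_{i,j=1}^N$ with $$\Delta_R(\omega^+_{ij})=\omega^+_{kl}\otimes u^k_iS(u^j_l),\qquad \omega^+_{ij}\triangleleft a=r_y(u^k_i,a_{(1)})\,r_x(a_{(2)},u^j_l)\,\omega^+_{kl},$$ $$\Delta_R(\omega^-_{ij})=\omega^-_{kl}\otimes S^2(u^k_i)S(u^j_l),\qquad \omega^-_{ij}\triangleleft a=r_x(a_{(1)},S(u^k_i))\,r_y(S(u^j_l),a_{(2)})\,\omega^-_{kl}.$$ Let $\sigma$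 be the braiding of Hopf bimodules, $\sigma(\alpha\otimes_{\mathcal A}\beta)=\beta_{(0)}\otimes_{\mathcal A}(\alpha\triangleleft\beta_{(1)})$ for left-coinvariant $\alpha,\beta$. For $\pi\in S_k$ let $\sigma_\pi$ be the product of the $\sigma_{i}$ ($\sigma$ acting in the factors $i,i+1$ of $\Gamma_\tau^{\otimes k}$, tensor products over $\mathcal A$) along a reduced word of $\pi$, let $A_k=\sum_{\pi\in S_k}\mathrm{sgn}(\pi)\sigma_\pi$, and let $B_{i,j}$ be the sum of $\mathrm{sgn}(\pi)\sigma_\pi$ over those $\pi\in S_{i+j}$ with $\pi^{-1}(1)<\dots<\pi^{-1}(i)$ and $\pi^{-1}(i+1)<\dots<\pi^{-1}(i+j)$. Write $B^{\pm}_{i,j}$ for the operators built from $\sigma^{\pm1}$. Woronowicz' external algebra is $\Gamma_\tau^\wedge=\bigoplus_{k\ge0}\Gamma_\tau^{\wedge k}$, $\Gamma_\tau^{\wedge k}=\Gamma_\tau^{\otimes k}/\ker A_k$. Put $\omega_0^+=\sum_i\omega^+_{ii}$, $\omega^-_0=\sum_i d_i^{-1}\omega^-_{ii}$, and $\mathrm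 d_\tau\rho=\omega_0^\tau\wedge\rho-(-1)^k\rho\wedge\omega^\tau_0$ for $\rho\in\Gamma_\tau^{\wedge k}$. Let $g:\Gamma_\tau\otimes_{\mathcal A}\Gamma_{-\tau}\to\mathcal A$ ($\tau=\pm$) be the left $\mathcal A$-linear maps with $g(\omega^+_{ij},\omega^-_{kl})=D^j_k(D^{-1})^l_i$ and $g(\omega^-_{ij},\omega^+_{kl})=\delta_{jk}\delta_{il}$. For $\rho\in\Gamma_\tau^{\wedge k}$, $k\ge1$, put $$\langle\rho,\omega_0^{-\tau}\rangle^\pm=(\mathrm{id}\otimes g)\bigl(B^\pm_{k-1,1}\rho\otimes\omega_0^{-\tau}\bigr),\qquad \langle\omega_0^{-\tau},\rho\rangle^\pm=(g\otimes\mathrm{id})\bigl(\omega_0^{-\tau}\otimes B^\pm_{1,k-1}\rho\bigr),$$ $$\partial^\pm_\tau\rho=\langle\rho,\omega_0^{-\tau}\rangle^\pm+(-1)^k\langle\omega_0^{-\tau},\rho\rangle^\pm,\qquad \partial_\tau^\pm=0\ \text{on}\ \Gamma_\tau^{\wedge0}=\mathcal A .$$ The quantum Laplace–Beltrami operators on $\Gamma_\tau^{\wedge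 k}$ are $\Delta^\pm=-\mathrm d_\tau\partial^\pm_\tau+\partial^\pm_\tau\mathrm d_\tau$. Let $\widehat{\mathcal A}$ be the set of equivalence classes of irreducible (finite-dimensional) corepresentations $u^\lambda$ of $\mathcal A$, $\mathcal C(u^\lambda)\subseteq\mathcal A$ the span of the matrix elements of $u^\lambda$, $P^\lambda$ the projection of $\mathcal A=\bigoplus_{\lambda\in\widehat{\mathcal A}}\mathcal C(u^\lambda)$ (Peter–Weyl decomposition) onto $\mathcal C(u^\lambda)$, and $h^\lambda=\varepsilon\circ P^\lambda$. For a functional $f$ on $\mathcal A$ put $f*a=a_{(1)}f(a_{(2)})$. Let $X^\tau_{ij}$ be the functionals with $\omega_0^\tau\triangleleft a-\varepsilon(a)\omega_0^\tau=X^\tau_{ij}(a)\,\omega^\tau_{ij}$, and let $X_0^+=\mathfrak s^{-1}\sum_i d_i^{-1}X^+_{ii}$, $X_0^-=\mathfrak s^{-1}\sum_iX^-_{ii}$. Let $E^\tau_\lambda\in\mathbb C$ be the numbers determined by $\mathfrak s\,X_0^\tau*h^\lambda*a=E^\tau_\lambda\,h^\lambda*a$ for all $a\in\mathcal A$. **Proposition.**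 Let $\tau\in\{+,-\}$ and $\Gamma=\Gamma_\tau$. For $\lambda,\mu\in\widehat{\mathcal A}$ and $k\ge0$ let $$\Gamma^{\wedge k}(\lambda,\mu)=\{\rho\in\Gamma^{\wedge k}\mid \rho_{(-1)}\otimes\rho_{(0)}\otimes\rho_{(1)}\in\mathcal C(u^\lambda)\otimes\Gamma^{\wedge k}\otimes\mathcal C(u^\mu)\},$$ and let $h^{\lambda\mu}(\rho)=h^\lambda(\rho_{(-1)})\,\rho_{(0)}\,h^\mu(\rho_{(1)})$ for $\rho\in\Gamma^\wedge$. The numbers $E^{\pm}_\lambda$ exist, and: 1. $h^{\lambda\mu}$ maps $\Gamma^{\wedge k}$ into $\Gamma^{\wedge k}(\lambda,\mu)$ and restricts to the identity on $\Gamma^{\wedge k}(\lambda,\mu)$. 2. For each $\rho\in\Gamma^\wedge$ only finitely many $h^{\lambda\mu}(\rho)$ are nonzero, and $\rho=\sum_{\lambda,\mu\in\widehat{\mathcal A}}h^{\lambda\mu}(\rho)$. Moreover $\Gamma^\wedge=\bigoplus_{k\ge0}\bigoplus_{\lambda,\mu\in\widehat{\mathcal A}}\Gamma^{\wedge k}(\lambda,\mu)$.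 3. For all $\rho\in\Gamma^{\wedge k}(\lambda,\mu)$, $$\Delta^+\rho=(-1)^k\bigl(E^{-\tau}_\lambda+E^{\tau}_\mu\bigr)\rho,\qquad \Delta^-\rho=(-1)^k\bigl(E^{\tau}_\lambda+E^{-\tau}_\mu\bigr)\rho .$$ -/

import Mathlib

open scoped TensorProduct

noncomputable section

/-! ## Matrices with entries in a noncommutative algebra -/

/-- The matrix `u₁u₂` with entries `(u₁u₂)^{ij}_{kl} = u^i_k u^j_l`. -/
def pairMat {ι B : Type*} [Mul B] (u : Matrix ι ι B) : Matrix (ι × ι) (ι × ι) B :=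
  Matrix.of fun p r => u p.1 r.1 * u p.2 r.2

/-- The matrix `u^{⊗n}` with entries `u^{i₁}_{j₁} u^{i₂}_{j₂} ⋯ u^{iₙ}_{jₙ}`. -/
def tensorPow {ι B : Type*} [Monoid B] (u : Matrix ι ι B) (n : ℕ) :
    Matrix (Fin n → ι) (Fin n → ι) B :=
  Matrix.of fun I J => (List.ofFn fun a => u (I a) (J a)).prod

/-! ## The data of a quantum group -/

/-- The types of quantum groups under consideration. -/
inductive QKind
  | GL | SL | O | SO | Sp
  deriving DecidableEq

/-- The rank conditions: `N ≥ 2` in type A, `N ≥ 3` in types B, C, D, and `N` is even for `Sp`. -/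
def QKind.ValidRank : QKind → ℕ → Prop
  | .GL, N => 2 ≤ N
  | .SL, N => 2 ≤ N
  | .O, N => 3 ≤ N
  | .SO, N => 3 ≤ N
  | .Sp, N => 3 ≤ N ∧ Even N

/-- The quantum group `G_q` with `G = GL(N), SL(N), O(N), SO(N), Sp(N)` and `q` transcendental.
The chosen square root `sqrtq` of `q` enters only the `R`-matrix of the odd orthogonal groups. -/
structure QuantumGroup where
  kind : QKind
  N : ℕ
  q : ℂ
  sqrtq : ℂ
  sqrtq_sq : sqrtq ^ 2 = q
  transcendental_q : Transcendental ℚ q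
  validRank : kind.ValidRank N

namespace QuantumGroup

variable (G : QuantumGroup)

/-- Type A, that is, `GL` or `SL`. -/
def IsTypeA : Prop := G.kind = .GL ∨ G.kind = .SL

instance : Decidable G.IsTypeA := inferInstanceAs (Decidable (_ ∨ _))

/-- `ε = 1` in the orthogonal case and `ε = -1` in the symplectic case. -/
def eps : ℂ := if G.kind = .Sp then -1 else 1

/-- The signs `ε_i`: all equal to `1` in the orthogonal case; in the symplectic case `1` in the
first half and `-1` in the second half of the indices. -/
def epsAt (i : Fin G.N) : ℂ := if G.kind = .Sp ∧ G.N ≤ 2 * (i : ℕ) then -1 else 1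

/-- The integers `2ρ_i`. With indices counted from `1`, `ρ` is
`(n - 1/2, …, 1/2, 0, -1/2, …, -n + 1/2)` for `O(2n+1)`,
`(n - 1, …, 1, 0, 0, -1, …, -n + 1)` for `O(2n)` and `(n, …, 1, -1, …, -n)` for `Sp(2n)`. -/
def twoRho (i : Fin G.N) : ℤ :=
  if G.kind = .Sp then
    if 2 * (i : ℕ) < G.N then (G.N : ℤ) - 2 * (i : ℕ) else (G.N : ℤ) - 2 - 2 * (i : ℕ)
  else
    if 2 * (i : ℕ) + 1 < G.N then (G.N : ℤ) - 2 - 2 * (i : ℕ)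
    else if 2 * (i : ℕ) + 1 = G.N then 0
    else (G.N : ℤ) - 2 * (i : ℕ)

/-- The Faddeev-Reshetikhin-Takhtajan matrix `R`, with entries `R^{ab}_{mn}` (the coefficient of
`e_{am} ⊗ e_{bn}`). In type A,
`R = q ∑ e_ii ⊗ e_ii + ∑_{i ≠ j} e_ii ⊗ e_jj + (q - q⁻¹) ∑_{i > j} e_ij ⊗ e_ji`; in the types B, C
and D, with `i' = N + 1 - i`,
`R = ∑ q^{δ_ij - δ_ij'} e_ii ⊗ e_jj
  + (q - q⁻¹) ∑_{i > j} (e_ij ⊗ e_ji - ε_i ε_j q^{ρ_i - ρ_j} e_ij ⊗ e_i'j')`. -/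
def Rmat (a b m n : Fin G.N) : ℂ :=
  if G.IsTypeA then
    (if a = m ∧ b = n then (if a = b then G.q else 1) else 0)
      + (if m < a ∧ a = n ∧ b = m then G.q - G.q⁻¹ else 0)
  else
    (if a = m ∧ b = n then
        G.q ^ ((if a = b then 1 else 0 : ℤ) - (if a = b.rev then 1 else 0 : ℤ)) else 0)
      + (if m < a ∧ a = n ∧ b = m then G.q - G.q⁻¹ else 0)
      - (if m < a ∧ b = a.rev ∧ n = m.rev then
          (G.q - G.q⁻¹) * (G.epsAt a * G.epsAt m * G.sqrtq ^ (G.twoRho a - G.twoRho m)) else 0)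

/-- The matrix `R̂ = PR` (`P` the flip), with entries `R̂^{ij}_{mn} = R^{ji}_{mn}`. -/
def Rhat : Matrix (Fin G.N × Fin G.N) (Fin G.N × Fin G.N) ℂ :=
  Matrix.of fun p r => G.Rmat p.2 p.1 r.1 r.2

/-- The matrix `C` of the types B, C and D, with entries `C^i_j = ε_i q^{-ρ_i} δ_{ij'}`. -/
def Cmat : Matrix (Fin G.N) (Fin G.N) ℂ :=
  Matrix.of fun i j => if j = i.rev then G.epsAt i * G.sqrtq ^ (-G.twoRho i) else 0

/-- The `q`-antisymmetric tensor of type A: its component at `I` is `(-q)^{ℓ(I)}`, `ℓ(I)` being the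
number of inversions, if `I` is a permutation of the indices, and `0` otherwise. -/
def qEps (I : Fin G.N → Fin G.N) : ℂ :=
  ∏ a, ∏ b, if a < b then (if I a < I b then 1 else if I b < I a then -G.q else 0) else 1

/-- The covectors `φ` on `(ℂ^N)^{⊗N}` which are `q`-antisymmetric, i.e. `φ R̂_{a,a+1} = -q⁻¹ φ` for
all neighbouring tensor factors. (In the types A, B and D they form a one-dimensional space.) -/
def IsQAntisymmetric (φ : (Fin G.N → Fin G.N) → ℂ) : Prop :=
  ∀ a b : Fin G.N, (b : ℕ) = a + 1 → ∀ J : Fin G.N → Fin G.N,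
    ∑ m, ∑ n, φ (Function.update (Function.update J a m) b n) * G.Rhat (m, n) (J a, J b)
      = -G.q⁻¹ * φ J

/-- The defining relations of `𝒪(G_q)` for a matrix `u` and an element `t` (the inverse of the
quantum determinant in the case `GL`, and `t = 1` otherwise):
* `R̂ u₁u₂ = u₁u₂ R̂` in all cases;
* in type A, `D t = t D = 1` where `D` is the quantum determinant, written by means of the
  `q`-antisymmetric tensor (rows and columns): `∑_I ε_I u^I_J = D ε_J` and `∑_J u^I_J ε_J = D ε_I`;
  in particular `D = ∑_π (-q)^{ℓ(π)} u^{π(1)}_1 ⋯ u^{π(N)}_N`;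
* in the types B, C, D, `u C uᵗ = C` and `uᵗ C⁻¹ u = C⁻¹`, i.e. `u C uᵗ C⁻¹ = 1 = C uᵗ C⁻¹ u`;
* for `SO`, the quantum determinant is `1`, i.e. `u^{⊗N}` fixes the `q`-antisymmetric covectors. -/
inductive Rel {B : Type*} [Ring B] [Algebra ℂ B] (u : Matrix (Fin G.N) (Fin G.N) B) (t : B) :
    B → B → Prop
  | rtt (p r : Fin G.N × Fin G.N) :
      Rel u t ((G.Rhat.map (algebraMap ℂ B) * pairMat u) p r)
        ((pairMat u * G.Rhat.map (algebraMap ℂ B)) p r)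
  | t_eq_one (h : G.kind ≠ .GL) : Rel u t t 1
  | row_mul_t (h : G.IsTypeA) (J : Fin G.N → Fin G.N) :
      Rel u t ((∑ I, G.qEps I • tensorPow u G.N I J) * t) (algebraMap ℂ B (G.qEps J))
  | t_mul_row (h : G.IsTypeA) (J : Fin G.N → Fin G.N) :
      Rel u t (t * ∑ I, G.qEps I • tensorPow u G.N I J) (algebraMap ℂ B (G.qEps J))
  | col_mul_t (h : G.IsTypeA) (I : Fin G.N → Fin G.N) :
      Rel u t ((∑ J, G.qEps J • tensorPow u G.N I J) * t) (algebraMap ℂ B (G.qEps I))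
  | t_mul_col (h : G.IsTypeA) (I : Fin G.N → Fin G.N) :
      Rel u t (t * ∑ J, G.qEps J • tensorPow u G.N I J) (algebraMap ℂ B (G.qEps I))
  | metric (h : ¬ G.IsTypeA) (i j : Fin G.N) :
      Rel u t (∑ k, ∑ l, G.Cmat k l • (u i k * u j l)) (algebraMap ℂ B (G.Cmat i j))
  | metric' (h : ¬ G.IsTypeA) (k l : Fin G.N) :
      Rel u t (∑ i, ∑ j, G.Cmat⁻¹ i j • (u i k * u j l)) (algebraMap ℂ B (G.Cmat⁻¹ k l))
  | so_det (h : G.kind = .SO) (φ : (Fin G.N → Fin G.N) → ℂ) (hφ : G.IsQAntisymmetric φ)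
      (J : Fin G.N → Fin G.N) :
      Rel u t (∑ I, φ I • tensorPow u G.N I J) (algebraMap ℂ B (φ J))

/-- The generators: the entries of `u`, and `t`. -/
inductive Gen (N : ℕ)
  | u (i j : Fin N)
  | t

/-- The matrix of free generators. -/
def freeU : Matrix (Fin G.N) (Fin G.N) (FreeAlgebra ℂ (Gen G.N)) :=
  Matrix.of fun i j => FreeAlgebra.ι ℂ (Gen.u i j)

/-- The coordinate algebra `𝒪(G_q)`. -/
def Alg : Type := RingQuot (G.Rel G.freeU (FreeAlgebra.ι ℂ Gen.t))

instance : Ring G.Alg := inferInstanceAs (Ring (RingQuot _))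
instance : Algebra ℂ G.Alg := inferInstanceAs (Algebra ℂ (RingQuot _))

/-- The quotient map from the free algebra. -/
def toAlg : FreeAlgebra ℂ (Gen G.N) →ₐ[ℂ] G.Alg := RingQuot.mkAlgHom ℂ _

/-- The fundamental matrix `u = (u^i_j)`. -/
def u : Matrix (Fin G.N) (Fin G.N) G.Alg := Matrix.of fun i j => G.toAlg (FreeAlgebra.ι ℂ (Gen.u i j))

/-- The generator `t`. -/
def t : G.Alg := G.toAlg (FreeAlgebra.ι ℂ Gen.t)

end QuantumGroup

/-! ## The Hopf algebra structure of `𝒪(G_q)` -/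

set_option linter.unusedSectionVars false
set_option linter.unusedSimpArgs false

section MatrixLemmas

lemma tensorPow_zero {ι B : Type*} [Monoid B] (u : Matrix ι ι B) (I J : Fin 0 → ι) :
    tensorPow u 0 I J = 1 := by
  simp [tensorPow]

lemma tensorPow_succ {ι B : Type*} [Monoid B] (u : Matrix ι ι B) (n : ℕ)
    (I J : Fin (n + 1) → ι) :
    tensorPow u (n + 1) I J = u (I 0) (J 0) * tensorPow u n (Fin.tail I) (Fin.tail J) := by
  simp [tensorPow, List.ofFn_succ, Fin.tail]

lemma tensorPow_succ_last {ι B : Type*} [Monoid B] (u : Matrix ι ι B) (n : ℕ)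
    (I J : Fin (n + 1) → ι) :
    tensorPow u (n + 1) I J
      = tensorPow u n (Fin.init I) (Fin.init J) * u (I (Fin.last n)) (J (Fin.last n)) := by
  simp only [tensorPow, Matrix.of_apply]
  rw [List.ofFn_succ', List.concat_eq_append, List.prod_append, List.prod_singleton]
  rfl

lemma sum_cons {ι M : Type*} [Fintype ι] [AddCommMonoid M] (n : ℕ)
    (F : (Fin (n + 1) → ι) → M) :
    ∑ K, F K = ∑ a, ∑ K : Fin n → ι, F (Fin.cons a K) := by
  rw [← (Fin.consEquiv fun _ => ι).sum_comp, Fintype.sum_prod_type]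
  rfl

lemma sum_snoc {ι M : Type*} [Fintype ι] [AddCommMonoid M] (n : ℕ)
    (F : (Fin (n + 1) → ι) → M) :
    ∑ K, F K = ∑ a, ∑ K : Fin n → ι, F (Fin.snoc K a) := by
  rw [← (Fin.snocEquiv fun _ => ι).sum_comp, Fintype.sum_prod_type]
  rfl

lemma commute_tensorPow {ι B : Type*} [Monoid B] (u : Matrix ι ι B) (x : B)
    (h : ∀ i j, Commute x (u i j)) (n : ℕ) (I J : Fin n → ι) : Commute x (tensorPow u n I J) := by
  induction n with
  | zero => rw [tensorPow_zero]; exact Commute.one_right x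
  | succ n ih => rw [tensorPow_succ]; exact (h _ _).mul_right (ih _ _)

variable {ι B : Type*} [Fintype ι] [DecidableEq ι] [Ring B]

lemma tensorPow_mul (u u' : Matrix ι ι B) (h : ∀ i j k l, Commute (u i j) (u' k l)) (n : ℕ) :
    tensorPow (u * u') n = tensorPow u n * tensorPow u' n := by
  induction n with
  | zero =>
    ext I J
    simp [Matrix.mul_apply, tensorPow_zero]
  | succ n ih =>
    ext I J
    rw [tensorPow_succ, ih, Matrix.mul_apply, Matrix.mul_apply, Matrix.mul_apply, sum_cons,
      Finset.sum_mul]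
    refine Finset.sum_congr rfl fun a _ => ?_
    rw [Finset.mul_sum]
    refine Finset.sum_congr rfl fun K _ => ?_
    rw [tensorPow_succ u, tensorPow_succ u']
    simp only [Fin.cons_zero, Fin.tail_cons]
    have := commute_tensorPow u (u' a (J 0)) (fun i j => (h i j a (J 0)).symm) n (Fin.tail I) K
    rw [mul_assoc, ← mul_assoc (u' a (J 0)), this.eq]
    simp only [mul_assoc]

lemma pairMat_mul (u u' : Matrix ι ι B) (h : ∀ i j k l, Commute (u i j) (u' k l)) :
    pairMat (u * u') = pairMat u * pairMat u' := by
  ext p r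
  simp only [pairMat, Matrix.of_apply, Matrix.mul_apply, Fintype.sum_prod_type, Finset.sum_mul,
    Finset.mul_sum]
  rw [Finset.sum_comm]
  refine Finset.sum_congr rfl fun a _ => Finset.sum_congr rfl fun b _ => ?_
  rw [mul_assoc, ← mul_assoc (u' _ _), ← (h p.2 _ _ _).eq]
  simp only [mul_assoc]

lemma pairMat_one : pairMat (1 : Matrix ι ι B) = 1 := by
  ext ⟨a, b⟩ ⟨c, d⟩
  simp only [pairMat, Matrix.of_apply, Matrix.one_apply, Prod.mk.injEq]
  split_ifs <;> simp_all

lemma tensorPow_one (n : ℕ) : tensorPow (1 : Matrix ι ι B) n = 1 := by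
  induction n with
  | zero => ext I J; simp [tensorPow_zero, Matrix.one_apply, Subsingleton.elim I J]
  | succ n ih =>
    ext I J
    rw [tensorPow_succ, ih, Matrix.one_apply, Matrix.one_apply, Matrix.one_apply]
    have : I = J ↔ I 0 = J 0 ∧ Fin.tail I = Fin.tail J := by
      constructor
      · rintro rfl; exact ⟨rfl, rfl⟩
      · rintro ⟨h0, h1⟩
        rw [← Fin.cons_self_tail I, ← Fin.cons_self_tail J, h0, h1]
    by_cases h0 : I 0 = J 0 <;> by_cases h1 : Fin.tail I = Fin.tail J <;> simp [this, h0, h1]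

/-- The products of entries of `V`, in reversed order. -/
def revPow (V : Matrix ι ι B) (n : ℕ) : Matrix (Fin n → ι) (Fin n → ι) B :=
  (tensorPow (V.map MulOpposite.op) n).map MulOpposite.unop

/-- The reversed products of two entries of `V`. -/
def revPair (V : Matrix ι ι B) : Matrix (ι × ι) (ι × ι) B :=
  (pairMat (V.map MulOpposite.op)).map MulOpposite.unop

lemma tensorPow_mul_revPow (u V : Matrix ι ι B) (h : u * V = 1) (n : ℕ) :
    tensorPow u n * revPow V n = 1 := by
  induction n with
  | zero =>
    ext I J
    simp [Matrix.mul_apply, revPow, tensorPow_zero, Matrix.one_apply, Subsingleton.elim I J]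
  | succ n ih =>
    ext I J
    rw [Matrix.mul_apply, sum_cons, Finset.sum_comm]
    have key : ∀ K : Fin n → ι, ∀ a, tensorPow u (n + 1) I (Fin.cons a K) * revPow V (n + 1) (Fin.cons a K) J
        = u (I 0) a * (tensorPow u n (Fin.tail I) K * revPow V n K (Fin.tail J)) * V a (J 0) := by
      intro K a
      simp [revPow, tensorPow_succ, mul_assoc]
    simp only [key]
    rw [Finset.sum_comm]
    simp only [← Finset.sum_mul, ← Finset.mul_sum, ← Matrix.mul_apply, ih]
    have h' := congrFun (congrFun h (I 0)) (J 0)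
    rw [Matrix.mul_apply] at h'
    have : I = J ↔ I 0 = J 0 ∧ Fin.tail I = Fin.tail J := by
      constructor
      · rintro rfl; exact ⟨rfl, rfl⟩
      · rintro ⟨h0, h1⟩
        rw [← Fin.cons_self_tail I, ← Fin.cons_self_tail J, h0, h1]
    by_cases h1 : Fin.tail I = Fin.tail J
    · simp [Matrix.one_apply, this, h1, h']
    · simp [Matrix.one_apply, this, h1]

lemma revPow_mul_tensorPow (u V : Matrix ι ι B) (h : V * u = 1) (n : ℕ) :
    revPow V n * tensorPow u n = 1 := by
  induction n with
  | zero =>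
    ext I J
    simp [Matrix.mul_apply, revPow, tensorPow_zero, Matrix.one_apply, Subsingleton.elim I J]
  | succ n ih =>
    ext I J
    rw [Matrix.mul_apply, sum_cons, Finset.sum_comm]
    have key : ∀ K : Fin n → ι, ∀ a, revPow V (n + 1) I (Fin.cons a K) * tensorPow u (n + 1) (Fin.cons a K) J
        = revPow V n (Fin.tail I) K * (V (I 0) a * u a (J 0)) * tensorPow u n K (Fin.tail J) := by
      intro K a
      simp [revPow, tensorPow_succ, mul_assoc]
    simp only [key, ← Finset.sum_mul, ← Finset.mul_sum, ← Matrix.mul_apply, h]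
    have ih' := congrFun (congrFun ih (Fin.tail I)) (Fin.tail J)
    rw [Matrix.mul_apply] at ih'
    have : I = J ↔ I 0 = J 0 ∧ Fin.tail I = Fin.tail J := by
      constructor
      · rintro rfl; exact ⟨rfl, rfl⟩
      · rintro ⟨h0, h1⟩
        rw [← Fin.cons_self_tail I, ← Fin.cons_self_tail J, h0, h1]
    by_cases h1 : I 0 = J 0
    · simp [Matrix.one_apply, this, h1, ih']
    · simp [Matrix.one_apply, this, h1]

lemma pairMat_mul_revPair (u V : Matrix ι ι B) (h : u * V = 1) :
    pairMat u * revPair V = 1 := by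
  ext ⟨a, b⟩ ⟨c, d⟩
  have key : ∀ k l, pairMat u (a, b) (k, l) * revPair V (k, l) (c, d)
      = u a k * (u b l * V l d) * V k c := by
    intro k l; simp [pairMat, revPair, mul_assoc]
  simp only [Matrix.mul_apply, Fintype.sum_prod_type, key, ← Finset.sum_mul, ← Finset.mul_sum]
  simp only [← Matrix.mul_apply, h]
  have h' := congrFun (congrFun h a) c
  rw [Matrix.mul_apply] at h'
  by_cases h1 : b = d
  · simp [Matrix.one_apply, h1, h']
  · simp [Matrix.one_apply, h1]

lemma revPair_mul_pairMat (u V : Matrix ι ι B) (h : V * u = 1) :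
    revPair V * pairMat u = 1 := by
  ext ⟨a, b⟩ ⟨c, d⟩
  have key : ∀ k l, revPair V (a, b) (k, l) * pairMat u (k, l) (c, d)
      = V b l * (V a k * u k c) * u l d := by
    intro k l; simp [pairMat, revPair, mul_assoc]
  simp only [Matrix.mul_apply, Fintype.sum_prod_type, key]
  rw [Finset.sum_comm]
  simp only [← Finset.sum_mul, ← Finset.mul_sum]
  simp only [← Matrix.mul_apply, h]
  have h' := congrFun (congrFun h b) d
  rw [Matrix.mul_apply] at h'
  by_cases h1 : a = c
  · simp [Matrix.one_apply, h1, h']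
  · simp [Matrix.one_apply, h1]

end MatrixLemmas

section Vec

variable {κ B : Type*} [Fintype κ] [Ring B] [Algebra ℂ B]

lemma row_comp (φ : κ → ℂ) (M M' : Matrix κ κ B) (J : κ) :
    ∑ I, φ I • (M * M') I J = ∑ K, (∑ I, φ I • M I K) * M' K J := by
  simp only [Matrix.mul_apply, Finset.smul_sum, Finset.sum_mul, smul_mul_assoc]
  exact Finset.sum_comm

lemma col_comp (φ : κ → ℂ) (M M' : Matrix κ κ B) (I : κ) :
    ∑ J, φ J • (M * M') I J = ∑ K, M I K * ∑ J, φ J • M' K J := by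
  simp only [Matrix.mul_apply, Finset.smul_sum, Finset.mul_sum, mul_smul_comm]
  exact Finset.sum_comm

end Vec

namespace QuantumGroup

variable (G : QuantumGroup)

/-- The pair `(u, t)` satisfies the defining relations. -/
def Sat {B : Type*} [Ring B] [Algebra ℂ B] (u : Matrix (Fin G.N) (Fin G.N) B) (t : B) : Prop :=
  ∀ a b, G.Rel u t a b → a = b

variable {G}
variable {B : Type*} [Ring B] [Algebra ℂ B]

lemma metric_iff_row (u : Matrix (Fin G.N) (Fin G.N) B) (c : Matrix (Fin G.N) (Fin G.N) ℂ)
    (k l : Fin G.N) :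
    ∑ i, ∑ j, c i j • (u i k * u j l) = ∑ p : Fin G.N × Fin G.N, c p.1 p.2 • pairMat u p (k, l) := by
  rw [Fintype.sum_prod_type]; rfl

lemma metric_iff_col (u : Matrix (Fin G.N) (Fin G.N) B) (c : Matrix (Fin G.N) (Fin G.N) ℂ)
    (i j : Fin G.N) :
    ∑ k, ∑ l, c k l • (u i k * u j l) = ∑ p : Fin G.N × Fin G.N, c p.1 p.2 • pairMat u (i, j) p := by
  rw [Fintype.sum_prod_type]; rfl

lemma rel_map {B' : Type*} [Ring B'] [Algebra ℂ B'] (f : B →ₐ[ℂ] B')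
    {u : Matrix (Fin G.N) (Fin G.N) B} {t : B} {a b : B} (h : G.Rel u t a b) :
    G.Rel (u.map f) (f t) (f a) (f b) := by
  have hT : ∀ n I J, f (tensorPow u n I J) = tensorPow (u.map f) n I J := by
    intro n I J; simp [tensorPow, map_list_prod, List.map_ofFn, Function.comp_def]
  have hP : ∀ p r, f (pairMat u p r) = pairMat (u.map f) p r := by
    intro p r; simp [pairMat]
  cases h with
  | rtt p r =>
    have := Rel.rtt (G := G) (u := u.map f) (t := f t) p r
    simpa only [Matrix.mul_apply, map_sum, map_mul, hP, Matrix.map_apply, AlgHom.commutes] using this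
  | t_eq_one h => rw [map_one]; exact Rel.t_eq_one h
  | row_mul_t h J =>
    simpa only [map_sum, map_mul, map_smul, hT, AlgHom.commutes] using
      Rel.row_mul_t (u := u.map f) (t := f t) h J
  | t_mul_row h J =>
    simpa only [map_sum, map_mul, map_smul, hT, AlgHom.commutes] using
      Rel.t_mul_row (u := u.map f) (t := f t) h J
  | col_mul_t h J =>
    simpa only [map_sum, map_mul, map_smul, hT, AlgHom.commutes] using
      Rel.col_mul_t (u := u.map f) (t := f t) h J
  | t_mul_col h J =>
    simpa only [map_sum, map_mul, map_smul, hT, AlgHom.commutes] using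
      Rel.t_mul_col (u := u.map f) (t := f t) h J
  | metric h i j =>
    simpa only [map_sum, map_mul, map_smul, Matrix.map_apply, AlgHom.commutes] using
      Rel.metric (u := u.map f) (t := f t) h i j
  | metric' h i j =>
    simpa only [map_sum, map_mul, map_smul, Matrix.map_apply, AlgHom.commutes] using
      Rel.metric' (u := u.map f) (t := f t) h i j
  | so_det h φ hφ J =>
    simpa only [map_sum, map_mul, map_smul, hT, AlgHom.commutes] using
      Rel.so_det (u := u.map f) (t := f t) h φ hφ J

lemma Sat.mul {u u' : Matrix (Fin G.N) (Fin G.N) B} {t t' : B} (hu : G.Sat u t) (hu' : G.Sat u' t')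
    (h : ∀ i j k l, Commute (u i j) (u' k l)) (ht : ∀ i j, Commute t (u' i j))
    (ht' : ∀ i j, Commute t' (u i j)) (htt : Commute t t') : G.Sat (u * u') (t * t') := by
  have hT : ∀ n I J, Commute t (tensorPow u' n I J) := commute_tensorPow u' t ht
  have hT' : ∀ n I J, Commute t' (tensorPow u n I J) := commute_tensorPow u t' ht'
  intro a b hab
  cases hab with
  | rtt p r =>
    rw [pairMat_mul u u' h]
    have e1 : G.Rhat.map (algebraMap ℂ B) * pairMat u = pairMat u * G.Rhat.map (algebraMap ℂ B) := by
      ext p r; exact hu _ _ (.rtt p r)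
    have e2 : G.Rhat.map (algebraMap ℂ B) * pairMat u' = pairMat u' * G.Rhat.map (algebraMap ℂ B) := by
      ext p r; exact hu' _ _ (.rtt p r)
    rw [← Matrix.mul_assoc, e1, Matrix.mul_assoc, e2, Matrix.mul_assoc]
  | t_eq_one h => rw [hu _ _ (.t_eq_one h), hu' _ _ (.t_eq_one h), mul_one]
  | row_mul_t hA J =>
    rw [tensorPow_mul u u' h, row_comp, Finset.sum_mul]
    have : ∀ K, (∑ I, G.qEps I • tensorPow u G.N I K) * tensorPow u' G.N K J * (t * t')
        = (G.qEps K • tensorPow u' G.N K J) * t' := by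
      intro K
      rw [mul_assoc, ← mul_assoc _ t, ← (hT _ _ _).eq, ← mul_assoc, ← mul_assoc,
        hu _ _ (.row_mul_t hA K), ← Algebra.smul_def]
    simp only [this, ← Finset.sum_mul]
    exact hu' _ _ (.row_mul_t hA J)
  | t_mul_row hA J =>
    rw [tensorPow_mul u u' h, row_comp, Finset.mul_sum]
    have : ∀ K, (t * t') * ((∑ I, G.qEps I • tensorPow u G.N I K) * tensorPow u' G.N K J)
        = t' * (G.qEps K • tensorPow u' G.N K J) := by
      intro K
      rw [htt.eq, mul_assoc, ← mul_assoc t, hu _ _ (.t_mul_row hA K), ← Algebra.smul_def]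
    simp only [this, ← Finset.mul_sum]
    exact hu' _ _ (.t_mul_row hA J)
  | col_mul_t hA J =>
    rw [tensorPow_mul u u' h, col_comp, Finset.sum_mul]
    have : ∀ K, tensorPow u G.N J K * (∑ I, G.qEps I • tensorPow u' G.N K I) * (t * t')
        = (G.qEps K • tensorPow u G.N J K) * t := by
      intro K
      rw [htt.eq, mul_assoc, ← mul_assoc _ t', hu' _ _ (.col_mul_t hA K), ← Algebra.smul_def,
        mul_smul_comm, smul_mul_assoc]
    simp only [this, ← Finset.sum_mul]
    exact hu _ _ (.col_mul_t hA J)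
  | t_mul_col hA J =>
    rw [tensorPow_mul u u' h, col_comp, Finset.mul_sum]
    have : ∀ K, (t * t') * (tensorPow u G.N J K * (∑ I, G.qEps I • tensorPow u' G.N K I))
        = t * (G.qEps K • tensorPow u G.N J K) := by
      intro K
      rw [mul_assoc, ← mul_assoc t', (hT' _ _ _).eq, mul_assoc, hu' _ _ (.t_mul_col hA K),
        ← Algebra.commutes, ← Algebra.smul_def]
    simp only [this, ← Finset.mul_sum]
    exact hu _ _ (.t_mul_col hA J)
  | metric hA i j =>
    rw [metric_iff_col, pairMat_mul u u' h, col_comp]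
    have : ∀ K : Fin G.N × Fin G.N, ∑ p : Fin G.N × Fin G.N, G.Cmat p.1 p.2 • pairMat u' K p
        = algebraMap ℂ B (G.Cmat K.1 K.2) := by
      intro K; rw [← hu' _ _ (.metric hA K.1 K.2), metric_iff_col]
    simp only [this, ← Algebra.commutes (R := ℂ), ← Algebra.smul_def]
    rw [← metric_iff_col]; exact hu _ _ (.metric hA i j)
  | metric' hA i j =>
    rw [metric_iff_row, pairMat_mul u u' h, row_comp]
    have : ∀ K : Fin G.N × Fin G.N, ∑ p : Fin G.N × Fin G.N, G.Cmat⁻¹ p.1 p.2 • pairMat u p K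
        = algebraMap ℂ B (G.Cmat⁻¹ K.1 K.2) := by
      intro K; rw [← hu _ _ (.metric' hA K.1 K.2), metric_iff_row]
    simp only [this, ← Algebra.smul_def]
    rw [← metric_iff_row]; exact hu' _ _ (.metric' hA i j)
  | so_det hS φ hφ J =>
    rw [tensorPow_mul u u' h, row_comp]
    have : ∀ K, ∑ I, φ I • tensorPow u G.N I K = algebraMap ℂ B (φ K) :=
      fun K => hu _ _ (.so_det hS φ hφ K)
    simp only [this, ← Algebra.smul_def]
    exact hu' _ _ (.so_det hS φ hφ J)

lemma sat_one : G.Sat (1 : Matrix (Fin G.N) (Fin G.N) B) 1 := by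
  intro a b hab
  cases hab with
  | rtt p r => rw [pairMat_one, mul_one, one_mul]
  | t_eq_one h => rfl
  | row_mul_t hA J => simp [tensorPow_one, Matrix.one_apply, Algebra.algebraMap_eq_smul_one]
  | t_mul_row hA J => simp [tensorPow_one, Matrix.one_apply, Algebra.algebraMap_eq_smul_one]
  | col_mul_t hA J => simp [tensorPow_one, Matrix.one_apply, Algebra.algebraMap_eq_smul_one]
  | t_mul_col hA J => simp [tensorPow_one, Matrix.one_apply, Algebra.algebraMap_eq_smul_one]
  | metric hA i j =>
    rw [metric_iff_col, pairMat_one]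
    simp [Matrix.one_apply, Algebra.algebraMap_eq_smul_one]
  | metric' hA i j =>
    rw [metric_iff_row, pairMat_one]
    simp [Matrix.one_apply, Algebra.algebraMap_eq_smul_one]
  | so_det hS φ hφ J => simp [tensorPow_one, Matrix.one_apply, Algebra.algebraMap_eq_smul_one]

/-- If `V` is the inverse of `u` and `d` the inverse of `t`, then `(V, d)` satisfies the defining
relations in the opposite algebra. -/
lemma Sat.op {u V : Matrix (Fin G.N) (Fin G.N) B} {t d : B} (hu : G.Sat u t)
    (h1 : u * V = 1) (h2 : V * u = 1) (h3 : t * d = 1) (h4 : d * t = 1) :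
    G.Sat (V.map MulOpposite.op) (MulOpposite.op d) := by
  have hN1 := tensorPow_mul_revPow u V h1 G.N
  have hN2 := revPow_mul_tensorPow u V h2 G.N
  have hP1 := pairMat_mul_revPair u V h1
  have hP2 := revPair_mul_pairMat u V h2
  have hT : ∀ I J, tensorPow (V.map MulOpposite.op) G.N I J = MulOpposite.op (revPow V G.N I J) := by
    intro I J; rfl
  have hPm : ∀ I J, pairMat (V.map MulOpposite.op) I J = MulOpposite.op (revPair V I J) := by
    intro I J; rfl
  have row : ∀ {κ : Type} [Fintype κ] [DecidableEq κ] (φ : κ → ℂ) (M M' : Matrix κ κ B) (s : B),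
      M * M' = 1 → (∀ J, s * ∑ I, φ I • M I J = algebraMap ℂ B (φ J)) →
      ∀ J, ∑ I, φ I • M' I J = s * algebraMap ℂ B (φ J) := by
    intro κ _ _ φ M M' s hM hφ J
    have := row_comp φ M M' J
    have e : s * ∑ I, φ I • (M * M') I J = ∑ K, (s * ∑ I, φ I • M I K) * M' K J := by
      rw [this, Finset.mul_sum]; simp only [mul_assoc]
    rw [hM] at e
    simp only [hφ, ← Algebra.smul_def] at e
    rw [← e]
    simp [Matrix.one_apply, Algebra.algebraMap_eq_smul_one]
  have col : ∀ {κ : Type} [Fintype κ] [DecidableEq κ] (φ : κ → ℂ) (M M' : Matrix κ κ B) (s : B),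
      M' * M = 1 → (∀ I, (∑ J, φ J • M I J) * s = algebraMap ℂ B (φ I)) →
      ∀ I, ∑ J, φ J • M' I J = algebraMap ℂ B (φ I) * s := by
    intro κ _ _ φ M M' s hM hφ I
    have := col_comp φ M' M I
    have e : (∑ J, φ J • (M' * M) I J) * s = ∑ K, M' I K * ((∑ J, φ J • M K J) * s) := by
      rw [this, Finset.sum_mul]; simp only [mul_assoc]
    rw [hM] at e
    simp only [hφ, ← Algebra.commutes (R := ℂ), ← Algebra.smul_def] at e
    rw [← e]
    simp [Matrix.one_apply, Algebra.algebraMap_eq_smul_one]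
  intro a b hab
  cases hab with
  | rtt p r =>
    have e1 : G.Rhat.map (algebraMap ℂ B) * pairMat u = pairMat u * G.Rhat.map (algebraMap ℂ B) := by
      ext p r; exact hu _ _ (.rtt p r)
    have e2 : G.Rhat.map (algebraMap ℂ B) * revPair V = revPair V * G.Rhat.map (algebraMap ℂ B) := by
      calc _ = (revPair V * pairMat u) * G.Rhat.map (algebraMap ℂ B) * revPair V := by
            rw [hP2, one_mul]
        _ = revPair V * (G.Rhat.map (algebraMap ℂ B) * pairMat u) * revPair V := by
            rw [e1, Matrix.mul_assoc (revPair V)]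
        _ = _ := by
            rw [Matrix.mul_assoc, Matrix.mul_assoc, hP1, Matrix.mul_one]
    have e3 := congrFun (congrFun e2 p) r
    simp only [Matrix.mul_apply, Matrix.map_apply] at e3 ⊢
    apply MulOpposite.unop_injective
    simp only [Finset.unop_sum, MulOpposite.unop_mul, hPm, MulOpposite.unop_op,
      MulOpposite.algebraMap_apply, ← Algebra.commutes (R := ℂ)]
    simp only [← Algebra.commutes (R := ℂ)] at e3
    exact e3
  | t_eq_one h =>
    have := hu _ _ (.t_eq_one h)
    rw [this, mul_one] at h4
    rw [h4]; rfl
  | row_mul_t hA J =>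
    have e := row G.qEps _ _ t hN1 (fun J => hu _ _ (.t_mul_row hA J)) J
    apply MulOpposite.unop_injective
    simp only [Finset.unop_sum, MulOpposite.unop_mul, hT, MulOpposite.unop_op,
      MulOpposite.unop_smul, MulOpposite.algebraMap_apply, e, ← mul_assoc, h4, one_mul]
  | t_mul_row hA J =>
    have e := row G.qEps _ _ t hN1 (fun J => hu _ _ (.t_mul_row hA J)) J
    apply MulOpposite.unop_injective
    simp only [Finset.unop_sum, MulOpposite.unop_mul, hT, MulOpposite.unop_op,
      MulOpposite.unop_smul, MulOpposite.algebraMap_apply, e]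
    rw [← Algebra.commutes (R := ℂ), mul_assoc, h3, mul_one]
  | col_mul_t hA J =>
    have e := col G.qEps _ _ t hN2 (fun J => hu _ _ (.col_mul_t hA J)) J
    apply MulOpposite.unop_injective
    simp only [Finset.unop_sum, MulOpposite.unop_mul, hT, MulOpposite.unop_op,
      MulOpposite.unop_smul, MulOpposite.algebraMap_apply, e]
    rw [Algebra.commutes (R := ℂ), ← mul_assoc, h4, one_mul]
  | t_mul_col hA J =>
    have e := col G.qEps _ _ t hN2 (fun J => hu _ _ (.col_mul_t hA J)) J
    apply MulOpposite.unop_injective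
    simp only [Finset.unop_sum, MulOpposite.unop_mul, hT, MulOpposite.unop_op,
      MulOpposite.unop_smul, MulOpposite.algebraMap_apply, e, mul_assoc, h3, mul_one]
  | metric hA i j =>
    have e := col (fun p : Fin G.N × Fin G.N => G.Cmat p.1 p.2) _ _ 1 hP2
      (fun p => by rw [mul_one, ← metric_iff_col]; exact hu _ _ (.metric hA p.1 p.2)) (i, j)
    rw [metric_iff_col]
    apply MulOpposite.unop_injective
    simp only [Finset.unop_sum, hPm, MulOpposite.unop_op, MulOpposite.unop_smul,
      MulOpposite.algebraMap_apply]
    simpa only [mul_one] using e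
  | metric' hA i j =>
    have e := row (fun p : Fin G.N × Fin G.N => G.Cmat⁻¹ p.1 p.2) _ _ 1 hP1
      (fun p => by rw [one_mul, ← metric_iff_row]; exact hu _ _ (.metric' hA p.1 p.2)) (i, j)
    rw [metric_iff_row]
    apply MulOpposite.unop_injective
    simp only [Finset.unop_sum, hPm, MulOpposite.unop_op, MulOpposite.unop_smul,
      MulOpposite.algebraMap_apply]
    simpa only [one_mul] using e
  | so_det hS φ hφ J =>
    have e := row φ _ _ 1 hN1
      (fun p => by rw [one_mul]; exact hu _ _ (.so_det hS φ hφ p)) J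
    apply MulOpposite.unop_injective
    simp only [Finset.unop_sum, hT, MulOpposite.unop_op, MulOpposite.unop_smul,
      MulOpposite.algebraMap_apply]
    simpa only [one_mul] using e

end QuantumGroup

namespace QuantumGroup

section Inverse

variable (G : QuantumGroup)

lemma q_ne_zero : G.q ≠ 0 := by
  intro h
  apply G.transcendental_q
  rw [h]
  exact isAlgebraic_zero

lemma sqrtq_ne_zero : G.sqrtq ≠ 0 := by
  intro h
  apply G.q_ne_zero
  rw [← G.sqrtq_sq, h]; simp

lemma Cmat_mul_inv : G.Cmat * G.Cmat⁻¹ = 1 := by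
  apply Matrix.mul_nonsing_inv
  have hne : ∀ i, G.Cmat i i.rev ≠ 0 := by
    intro i
    simp only [Cmat, Matrix.of_apply, if_true]
    refine mul_ne_zero ?_ (zpow_ne_zero _ G.sqrtq_ne_zero)
    unfold epsAt; split_ifs <;> norm_num
  refine Matrix.isUnit_det_of_right_inverse
    (B := Matrix.of fun i k => if k = i.rev then (G.Cmat k i)⁻¹ else 0) ?_
  ext i k
  rw [Matrix.mul_apply, Finset.sum_eq_single i.rev]
  · by_cases h : k = i
    · subst h; simp [hne]
    · simp [h, Matrix.one_apply, Ne.symm h]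
  · intro b _ hb
    simp [Cmat, hb]
  · simp

lemma Cmat_inv_mul : G.Cmat⁻¹ * G.Cmat = 1 := mul_eq_one_comm.mp G.Cmat_mul_inv

lemma qEps_eq_zero {I : Fin G.N → Fin G.N} {a b : Fin G.N} (hab : a ≠ b) (h : I a = I b) :
    G.qEps I = 0 := by
  unfold qEps
  rcases lt_or_gt_of_ne hab with hl | hl
  · exact Finset.prod_eq_zero (Finset.mem_univ a)
      (Finset.prod_eq_zero (Finset.mem_univ b) (by simp [hl, h]))
  · exact Finset.prod_eq_zero (Finset.mem_univ b)
      (Finset.prod_eq_zero (Finset.mem_univ a) (by simp [hl, h]))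

lemma qEps_ne_zero {I : Fin G.N → Fin G.N} (h : Function.Injective I) : G.qEps I ≠ 0 := by
  unfold qEps
  refine Finset.prod_ne_zero_iff.mpr fun a _ => Finset.prod_ne_zero_iff.mpr fun b _ => ?_
  split_ifs with h1 h2 h3
  · exact one_ne_zero
  · exact neg_ne_zero.mpr G.q_ne_zero
  · exact absurd (h (le_antisymm (not_lt.mp h3) (not_lt.mp h2))) h1.ne
  · exact one_ne_zero

variable {B : Type*} [Ring B] [Algebra ℂ B]

/-- A version of Laplace expansion along the last index: a left inverse of `u`. -/
lemma exists_left_inverse_aux (N n : ℕ) (hn : N = n) (hN : 0 < N) (e : (Fin n → Fin N) → ℂ)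
    (h0 : ∀ I a b, a ≠ b → I a = I b → e I = 0) (h1 : ∀ I, Function.Injective I → e I ≠ 0)
    (u : Matrix (Fin N) (Fin N) B) (t : B)
    (h : ∀ J, t * ∑ I, e I • tensorPow u n I J = algebraMap ℂ B (e J)) :
    ∃ V : Matrix (Fin N) (Fin N) B, V * u = 1 := by
  obtain ⟨m, rfl⟩ : ∃ m, n = m + 1 := ⟨n - 1, by omega⟩
  subst hn
  refine ⟨Matrix.of fun k i => (e (Fin.snoc k.succAbove k))⁻¹ •
    (t * ∑ K : Fin m → Fin (m + 1), e (Fin.snoc K i) • tensorPow u m K k.succAbove), ?_⟩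
  ext k j
  have hk := h (Fin.snoc k.succAbove j)
  rw [sum_snoc] at hk
  simp only [tensorPow_succ_last, Fin.init_snoc, Fin.snoc_last] at hk
  rw [Matrix.mul_apply]
  simp only [Matrix.of_apply, smul_mul_assoc, ← Finset.smul_sum, mul_assoc, ← Finset.mul_sum,
    Finset.sum_mul]
  simp only [Finset.mul_sum, smul_mul_assoc] at hk ⊢
  rw [hk]
  by_cases hkj : k = j
  · subst hkj
    have : e (Fin.snoc k.succAbove k) ≠ 0 := by
      refine h1 _ ?_
      rw [Fin.snoc_injective_iff]
      refine ⟨Fin.succAbove_right_injective, ?_⟩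
      rintro ⟨x, hx⟩
      exact Fin.succAbove_ne _ _ hx
    simp [Algebra.algebraMap_eq_smul_one, this, smul_smul]
  · obtain ⟨x, hx⟩ := Fin.exists_succAbove_eq (Ne.symm hkj)
    have : e (Fin.snoc k.succAbove j) = 0 := by
      refine h0 _ (Fin.castSucc x) (Fin.last m) (Fin.castSucc_lt_last x).ne ?_
      simp only [Fin.snoc_castSucc, Fin.snoc_last, hx]
    simp [this, Matrix.one_apply, hkj]

/-- A version of Laplace expansion along the first index: a right inverse of `u`. -/
lemma exists_right_inverse_aux (N n : ℕ) (hn : N = n) (hN : 0 < N) (e : (Fin n → Fin N) → ℂ)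
    (h0 : ∀ I a b, a ≠ b → I a = I b → e I = 0) (h1 : ∀ I, Function.Injective I → e I ≠ 0)
    (u : Matrix (Fin N) (Fin N) B) (t : B)
    (h : ∀ I, (∑ J, e J • tensorPow u n I J) * t = algebraMap ℂ B (e I)) :
    ∃ V : Matrix (Fin N) (Fin N) B, u * V = 1 := by
  obtain ⟨m, rfl⟩ : ∃ m, n = m + 1 := ⟨n - 1, by omega⟩
  subst hn
  refine ⟨Matrix.of fun j k => (e (Fin.cons k k.succAbove))⁻¹ •
    ((∑ L : Fin m → Fin (m + 1), e (Fin.cons j L) • tensorPow u m k.succAbove L) * t), ?_⟩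
  ext i k
  have hk := h (Fin.cons i k.succAbove)
  rw [sum_cons] at hk
  simp only [tensorPow_succ, Fin.tail_cons, Fin.cons_zero] at hk
  rw [Matrix.mul_apply]
  simp only [Matrix.of_apply, mul_smul_comm, ← Finset.smul_sum]
  have e1 : ∑ x, u i x * ((∑ L : Fin m → Fin (m + 1),
      e (Fin.cons x L) • tensorPow u m k.succAbove L) * t)
      = algebraMap ℂ B (e (Fin.cons i k.succAbove)) := by
    rw [← hk, Finset.sum_mul]
    refine Finset.sum_congr rfl fun x _ => ?_
    rw [← mul_assoc, Finset.mul_sum]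
    simp only [mul_smul_comm]
  rw [e1]
  by_cases hkj : i = k
  · subst hkj
    have : e (Fin.cons i i.succAbove) ≠ 0 := by
      refine h1 _ ?_
      rw [Fin.cons_injective_iff]
      refine ⟨?_, Fin.succAbove_right_injective⟩
      rintro ⟨x, hx⟩
      exact Fin.succAbove_ne _ _ hx
    simp [Algebra.algebraMap_eq_smul_one, this, smul_smul]
  · obtain ⟨x, hx⟩ := Fin.exists_succAbove_eq hkj
    have : e (Fin.cons i k.succAbove) = 0 := by
      refine h0 _ 0 x.succ (Fin.succ_ne_zero x).symm ?_
      simp only [Fin.cons_zero, Fin.cons_succ, hx]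
    simp [this, Matrix.one_apply, hkj]

variable {G}

lemma N_pos : 0 < G.N := by
  have := G.validRank
  cases h : G.kind <;> rw [h] at this <;> simp only [QKind.ValidRank] at this <;> omega

lemma Sat.exists_inverse {u : Matrix (Fin G.N) (Fin G.N) B} {t : B} (hu : G.Sat u t) :
    ∃ V : Matrix (Fin G.N) (Fin G.N) B, u * V = 1 ∧ V * u = 1 := by
  by_cases hA : G.IsTypeA
  · obtain ⟨V, hV⟩ := exists_left_inverse_aux G.N G.N rfl N_pos G.qEps
      (fun I a b => G.qEps_eq_zero) (fun I => G.qEps_ne_zero) u t (fun J => hu _ _ (.t_mul_row hA J))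
    obtain ⟨W, hW⟩ := exists_right_inverse_aux G.N G.N rfl N_pos G.qEps
      (fun I a b => G.qEps_eq_zero) (fun I => G.qEps_ne_zero) u t (fun J => hu _ _ (.col_mul_t hA J))
    have : V = W := by
      calc V = V * (u * W) := by rw [hW, mul_one]
        _ = W := by rw [← mul_assoc, hV, one_mul]
    subst this
    exact ⟨V, hW, hV⟩
  · have c1 : G.Cmat.map (algebraMap ℂ B) * G.Cmat⁻¹.map (algebraMap ℂ B) = 1 := by
      rw [← Matrix.map_mul, G.Cmat_mul_inv]; simp [Matrix.map_one]
    have c2 : G.Cmat⁻¹.map (algebraMap ℂ B) * G.Cmat.map (algebraMap ℂ B) = 1 := by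
      rw [← Matrix.map_mul, G.Cmat_inv_mul]; simp [Matrix.map_one]
    have m1 : u * G.Cmat.map (algebraMap ℂ B) * u.transpose = G.Cmat.map (algebraMap ℂ B) := by
      ext i j
      have := hu _ _ (.metric hA i j)
      rw [Matrix.map_apply, ← this]
      simp only [Matrix.mul_apply, Finset.sum_mul, Matrix.map_apply, Matrix.transpose_apply]
      rw [Finset.sum_comm]
      refine Finset.sum_congr rfl fun k _ => Finset.sum_congr rfl fun l _ => ?_
      rw [← Algebra.commutes, Algebra.smul_def, mul_assoc]
    have m2 : u.transpose * G.Cmat⁻¹.map (algebraMap ℂ B) * u = G.Cmat⁻¹.map (algebraMap ℂ B) := by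
      ext i j
      have := hu _ _ (.metric' hA i j)
      rw [Matrix.map_apply, ← this]
      simp only [Matrix.mul_apply, Finset.sum_mul, Matrix.map_apply, Matrix.transpose_apply]
      rw [Finset.sum_comm]
      refine Finset.sum_congr rfl fun k _ => Finset.sum_congr rfl fun l _ => ?_
      rw [← Algebra.commutes, Algebra.smul_def, mul_assoc]
    refine ⟨G.Cmat.map (algebraMap ℂ B) * u.transpose * G.Cmat⁻¹.map (algebraMap ℂ B), ?_, ?_⟩
    · rw [← mul_assoc, ← mul_assoc, m1, c1]
    · rw [mul_assoc, mul_assoc, ← mul_assoc u.transpose, m2, c1]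

lemma Sat.exists_t_inverse {u : Matrix (Fin G.N) (Fin G.N) B} {t : B} (hu : G.Sat u t) :
    ∃ d : B, t * d = 1 ∧ d * t = 1 := by
  by_cases hA : G.kind = .GL
  · have hA' : G.IsTypeA := Or.inl hA
    have h1 := G.qEps_ne_zero (I := id) Function.injective_id
    refine ⟨(G.qEps id)⁻¹ • ∑ I, G.qEps I • tensorPow u G.N I id, ?_, ?_⟩
    · rw [mul_smul_comm, hu _ _ (.t_mul_row hA' id), Algebra.algebraMap_eq_smul_one, smul_smul,
        inv_mul_cancel₀ h1, one_smul]
    · rw [smul_mul_assoc, hu _ _ (.row_mul_t hA' id), Algebra.algebraMap_eq_smul_one, smul_smul,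
        inv_mul_cancel₀ h1, one_smul]
  · exact ⟨1, by rw [hu _ _ (.t_eq_one hA)]; simp⟩

end Inverse

end QuantumGroup

namespace QuantumGroup

section Hopf

variable {G : QuantumGroup}

lemma exists_rel_of_map {B B' : Type*} [Ring B] [Algebra ℂ B] [Ring B'] [Algebra ℂ B']
    (f : B →ₐ[ℂ] B') {u : Matrix (Fin G.N) (Fin G.N) B} {t : B} {a b : B'}
    (h : G.Rel (u.map f) (f t) a b) : ∃ a' b', G.Rel u t a' b' ∧ f a' = a ∧ f b' = b := by
  have hT : ∀ n I J, f (tensorPow u n I J) = tensorPow (u.map f) n I J := by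
    intro n I J; simp [tensorPow, map_list_prod, List.map_ofFn, Function.comp_def]
  have hP : ∀ p r, f (pairMat u p r) = pairMat (u.map f) p r := by
    intro p r; simp [pairMat]
  cases h with
  | rtt p r =>
    refine ⟨_, _, .rtt p r, ?_, ?_⟩ <;>
    simp only [Matrix.mul_apply, map_sum, map_mul, hP, Matrix.map_apply, AlgHom.commutes]
  | t_eq_one h => exact ⟨_, _, .t_eq_one h, rfl, map_one f⟩
  | row_mul_t h J =>
    refine ⟨_, _, .row_mul_t h J, ?_, ?_⟩ <;>
    simp only [map_sum, map_mul, map_smul, hT, AlgHom.commutes]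
  | t_mul_row h J =>
    refine ⟨_, _, .t_mul_row h J, ?_, ?_⟩ <;>
    simp only [map_sum, map_mul, map_smul, hT, AlgHom.commutes]
  | col_mul_t h J =>
    refine ⟨_, _, .col_mul_t h J, ?_, ?_⟩ <;>
    simp only [map_sum, map_mul, map_smul, hT, AlgHom.commutes]
  | t_mul_col h J =>
    refine ⟨_, _, .t_mul_col h J, ?_, ?_⟩ <;>
    simp only [map_sum, map_mul, map_smul, hT, AlgHom.commutes]
  | metric h i j =>
    refine ⟨_, _, .metric h i j, ?_, ?_⟩ <;>
    simp only [map_sum, map_mul, map_smul, Matrix.map_apply, AlgHom.commutes]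
  | metric' h i j =>
    refine ⟨_, _, .metric' h i j, ?_, ?_⟩ <;>
    simp only [map_sum, map_mul, map_smul, Matrix.map_apply, AlgHom.commutes]
  | so_det h φ hφ J =>
    refine ⟨_, _, .so_det h φ hφ J, ?_, ?_⟩ <;>
    simp only [map_sum, map_smul, hT, AlgHom.commutes]

lemma sat_u : G.Sat G.u G.t := by
  intro a b hab
  obtain ⟨a', b', h, rfl, rfl⟩ := exists_rel_of_map G.toAlg (u := G.freeU) hab
  exact RingQuot.mkAlgHom_rel ℂ h

lemma Sat.map {B B' : Type*} [Ring B] [Algebra ℂ B] [Ring B'] [Algebra ℂ B']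
    (f : B →ₐ[ℂ] B') {u : Matrix (Fin G.N) (Fin G.N) B} {t : B} (h : G.Sat u t) :
    G.Sat (u.map f) (f t) := by
  intro a b hab
  obtain ⟨a', b', h', rfl, rfl⟩ := exists_rel_of_map f hab
  rw [h _ _ h']

/-- The universal property of `𝒪(G_q)`. -/
def liftHom {B : Type*} [Ring B] [Algebra ℂ B] {u : Matrix (Fin G.N) (Fin G.N) B} {t : B}
    (h : G.Sat u t) : G.Alg →ₐ[ℂ] B :=
  RingQuot.liftAlgHom ℂ ⟨FreeAlgebra.lift ℂ fun g : Gen G.N =>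
      match g with
      | .u i j => u i j
      | .t => t, by
    intro a b hab
    have h1 := rel_map (FreeAlgebra.lift ℂ fun g : Gen G.N =>
      match g with
      | .u i j => u i j
      | .t => t) hab
    refine h _ _ ?_
    convert h1 using 1
    · ext i j; simp [freeU]
    · simp⟩

@[simp] lemma liftHom_u {B : Type*} [Ring B] [Algebra ℂ B] {u : Matrix (Fin G.N) (Fin G.N) B}
    {t : B} (h : G.Sat u t) (i j : Fin G.N) : liftHom h (G.u i j) = u i j := by
  simp only [liftHom, QuantumGroup.u, toAlg, Matrix.of_apply]
  erw [RingQuot.liftAlgHom_mkAlgHom_apply]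
  simp

@[simp] lemma liftHom_t {B : Type*} [Ring B] [Algebra ℂ B] {u : Matrix (Fin G.N) (Fin G.N) B}
    {t : B} (h : G.Sat u t) : liftHom h G.t = t := by
  simp only [liftHom, QuantumGroup.t, toAlg]
  erw [RingQuot.liftAlgHom_mkAlgHom_apply]
  simp

lemma algHom_ext {B : Type*} [Ring B] [Algebra ℂ B] {f g : G.Alg →ₐ[ℂ] B}
    (hu : ∀ i j, f (G.u i j) = g (G.u i j)) (ht : f G.t = g G.t) : f = g := by
  refine RingQuot.ringQuot_ext' (S := ℂ) f g ?_
  refine FreeAlgebra.hom_ext ?_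
  funext x
  cases x with
  | u i j => exact hu i j
  | t => exact ht

lemma alg_induction {p : G.Alg → Prop} (hu : ∀ i j, p (G.u i j)) (ht : p G.t)
    (hs : ∀ c : ℂ, p (algebraMap ℂ G.Alg c)) (ha : ∀ a b, p a → p b → p (a + b))
    (hm : ∀ a b, p a → p b → p (a * b)) (a : G.Alg) : p a := by
  obtain ⟨x, rfl⟩ := RingQuot.mkAlgHom_surjective ℂ _ a
  change p (G.toAlg x)
  induction x using FreeAlgebra.induction with
  | grade0 r => rw [AlgHom.commutes]; exact hs r
  | grade1 x => cases x with
    | u i j => exact hu i j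
    | t => exact ht
  | mul a b h1 h2 => rw [map_mul]; exact hm _ _ h1 h2
  | add a b h1 h2 => rw [map_add]; exact ha _ _ h1 h2

/-- The comultiplication, `Δ(u^i_j) = ∑_k u^i_k ⊗ u^k_j`, `Δ(t) = t ⊗ t`. -/
def comulHom (G : QuantumGroup) : G.Alg →ₐ[ℂ] G.Alg ⊗[ℂ] G.Alg :=
  liftHom (u := G.u.map (Algebra.TensorProduct.includeLeft (R := ℂ) (S := ℂ) (A := G.Alg)
        (B := G.Alg)) *
      G.u.map (Algebra.TensorProduct.includeRight (R := ℂ) (A := G.Alg) (B := G.Alg)))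
    (t := Algebra.TensorProduct.includeLeft (R := ℂ) (S := ℂ) (A := G.Alg) (B := G.Alg) G.t *
      Algebra.TensorProduct.includeRight (R := ℂ) (A := G.Alg) (B := G.Alg) G.t)
    ((sat_u.map _).mul (sat_u.map _) (fun _ _ _ _ => by simp [Commute, SemiconjBy])
      (fun _ _ => by simp [Commute, SemiconjBy]) (fun _ _ => by simp [Commute, SemiconjBy])
      (by simp [Commute, SemiconjBy]))

lemma comulHom_u (i j : Fin G.N) : comulHom G (G.u i j) = ∑ k, G.u i k ⊗ₜ G.u k j := by
  simp [comulHom, Matrix.mul_apply]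

lemma comulHom_t : comulHom G G.t = G.t ⊗ₜ G.t := by
  simp [comulHom]

/-- The counit, `ε(u^i_j) = δ_ij`, `ε(t) = 1`. -/
def counitHom (G : QuantumGroup) : G.Alg →ₐ[ℂ] ℂ :=
  liftHom (sat_one (G := G) (B := ℂ))

lemma counitHom_u (i j : Fin G.N) : counitHom G (G.u i j) = if i = j then 1 else 0 := by
  simp [counitHom, Matrix.one_apply]

lemma counitHom_t : counitHom G G.t = 1 := by
  simp [counitHom]

instance : Bialgebra ℂ G.Alg :=
  Bialgebra.ofAlgHom (comulHom G) (counitHom G)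
    (algHom_ext (fun i j => by
        simp only [AlgHom.comp_apply, comulHom_u, map_sum, Algebra.TensorProduct.map_tmul,
          TensorProduct.sum_tmul, TensorProduct.tmul_sum, AlgHom.coe_id, id_eq]
        rw [Finset.sum_comm]
        simp)
      (by simp [comulHom_t]))
    (algHom_ext (fun i j => by simp [comulHom_u, counitHom_u, TensorProduct.ite_tmul])
      (by simp [comulHom_t, counitHom_t]))
    (algHom_ext (fun i j => by simp [comulHom_u, counitHom_u, TensorProduct.tmul_ite])
      (by simp [comulHom_t, counitHom_t]))

lemma comul_eq (a : G.Alg) : Coalgebra.comul (R := ℂ) a = comulHom G a := rfl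

lemma counit_eq (a : G.Alg) : Coalgebra.counit (R := ℂ) a = counitHom G a := rfl

/-- The matrix `(S(u^i_j))`, the inverse of `u`. -/
def uInv (G : QuantumGroup) : Matrix (Fin G.N) (Fin G.N) G.Alg := sat_u.exists_inverse.choose

/-- The inverse of `t`. -/
def tInv (G : QuantumGroup) : G.Alg := sat_u.exists_t_inverse.choose

lemma u_mul_uInv : G.u * G.uInv = 1 := sat_u.exists_inverse.choose_spec.1
lemma uInv_mul_u : G.uInv * G.u = 1 := sat_u.exists_inverse.choose_spec.2
lemma t_mul_tInv : G.t * G.tInv = 1 := sat_u.exists_t_inverse.choose_spec.1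
lemma tInv_mul_t : G.tInv * G.t = 1 := sat_u.exists_t_inverse.choose_spec.2

/-- The antipode as a homomorphism to the opposite algebra, `S(u) = u⁻¹`, `S(t) = t⁻¹`. -/
def antipodeHom (G : QuantumGroup) : G.Alg →ₐ[ℂ] G.Algᵐᵒᵖ :=
  liftHom (sat_u.op u_mul_uInv uInv_mul_u t_mul_tInv tInv_mul_t)

/-- The antipode. -/
def antipodeLin (G : QuantumGroup) : G.Alg →ₗ[ℂ] G.Alg :=
  (MulOpposite.opLinearEquiv ℂ).symm.toLinearMap ∘ₗ (antipodeHom G).toLinearMap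

lemma antipodeLin_u (i j : Fin G.N) : antipodeLin G (G.u i j) = G.uInv i j := by
  simp [antipodeLin, antipodeHom]

lemma antipodeLin_t : antipodeLin G G.t = G.tInv := by
  simp [antipodeLin, antipodeHom]

lemma antipodeLin_mul (a b : G.Alg) :
    antipodeLin G (a * b) = antipodeLin G b * antipodeLin G a := by
  simp [antipodeLin]

lemma antipodeLin_algebraMap (c : ℂ) :
    antipodeLin G (algebraMap ℂ G.Alg c) = algebraMap ℂ G.Alg c := by
  simp [antipodeLin]

lemma antipode_left (a : G.Alg) :
    LinearMap.mul' ℂ G.Alg ((antipodeLin G).rTensor G.Alg (comulHom G a))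
      = algebraMap ℂ G.Alg (counitHom G a) := by
  induction a using alg_induction with
  | hu i j =>
    have := congrFun (congrFun (uInv_mul_u (G := G)) i) j
    rw [Matrix.mul_apply] at this
    simp only [comulHom_u, map_sum, LinearMap.rTensor_tmul, LinearMap.mul'_apply, antipodeLin_u,
      this, counitHom_u, Matrix.one_apply]
    split_ifs <;> simp
  | ht => simp [comulHom_t, antipodeLin_t, tInv_mul_t, counitHom_t]
  | hs c =>
    rw [AlgHom.commutes, AlgHom.commutes, Algebra.TensorProduct.algebraMap_apply]
    simp [antipodeLin_algebraMap]
  | ha a b h1 h2 => simp only [map_add, h1, h2]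
  | hm a b h1 h2 =>
    have key : ∀ z w : G.Alg ⊗[ℂ] G.Alg, ∀ c : ℂ,
        LinearMap.mul' ℂ G.Alg ((antipodeLin G).rTensor G.Alg z) = algebraMap ℂ G.Alg c →
        LinearMap.mul' ℂ G.Alg ((antipodeLin G).rTensor G.Alg (z * w))
          = c • LinearMap.mul' ℂ G.Alg ((antipodeLin G).rTensor G.Alg w) := by
      intro z w c hz
      induction w using TensorProduct.induction_on with
      | zero => simp
      | add w1 w2 e1 e2 => rw [mul_add, map_add, map_add, e1, e2, map_add, map_add, smul_add]
      | tmul x y =>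
        have : ∀ z : G.Alg ⊗[ℂ] G.Alg,
            LinearMap.mul' ℂ G.Alg ((antipodeLin G).rTensor G.Alg (z * x ⊗ₜ y))
            = antipodeLin G x * LinearMap.mul' ℂ G.Alg ((antipodeLin G).rTensor G.Alg z) * y := by
          intro z
          induction z using TensorProduct.induction_on with
          | zero => simp
          | add w1 w2 e1 e2 => simp only [add_mul, mul_add, map_add, e1, e2]
          | tmul a b => simp [antipodeLin_mul, mul_assoc]
        rw [this, hz, ← Algebra.commutes, mul_assoc, Algebra.smul_def]
        simp
    rw [map_mul, key _ _ _ h1, h2, map_mul, map_mul, Algebra.smul_def]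

lemma antipode_right (a : G.Alg) :
    LinearMap.mul' ℂ G.Alg ((antipodeLin G).lTensor G.Alg (comulHom G a))
      = algebraMap ℂ G.Alg (counitHom G a) := by
  induction a using alg_induction with
  | hu i j =>
    have := congrFun (congrFun (u_mul_uInv (G := G)) i) j
    rw [Matrix.mul_apply] at this
    simp only [comulHom_u, map_sum, LinearMap.lTensor_tmul, LinearMap.mul'_apply, antipodeLin_u,
      this, counitHom_u, Matrix.one_apply]
    split_ifs <;> simp
  | ht => simp [comulHom_t, antipodeLin_t, t_mul_tInv, counitHom_t]
  | hs c =>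
    rw [AlgHom.commutes, AlgHom.commutes, Algebra.TensorProduct.algebraMap_apply]
    have h1 : antipodeLin G (1 : G.Alg) = 1 := by simpa using antipodeLin_algebraMap (G := G) 1
    simp [h1]
  | ha a b h1 h2 => simp only [map_add, h1, h2]
  | hm a b h1 h2 =>
    have key : ∀ z w : G.Alg ⊗[ℂ] G.Alg, ∀ c : ℂ,
        LinearMap.mul' ℂ G.Alg ((antipodeLin G).lTensor G.Alg w) = algebraMap ℂ G.Alg c →
        LinearMap.mul' ℂ G.Alg ((antipodeLin G).lTensor G.Alg (z * w))
          = c • LinearMap.mul' ℂ G.Alg ((antipodeLin G).lTensor G.Alg z) := by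
      intro z w c hw
      induction z using TensorProduct.induction_on with
      | zero => simp
      | add w1 w2 e1 e2 => rw [add_mul, map_add, map_add, e1, e2, map_add, map_add, smul_add]
      | tmul x y =>
        have : ∀ w : G.Alg ⊗[ℂ] G.Alg,
            LinearMap.mul' ℂ G.Alg ((antipodeLin G).lTensor G.Alg (x ⊗ₜ y * w))
            = x * LinearMap.mul' ℂ G.Alg ((antipodeLin G).lTensor G.Alg w) * antipodeLin G y := by
          intro z
          induction z using TensorProduct.induction_on with
          | zero => simp
          | add w1 w2 e1 e2 => simp only [add_mul, mul_add, map_add, e1, e2]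
          | tmul a b => simp [antipodeLin_mul, mul_assoc]
        rw [this, hw, ← Algebra.commutes, mul_assoc, Algebra.smul_def]
        simp
    rw [map_mul, key _ _ _ h2, h1, map_mul (counitHom G), mul_comm (counitHom G a), map_mul,
      Algebra.smul_def]

/-- The Hopf algebra `𝒪(G_q)`. -/
instance : HopfAlgebra ℂ G.Alg where
  antipode := antipodeLin G
  mul_antipode_rTensor_comul := LinearMap.ext fun a => antipode_left a
  mul_antipode_lTensor_comul := LinearMap.ext fun a => antipode_right a

end Hopf

end QuantumGroup

/-! ## Functionals and universal `r`-forms -/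

section General

open Coalgebra

variable {A : Type*} [Ring A] [HopfAlgebra ℂ A]

/-- The convolution product `(fg)(a) = f(a₁) g(a₂)` of two functionals. -/
def convMul (f g : A →ₗ[ℂ] ℂ) : A →ₗ[ℂ] ℂ :=
  LinearMap.mul' ℂ ℂ ∘ₗ TensorProduct.map f g ∘ₗ comul

/-- `f ∗ a = a₁ f(a₂)`. -/
def lstar (f : A →ₗ[ℂ] ℂ) : A →ₗ[ℂ] A :=
  (TensorProduct.rid ℂ A).toLinearMap ∘ₗ TensorProduct.map LinearMap.id f ∘ₗ comul

/-- The element `a₁ ⊗ b₁ ⊗ a₂ ⊗ b₂`. -/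
def comulPair (a b : A) : (A ⊗[ℂ] A) ⊗[ℂ] (A ⊗[ℂ] A) :=
  TensorProduct.tensorTensorTensorComm ℂ A A A A (comul a ⊗ₜ comul b)

/-- A universal `r`-form on a Hopf algebra (a coquasitriangular structure). -/
structure UniversalRForm (A : Type*) [Ring A] [HopfAlgebra ℂ A] where
  form : A →ₗ[ℂ] A →ₗ[ℂ] ℂ
  /-- `r` is convolution invertible. -/
  exists_inv : ∃ s : A →ₗ[ℂ] A →ₗ[ℂ] ℂ, ∀ a b : A,
    LinearMap.mul' ℂ ℂ (TensorProduct.map (TensorProduct.lift form) (TensorProduct.lift s)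
        (comulPair a b)) = counit (R := ℂ) a * counit (R := ℂ) b ∧
    LinearMap.mul' ℂ ℂ (TensorProduct.map (TensorProduct.lift s) (TensorProduct.lift form)
        (comulPair a b)) = counit (R := ℂ) a * counit (R := ℂ) b
  /-- `r(ab, c) = r(a, c₁) r(b, c₂)`. -/
  mul_left : ∀ a b c : A, form (a * b) c = convMul (form a) (form b) c
  /-- `r(a, bc) = r(a₁, c) r(a₂, b)`. -/
  mul_right : ∀ a b c : A, form a (b * c) = convMul (form.flip c) (form.flip b) a
  /-- `r(a₁, b₁) a₂ b₂ = b₁ a₁ r(a₂, b₂)`. -/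
  quasi_comm : ∀ a b : A,
    TensorProduct.lid ℂ A (TensorProduct.map (TensorProduct.lift form) (LinearMap.mul' ℂ A)
        (comulPair a b)) =
    TensorProduct.rid ℂ A (TensorProduct.map
        (LinearMap.mul' ℂ A ∘ₗ (TensorProduct.comm ℂ A A).toLinearMap) (TensorProduct.lift form)
        (comulPair a b))

/-! ## Corepresentations, cosemisimplicity and the Peter-Weyl decomposition -/

/-- A subcoalgebra: `Δ(C) ⊆ C ⊗ C`. -/
def IsSubcoalgebra (C : Submodule ℂ A) : Prop :=
  ∀ a ∈ C, comul (R := ℂ) a ∈ LinearMap.range (TensorProduct.map C.subtype C.subtype)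

/-- A simple subcoalgebra. -/
def IsSimpleSubcoalgebra (C : Submodule ℂ A) : Prop :=
  IsSubcoalgebra C ∧ C ≠ ⊥ ∧ ∀ D : Submodule ℂ A, IsSubcoalgebra D → D ≤ C → D = ⊥ ∨ D = C

/-- A Hopf algebra is cosemisimple if it is the sum of its simple subcoalgebras. -/
def IsCosemisimple (A : Type*) [Ring A] [HopfAlgebra ℂ A] : Prop :=
  ⨆ C : {C : Submodule ℂ A // IsSimpleSubcoalgebra C}, (C : Submodule ℂ A) = ⊤

/-- A finite-dimensional (matrix) corepresentation, `Δ(v^i_j) = ∑ v^i_k ⊗ v^k_j`,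
`ε(v^i_j) = δ_ij`. It acts on `ℂ^dim` by `e_j ↦ ∑ e_i ⊗ v^i_j`. -/
structure MatrixCorep (A : Type*) [Ring A] [HopfAlgebra ℂ A] where
  dim : ℕ
  v : Matrix (Fin dim) (Fin dim) A
  comul_v : ∀ i j, comul (R := ℂ) (v i j) = ∑ k, v i k ⊗ₜ[ℂ] v k j
  counit_v : ∀ i j, counit (R := ℂ) (v i j) = if i = j then 1 else 0

/-- The coaction `e_j ↦ ∑ e_i ⊗ v^i_j` on `ℂ^dim`. -/
def MatrixCorep.coaction (v : MatrixCorep A) : (Fin v.dim → ℂ) →ₗ[ℂ] (Fin v.dim → ℂ) ⊗[ℂ] A :=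
  ∑ j, (LinearMap.proj j : (Fin v.dim → ℂ) →ₗ[ℂ] ℂ).smulRight
    (∑ i, (Pi.single i 1 : Fin v.dim → ℂ) ⊗ₜ[ℂ] v.v i j)

/-- Irreducibility: there are exactly two invariant subspaces. -/
def MatrixCorep.IsIrreducible (v : MatrixCorep A) : Prop :=
  0 < v.dim ∧ ∀ W : Submodule ℂ (Fin v.dim → ℂ),
    (∀ w ∈ W, v.coaction w ∈ LinearMap.range (W.subtype.rTensor A)) → W = ⊥ ∨ W = ⊤

/-- Equivalence of corepresentations: there is an invertible intertwiner `T`, `T v = w T`. -/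
def MatrixCorep.Equivalent (v w : MatrixCorep A) : Prop :=
  ∃ (T : Matrix (Fin w.dim) (Fin v.dim) ℂ) (T' : Matrix (Fin v.dim) (Fin w.dim) ℂ),
    T * T' = 1 ∧ T' * T = 1 ∧ T.map (algebraMap ℂ A) * v.v = w.v * T.map (algebraMap ℂ A)

lemma MatrixCorep.Equivalent.refl (v : MatrixCorep A) : v.Equivalent v :=
  ⟨1, 1, by simp, by simp, by simp [Matrix.map_one]⟩

lemma MatrixCorep.Equivalent.symm {v w : MatrixCorep A} (h : v.Equivalent w) : w.Equivalent v := by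
  obtain ⟨T, T', h1, h2, h3⟩ := h
  refine ⟨T', T, h2, h1, ?_⟩
  have e1 : T.map (algebraMap ℂ A) * T'.map (algebraMap ℂ A) = 1 := by
    rw [← Matrix.map_mul, h1]; simp [Matrix.map_one]
  have e2 : T'.map (algebraMap ℂ A) * T.map (algebraMap ℂ A) = 1 := by
    rw [← Matrix.map_mul, h2]; simp [Matrix.map_one]
  calc _ = T'.map (algebraMap ℂ A) * (w.v * T.map (algebraMap ℂ A)) * T'.map (algebraMap ℂ A) := by
        rw [Matrix.mul_assoc, Matrix.mul_assoc w.v, e1, Matrix.mul_one]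
    _ = v.v * T'.map (algebraMap ℂ A) := by
        rw [← h3, ← Matrix.mul_assoc, e2, Matrix.one_mul]

lemma MatrixCorep.Equivalent.trans {v w x : MatrixCorep A} (h : v.Equivalent w)
    (h' : w.Equivalent x) : v.Equivalent x := by
  obtain ⟨T, T', h1, h2, h3⟩ := h
  obtain ⟨S, S', k1, k2, k3⟩ := h'
  refine ⟨S * T, T' * S', ?_, ?_, ?_⟩
  · rw [Matrix.mul_assoc, ← Matrix.mul_assoc T, h1, Matrix.one_mul, k1]
  · rw [Matrix.mul_assoc, ← Matrix.mul_assoc S', k2, Matrix.one_mul, h2]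
  · rw [Matrix.map_mul, Matrix.mul_assoc, h3, ← Matrix.mul_assoc, k3, Matrix.mul_assoc]

instance irrepSetoid (A : Type*) [Ring A] [HopfAlgebra ℂ A] :
    Setoid {v : MatrixCorep A // v.IsIrreducible} where
  r v w := v.1.Equivalent w.1
  iseqv := ⟨fun v => .refl v.1, fun h => h.symm, fun h h' => h.trans h'⟩

/-- The set `Â` of equivalence classes of irreducible corepresentations. -/
def Irrep (A : Type*) [Ring A] [HopfAlgebra ℂ A] := Quotient (irrepSetoid A)

/-- The coalgebra `𝒞(u^α)` of matrix elements (it depends only on the class `α`). -/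
def Irrep.coeff (α : Irrep A) : Submodule ℂ A :=
  let v := (Quotient.out α).1
  Submodule.span ℂ (Set.range fun p : Fin v.dim × Fin v.dim => v.v p.1 p.2)

open Classical in
/-- The projection `P^α` of `A` onto `𝒞(u^α)` along the sum of the other `𝒞(u^β)`. For a
cosemisimple Hopf algebra these two subspaces are complementary (Peter-Weyl decomposition). -/
def Irrep.proj (α : Irrep A) : A →ₗ[ℂ] A :=
  if h : IsCompl α.coeff (⨆ β ∈ {β : Irrep A | β ≠ α}, β.coeff) then
    Submodule.projection _ _ h
  else 0

/-- The functional `h^α = ε ∘ P^α`. -/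
def Irrep.h (α : Irrep A) : A →ₗ[ℂ] ℂ := counit ∘ₗ α.proj

end General

/-! ## Permutations, braidings and antisymmetrisers -/

section Braid

/-- The adjacent transposition of `m` and `m + 1` (counting from `0`) in the group of permutations
of `n` letters. -/
def adjSwap (n : ℕ) (m : Fin (n - 1)) : Equiv.Perm (Fin n) :=
  Equiv.swap ⟨m, by omega⟩ ⟨m + 1, by omega⟩

/-- `w = (i₁, …, i_r)` is a reduced word of `π`: `π = s_{i₁} ⋯ s_{i_r}` and `r` is minimal. -/
def IsReducedWord {n : ℕ} (w : List (Fin (n - 1))) (π : Equiv.Perm (Fin n)) : Prop :=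
  (w.map (adjSwap n)).prod = π ∧
    ∀ w' : List (Fin (n - 1)), (w'.map (adjSwap n)).prod = π → w.length ≤ w'.length

lemma exists_reducedWord {n : ℕ} (π : Equiv.Perm (Fin n)) : ∃ w, IsReducedWord w π := by
  have hex : ∃ w : List (Fin (n - 1)), (w.map (adjSwap n)).prod = π := by
    cases n with
    | zero => exact ⟨[], Subsingleton.elim _ _⟩
    | succ n =>
      have h : π ∈ Submonoid.closure (Set.range (adjSwap (n + 1))) := by
        have e : Set.range (adjSwap (n + 1))
            = Set.range fun i : Fin n => Equiv.swap i.castSucc i.succ := by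
          apply congrArg Set.range
          funext i
          rfl
        rw [e, Equiv.Perm.mclosure_swap_castSucc_succ]
        trivial
      induction h using Submonoid.closure_induction with
      | mem x hx =>
        obtain ⟨i, rfl⟩ := hx
        exact ⟨[i], by simp⟩
      | one => exact ⟨[], rfl⟩
      | mul x y _ _ hx hy =>
        obtain ⟨l, rfl⟩ := hx
        obtain ⟨l', rfl⟩ := hy
        exact ⟨l ++ l', by rw [List.map_append, List.prod_append]⟩
  classical
  have hex' : ∃ r, ∃ w : List (Fin (n - 1)), w.length = r ∧ (w.map (adjSwap n)).prod = π := by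
    obtain ⟨w, hw⟩ := hex
    exact ⟨_, w, rfl, hw⟩
  obtain ⟨w, hw, hw'⟩ := Nat.find_spec hex'
  exact ⟨w, hw', fun w' h => hw ▸ Nat.find_min' hex' ⟨w', rfl, h⟩⟩

/-- A reduced word of `π`. -/
def reducedWord {n : ℕ} (π : Equiv.Perm (Fin n)) : List (Fin (n - 1)) :=
  (exists_reducedWord π).choose

variable {I : Type*} [Fintype I] [DecidableEq I]

/-- For a matrix `s` acting on `V ⊗ V`, `V` with basis `(e_i)_{i ∈ I}`, by
`e_i ⊗ e_j ↦ ∑ s_{(kl),(ij)} e_k ⊗ e_l`, the matrix of `s` acting in the tensor factors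
`m` and `m + 1` (counting from `0`) of `V^{⊗n}`. -/
def legMat (s : Matrix (I × I) (I × I) ℂ) (n : ℕ) (m : Fin (n - 1)) :
    Matrix (Fin n → I) (Fin n → I) ℂ :=
  Matrix.of fun K J =>
    if ∀ a : Fin n, (a : ℕ) ≠ m → (a : ℕ) ≠ m + 1 → K a = J a then
      s (K ⟨m, by omega⟩, K ⟨m + 1, by omega⟩) (J ⟨m, by omega⟩, J ⟨m + 1, by omega⟩)
    else 0

/-- `s_π = s_{i₁} ⋯ s_{i_r}` for a reduced word `π = s_{i₁} ⋯ s_{i_r}`. (It does not depend on the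
reduced word if `s` satisfies the braid equation.) -/
def permMat (s : Matrix (I × I) (I × I) ℂ) {n : ℕ} (π : Equiv.Perm (Fin n)) :
    Matrix (Fin n → I) (Fin n → I) ℂ :=
  ((reducedWord π).map (legMat s n)).prod

/-- The antisymmetriser `A_n = ∑_π sgn(π) s_π`. -/
def antisymmetriser (s : Matrix (I × I) (I × I) ℂ) (n : ℕ) : Matrix (Fin n → I) (Fin n → I) ℂ :=
  ∑ π : Equiv.Perm (Fin n), ((Equiv.Perm.sign π : ℤ) : ℂ) • permMat s π

open Classical in
/-- The operator `B_{i,n-i} = ∑ sgn(π) s_π`, where the sum is over all `π` such that `π⁻¹` is a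
shuffle permutation: `π⁻¹(1) < ⋯ < π⁻¹(i)` and `π⁻¹(i+1) < ⋯ < π⁻¹(n)`. -/
def shuffleOp (s : Matrix (I × I) (I × I) ℂ) (n i : ℕ) : Matrix (Fin n → I) (Fin n → I) ℂ :=
  ∑ π : Equiv.Perm (Fin n) with
      (∀ a b : Fin n, a < b → ((b : ℕ) < i ∨ i ≤ (a : ℕ)) → π⁻¹ a < π⁻¹ b),
    ((Equiv.Perm.sign π : ℤ) : ℂ) • permMat s π

end Braid

/-! ## Hopf bimodules, their tensor powers and exterior algebras -/

/-- The signs `+` and `-`. -/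
inductive Sgn
  | plus | minus

instance : Neg Sgn := ⟨fun | .plus => .minus | .minus => .plus⟩

section Descend

open Classical in
/-- The linear mapping on `M ⧸ p` induced by a linear mapping `f` on `M`, if `f` vanishes on `p`
(and `0` otherwise). -/
def descend {M M' : Type*} [AddCommGroup M] [Module ℂ M] [AddCommGroup M'] [Module ℂ M']
    (p : Submodule ℂ M) (f : M →ₗ[ℂ] M') : M ⧸ p →ₗ[ℂ] M' :=
  if h : p ≤ LinearMap.ker f then p.liftQ f h else 0

end Descend

/-- A Hopf bimodule `Γ = (v, f)` over `A`, with basis `(ω_i)_{i ∈ I}` of the space of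
left-coinvariant elements: `Γ` is the free left `A`-module with basis `(ω_i)`,
`Δ_R(ω_j) = ∑ ω_i ⊗ v^i_j` and `ω_i ◁ a = ∑ f^i_j(a) ω_j`, i.e. `ω_i a = ∑ (f^i_j ∗ a) ω_j`. -/
structure HopfBimod (A : Type*) [Ring A] [HopfAlgebra ℂ A] (I : Type*) where
  v : Matrix I I A
  f : I → I → A →ₗ[ℂ] ℂ

namespace HopfBimod

open Coalgebra

variable {A : Type*} [Ring A] [HopfAlgebra ℂ A] {I : Type*} [Fintype I] [DecidableEq I]
variable (Γ : HopfBimod A I)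

/-- `Γ^{⊗k}` (over `A`): the free left `A`-module with basis `ω_J = ω_{J₁} ⊗ ⋯ ⊗ ω_{J_k}`; the
element `∑ ρ_J ω_J` is represented by the family `(ρ_J)`. -/
abbrev Tens (_Γ : HopfBimod A I) (k : ℕ) : Type _ := (Fin k → I) → A

/-- The left `A`-linear mapping `Γ^{⊗k} → Γ^{⊗l}`, `ω_J ↦ ∑ M_{KJ} ω_K`. -/
def ext {k l : ℕ} (M : Matrix (Fin l → I) (Fin k → I) ℂ) : Γ.Tens k →ₗ[ℂ] Γ.Tens l :=
  LinearMap.pi fun K => ∑ J, M K J • LinearMap.proj J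

/-- The braiding `σ(ω_i ⊗ ω_j) = (ω_j)_(0) ⊗ (ω_i ◁ (ω_j)_(1)) = ∑ f^i_l(v^k_j) ω_k ⊗ ω_l`. -/
def sigma : Matrix (I × I) (I × I) ℂ := Matrix.of fun p r => Γ.f r.1 p.2 (Γ.v p.1 r.2)

/-- `σ^{±1}`. -/
def sigmaPow : Sgn → Matrix (I × I) (I × I) ℂ
  | .plus => Γ.sigma
  | .minus => Γ.sigma⁻¹

/-- The kernel of the antisymmetriser `A_k` on `Γ^{⊗k}`. -/
def kerA (k : ℕ) : Submodule ℂ (Γ.Tens k) :=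
  LinearMap.ker (Γ.ext (antisymmetriser Γ.sigma k))

/-- The space of `k`-forms `Γ^{∧k} = Γ^{⊗k} / ker A_k`. -/
abbrev Forms (k : ℕ) : Type _ := Γ.Tens k ⧸ Γ.kerA k

/-- Woronowicz' external algebra `Γ^∧ = ⨁ Γ^{∧k}`. -/
abbrev ExtAlg : Type _ := DirectSum ℕ Γ.Forms

/-- The left coaction on `Γ^{⊗k}`, `a ω_J ↦ a₁ ⊗ a₂ ω_J`. -/
def coactL (k : ℕ) : Γ.Tens k →ₗ[ℂ] A ⊗[ℂ] Γ.Tens k :=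
  ∑ J, TensorProduct.map LinearMap.id (LinearMap.single ℂ (fun _ : Fin k → I => A) J) ∘ₗ
    comul ∘ₗ LinearMap.proj J

/-- The right coaction on `Γ^{⊗k}`, `a ω_J ↦ ∑ a₁ ω_K ⊗ a₂ v^{K₁}_{J₁} ⋯ v^{K_k}_{J_k}`. -/
def coactR (k : ℕ) : Γ.Tens k →ₗ[ℂ] Γ.Tens k ⊗[ℂ] A :=
  ∑ J, ∑ K, TensorProduct.map (LinearMap.single ℂ (fun _ : Fin k → I => A) K)
    (LinearMap.mulRight ℂ (tensorPow Γ.v k K J)) ∘ₗ comul ∘ₗ LinearMap.proj J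

/-- The left coaction `Δ_L` on `Γ^{∧k}`. -/
def formsCoactL (k : ℕ) : Γ.Forms k →ₗ[ℂ] A ⊗[ℂ] Γ.Forms k :=
  descend _ ((Γ.kerA k).mkQ.lTensor A ∘ₗ Γ.coactL k)

/-- The right coaction `Δ_R` on `Γ^{∧k}`. -/
def formsCoactR (k : ℕ) : Γ.Forms k →ₗ[ℂ] Γ.Forms k ⊗[ℂ] A :=
  descend _ ((Γ.kerA k).mkQ.rTensor A ∘ₗ Γ.coactR k)

/-- The two-sided coaction `(Δ_L ⊗ id) Δ_R`, `ρ ↦ ρ_(-1) ⊗ ρ_(0) ⊗ ρ_(1)`. -/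
def coactLR (k : ℕ) : Γ.Forms k →ₗ[ℂ] (A ⊗[ℂ] Γ.Forms k) ⊗[ℂ] A :=
  (Γ.formsCoactL k).rTensor A ∘ₗ Γ.formsCoactR k

/-- The mapping `h^{αβ}(ρ) = h^α(ρ_(-1)) ρ_(0) h^β(ρ_(1))` on `Γ^{∧k}`. -/
def hForms (α β : Irrep A) (k : ℕ) : Γ.Forms k →ₗ[ℂ] Γ.Forms k :=
  (TensorProduct.rid ℂ (Γ.Forms k)).toLinearMap ∘ₗ
    TensorProduct.map ((TensorProduct.lid ℂ (Γ.Forms k)).toLinearMap ∘ₗ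
      TensorProduct.map α.h LinearMap.id) β.h ∘ₗ Γ.coactLR k

/-- The mapping `h^{αβ}` on `Γ^∧`. -/
def hExt (α β : Irrep A) : Γ.ExtAlg →ₗ[ℂ] Γ.ExtAlg := DirectSum.lmap (Γ.hForms α β)

/-- The space `Γ^{∧k}(α, β)` of all `ρ ∈ Γ^{∧k}` with
`ρ_(-1) ⊗ ρ_(0) ⊗ ρ_(1) ∈ 𝒞(u^α) ⊗ Γ^{∧k} ⊗ 𝒞(u^β)`. -/
def component (α β : Irrep A) (k : ℕ) : Submodule ℂ (Γ.Forms k) :=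
  (LinearMap.range (TensorProduct.map
    (TensorProduct.map α.coeff.subtype (LinearMap.id (M := Γ.Forms k))) β.coeff.subtype)).comap
    (Γ.coactLR k)

/-- The right multiplication of a left-coinvariant element `θ = ∑ c_i ω_i` of `Γ`:
`θ a = ∑_j (∑_i c_i (f^i_j ∗ a)) ω_j`; this is the coefficient of `ω_j`. -/
def coinvMul (c : I → ℂ) (j : I) : A →ₗ[ℂ] A := ∑ i, c i • lstar (Γ.f i j)

/-- `ρ ↦ θ ⊗ ρ`, `Γ^{⊗k} → Γ^{⊗(k+1)}`, for `θ = ∑ c_i ω_i`. -/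
def tensLeft (c : I → ℂ) (k : ℕ) : Γ.Tens k →ₗ[ℂ] Γ.Tens (k + 1) :=
  LinearMap.pi fun L => Γ.coinvMul c (L 0) ∘ₗ LinearMap.proj (Fin.tail L)

/-- `ρ ↦ ρ ⊗ θ`, `Γ^{⊗k} → Γ^{⊗(k+1)}`, for `θ = ∑ c_i ω_i`. -/
def tensRight (c : I → ℂ) (k : ℕ) : Γ.Tens k →ₗ[ℂ] Γ.Tens (k + 1) :=
  LinearMap.pi fun L => c (L (Fin.last k)) • LinearMap.proj (Fin.init L)

/-- The differential `d ρ = ω₀ ∧ ρ - (-1)^k ρ ∧ ω₀` on `Γ^{∧k}`, where `ω₀ = ∑ c_i ω_i`. -/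
def diff (c : I → ℂ) (k : ℕ) : Γ.Forms k →ₗ[ℂ] Γ.Forms (k + 1) :=
  descend _ ((Γ.kerA (k + 1)).mkQ ∘ₗ (Γ.tensLeft c k - (-1 : ℂ) ^ k • Γ.tensRight c k))

/-- The functional `X_j` of the quantum tangent space dual to `ω_j`, for the inner calculus given
by `ω₀ = ∑ c_i ω_i`: by definition `ω(a) = S(a₁) d a₂ = ω₀ ◁ a - ε(a) ω₀ = ∑ X_j(a) ω_j`. -/
def X (c : I → ℂ) (j : I) : A →ₗ[ℂ] ℂ := (∑ i, c i • Γ.f i j) - c j • counit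

variable (Γ' : HopfBimod A I)

/-- Let `g : Γ ⊗ Γ' → A` be the left `A`-linear mapping with `g(ω_i, ω'_j) = g_ij` and let
`θ = ∑ c_i ω'_i ∈ Γ'`. This is `g̃(·, θ) : Γ^{⊗(k+1)} → Γ^{⊗k}`,
`ω_{J₁} ⊗ ⋯ ⊗ ω_{J_{k+1}} ↦ ω_{J₁} ⊗ ⋯ ⊗ ω_{J_k} g(ω_{J_{k+1}}, θ)`. -/
def gRight (g : I → I → ℂ) (c : I → ℂ) (k : ℕ) : Γ.Tens (k + 1) →ₗ[ℂ] Γ.Tens k :=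
  LinearMap.pi fun J => ∑ j, (∑ i, c i * g j i) •
    LinearMap.proj (Fin.snoc (α := fun _ => I) J j)

/-- Let `g : Γ' ⊗ Γ → A` be the left `A`-linear mapping with `g(ω'_i, ω_j) = g_ij` and let
`θ = ∑ c_i ω'_i ∈ Γ'`. This is `g̃(θ, ·) : Γ^{⊗(k+1)} → Γ^{⊗k}`,
`a ω_{J₁} ⊗ ⋯ ⊗ ω_{J_{k+1}} ↦ g(θ a, ω_{J₁}) ω_{J₂} ⊗ ⋯ ⊗ ω_{J_{k+1}}`. -/
def gLeft (g : I → I → ℂ) (c : I → ℂ) (k : ℕ) : Γ.Tens (k + 1) →ₗ[ℂ] Γ.Tens k :=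
  LinearMap.pi fun J => ∑ j, (∑ i, g i j • Γ'.coinvMul c i) ∘ₗ
    LinearMap.proj (Fin.cons (α := fun _ => I) j J)

end HopfBimod

/-! ## The calculi `Γ_{±,z}`, the metric and the Laplace-Beltrami operators -/

namespace QuantumGroup

open HopfAlgebra

variable (G : QuantumGroup)

/-- The admissible complex numbers. -/
def Admissible (x : ℂ) : Prop :=
  match G.kind with
  | .GL => x ≠ 0
  | .SL => x ^ G.N = G.q
  | .O => x ^ 2 = 1
  | .SO => if Even G.N then x ^ 2 = 1 else x = 1
  | .Sp => x ^ 2 = 1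

/-- The universal `r`-form `r_x` on `𝒪(G_q)`: `r_x(u^i_j, u^k_l) = x⁻¹ R̂^{ki}_{jl}`. (It is uniquely
determined by these values.) -/
structure RForm (x : ℂ) extends UniversalRForm G.Alg where
  form_u : ∀ i j k l, form (G.u i j) (G.u k l) = x⁻¹ * G.Rhat (k, i) (j, l)

/-- The diagonal entries `d_i` of the matrix `D`: in type A, `d_i = q^{N+1-2i}` (for indices counted
from `1`); in the types B, C, D, `D = Cᵗ C⁻¹`. -/
def d (i : Fin G.N) : ℂ :=
  if G.IsTypeA then G.q ^ ((G.N : ℤ) - 1 - 2 * (i : ℕ)) else (G.Cmat.transpose * G.Cmat⁻¹) i i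

/-- The number `𝔰 = tr D`. -/
def trD : ℂ := ∑ i, G.d i

variable {G} {x y : ℂ} (rx : G.RForm x) (ry : G.RForm y)

/-- The Hopf bimodules `Γ_{+,z}` and `Γ_{-,z}`, `z = xy`, with left-coinvariant bases `(ω^±_ij)`:
`Δ_R(ω⁺_ij) = ∑ ω⁺_kl ⊗ u^k_i S(u^j_l)`, `ω⁺_ij ◁ a = ∑ r_y(u^k_i, a₁) r_x(a₂, u^j_l) ω⁺_kl`, and
`Δ_R(ω⁻_ij) = ∑ ω⁻_kl ⊗ S²(u^k_i) S(u^j_l)`,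
`ω⁻_ij ◁ a = ∑ r_x(a₁, S(u^k_i)) r_y(S(u^j_l), a₂) ω⁻_kl`. -/
def Gamma : Sgn → HopfBimod G.Alg (Fin G.N × Fin G.N)
  | .plus =>
    { v := Matrix.of fun p r => G.u p.1 r.1 * antipode ℂ (G.u r.2 p.2)
      f := fun r p => convMul (ry.form (G.u p.1 r.1)) (rx.form.flip (G.u r.2 p.2)) }
  | .minus =>
    { v := Matrix.of fun p r =>
        antipode ℂ (antipode ℂ (G.u p.1 r.1)) * antipode ℂ (G.u r.2 p.2)
      f := fun r p => convMul (rx.form.flip (antipode ℂ (G.u p.1 r.1)))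
        (ry.form (antipode ℂ (G.u r.2 p.2))) }

/-- The coefficients of `ω⁺₀ = ∑ ω⁺_ii` and `ω⁻₀ = ∑ d_i⁻¹ ω⁻_ii`. -/
def omega0 (G : QuantumGroup) : Sgn → Fin G.N × Fin G.N → ℂ
  | .plus, p => if p.1 = p.2 then 1 else 0
  | .minus, p => if p.1 = p.2 then (G.d p.1)⁻¹ else 0

/-- The metric: `metric τ p r = g(ω^τ_p, ω^{-τ}_r)`, with `g(ω⁺_ij, ω⁻_kl) = D^j_k (D⁻¹)^l_i` and
`g(ω⁻_ij, ω⁺_kl) = δ_jk δ_il`. -/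
def metric (G : QuantumGroup) : Sgn → Fin G.N × Fin G.N → Fin G.N × Fin G.N → ℂ
  | .plus, p, r => if p.2 = r.1 ∧ r.2 = p.1 then G.d p.2 * (G.d p.1)⁻¹ else 0
  | .minus, p, r => if p.2 = r.1 ∧ r.2 = p.1 then 1 else 0

/-- The element `X₀^τ` of the quantum tangent space dual to `ω₀^τ`:
`X⁺₀ = 𝔰⁻¹ ∑ d_i⁻¹ X⁺_ii` and `X⁻₀ = 𝔰⁻¹ ∑ X⁻_ii`. -/
def X0 : Sgn → G.Alg →ₗ[ℂ] ℂ
  | .plus => G.trD⁻¹ • ∑ i, (G.d i)⁻¹ • (Gamma rx ry .plus).X (G.omega0 .plus) (i, i)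
  | .minus => G.trD⁻¹ • ∑ i, (Gamma rx ry .minus).X (G.omega0 .minus) (i, i)

open Classical in
/-- The eigenvalue `E^τ_α` of `𝔰 X₀^τ ∗` on `𝒞(u^α)`. -/
def E (τ : Sgn) (α : Irrep G.Alg) : ℂ :=
  if h : ∃ e : ℂ, ∀ a ∈ α.coeff, G.trD • lstar (X0 rx ry τ) a = e • a then h.choose else 0

/-- The differential `d_τ` on `Γ_τ^{∧k}`. -/
def dTau (τ : Sgn) (k : ℕ) :
    (Gamma rx ry τ).Forms k →ₗ[ℂ] (Gamma rx ry τ).Forms (k + 1) :=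
  (Gamma rx ry τ).diff (G.omega0 τ) k

/-- The contraction `ρ ↦ ⟨ρ, ω₀^{-τ}⟩^± = g̃(B^±_{k,1} ρ, ω₀^{-τ})` on `Γ_τ^{⊗(k+1)}`. -/
def contrRight (τ s : Sgn) (k : ℕ) :
    (Gamma rx ry τ).Tens (k + 1) →ₗ[ℂ] (Gamma rx ry τ).Tens k :=
  (Gamma rx ry τ).gRight (G.metric τ) (G.omega0 (-τ)) k ∘ₗ
    (Gamma rx ry τ).ext (shuffleOp ((Gamma rx ry τ).sigmaPow s) (k + 1) k)

/-- The contraction `ρ ↦ ⟨ω₀^{-τ}, ρ⟩^± = g̃(ω₀^{-τ}, B^±_{1,k} ρ)` on `Γ_τ^{⊗(k+1)}`. -/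
def contrLeft (τ s : Sgn) (k : ℕ) :
    (Gamma rx ry τ).Tens (k + 1) →ₗ[ℂ] (Gamma rx ry τ).Tens k :=
  (Gamma rx ry τ).gLeft (Gamma rx ry (-τ)) (G.metric (-τ)) (G.omega0 (-τ)) k ∘ₗ
    (Gamma rx ry τ).ext (shuffleOp ((Gamma rx ry τ).sigmaPow s) (k + 1) 1)

/-- The codifferential `∂^±_τ ρ = ⟨ρ, ω₀^{-τ}⟩^± + (-1)^{k+1} ⟨ω₀^{-τ}, ρ⟩^±` on
`Γ_τ^{∧(k+1)}`. -/
def codiff (τ s : Sgn) (k : ℕ) :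
    (Gamma rx ry τ).Forms (k + 1) →ₗ[ℂ] (Gamma rx ry τ).Forms k :=
  descend _ (((Gamma rx ry τ).kerA k).mkQ ∘ₗ
    (contrRight rx ry τ s k + (-1 : ℂ) ^ (k + 1) • contrLeft rx ry τ s k))

/-- The quantum Laplace-Beltrami operators `Δ^± = -d ∂^± + ∂^± d` on `Γ_τ^{∧k}` (where `∂^±` is
zero on `Γ_τ^{∧0} = 𝒪(G_q)`). -/
def laplace (τ s : Sgn) : (k : ℕ) → (Gamma rx ry τ).Forms k →ₗ[ℂ] (Gamma rx ry τ).Forms k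
  | 0 => codiff rx ry τ s 0 ∘ₗ dTau rx ry τ 0
  | k + 1 => -(dTau rx ry τ k ∘ₗ codiff rx ry τ s k) + codiff rx ry τ s (k + 1) ∘ₗ dTau rx ry τ (k + 1)

end QuantumGroup

end

set_option linter.unusedSectionVars false
set_option linter.unusedSimpArgs false

noncomputable section

/-! ## Calculus of functionals -/

section Functionals

open Coalgebra

variable {A : Type*} [Ring A] [HopfAlgebra ℂ A]

/-! The two coactions make `Γ^∧` a bicomodule, so each pair of functionals acts on forms by `ξ ↦
f(ξ_(-1)) ξ_(0) g(ξ_(1))` (`formsAct`). For the decomposition, regard `A` as a module over the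
operators `f ∗ ·`. The rows of an irreducible matrix corepresentation are simple submodules, and
inequivalent ones lie in different isotypic components; with cosemisimplicity this gives the
Peter-Weyl decomposition (`Irrep.isCompl_coeff`). Convolution with `h^λ` from either side is the
Peter-Weyl projection (`Irrep.lstar_h`, `Irrep.rstar_h`). Hence `h^{λμ}` projects onto the `(λ, μ)`
part of the bicomodule of forms, and the first two assertions follow.

For the Laplace operators put `θ = ω₀^τ`, `θ' = ω₀^{-τ}`. Let `L`, `R` be tensoring with `θ` from
the left and from the right, and let `c_r`, `c_l` be the contractions with `θ'` on the right and on
the left. The factorisations `A_{k+1} = (A_k ⊗ id) B_{k,1} = (id ⊗ A_k) B_{1,k}` and their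
transposes show that `d` and `∂^±` descend to forms, so everything can be computed on tensors. For
`σ⁻¹` this also needs that the antisymmetrisers of `σ` and `σ⁻¹` have the same kernel
(`permMat_rev_mul_antisymmetriser`).

Since `θ`, `θ'` are right-coinvariant and the metric is invariant, recursions for the shuffle
operators give, in degree `k`, `c_r R = e - R c_r`, `c_l L = e' - L c_l`, `c_r L = L c_r + (-1)^k
F`, `c_l R = R c_l + (-1)^k F'`, with `e = g(θ, θ')`, `e' = g(θ', θ)` and contractions read as zero
in degree `0`. In `-d∂ + ∂d` every term that still contracts `ρ` cancels, and `(-1)^k (F - e + F' -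
e')` remains (`laplace_mk`). The operator `F` arises when `θ` is carried through all `k` factors and
then contracted. For `σ` it is the action of the functional `a ↦ g(θ ◁ a, θ')` through the right
coaction, for `σ⁻¹` through the left one; `F'` comes from `a ↦ g(θ' ◁ a, θ)` with the sides
exchanged.

These functionals are central (`HopfBimod.IsBicovariant.isCentral_casimir`) and, up to their value
at `1`, equal `𝔰 X₀^{±τ}` (`trD_smul_X0`). By Schur's lemma (`exists_eigenvalue`) they act by
scalars on the coefficients of an irreducible corepresentation, and these scalars are the numbers
`E`.

The concrete input is that `Γ_±` are products of two bimodules given by r-forms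
(`isBicovariant_Gamma`) and that `D` implements the square of the antipode (`antipode_antipode_u`).
The latter makes `ω₀⁻` coinvariant and the metrics invariant. Transcendence of `q` enters through `𝔰
≠ 0` (`trD_ne_zero`). -/

/-- `a ∗ f = f(a₁) a₂`. -/
def rstar (f : A →ₗ[ℂ] ℂ) : A →ₗ[ℂ] A :=
  (TensorProduct.lid ℂ A).toLinearMap ∘ₗ TensorProduct.map f LinearMap.id ∘ₗ comul

lemma lstar_eq_of_comul {ι : Type*} {s : Finset ι} {a : A} {x y : ι → A}
    (h : comul (R := ℂ) a = ∑ i ∈ s, x i ⊗ₜ[ℂ] y i) (f : A →ₗ[ℂ] ℂ) :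
    lstar f a = ∑ i ∈ s, f (y i) • x i := by
  simp [lstar, h]

lemma rstar_eq_of_comul {ι : Type*} {s : Finset ι} {a : A} {x y : ι → A}
    (h : comul (R := ℂ) a = ∑ i ∈ s, x i ⊗ₜ[ℂ] y i) (f : A →ₗ[ℂ] ℂ) :
    rstar f a = ∑ i ∈ s, f (x i) • y i := by
  simp [rstar, h]

lemma convMul_eq_of_comul {ι : Type*} {s : Finset ι} {a : A} {x y : ι → A}
    (h : comul (R := ℂ) a = ∑ i ∈ s, x i ⊗ₜ[ℂ] y i) (f g : A →ₗ[ℂ] ℂ) :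
    convMul f g a = ∑ i ∈ s, f (x i) * g (y i) := by
  simp [convMul, h]

/-- Both sides contract the last two legs of the iterated coproduct, bracketed differently; the map
`T` is this contraction. Thus `f ↦ f ∗ ·` is multiplicative, while `f ↦ · ∗ f` reverses the order
(`rstar_rstar`). -/
lemma lstar_lstar (f g : A →ₗ[ℂ] ℂ) (a : A) : lstar f (lstar g a) = lstar (convMul f g) a := by
  let T : A ⊗[ℂ] (A ⊗[ℂ] A) →ₗ[ℂ] A := (TensorProduct.rid ℂ A).toLinearMap ∘ₗ
    TensorProduct.map LinearMap.id (LinearMap.mul' ℂ ℂ ∘ₗ TensorProduct.map f g)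
  have h1 : ∀ t : A ⊗[ℂ] A,
      lstar f ((TensorProduct.rid ℂ A) (TensorProduct.map LinearMap.id g t))
        = T (TensorProduct.assoc ℂ A A A (comul.rTensor A t)) := by
    intro t
    induction t using TensorProduct.induction_on with
    | zero => simp
    | add _ _ h h' => simp only [map_add, h, h']
    | tmul x y =>
      simp only [TensorProduct.map_tmul, LinearMap.id_apply, TensorProduct.rid_tmul, map_smul,
        LinearMap.rTensor_tmul, lstar, LinearMap.comp_apply]
      generalize comul (R := ℂ) x = t
      induction t using TensorProduct.induction_on with
      | zero => simp
      | add _ _ h h' => simp only [map_add, smul_add, TensorProduct.add_tmul, h, h']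
      | tmul u w => simp [T, smul_smul, mul_comm]
  have h2 : ∀ t : A ⊗[ℂ] A,
      (TensorProduct.rid ℂ A) (TensorProduct.map LinearMap.id (convMul f g) t)
        = T (comul.lTensor A t) := by
    intro t
    induction t using TensorProduct.induction_on with
    | zero => simp
    | add _ _ h h' => simp only [map_add, h, h']
    | tmul x y => simp [T, convMul]
  have := h1 (comul a)
  rw [coassoc_apply, ← h2] at this
  exact this

/-- The functionals touch the two outer legs of the iterated coproduct. This is why the left and
right actions on forms commute. -/
lemma rstar_lstar (f g : A →ₗ[ℂ] ℂ) (a : A) : rstar f (lstar g a) = lstar g (rstar f a) := by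
  let T : A ⊗[ℂ] (A ⊗[ℂ] A) →ₗ[ℂ] A := (TensorProduct.lid ℂ A).toLinearMap ∘ₗ
    TensorProduct.map f ((TensorProduct.rid ℂ A).toLinearMap ∘ₗ TensorProduct.map LinearMap.id g)
  have h1 : ∀ t : A ⊗[ℂ] A,
      rstar f ((TensorProduct.rid ℂ A) (TensorProduct.map LinearMap.id g t))
        = T (TensorProduct.assoc ℂ A A A (comul.rTensor A t)) := by
    intro t
    induction t using TensorProduct.induction_on with
    | zero => simp
    | add _ _ h h' => simp only [map_add, h, h']
    | tmul x y =>
      simp only [TensorProduct.map_tmul, LinearMap.id_apply, TensorProduct.rid_tmul, map_smul,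
        LinearMap.rTensor_tmul, rstar, LinearMap.comp_apply]
      generalize comul (R := ℂ) x = t
      induction t using TensorProduct.induction_on with
      | zero => simp
      | add _ _ h h' => simp only [map_add, smul_add, TensorProduct.add_tmul, h, h']
      | tmul u w => simp [T, smul_smul, mul_comm]
  have h2 : ∀ t : A ⊗[ℂ] A,
      lstar g ((TensorProduct.lid ℂ A) (TensorProduct.map f LinearMap.id t))
        = T (comul.lTensor A t) := by
    intro t
    induction t using TensorProduct.induction_on with
    | zero => simp
    | add _ _ h h' => simp only [map_add, h, h']
    | tmul x y => simp [T, lstar]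
  have := h1 (comul a)
  rw [coassoc_apply, ← h2] at this
  exact this

lemma rstar_rstar (f g : A →ₗ[ℂ] ℂ) (a : A) : rstar f (rstar g a) = rstar (convMul g f) a := by
  let T : A ⊗[ℂ] (A ⊗[ℂ] A) →ₗ[ℂ] A := (TensorProduct.lid ℂ A).toLinearMap ∘ₗ
    TensorProduct.map g ((TensorProduct.lid ℂ A).toLinearMap ∘ₗ TensorProduct.map f LinearMap.id)
  have h1 : ∀ t : A ⊗[ℂ] A,
      (TensorProduct.lid ℂ A) (TensorProduct.map (convMul g f) LinearMap.id t)
        = T (TensorProduct.assoc ℂ A A A (comul.rTensor A t)) := by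
    intro t
    induction t using TensorProduct.induction_on with
    | zero => simp
    | add _ _ h h' => simp only [map_add, h, h']
    | tmul x y =>
      simp only [TensorProduct.map_tmul, LinearMap.id_apply, TensorProduct.lid_tmul,
        LinearMap.rTensor_tmul, convMul, LinearMap.comp_apply]
      generalize comul (R := ℂ) x = t
      induction t using TensorProduct.induction_on with
      | zero => simp
      | add _ _ h h' => simp only [map_add, add_smul, TensorProduct.add_tmul, h, h']
      | tmul u w => simp [T, smul_smul, mul_comm]
  have h2 : ∀ t : A ⊗[ℂ] A,
      rstar f ((TensorProduct.lid ℂ A) (TensorProduct.map g LinearMap.id t))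
        = T (comul.lTensor A t) := by
    intro t
    induction t using TensorProduct.induction_on with
    | zero => simp
    | add _ _ h h' => simp only [map_add, h, h']
    | tmul x y => simp [T, rstar]
  have := h1 (comul a)
  rw [coassoc_apply, ← h2] at this
  exact this.symm

lemma lstar_counit (a : A) : lstar (counit (R := ℂ)) a = a := by
  have h := lTensor_counit_comul (R := ℂ) a
  change (TensorProduct.rid ℂ A) (counit.lTensor A (comul a)) = a
  rw [h]; simp

lemma rstar_counit (a : A) : rstar (counit (R := ℂ)) a = a := by
  have h := rTensor_counit_comul (R := ℂ) a
  change (TensorProduct.lid ℂ A) (counit.rTensor A (comul a)) = a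
  rw [h]; simp

lemma apply_rstar (f g : A →ₗ[ℂ] ℂ) (a : A) : f (rstar g a) = convMul g f a := by
  simp only [rstar, convMul, LinearMap.comp_apply]
  generalize comul (R := ℂ) a = t
  induction t using TensorProduct.induction_on with
  | zero => simp
  | add _ _ h h' => simp only [map_add, h, h']
  | tmul u w => simp

lemma apply_lstar (f g : A →ₗ[ℂ] ℂ) (a : A) : f (lstar g a) = convMul f g a := by
  simp only [lstar, convMul, LinearMap.comp_apply]
  generalize comul (R := ℂ) a = t
  induction t using TensorProduct.induction_on with
  | zero => simp
  | add _ _ h h' => simp only [map_add, h, h']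
  | tmul u w => simp [mul_comm]

@[simp] lemma convMul_counit (f : A →ₗ[ℂ] ℂ) : convMul f counit = f := by
  ext a; rw [← apply_lstar, lstar_counit]

@[simp] lemma counit_convMul (f : A →ₗ[ℂ] ℂ) : convMul counit f = f := by
  ext a; rw [← apply_rstar, rstar_counit]

lemma counit_lstar (f : A →ₗ[ℂ] ℂ) (a : A) : counit (R := ℂ) (lstar f a) = f a := by
  rw [apply_lstar, counit_convMul]

lemma counit_rstar (f : A →ₗ[ℂ] ℂ) (a : A) : counit (R := ℂ) (rstar f a) = f a := by
  rw [apply_rstar, convMul_counit]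

/-- Inherited from the composition of the operators `f ∗ ·`, so coassociativity is not used a second
time. -/
lemma convMul_assoc (f g h : A →ₗ[ℂ] ℂ) :
    convMul (convMul f g) h = convMul f (convMul g h) := by
  ext a; rw [← apply_lstar, ← apply_lstar, ← apply_lstar, lstar_lstar]

/-- `f ↦ f ∗ ·` as a linear map. -/
def lstarHom : (A →ₗ[ℂ] ℂ) →ₗ[ℂ] A →ₗ[ℂ] A where
  toFun := lstar
  map_add' f g := by
    ext a; simp [lstar, TensorProduct.map_add_right]
  map_smul' c f := by
    ext a; simp [lstar, TensorProduct.map_smul_right]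

/-- `f ↦ · ∗ f` as a linear map. -/
def rstarHom : (A →ₗ[ℂ] ℂ) →ₗ[ℂ] A →ₗ[ℂ] A where
  toFun := rstar
  map_add' f g := by
    ext a; simp [rstar, TensorProduct.map_add_left]
  map_smul' c f := by
    ext a; simp [rstar, TensorProduct.map_smul_left]

/-- The convolution product as a bilinear map. -/
def convHom : (A →ₗ[ℂ] ℂ) →ₗ[ℂ] (A →ₗ[ℂ] ℂ) →ₗ[ℂ] A →ₗ[ℂ] ℂ :=
  LinearMap.mk₂ ℂ convMul
    (fun f f' g => by ext a; simp [convMul, TensorProduct.map_add_left])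
    (fun c f g => by ext a; simp [convMul, TensorProduct.map_smul_left])
    (fun f g g' => by ext a; simp [convMul, TensorProduct.map_add_right])
    (fun c f g => by ext a; simp [convMul, TensorProduct.map_smul_right])

lemma lstar_sum {ι : Type*} (s : Finset ι) (f : ι → A →ₗ[ℂ] ℂ) (a : A) :
    lstar (∑ i ∈ s, f i) a = ∑ i ∈ s, lstar (f i) a := by
  change lstarHom _ a = _
  rw [map_sum, LinearMap.sum_apply]; rfl

lemma lstar_smul (c : ℂ) (f : A →ₗ[ℂ] ℂ) (a : A) : lstar (c • f) a = c • lstar f a := by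
  change lstarHom _ a = _
  rw [map_smul]; rfl

lemma lstar_sub (f g : A →ₗ[ℂ] ℂ) (a : A) : lstar (f - g) a = lstar f a - lstar g a := by
  change lstarHom _ a = _
  rw [map_sub]; rfl

lemma rstar_sum {ι : Type*} (s : Finset ι) (f : ι → A →ₗ[ℂ] ℂ) (a : A) :
    rstar (∑ i ∈ s, f i) a = ∑ i ∈ s, rstar (f i) a := by
  change rstarHom _ a = _
  rw [map_sum, LinearMap.sum_apply]; rfl

lemma rstar_smul (c : ℂ) (f : A →ₗ[ℂ] ℂ) (a : A) : rstar (c • f) a = c • rstar f a := by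
  change rstarHom _ a = _
  rw [map_smul]; rfl

lemma rstar_sub (f g : A →ₗ[ℂ] ℂ) (a : A) : rstar (f - g) a = rstar f a - rstar g a := by
  change rstarHom _ a = _
  rw [map_sub]; rfl

lemma convMul_sum {ι : Type*} (s : Finset ι) (f : A →ₗ[ℂ] ℂ) (g : ι → A →ₗ[ℂ] ℂ) :
    convMul f (∑ i ∈ s, g i) = ∑ i ∈ s, convMul f (g i) :=
  map_sum (convHom f) g s

lemma sum_convMul {ι : Type*} (s : Finset ι) (f : ι → A →ₗ[ℂ] ℂ) (g : A →ₗ[ℂ] ℂ) :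
    convMul (∑ i ∈ s, f i) g = ∑ i ∈ s, convMul (f i) g :=
  (congrFun (congrArg DFunLike.coe (map_sum (convHom (A := A)) f s)) g).trans
    (LinearMap.sum_apply _ _ _)

lemma convMul_smul (c : ℂ) (f g : A →ₗ[ℂ] ℂ) : convMul f (c • g) = c • convMul f g :=
  map_smul (convHom f) c g

lemma smul_convMul (c : ℂ) (f g : A →ₗ[ℂ] ℂ) : convMul (c • f) g = c • convMul f g :=
  congrFun (congrArg DFunLike.coe (map_smul (convHom (A := A)) c f)) g

/-- If `φ(ab) = ∑ φ_k(a) φ'_k(b)` and similarly for `ψ`, then the convolution product `φψ` has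
the same property. -/
lemma convMul_apply_mul {κ κ' : Type*} [Fintype κ] [Fintype κ'] {φ ψ : A →ₗ[ℂ] ℂ}
    {φ₁ φ₂ : κ → A →ₗ[ℂ] ℂ} {ψ₁ ψ₂ : κ' → A →ₗ[ℂ] ℂ}
    (hφ : ∀ a b, φ (a * b) = ∑ k, φ₁ k a * φ₂ k b)
    (hψ : ∀ a b, ψ (a * b) = ∑ k, ψ₁ k a * ψ₂ k b) (a b : A) :
    convMul φ ψ (a * b)
      = ∑ k, ∑ l, convMul (φ₁ k) (ψ₁ l) a * convMul (φ₂ k) (ψ₂ l) b := by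
  simp only [convMul, LinearMap.comp_apply, Bialgebra.comul_mul]
  generalize comul (R := ℂ) a = s
  generalize comul (R := ℂ) b = t
  induction s using TensorProduct.induction_on with
  | zero => simp
  | add _ _ h h' => simp only [map_add, h, h', add_mul, Finset.sum_add_distrib]
  | tmul u w =>
    induction t using TensorProduct.induction_on with
    | zero => simp
    | add _ _ h h' => simp only [map_add, h, h', mul_add, Finset.sum_add_distrib]
    | tmul u' w' =>
      simp only [Algebra.TensorProduct.tmul_mul_tmul, TensorProduct.map_tmul, hφ, hψ,
        LinearMap.mul'_apply, Finset.sum_mul_sum]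
      exact Finset.sum_congr rfl fun k _ => Finset.sum_congr rfl fun l _ => by ring

lemma convMul_one (f g : A →ₗ[ℂ] ℂ) : convMul f g 1 = f 1 * g 1 := by
  simp [convMul, Algebra.TensorProduct.one_def]

/-- A functional is central if `f ∗ a = a ∗ f` for all `a`. -/
def IsCentralFunctional (f : A →ₗ[ℂ] ℂ) : Prop := ∀ a, lstar f a = rstar f a

lemma lstar_apply_mul_matrix {κ : Type*} [Fintype κ] {v : κ → κ → A}
    (hv : ∀ i j, comul (R := ℂ) (v i j) = ∑ k, v i k ⊗ₜ[ℂ] v k j) (f : A →ₗ[ℂ] ℂ) (i j : κ) :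
    lstar f (v i j) = ∑ k, f (v k j) • v i k :=
  lstar_eq_of_comul (hv i j) f

lemma rstar_apply_matrix {κ : Type*} [Fintype κ] {v : κ → κ → A}
    (hv : ∀ i j, comul (R := ℂ) (v i j) = ∑ k, v i k ⊗ₜ[ℂ] v k j) (f : A →ₗ[ℂ] ℂ) (i j : κ) :
    rstar f (v i j) = ∑ k, f (v i k) • v k j :=
  rstar_eq_of_comul (hv i j) f

end Functionals

end

noncomputable section

/-! ## Inversions and reduced words -/

section Inversions

variable {n : ℕ}

/-- The set of inversions of a permutation. -/
def invSet (π : Equiv.Perm (Fin n)) : Finset (Fin n × Fin n) :=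
  Finset.univ.filter fun p => p.1 < p.2 ∧ π p.2 < π p.1

/-- The number of inversions of a permutation. -/
def invNum (π : Equiv.Perm (Fin n)) : ℕ := (invSet π).card

/-- The product of a word in the adjacent transpositions. -/
def wordProd (w : List (Fin (n - 1))) : Equiv.Perm (Fin n) := (w.map (adjSwap n)).prod

@[simp] lemma wordProd_append (w w' : List (Fin (n - 1))) :
    wordProd (w ++ w') = wordProd w * wordProd w' := by
  simp [wordProd]

@[simp] lemma wordProd_nil : wordProd ([] : List (Fin (n - 1))) = 1 := rfl

@[simp] lemma wordProd_cons (m : Fin (n - 1)) (w : List (Fin (n - 1))) :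
    wordProd (m :: w) = adjSwap n m * wordProd w := by
  simp [wordProd]

@[simp] lemma adjSwap_mul_self (m : Fin (n - 1)) : adjSwap n m * adjSwap n m = 1 :=
  Equiv.swap_mul_self _ _

@[simp] lemma adjSwap_inv (m : Fin (n - 1)) : (adjSwap n m)⁻¹ = adjSwap n m :=
  Equiv.swap_inv _ _

lemma adjSwap_val (m : Fin (n - 1)) (a : Fin n) :
    ((adjSwap n m a : Fin n) : ℕ)
      = if (a : ℕ) = m then (m : ℕ) + 1 else if (a : ℕ) = m + 1 then (m : ℕ) else a := by
  rw [adjSwap, Equiv.swap_apply_def]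
  simp only [Fin.ext_iff]
  split_ifs <;> rfl

lemma adjSwap_lt (m : Fin (n - 1)) {a b : Fin n} (h : a < b)
    (h' : ¬ ((a : ℕ) = m ∧ (b : ℕ) = m + 1)) : adjSwap n m a < adjSwap n m b := by
  rw [Fin.lt_def] at h ⊢
  rw [adjSwap_val, adjSwap_val]
  split_ifs <;> omega

lemma adjSwap_left (m : Fin (n - 1)) (h : (m : ℕ) < n) (h' : (m : ℕ) + 1 < n) :
    adjSwap n m ⟨m, h⟩ = ⟨m + 1, h'⟩ := Equiv.swap_apply_left _ _

lemma adjSwap_right (m : Fin (n - 1)) (h : (m : ℕ) < n) (h' : (m : ℕ) + 1 < n) :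
    adjSwap n m ⟨m + 1, h'⟩ = ⟨m, h⟩ := Equiv.swap_apply_right _ _

lemma adjSwap_apply_eq {m : Fin (n - 1)} {a b : ℕ} (ha : a < n) (hb : b < n)
    (h : (if a = m then (m : ℕ) + 1 else if a = m + 1 then (m : ℕ) else a) = b) :
    adjSwap n m ⟨a, ha⟩ = ⟨b, hb⟩ := Fin.ext ((adjSwap_val m _).trans h)

lemma mem_invSet {π : Equiv.Perm (Fin n)} {a b : Fin n} :
    (a, b) ∈ invSet π ↔ a < b ∧ π b < π a := by
  simp [invSet]

/-- The transposition preserves the order of every pair except `(m, m+1)`. It therefore transports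
the inversions of `π`, and the exceptional pair becomes a new one. -/
lemma invNum_mul_adjSwap (π : Equiv.Perm (Fin n)) (m : Fin (n - 1))
    (h : π ⟨m, by omega⟩ < π ⟨m + 1, by omega⟩) :
    invNum (π * adjSwap n m) = invNum π + 1 := by
  have e : invSet (π * adjSwap n m) = insert (⟨m, by omega⟩, ⟨m + 1, by omega⟩)
      ((invSet π).map ((adjSwap n m).prodCongr (adjSwap n m)).toEmbedding) := by
    ext ⟨a, b⟩
    have hs : (adjSwap n m).symm = adjSwap n m := adjSwap_inv m
    rw [mem_invSet, Finset.mem_insert, Finset.mem_map_equiv, Equiv.prodCongr_symm, hs,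
      Equiv.prodCongr_apply, Prod.map, mem_invSet, Prod.mk.injEq, Equiv.Perm.mul_apply,
      Equiv.Perm.mul_apply]
    -- The pair exchanged by the transposition and its reversal are treated by hand; on all other
    -- pairs the order is preserved.
    by_cases hab : (a : ℕ) = m ∧ (b : ℕ) = m + 1
    · have ha : a = ⟨m, by omega⟩ := Fin.ext hab.1
      have hb : b = ⟨m + 1, by omega⟩ := Fin.ext hab.2
      simp only [ha, hb]
      rw [adjSwap_left m (by omega) (by omega), adjSwap_right m (by omega) (by omega)]
      simp [h, Fin.lt_def]
    by_cases hba : (b : ℕ) = m ∧ (a : ℕ) = m + 1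
    · have ha : a = ⟨m + 1, by omega⟩ := Fin.ext hba.2
      have hb : b = ⟨m, by omega⟩ := Fin.ext hba.1
      simp only [ha, hb]
      rw [adjSwap_left m (by omega) (by omega), adjSwap_right m (by omega) (by omega)]
      constructor
      · rintro ⟨h1, -⟩
        simp at h1
      · rintro (⟨h1, -⟩ | ⟨-, h1⟩)
        · simp at h1
        · exact absurd h1 h.not_gt
    · have h1 : a < b ↔ adjSwap n m a < adjSwap n m b := by
        refine ⟨fun h1 => adjSwap_lt m h1 hab, fun h1 => ?_⟩
        by_contra h2
        have h3 : b < a := lt_of_le_of_ne (not_lt.mp h2) (by rintro rfl; exact lt_irrefl _ h1)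
        exact absurd (adjSwap_lt m h3 hba) (not_lt.mpr h1.le)
      rw [h1]
      constructor
      · exact fun h => Or.inr h
      · rintro (⟨rfl, rfl⟩ | h)
        · exact absurd ⟨rfl, rfl⟩ hab
        · exact h
  rw [invNum, e, Finset.card_insert_of_notMem, Finset.card_map]
  · rfl
  · have hs : (adjSwap n m).symm = adjSwap n m := adjSwap_inv m
    rw [Finset.mem_map_equiv, Equiv.prodCongr_symm, hs, Equiv.prodCongr_apply, Prod.map,
      mem_invSet, adjSwap_left m (by omega) (by omega), adjSwap_right m (by omega) (by omega)]
    rintro ⟨h1, -⟩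
    simp [Fin.lt_def] at h1

lemma invNum_mul_adjSwap' (π : Equiv.Perm (Fin n)) (m : Fin (n - 1))
    (h : π ⟨m + 1, by omega⟩ < π ⟨m, by omega⟩) :
    invNum (π * adjSwap n m) + 1 = invNum π := by
  have := invNum_mul_adjSwap (π * adjSwap n m) m (by
    simpa [adjSwap_left m (by omega) (by omega), adjSwap_right m (by omega) (by omega)] using h)
  rw [mul_assoc, adjSwap_mul_self, mul_one] at this
  exact this.symm

lemma adjSwap_trichotomy (π : Equiv.Perm (Fin n)) (m : Fin (n - 1)) :
    π ⟨m, by omega⟩ < π ⟨m + 1, by omega⟩ ∨ π ⟨m + 1, by omega⟩ < π ⟨m, by omega⟩ := by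
  apply lt_or_gt_of_ne
  intro h
  have := π.injective h
  simp at this

lemma invNum_one : invNum (1 : Equiv.Perm (Fin n)) = 0 := by
  rw [invNum, Finset.card_eq_zero, invSet, Finset.filter_eq_empty_iff]
  rintro ⟨a, b⟩ -
  simp only [Equiv.Perm.coe_one, id_eq, not_and, not_lt]
  exact fun h => h.le

/-- Every letter changes the inversion number by exactly one, up or down. -/
lemma invNum_wordProd_le (w : List (Fin (n - 1))) : invNum (wordProd w) ≤ w.length := by
  induction w using List.reverseRecOn with
  | nil => rw [wordProd_nil, invNum_one]; simp
  | append_singleton w m ih =>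
    rw [wordProd_append, wordProd_cons, wordProd_nil, mul_one, List.length_append,
      List.length_singleton]
    rcases adjSwap_trichotomy (wordProd w) m with h | h
    · rw [invNum_mul_adjSwap _ _ h]; omega
    · have := invNum_mul_adjSwap' _ _ h; omega

/-- A finite linear order has only one order automorphism. -/
lemma perm_eq_one_of_strictMono {π : Equiv.Perm (Fin n)} (h : StrictMono π) : π = 1 := by
  have : StrictMono.orderIsoOfSurjective π h π.surjective = OrderIso.refl _ :=
    Subsingleton.elim _ _
  ext a
  exact congrArg (fun e : Fin n ≃o Fin n => ((e a : Fin n) : ℕ)) this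

/-- Bubble sort: multiplying by a transposition at a descent removes one inversion, and a
permutation without descents is increasing, hence trivial. -/
lemma exists_word (π : Equiv.Perm (Fin n)) :
    ∃ w : List (Fin (n - 1)), wordProd w = π ∧ w.length = invNum π := by
  induction hN : invNum π using Nat.strong_induction_on generalizing π with
  | _ N ih =>
    by_cases hd : ∃ m : Fin (n - 1), π ⟨m + 1, by omega⟩ < π ⟨m, by omega⟩
    · obtain ⟨m, hm⟩ := hd
      have h1 := invNum_mul_adjSwap' π m hm
      obtain ⟨w, hw, hl⟩ := ih _ (by omega) (π * adjSwap n m) rfl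
      refine ⟨w ++ [m], ?_, ?_⟩
      · rw [wordProd_append, hw, wordProd_cons, wordProd_nil, mul_one, mul_assoc,
          adjSwap_mul_self, mul_one]
      · rw [List.length_append, hl, List.length_singleton]; omega
    · have : π = 1 := by
        push Not at hd
        apply perm_eq_one_of_strictMono
        cases n with
        | zero => intro a; exact a.elim0
        | succ n =>
          rw [Fin.strictMono_iff_lt_succ]
          intro i
          rcases adjSwap_trichotomy π i with h | h
          · exact h
          · exact absurd h (not_lt.mpr (hd i))
      subst this
      exact ⟨[], rfl, by rw [← hN, invNum_one]; rfl⟩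

/-- The inversion number is a lower bound for the length of a word and is attained, so minimality
becomes a count. -/
lemma isReducedWord_iff {w : List (Fin (n - 1))} {π : Equiv.Perm (Fin n)} :
    IsReducedWord w π ↔ wordProd w = π ∧ w.length = invNum π := by
  constructor
  · rintro ⟨h, h'⟩
    refine ⟨h, ?_⟩
    obtain ⟨w', hw', hl⟩ := exists_word π
    have h1 := h' w' hw'
    have h2 := invNum_wordProd_le w
    rw [show wordProd w = π from h] at h2
    omega
  · rintro ⟨h, h'⟩
    refine ⟨h, fun w' hw' => ?_⟩
    have h2 := invNum_wordProd_le w'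
    rw [show wordProd w' = π from hw'] at h2
    omega

lemma adjSwap_comm {i j : Fin (n - 1)} (h : (i : ℕ) + 1 < j) :
    adjSwap n i * adjSwap n j = adjSwap n j * adjSwap n i := by
  ext a
  simp only [Equiv.Perm.coe_mul, Function.comp_apply, adjSwap_val]
  split_ifs <;> omega

lemma adjSwap_braid {i j : Fin (n - 1)} (h : (j : ℕ) = i + 1) :
    adjSwap n i * adjSwap n j * adjSwap n i = adjSwap n j * adjSwap n i * adjSwap n j := by
  have e : adjSwap n j = Equiv.swap ⟨i + 1, by omega⟩ ⟨i + 2, by omega⟩ := by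
    simp only [adjSwap, h]
  have key : ∀ x y z : Fin n, x ≠ y → x ≠ z → y ≠ z →
      Equiv.swap x y * Equiv.swap y z * Equiv.swap x y
        = Equiv.swap y z * Equiv.swap x y * Equiv.swap y z := by
    intro x y z hxy hxz hyz
    rw [Equiv.swap_mul_swap_mul_swap hxy hxz, Equiv.swap_comm x y, Equiv.swap_comm y z,
      Equiv.swap_mul_swap_mul_swap hyz.symm hxz.symm, Equiv.swap_comm]
  rw [e, adjSwap]
  exact key _ _ _ (by simp) (by simp) (by simp)

set_option maxHeartbeats 1000000 in
/-- Matsumoto's theorem for the symmetric group: in a monoid, products along reduced words of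
elements satisfying the braid relations depend only on the permutation. -/
theorem prod_map_eq_of_reduced {M : Type*} [Monoid M] {T : Fin (n - 1) → M}
    (hcomm : ∀ i j : Fin (n - 1), (i : ℕ) + 1 < j → T i * T j = T j * T i)
    (hbraid : ∀ i j : Fin (n - 1), (j : ℕ) = i + 1 → T i * T j * T i = T j * T i * T j)
    (N : ℕ) : ∀ (π : Equiv.Perm (Fin n)) (w w' : List (Fin (n - 1))), invNum π = N →
      wordProd w = π → wordProd w' = π → w.length = N → w'.length = N →
      (w.map T).prod = (w'.map T).prod := by
  induction N with
  | zero =>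
    intro π w w' _ _ _ hl hl'
    rw [List.length_eq_zero_iff] at hl hl'
    rw [hl, hl']
  | succ N ih =>
    -- The last letter of a reduced word is a descent, and dropping it leaves a reduced word of `π
    -- s_i`.
    have descent : ∀ (π : Equiv.Perm (Fin n)) (u : List (Fin (n - 1))) (i : Fin (n - 1)),
        invNum π = N + 1 → wordProd (u ++ [i]) = π → (u ++ [i]).length = N + 1 →
        wordProd u = π * adjSwap n i ∧ u.length = N ∧ invNum (π * adjSwap n i) = N ∧
          π ⟨i + 1, by omega⟩ < π ⟨i, by omega⟩ := by
      intro π u i hπ hu hl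
      have hl' : u.length = N := by simpa using hl
      have h1 : wordProd u = π * adjSwap n i := by
        rw [← hu, wordProd_append, wordProd_cons, wordProd_nil, mul_one, mul_assoc,
          adjSwap_mul_self, mul_one]
      have h2 := invNum_wordProd_le u
      rw [h1] at h2
      rcases adjSwap_trichotomy π i with h | h
      · have := invNum_mul_adjSwap π i h
        omega
      · have := invNum_mul_adjSwap' π i h
        exact ⟨h1, hl', by omega, h⟩
    have key : ∀ (π : Equiv.Perm (Fin n)) (u u' : List (Fin (n - 1))) (i j : Fin (n - 1)),
        invNum π = N + 1 → wordProd (u ++ [i]) = π → wordProd (u' ++ [j]) = π →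
        (u ++ [i]).length = N + 1 → (u' ++ [j]).length = N + 1 → (i : ℕ) ≤ j →
        ((u ++ [i]).map T).prod = ((u' ++ [j]).map T).prod := by
      intro π u u' i j hπ hu hu' hl hl' hij
      obtain ⟨h1, h2, h3, h4⟩ := descent π u i hπ hu hl
      obtain ⟨k1, k2, k3, k4⟩ := descent π u' j hπ hu' hl'
      simp only [List.map_append, List.map_cons, List.map_nil, List.prod_append, List.prod_cons,
        List.prod_nil, mul_one]
      rcases hij.lt_or_eq with hlt | heq
      swap
      · obtain rfl : i = j := Fin.ext heq
        rw [ih _ u u' h3 h1 k1 h2 k2]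
      rcases (Nat.succ_le_of_lt hlt).lt_or_eq with hlt' | heq
      · have d1 := invNum_mul_adjSwap' (π * adjSwap n i) j (by
          have e1 : adjSwap n i ⟨j + 1, by omega⟩ = ⟨j + 1, by omega⟩ :=
            adjSwap_apply_eq _ _ (by split_ifs <;> omega)
          have e2 : adjSwap n i ⟨j, by omega⟩ = ⟨j, by omega⟩ :=
            adjSwap_apply_eq _ _ (by split_ifs <;> omega)
          rwa [Equiv.Perm.mul_apply, Equiv.Perm.mul_apply, e1, e2])
        -- Two commuting descents. By induction `u` may be replaced by `z j` and `u'` by `z i`, so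
        -- that the words end in `j i` and in `i j`.
        obtain ⟨z, hz, hzl⟩ := exists_word (π * adjSwap n i * adjSwap n j)
        have hc := adjSwap_comm (n := n) hlt'
        rw [ih _ u (z ++ [j]) h3 h1 (by simp [hz, mul_assoc]) h2 (by simp; omega),
          ih _ u' (z ++ [i]) k3 k1 (by
            simp only [wordProd_append, wordProd_cons, wordProd_nil, mul_one, hz]
            rw [mul_assoc π, hc, mul_assoc, mul_assoc, adjSwap_mul_self, mul_one]) k2
            (by simp; omega)]
        simp only [List.map_append, List.map_cons, List.map_nil, List.prod_append,
          List.prod_cons, List.prod_nil, mul_one, mul_assoc]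
        rw [hcomm i j hlt']
      · have heq' : (j : ℕ) = i + 1 := heq.symm
        have hb := adjSwap_braid (n := n) heq'
        have f1 : (⟨i + 1, by omega⟩ : Fin n) = ⟨j, by omega⟩ := Fin.ext heq
        have d1 := invNum_mul_adjSwap' (π * adjSwap n i) j (by
          have e1 : adjSwap n i ⟨j + 1, by omega⟩ = ⟨j + 1, by omega⟩ :=
            adjSwap_apply_eq _ _ (by split_ifs <;> omega)
          have e2 : adjSwap n i ⟨j, by omega⟩ = ⟨i, by omega⟩ :=
            adjSwap_apply_eq _ _ (by split_ifs <;> omega)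
          rw [Equiv.Perm.mul_apply, Equiv.Perm.mul_apply, e1, e2]
          rw [f1] at h4
          exact k4.trans h4)
        have d2 := invNum_mul_adjSwap' (π * adjSwap n i * adjSwap n j) i (by
          have e1 : adjSwap n i (adjSwap n j ⟨i + 1, by omega⟩) = ⟨j + 1, by omega⟩ :=
            (congrArg _ (adjSwap_apply_eq (b := (i : ℕ) + 1 + 1) _ (by omega)
              (by split_ifs <;> omega))).trans (adjSwap_apply_eq _ _ (by split_ifs <;> omega))
          have e2 : adjSwap n i (adjSwap n j ⟨i, by omega⟩) = ⟨j, by omega⟩ :=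
            (congrArg _ (adjSwap_apply_eq (b := (i : ℕ)) _ (by omega)
              (by split_ifs <;> omega))).trans (adjSwap_apply_eq _ _ (by split_ifs <;> omega))
          rw [Equiv.Perm.mul_apply, Equiv.Perm.mul_apply, Equiv.Perm.mul_apply,
            Equiv.Perm.mul_apply, e1, e2]
          exact k4)
        -- Two adjacent descents force the whole braid word off the end of `π`. By induction `u`
        -- becomes `z i j` and `u'` becomes `z j i`, so the words end in `i j i` and `j i j`.
        obtain ⟨z, hz, hzl⟩ := exists_word (π * adjSwap n i * adjSwap n j * adjSwap n i)
        rw [ih _ u (z ++ [i, j]) h3 h1 (by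
            simp only [wordProd_append, wordProd_cons, wordProd_nil, mul_one, hz]
            rw [mul_assoc _ (adjSwap n i), ← mul_assoc (adjSwap n i), adjSwap_mul_self, one_mul,
              mul_assoc _ (adjSwap n j), adjSwap_mul_self, mul_one]) h2 (by simp; omega),
          ih _ u' (z ++ [j, i]) k3 k1 (by
            simp only [wordProd_append, wordProd_cons, wordProd_nil, mul_one, hz]
            rw [mul_assoc π, mul_assoc π, hb]
            calc _ = π * adjSwap n j * adjSwap n i * (adjSwap n j * adjSwap n j)
                  * adjSwap n i := by simp only [mul_assoc]
              _ = _ := by rw [adjSwap_mul_self, mul_one, mul_assoc, adjSwap_mul_self, mul_one])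
            k2 (by simp; omega)]
        simp only [List.map_append, List.map_cons, List.map_nil, List.prod_append,
          List.prod_cons, List.prod_nil, mul_one]
        have := hbraid i j heq'
        simp only [mul_assoc] at this ⊢
        rw [this]
    intro π w w' hπ hw hw' hl hl'
    rcases List.eq_nil_or_concat' w with rfl | ⟨u, i, rfl⟩
    · simp at hl
    rcases List.eq_nil_or_concat' w' with rfl | ⟨u', j, rfl⟩
    · simp at hl'
    rcases le_total (i : ℕ) j with h | h
    · exact key π u u' i j hπ hw hw' hl hl' h
    · exact (key π u' u j i hπ hw' hw hl' hl h).symm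

lemma wordProd_reverse (w : List (Fin (n - 1))) : wordProd w.reverse = (wordProd w)⁻¹ := by
  induction w with
  | nil => simp
  | cons m w ih => rw [List.reverse_cons, wordProd_append, ih]; simp

/-- Reversing a reduced word gives a word of the same length for the inverse; apply this to `π` and
to `π⁻¹`. -/
lemma invNum_inv (π : Equiv.Perm (Fin n)) : invNum π⁻¹ = invNum π := by
  have h : ∀ π : Equiv.Perm (Fin n), invNum π⁻¹ ≤ invNum π := by
    intro π
    obtain ⟨w, hw, hl⟩ := exists_word π
    rw [← hw, ← wordProd_reverse, hw, ← hl, ← List.length_reverse (as := w)]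
    exact invNum_wordProd_le _
  refine le_antisymm (h π) ?_
  simpa using h π⁻¹

end Inversions

end

noncomputable section

/-! ## Matrices acting in tensor powers -/

section Legs

variable {I : Type*} [Fintype I] [DecidableEq I]

/-- `M ↦ M ⊗ id`. -/
def snocMat (k : ℕ) : Matrix (Fin k → I) (Fin k → I) ℂ →ₐ[ℂ]
    Matrix (Fin (k + 1) → I) (Fin (k + 1) → I) ℂ :=
  AlgHom.ofLinearMap
    { toFun := fun M => Matrix.of fun K J =>
        if K (Fin.last k) = J (Fin.last k) then M (Fin.init K) (Fin.init J) else 0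
      map_add' := fun M M' => by
        ext K J
        simp only [Matrix.of_apply, Matrix.add_apply]
        split_ifs <;> simp
      map_smul' := fun c M => by
        ext K J
        simp only [Matrix.of_apply, Matrix.smul_apply]
        split_ifs <;> simp }
    (by
      ext K J
      have h : K = J ↔ K (Fin.last k) = J (Fin.last k) ∧ Fin.init K = Fin.init J := by
        constructor
        · rintro rfl; exact ⟨rfl, rfl⟩
        · rintro ⟨h0, h1⟩
          rw [← Fin.snoc_init_self K, ← Fin.snoc_init_self J, h0, h1]
      simp only [LinearMap.coe_mk, AddHom.coe_mk, Matrix.of_apply, Matrix.one_apply, h]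
      split_ifs <;> simp_all)
    (fun M M' => by
      ext K J
      simp only [LinearMap.coe_mk, AddHom.coe_mk, Matrix.of_apply, Matrix.mul_apply, sum_snoc,
        Fin.snoc_last, Fin.init_snoc]
      rw [Finset.sum_eq_single (K (Fin.last k))]
      · simp only [if_true]
        split_ifs <;> simp
      · intro a _ ha
        simp [ha.symm]
      · simp)

/-- `M ↦ id ⊗ M`. -/
def consMat (k : ℕ) : Matrix (Fin k → I) (Fin k → I) ℂ →ₐ[ℂ]
    Matrix (Fin (k + 1) → I) (Fin (k + 1) → I) ℂ :=
  AlgHom.ofLinearMap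
    { toFun := fun M => Matrix.of fun K J => if K 0 = J 0 then M (Fin.tail K) (Fin.tail J) else 0
      map_add' := fun M M' => by
        ext K J
        simp only [Matrix.of_apply, Matrix.add_apply]
        split_ifs <;> simp
      map_smul' := fun c M => by
        ext K J
        simp only [Matrix.of_apply, Matrix.smul_apply]
        split_ifs <;> simp }
    (by
      ext K J
      have h : K = J ↔ K 0 = J 0 ∧ Fin.tail K = Fin.tail J := by
        constructor
        · rintro rfl; exact ⟨rfl, rfl⟩
        · rintro ⟨h0, h1⟩
          rw [← Fin.cons_self_tail K, ← Fin.cons_self_tail J, h0, h1]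
      simp only [LinearMap.coe_mk, AddHom.coe_mk, Matrix.of_apply, Matrix.one_apply, h]
      split_ifs <;> simp_all)
    (fun M M' => by
      ext K J
      simp only [LinearMap.coe_mk, AddHom.coe_mk, Matrix.of_apply, Matrix.mul_apply, sum_cons,
        Fin.cons_zero, Fin.tail_cons]
      rw [Finset.sum_eq_single (K 0)]
      · simp only [if_true]
        split_ifs <;> simp
      · intro a _ ha
        simp [ha.symm]
      · simp)

lemma snocMat_apply (k : ℕ) (M : Matrix (Fin k → I) (Fin k → I) ℂ) (K J : Fin (k + 1) → I) :
    snocMat k M K J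
      = if K (Fin.last k) = J (Fin.last k) then M (Fin.init K) (Fin.init J) else 0 := rfl

lemma consMat_apply (k : ℕ) (M : Matrix (Fin k → I) (Fin k → I) ℂ) (K J : Fin (k + 1) → I) :
    consMat k M K J = if K 0 = J 0 then M (Fin.tail K) (Fin.tail J) else 0 := rfl

lemma snocMat_transpose (k : ℕ) (M : Matrix (Fin k → I) (Fin k → I) ℂ) :
    snocMat k M.transpose = (snocMat k M).transpose := by
  ext K J
  simp only [snocMat_apply, Matrix.transpose_apply, eq_comm]

lemma consMat_transpose (k : ℕ) (M : Matrix (Fin k → I) (Fin k → I) ℂ) :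
    consMat k M.transpose = (consMat k M).transpose := by
  ext K J
  simp only [consMat_apply, Matrix.transpose_apply, eq_comm]

variable (s : Matrix (I × I) (I × I) ℂ)

lemma legMat_castSucc (k : ℕ) (m : Fin (k - 1)) (h : (m : ℕ) < k + 1 - 1) :
    legMat s (k + 1) ⟨m, h⟩ = snocMat k (legMat s k m) := by
  ext K J
  simp only [legMat, Matrix.of_apply, snocMat_apply]
  have e : (∀ a : Fin (k + 1), (a : ℕ) ≠ m → (a : ℕ) ≠ m + 1 → K a = J a) ↔
      K (Fin.last k) = J (Fin.last k) ∧
        ∀ a : Fin k, (a : ℕ) ≠ m → (a : ℕ) ≠ m + 1 → Fin.init K a = Fin.init J a := by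
    constructor
    · intro h
      exact ⟨h _ (by simp; omega) (by simp; omega), fun a => h a.castSucc⟩
    · rintro ⟨h0, h1⟩ a
      refine Fin.lastCases (fun _ _ => h0) (fun a => h1 a) a
  simp only [e, ite_and]
  rfl

lemma legMat_succ (k : ℕ) (m : Fin (k - 1)) (h : (m : ℕ) + 1 < k + 1 - 1) :
    legMat s (k + 1) ⟨m + 1, h⟩ = consMat k (legMat s k m) := by
  ext K J
  simp only [legMat, Matrix.of_apply, consMat_apply]
  have e : (∀ a : Fin (k + 1), (a : ℕ) ≠ m + 1 → (a : ℕ) ≠ m + 1 + 1 → K a = J a) ↔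
      K 0 = J 0 ∧
        ∀ a : Fin k, (a : ℕ) ≠ m → (a : ℕ) ≠ m + 1 → Fin.tail K a = Fin.tail J a := by
    constructor
    · intro h
      exact ⟨h _ (by simp) (by simp), fun a h1 h2 => h a.succ (by simpa using h1)
        (by simpa using h2)⟩
    · rintro ⟨h0, h1⟩ a
      refine Fin.cases (fun _ _ => h0) (fun a h2 h3 => h1 a (by simpa using h2)
        (by simpa using h3)) a
  simp only [e, ite_and]
  rfl

omit [Fintype I] in
lemma legMat_transpose (n : ℕ) (m : Fin (n - 1)) :
    legMat s.transpose n m = (legMat s n m).transpose := by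
  ext K J
  simp only [legMat, Matrix.of_apply, Matrix.transpose_apply, eq_comm]

/-- Replace the components `m` and `m + 1` of a multi-index. -/
def updPair {n : ℕ} (K : Fin n → I) (m : Fin (n - 1)) (p : I × I) : Fin n → I :=
  fun a => if (a : ℕ) = m then p.1 else if (a : ℕ) = m + 1 then p.2 else K a

/-- Only the two affected indices are summed over. Relations between leg operators are checked
through this action on functions, which avoids sums over whole multi-indices. -/
lemma legMat_mulVec {n : ℕ} (m : Fin (n - 1)) (F : (Fin n → I) → ℂ) (K : Fin n → I) :
    (legMat s n m).mulVec F K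
      = ∑ p, s (K ⟨m, by omega⟩, K ⟨m + 1, by omega⟩) p * F (updPair K m p) := by
  rw [Matrix.mulVec, dotProduct]
  symm
  -- A multi-index outside the image of `updPair K m` differs from `K` in some other place, and
  -- there the matrix entry vanishes.
  refine Fintype.sum_of_injective (updPair K m) ?_ _ _ ?_ ?_
  · intro p p' h
    have h1 := congrFun h ⟨m, by omega⟩
    have h2 := congrFun h ⟨m + 1, by omega⟩
    simp only [updPair, if_true] at h1 h2
    exact Prod.ext h1 (by simpa using h2)
  · intro J hJ
    rw [legMat, Matrix.of_apply, if_neg, zero_mul]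
    intro h
    apply hJ
    refine ⟨(J ⟨m, by omega⟩, J ⟨m + 1, by omega⟩), ?_⟩
    funext a
    simp only [updPair]
    split_ifs with h1 h2
    · exact congrArg J (Fin.ext h1.symm)
    · exact congrArg J (Fin.ext h2.symm)
    · exact h a h1 h2
  · intro p
    rw [legMat, Matrix.of_apply, if_pos]
    · simp [updPair]
    · intro a h1 h2
      simp [updPair, h1, h2]

lemma legMat_mul (s' : Matrix (I × I) (I × I) ℂ) (n : ℕ) (m : Fin (n - 1)) :
    legMat (s * s') n m = legMat s n m * legMat s' n m := by
  apply Matrix.toLin'.injective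
  refine LinearMap.ext fun F => funext fun K => ?_
  simp only [Matrix.toLin'_apply, ← Matrix.mulVec_mulVec, legMat_mulVec]
  simp only [updPair, Matrix.mul_apply, Finset.mul_sum, Finset.sum_mul]
  rw [Finset.sum_comm]
  refine Finset.sum_congr rfl fun p _ => Finset.sum_congr rfl fun r _ => ?_
  simp only [if_true, Nat.succ_ne_self, if_false, mul_assoc]
  congr 3
  funext a
  simp only [updPair]
  split_ifs <;> rfl

omit [Fintype I] in
lemma legMat_one (n : ℕ) (m : Fin (n - 1)) :
    legMat (1 : Matrix (I × I) (I × I) ℂ) n m = 1 := by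
  ext K J
  simp only [legMat, Matrix.of_apply, Matrix.one_apply, Prod.mk.injEq]
  by_cases h : K = J
  · subst h; simp
  · rw [if_neg h]
    split_ifs with h1 h2
    · exfalso
      apply h
      funext a
      by_cases h3 : (a : ℕ) = m
      · rw [show a = ⟨m, by omega⟩ from Fin.ext h3]; exact h2.1
      by_cases h4 : (a : ℕ) = m + 1
      · rw [show a = ⟨m + 1, by omega⟩ from Fin.ext h4]; exact h2.2
      exact h1 a h3 h4
    · rfl
    · rfl

lemma legMat_comm {n : ℕ} {i j : Fin (n - 1)} (h : (i : ℕ) + 1 < j) :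
    legMat s n i * legMat s n j = legMat s n j * legMat s n i := by
  apply Matrix.toLin'.injective
  refine LinearMap.ext fun F => funext fun K => ?_
  simp only [Matrix.toLin'_apply, ← Matrix.mulVec_mulVec, legMat_mulVec]
  simp only [updPair, Finset.mul_sum]
  rw [Finset.sum_comm]
  refine Finset.sum_congr rfl fun p _ => Finset.sum_congr rfl fun r _ => ?_
  have h1 : (j : ℕ) ≠ i := by omega
  have h2 : (j : ℕ) ≠ i + 1 := by omega
  have h3 : (j : ℕ) + 1 ≠ i := by omega
  have h4 : (j : ℕ) + 1 ≠ i + 1 := by omega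
  simp only [h1, h2, h3, h4, h1.symm, h2.symm, h3.symm, h4.symm, if_false]
  rw [mul_left_comm]
  congr 3
  funext a
  simp only [updPair]
  split_ifs <;> first | rfl | omega

/-- The braid relation for the actions of `s` in neighbouring tensor factors. -/
def IsBraiding : Prop :=
  ∀ (n : ℕ) (i j : Fin (n - 1)), (j : ℕ) = i + 1 →
    legMat s n i * legMat s n j * legMat s n i = legMat s n j * legMat s n i * legMat s n j

variable {s}

/-- Neighbouring leg operators touch three factors only, so the braid relation in every tensor power
is the one in `V ⊗ V ⊗ V`, written in entries. -/
lemma isBraiding_of_entries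
    (h : ∀ x y z a b c : I,
      ∑ p : I × I, ∑ d, s (x, y) p * s (p.2, z) (d, c) * s (p.1, d) (a, b)
        = ∑ p : I × I, ∑ d, s (y, z) p * s (x, p.1) (a, d) * s (d, p.2) (b, c)) :
    IsBraiding s := by
  intro n i j hij
  obtain ⟨j, hj⟩ := j
  obtain rfl : j = i + 1 := hij
  apply Matrix.toLin'.injective
  refine LinearMap.ext fun F => funext fun K => ?_
  simp only [Matrix.toLin'_apply, ← Matrix.mulVec_mulVec, legMat_mulVec]
  -- All indices are frozen except the three that move; the nested updates on both sides then depend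
  -- only on these.
  let G : I → I → I → ℂ := fun a b c => F fun t => if (t : ℕ) = i then a else
    if (t : ℕ) = i + 1 then b else if (t : ℕ) = i + 1 + 1 then c else K t
  have hF1 : ∀ p q r : I × I, F (updPair (updPair (updPair K i p) ⟨i + 1, by omega⟩ q) i r)
      = G r.1 r.2 q.2 := by
    intro p q r
    refine congrArg F (funext fun t => ?_)
    simp only [updPair]
    split_ifs <;> rfl
  have hF2 : ∀ p q r : I × I, F (updPair (updPair (updPair K ⟨i + 1, by omega⟩ p) i q)
      ⟨i + 1, by omega⟩ r) = G q.1 r.1 r.2 := by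
    intro p q r
    refine congrArg F (funext fun t => ?_)
    simp only [updPair]
    split_ifs <;> first | rfl | omega
  simp only [hF1, hF2]
  simp only [updPair, if_true, Nat.succ_ne_self, if_false, Finset.mul_sum]
  have e1 : ¬ ((i : ℕ) = i + 1) := by omega
  have e2 : ¬ ((i : ℕ) = i + 1 + 1) := by omega
  have e3 : ¬ ((i : ℕ) + 1 + 1 = i) := by omega
  simp only [e1, e2, e3, if_false]
  generalize K ⟨i, _⟩ = x
  generalize K ⟨i + 1, _⟩ = y
  generalize K ⟨i + 1 + 1, _⟩ = z
  trans ∑ a, ∑ b, ∑ c, (∑ p : I × I, ∑ d, s (x, y) p * s (p.2, z) (d, c) * s (p.1, d) (a, b))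
    * G a b c
  · trans ∑ t : I × I × I, (∑ p : I × I, ∑ d, s (x, y) p * s (p.2, z) (d, t.1)
      * s (p.1, d) t.2) * G t.2.1 t.2.2 t.1
    · symm
      simp only [Finset.sum_mul]
      rw [Finset.sum_comm]
      refine Finset.sum_congr rfl fun p _ => ?_
      rw [Finset.sum_comm]
      simp only [Fintype.sum_prod_type, mul_assoc]
    · rw [Fintype.sum_prod_type, Finset.sum_comm, Fintype.sum_prod_type]
  · simp only [h]
    trans ∑ t : I × I × I, (∑ p : I × I, ∑ d, s (y, z) p * s (x, p.1) (t.1, d)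
      * s (d, p.2) t.2) * G t.1 t.2.1 t.2.2
    · rw [Fintype.sum_prod_type]
      refine Finset.sum_congr rfl fun a _ => ?_
      rw [Fintype.sum_prod_type]
    · simp only [Finset.sum_mul]
      rw [Finset.sum_comm]
      refine Finset.sum_congr rfl fun p _ => ?_
      rw [Fintype.sum_prod_type, Fintype.sum_prod_type]
      refine Finset.sum_congr rfl fun a _ => ?_
      rw [Finset.sum_comm]
      simp only [mul_assoc]

lemma IsBraiding.transpose (h : IsBraiding s) : IsBraiding s.transpose := by
  intro n i j hij
  simp only [legMat_transpose, ← Matrix.transpose_mul]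
  rw [← Matrix.mul_assoc, ← Matrix.mul_assoc, h n i j hij]

/-- Invert both sides of the braid relation. The words are palindromes, so the inverses satisfy the
relation of the same shape. -/
lemma IsBraiding.of_mul_eq_one {s' : Matrix (I × I) (I × I) ℂ} (h : IsBraiding s)
    (hs : s * s' = 1) : IsBraiding s' := by
  have h1 : ∀ (n : ℕ) (i : Fin (n - 1)), legMat s n i * legMat s' n i = 1 := fun n i => by
    rw [← legMat_mul, hs, legMat_one]
  have h2 : ∀ (n : ℕ) (i : Fin (n - 1)), legMat s' n i * legMat s n i = 1 := fun n i =>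
    mul_eq_one_comm.mp (h1 n i)
  intro n i j hij
  have cancel : ∀ a b c a' b' c' : Matrix (Fin n → I) (Fin n → I) ℂ, a * a' = 1 → b * b' = 1 →
      c * c' = 1 → (a * b * c) * (c' * b' * a') = 1 := by
    intro a b c a' b' c' ha hb hc
    calc _ = a * (b * (c * c') * b') * a' := by simp only [mul_assoc]
      _ = 1 := by rw [hc, mul_one, hb, mul_one, ha]
  have l := cancel _ _ _ _ _ _ (h2 n i) (h2 n j) (h2 n i)
  have r := cancel _ _ _ _ _ _ (h1 n j) (h1 n i) (h1 n j)
  rw [h n i j hij] at l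
  calc _ = legMat s' n i * legMat s' n j * legMat s' n i * 1 := (mul_one _).symm
    _ = _ := by rw [← r, ← mul_assoc, l, one_mul]

/-! ### Operators of permutations and the antisymmetrisers of `s` and `s⁻¹`. -/

section PermMat

variable {n : ℕ}

lemma reducedWord_spec (π : Equiv.Perm (Fin n)) :
    wordProd (reducedWord π) = π ∧ (reducedWord π).length = invNum π :=
  isReducedWord_iff.mp (exists_reducedWord π).choose_spec

/-- Matsumoto's theorem removes the dependence on the reduced word chosen in `permMat`. -/
lemma IsBraiding.permMat_eq (h : IsBraiding s) {π : Equiv.Perm (Fin n)} {w : List (Fin (n - 1))}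
    (hw : wordProd w = π) (hl : w.length = invNum π) :
    permMat s π = (w.map (legMat s n)).prod :=
  prod_map_eq_of_reduced (fun _ _ hij => legMat_comm s hij) (h n) _ π _ _ rfl
    (reducedWord_spec π).1 hw (reducedWord_spec π).2 hl

/-- If the lengths add, the concatenation of reduced words is reduced. -/
lemma IsBraiding.permMat_mul (h : IsBraiding s) {π ρ : Equiv.Perm (Fin n)}
    (hl : invNum (π * ρ) = invNum π + invNum ρ) : permMat s (π * ρ) = permMat s π * permMat s ρ := by
  obtain ⟨w, hw, hwl⟩ := exists_word π
  obtain ⟨w', hw', hwl'⟩ := exists_word ρ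
  rw [h.permMat_eq hw hwl, h.permMat_eq hw' hwl', ← List.prod_append, ← List.map_append]
  exact h.permMat_eq (by rw [wordProd_append, hw, hw']) (by rw [List.length_append, hl, hwl, hwl'])

lemma permMat_one : permMat s (1 : Equiv.Perm (Fin n)) = 1 := by
  have := (reducedWord_spec (1 : Equiv.Perm (Fin n))).2
  rw [invNum_one, List.length_eq_zero_iff] at this
  rw [permMat, this]; rfl

lemma IsBraiding.permMat_transpose (h : IsBraiding s) (π : Equiv.Perm (Fin n)) :
    permMat s.transpose π = (permMat s π⁻¹).transpose := by
  obtain ⟨w, hw, hwl⟩ := exists_word π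
  rw [h.transpose.permMat_eq hw hwl, h.permMat_eq (w := w.reverse) (by rw [wordProd_reverse, hw])
    (by rw [List.length_reverse, hwl, invNum_inv]), Matrix.transpose_list_prod]
  rw [List.map_reverse, List.map_reverse, List.reverse_reverse, List.map_map]
  congr 2
  funext m
  exact legMat_transpose s n m

/-- A reduced word followed by its reversal in the inverse letters cancels from the middle outwards.
-/
lemma IsBraiding.permMat_mul_inv {s' : Matrix (I × I) (I × I) ℂ} (h : IsBraiding s)
    (hs : s * s' = 1) (π : Equiv.Perm (Fin n)) : permMat s π * permMat s' π⁻¹ = 1 := by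
  obtain ⟨w, hw, hwl⟩ := exists_word π
  rw [h.permMat_eq hw hwl, (h.of_mul_eq_one hs).permMat_eq (w := w.reverse)
    (by rw [wordProd_reverse, hw]) (by rw [List.length_reverse, hwl, invNum_inv])]
  clear hw hwl
  induction w with
  | nil => simp
  | cons m w ih =>
    rw [List.reverse_cons, List.map_append, List.prod_append, List.map_cons, List.prod_cons,
      List.map_singleton, List.prod_singleton, mul_assoc, ← mul_assoc _ _ (legMat s' n m), ih,
      one_mul, ← legMat_mul, hs, legMat_one]

lemma sign_wordProd (w : List (Fin (n - 1))) :
    Equiv.Perm.sign (wordProd w) = (-1) ^ w.length := by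
  induction w with
  | nil => simp
  | cons m w ih =>
    rw [wordProd_cons, Equiv.Perm.sign_mul, ih, adjSwap, Equiv.Perm.sign_swap (by simp),
      List.length_cons, pow_succ']

lemma sign_eq_pow_invNum (π : Equiv.Perm (Fin n)) : Equiv.Perm.sign π = (-1) ^ invNum π := by
  obtain ⟨w, rfl, hl⟩ := exists_word π
  rw [sign_wordProd, hl]

/-- Transposition reverses words, that is, inverts permutations, which keeps the sign. It converts
factorisations with `A_k` on the left into factorisations with `A_k` on the right. -/
lemma IsBraiding.antisymmetriser_transpose (h : IsBraiding s) (n : ℕ) :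
    antisymmetriser s.transpose n = (antisymmetriser s n).transpose := by
  rw [antisymmetriser, antisymmetriser, Matrix.transpose_sum,
    ← Equiv.sum_comp (Equiv.inv (Equiv.Perm (Fin n)))]
  refine Finset.sum_congr rfl fun π _ => ?_
  rw [Matrix.transpose_smul, h.permMat_transpose]
  simp

/-- Composing with the order reversal exchanges inversions and non-inversions, so the two inversion
sets partition the pairs `a < b`. -/
lemma invNum_rev_mul (π : Equiv.Perm (Fin n)) :
    invNum (Fin.revPerm * π) + invNum π = invNum (Fin.revPerm : Equiv.Perm (Fin n)) := by
  rw [invNum, invNum, ← Finset.card_union_of_disjoint]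
  · rw [invNum]
    congr 1
    ext ⟨a, b⟩
    rw [Finset.mem_union, mem_invSet, mem_invSet, mem_invSet]
    simp only [Equiv.Perm.mul_apply, Fin.revPerm_apply, Fin.rev_lt_rev]
    constructor
    · rintro (h | h) <;> exact ⟨h.1, h.1⟩
    · rintro ⟨h, -⟩
      rcases lt_or_gt_of_ne (fun e => h.ne (π.injective e)) with h' | h'
      · exact Or.inl ⟨h, h'⟩
      · exact Or.inr ⟨h, h'⟩
  · rw [Finset.disjoint_left]
    rintro ⟨a, b⟩ h h'
    rw [mem_invSet] at h h'
    simp only [Equiv.Perm.mul_apply, Fin.revPerm_apply, Fin.rev_lt_rev] at h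
    exact lt_asymm h.2 h'.2

/-- The antisymmetrisers of `s` and of `s⁻¹` differ by an invertible factor. -/
lemma IsBraiding.permMat_rev_mul_antisymmetriser {s' : Matrix (I × I) (I × I) ℂ}
    (h : IsBraiding s) (hs : s * s' = 1) (n : ℕ) :
    permMat s (Fin.revPerm : Equiv.Perm (Fin n)) * antisymmetriser s' n
      = ((Equiv.Perm.sign (Fin.revPerm : Equiv.Perm (Fin n)) : ℤ) : ℂ) • antisymmetriser s n := by
  rw [antisymmetriser, antisymmetriser, Finset.mul_sum, Finset.smul_sum,
    ← Equiv.sum_comp (Equiv.mulLeft (Fin.revPerm : Equiv.Perm (Fin n)))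
      (fun π => ((Equiv.Perm.sign Fin.revPerm : ℤ) : ℂ) •
        ((Equiv.Perm.sign π : ℤ) : ℂ) • permMat s π)]
  refine Finset.sum_congr rfl fun π _ => ?_
  -- The lengths of `w₀π` and `π⁻¹` add up to that of the longest element `w₀`. The factor belonging
  -- to `π⁻¹` then cancels the summand of the antisymmetriser of `s'` at `π`.
  have e : permMat s (Fin.revPerm : Equiv.Perm (Fin n))
      = permMat s (Fin.revPerm * π) * permMat s π⁻¹ := by
    rw [← h.permMat_mul]
    · simp
    · rw [mul_inv_cancel_right, invNum_inv, invNum_rev_mul]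
  have e2 := h.permMat_mul_inv hs π⁻¹
  rw [inv_inv] at e2
  have e3 : ((Equiv.Perm.sign (Fin.revPerm : Equiv.Perm (Fin n)) : ℤ) : ℂ)
      * ((Equiv.Perm.sign (Fin.revPerm : Equiv.Perm (Fin n)) : ℤ) : ℂ) = 1 := by
    rw [← Int.cast_mul, ← Units.val_mul, Int.units_mul_self]; simp
  rw [mul_smul_comm, e, mul_assoc, e2, mul_one, Equiv.coe_mulLeft, smul_smul,
    Equiv.Perm.sign_mul, Units.val_mul, Int.cast_mul, ← mul_assoc, e3, one_mul]

end PermMat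

end Legs

end

noncomputable section

/-! ## Factorisations of the antisymmetriser -/

section Embeddings

variable {k : ℕ}

/-- The embedding `S_k → S_{k+1}` as permutations fixing the last letter. -/
def embLast (π : Equiv.Perm (Fin k)) : Equiv.Perm (Fin (k + 1)) where
  toFun := Fin.lastCases (Fin.last k) fun a => (π a).castSucc
  invFun := Fin.lastCases (Fin.last k) fun a => (π⁻¹ a).castSucc
  left_inv := by refine Fin.lastCases ?_ fun a => ?_ <;> simp
  right_inv := by refine Fin.lastCases ?_ fun a => ?_ <;> simp

/-- The embedding `S_k → S_{k+1}` as permutations fixing the first letter. -/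
def embFirst (π : Equiv.Perm (Fin k)) : Equiv.Perm (Fin (k + 1)) where
  toFun := Fin.cases 0 fun a => (π a).succ
  invFun := Fin.cases 0 fun a => (π⁻¹ a).succ
  left_inv := by refine Fin.cases ?_ fun a => ?_ <;> simp
  right_inv := by refine Fin.cases ?_ fun a => ?_ <;> simp

@[simp] lemma embLast_last (π : Equiv.Perm (Fin k)) : embLast π (Fin.last k) = Fin.last k := by
  simp [embLast]

@[simp] lemma embLast_castSucc (π : Equiv.Perm (Fin k)) (a : Fin k) :
    embLast π a.castSucc = (π a).castSucc := by
  simp [embLast]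

@[simp] lemma embFirst_zero (π : Equiv.Perm (Fin k)) : embFirst π 0 = 0 := rfl

@[simp] lemma embFirst_succ (π : Equiv.Perm (Fin k)) (a : Fin k) :
    embFirst π a.succ = (π a).succ := rfl

lemma embLast_mul (π ρ : Equiv.Perm (Fin k)) : embLast (π * ρ) = embLast π * embLast ρ := by
  ext a; refine Fin.lastCases ?_ (fun a => ?_) a <;> simp

lemma embFirst_mul (π ρ : Equiv.Perm (Fin k)) : embFirst (π * ρ) = embFirst π * embFirst ρ := by
  ext a; refine Fin.cases ?_ (fun a => ?_) a <;> simp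

lemma embLast_one : embLast (1 : Equiv.Perm (Fin k)) = 1 := by
  ext a; refine Fin.lastCases ?_ (fun a => ?_) a <;> simp

lemma embFirst_one : embFirst (1 : Equiv.Perm (Fin k)) = 1 := by
  ext a; refine Fin.cases ?_ (fun a => ?_) a <;> simp

lemma embLast_injective : Function.Injective (embLast (k := k)) := by
  intro π ρ h
  ext a
  have := congrArg (fun e : Equiv.Perm (Fin (k + 1)) => ((e a.castSucc : Fin (k + 1)) : ℕ)) h
  simpa using this

lemma embFirst_injective : Function.Injective (embFirst (k := k)) := by
  intro π ρ h
  ext a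
  have := congrArg (fun e : Equiv.Perm (Fin (k + 1)) => ((e a.succ : Fin (k + 1)) : ℕ)) h
  simpa using this

lemma invNum_embLast (π : Equiv.Perm (Fin k)) : invNum (embLast π) = invNum π := by
  have : invSet (embLast π)
      = (invSet π).map (Fin.castSuccEmb.prodMap Fin.castSuccEmb) := by
    ext ⟨a, b⟩
    rw [mem_invSet]
    simp only [Finset.mem_map, Function.Embedding.coe_prodMap, Prod.exists, Prod.map, Prod.mk.injEq,
      mem_invSet]
    constructor
    · intro h
      induction b using Fin.lastCases with
      | last => exact absurd h.2 (by simp [Fin.le_last])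
      | cast b =>
        induction a using Fin.lastCases with
        | last => exact absurd h.1 (by simp [Fin.le_last])
        | cast a => exact ⟨a, b, by simpa using h, rfl, rfl⟩
    · rintro ⟨a, b, h, rfl, rfl⟩
      simpa using h
  rw [invNum, this, Finset.card_map, invNum]

lemma invNum_embFirst (π : Equiv.Perm (Fin k)) : invNum (embFirst π) = invNum π := by
  have : invSet (embFirst π)
      = (invSet π).map ((Fin.succEmb k).prodMap (Fin.succEmb k)) := by
    ext ⟨a, b⟩
    rw [mem_invSet]
    simp only [Finset.mem_map, Function.Embedding.coe_prodMap, Prod.exists, Prod.map, Prod.mk.injEq,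
      mem_invSet]
    constructor
    · intro h
      induction a using Fin.cases with
      | zero => exact absurd h.2 (by simp)
      | succ a =>
        induction b using Fin.cases with
        | zero => exact absurd h.1 (by simp)
        | succ b => exact ⟨a, b, by simpa using h, rfl, rfl⟩
    · rintro ⟨a, b, h, rfl, rfl⟩
      simpa using h
  rw [invNum, this, Finset.card_map, invNum]

/-- The inclusion of letters `m ↦ m`. -/
def letterLast (m : Fin (k - 1)) : Fin (k + 1 - 1) := ⟨m, by omega⟩

/-- The inclusion of letters `m ↦ m + 1`. -/
def letterFirst (m : Fin (k - 1)) : Fin (k + 1 - 1) := ⟨m + 1, by omega⟩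

lemma embLast_adjSwap (m : Fin (k - 1)) :
    embLast (adjSwap k m) = adjSwap (k + 1) (letterLast m) := by
  ext a
  rw [adjSwap_val]
  induction a using Fin.lastCases with
  | last => rw [embLast_last, letterLast]; dsimp; split_ifs <;> omega
  | cast a => rw [embLast_castSucc, Fin.val_castSucc, adjSwap_val]; rfl

lemma embFirst_adjSwap (m : Fin (k - 1)) :
    embFirst (adjSwap k m) = adjSwap (k + 1) (letterFirst m) := by
  ext a
  rw [adjSwap_val]
  induction a using Fin.cases with
  | zero => rw [embFirst_zero, letterFirst]; dsimp
  | succ a =>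
    rw [embFirst_succ, Fin.val_succ, adjSwap_val, letterFirst]; dsimp; split_ifs <;> omega

lemma wordProd_map_letterLast (w : List (Fin (k - 1))) :
    wordProd (w.map letterLast) = embLast (wordProd w) := by
  induction w with
  | nil => exact embLast_one.symm
  | cons m w ih => rw [List.map_cons, wordProd_cons, wordProd_cons, ih, embLast_mul, embLast_adjSwap]

lemma wordProd_map_letterFirst (w : List (Fin (k - 1))) :
    wordProd (w.map letterFirst) = embFirst (wordProd w) := by
  induction w with
  | nil => exact embFirst_one.symm
  | cons m w ih =>
    rw [List.map_cons, wordProd_cons, wordProd_cons, ih, embFirst_mul, embFirst_adjSwap]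

/-- The word `(k-1, k-2, …, k-r)` in the letters `0, …, k-1`. -/
def descWord (k r : ℕ) : List (Fin (k + 1 - 1)) := (List.finRange k).reverse.take r

/-- The word `(0, 1, …, r-1)` in the letters `0, …, k-1`. -/
def ascWord (k r : ℕ) : List (Fin (k + 1 - 1)) := (List.finRange k).take r

lemma descWord_zero (k : ℕ) : descWord k 0 = [] := rfl

lemma ascWord_zero (k : ℕ) : ascWord k 0 = [] := rfl

lemma length_descWord {k r : ℕ} (h : r ≤ k) : (descWord k r).length = r := by
  simp [descWord, h]

lemma length_ascWord {k r : ℕ} (h : r ≤ k) : (ascWord k r).length = r := by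
  simp [ascWord, h]

lemma descWord_succ {k r : ℕ} (h : r < k) :
    descWord k (r + 1) = descWord k r ++ [⟨k - 1 - r, by omega⟩] := by
  rw [descWord, descWord, List.take_add_one, List.getElem?_reverse (by simpa using h)]
  simp [show k - 1 - r < k by omega]

lemma ascWord_succ {k r : ℕ} (h : r < k) :
    ascWord k (r + 1) = ascWord k r ++ [⟨r, by omega⟩] := by
  rw [ascWord, ascWord, List.take_add_one]
  simp [h]

lemma descWord_succ_succ (k r : ℕ) :
    descWord (k + 1) (r + 1) = (Fin.last k : Fin (k + 1)) :: (descWord k r).map letterLast := by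
  rw [descWord, List.finRange_succ_last, List.reverse_append, List.reverse_singleton,
    List.singleton_append, List.take_succ_cons, descWord, ← List.map_reverse, ← List.map_take]
  rfl

lemma ascWord_succ_succ (k r : ℕ) :
    ascWord (k + 1) (r + 1) = (0 : Fin (k + 1)) :: (ascWord k r).map letterFirst := by
  rw [ascWord, List.finRange_succ, List.take_succ_cons, ascWord, ← List.map_take]
  rfl

lemma descWord_succ_left {k r : ℕ} (h : r ≤ k) :
    descWord (k + 1) r = (descWord k r).map letterFirst := by
  rw [descWord, List.finRange_succ, List.reverse_cons, List.take_append_of_le_length (by simpa using h),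
    descWord, ← List.map_reverse, ← List.map_take]
  rfl

lemma ascWord_succ_left {k r : ℕ} (h : r ≤ k) :
    ascWord (k + 1) r = (ascWord k r).map letterLast := by
  rw [ascWord, List.finRange_succ_last, List.take_append_of_le_length (by simpa using h),
    ascWord, ← List.map_take]
  rfl

/-- In one-line notation the largest value starts in the last place, and each letter moves it one
place to the left past a smaller value; every letter thus creates an inversion. -/
lemma embLast_mul_descWord (π : Equiv.Perm (Fin k)) (r : ℕ) (hr : r ≤ k) :
    invNum (embLast π * wordProd (descWord k r)) = invNum π + r ∧
      (embLast π * wordProd (descWord k r)) ⟨k - r, by omega⟩ = Fin.last k := by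
  induction r with
  | zero => exact ⟨invNum_embLast π, embLast_last π⟩
  | succ r ih =>
    obtain ⟨h1, h2⟩ := ih (by omega)
    have e : (⟨k - 1 - r + 1, by omega⟩ : Fin (k + 1)) = ⟨k - r, by omega⟩ :=
      Fin.ext (by simp; omega)
    rw [descWord_succ (by omega), wordProd_append, wordProd_cons, wordProd_nil, mul_one,
      ← mul_assoc]
    constructor
    · rw [invNum_mul_adjSwap, h1, add_assoc]
      rw [e, h2]
      refine lt_of_le_of_ne (Fin.le_last _) fun h => ?_
      rw [← h2] at h
      have := congrArg Fin.val ((Equiv.injective _) h)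
      simp at this
      omega
    · rw [Equiv.Perm.mul_apply, adjSwap_apply_eq (b := k - r) _ (by omega)
        (by dsimp; split_ifs <;> omega), h2]

/-- The mirror image: the smallest value travels to the right. -/
lemma embFirst_mul_ascWord (π : Equiv.Perm (Fin k)) (r : ℕ) (hr : r ≤ k) :
    invNum (embFirst π * wordProd (ascWord k r)) = invNum π + r ∧
      (embFirst π * wordProd (ascWord k r)) ⟨r, by omega⟩ = 0 := by
  induction r with
  | zero => exact ⟨invNum_embFirst π, embFirst_zero π⟩
  | succ r ih =>
    obtain ⟨h1, h2⟩ := ih (by omega)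
    rw [ascWord_succ (by omega), wordProd_append, wordProd_cons, wordProd_nil, mul_one,
      ← mul_assoc]
    constructor
    · rw [invNum_mul_adjSwap, h1, add_assoc]
      rw [h2]
      refine lt_of_le_of_ne (Fin.zero_le _) fun h => ?_
      rw [← h2] at h
      have := congrArg Fin.val ((Equiv.injective _) h)
      simp at this
    · rw [Equiv.Perm.mul_apply, adjSwap_apply_eq (b := r) _ (by omega)
        (by dsimp; split_ifs <;> omega), h2]

/-- Coset decomposition of `S_{k+1}`: the place of the largest value determines `r`, after which `π`
is determined, and the cardinalities agree. -/
lemma bijective_embLast_mul :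
    Function.Bijective fun p : Equiv.Perm (Fin k) × Fin (k + 1) =>
      embLast p.1 * wordProd (descWord k p.2) := by
  rw [Fintype.bijective_iff_injective_and_card]
  constructor
  · rintro ⟨π, r⟩ ⟨π', r'⟩ h
    have h1 := (embLast_mul_descWord π r (by omega)).2
    have h2 := (embLast_mul_descWord π' r' (by omega)).2
    dsimp only at h
    rw [h, ← h2] at h1
    have h3 := congrArg Fin.val ((Equiv.injective _) h1)
    have h4 : r = r' := Fin.ext (by simp at h3; omega)
    subst h4
    rw [embLast_injective (mul_right_cancel h)]
  · rw [Fintype.card_prod, Fintype.card_perm, Fintype.card_perm, Fintype.card_fin, Fintype.card_fin,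
      Nat.factorial_succ, mul_comm]

lemma bijective_embFirst_mul :
    Function.Bijective fun p : Equiv.Perm (Fin k) × Fin (k + 1) =>
      embFirst p.1 * wordProd (ascWord k p.2) := by
  rw [Fintype.bijective_iff_injective_and_card]
  constructor
  · rintro ⟨π, r⟩ ⟨π', r'⟩ h
    have h1 := (embFirst_mul_ascWord π r (by omega)).2
    have h2 := (embFirst_mul_ascWord π' r' (by omega)).2
    dsimp only at h
    rw [h, ← h2] at h1
    have h3 := congrArg Fin.val ((Equiv.injective _) h1)
    have h4 : r = r' := Fin.ext (by simpa using h3)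
    subst h4
    rw [embFirst_injective (mul_right_cancel h)]
  · rw [Fintype.card_prod, Fintype.card_perm, Fintype.card_perm, Fintype.card_fin, Fintype.card_fin,
      Nat.factorial_succ, mul_comm]

/-- The inverse of the word keeps the first `k` letters in order and only opens a gap at `k - r`,
which is what the shuffle condition asks for. -/
lemma descWord_inv_apply (r : ℕ) (hr : r ≤ k) (a : Fin k) :
    (((wordProd (descWord k r))⁻¹ a.castSucc : Fin (k + 1)) : ℕ)
      = if (a : ℕ) < k - r then (a : ℕ) else a + 1 := by
  induction r with
  | zero =>
    rw [descWord_zero]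
    change ((a.castSucc : Fin (k + 1)) : ℕ) = _
    simp
  | succ r ih =>
    rw [descWord_succ (by omega), wordProd_append, wordProd_cons, wordProd_nil, mul_one,
      mul_inv_rev, adjSwap_inv, Equiv.Perm.mul_apply, adjSwap_val, ih (by omega)]
    dsimp only
    split_ifs <;> omega

lemma ascWord_inv_apply (r : ℕ) (hr : r ≤ k) (a : Fin k) :
    (((wordProd (ascWord k r))⁻¹ a.succ : Fin (k + 1)) : ℕ)
      = if (a : ℕ) < r then (a : ℕ) else a + 1 := by
  induction r with
  | zero =>
    rw [ascWord_zero]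
    change ((a.succ : Fin (k + 1)) : ℕ) = _
    simp
  | succ r ih =>
    rw [ascWord_succ (by omega), wordProd_append, wordProd_cons, wordProd_nil, mul_one,
      mul_inv_rev, adjSwap_inv, Equiv.Perm.mul_apply, adjSwap_val, ih (by omega)]
    dsimp only
    split_ifs <;> omega

end Embeddings

/-! ### Shuffle operators: factorisation of the antisymmetriser and recursions. -/

section Shuffles

variable {I : Type*} [Fintype I] [DecidableEq I] (s : Matrix (I × I) (I × I) ℂ)

/-- The operator `∑_r (-1)^r s_{k-1} s_{k-2} ⋯ s_{k-r}`. -/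
def lastShuffle (k : ℕ) : Matrix (Fin (k + 1) → I) (Fin (k + 1) → I) ℂ :=
  ∑ r : Fin (k + 1), (-1 : ℂ) ^ (r : ℕ) • ((descWord k r).map (legMat s (k + 1))).prod

/-- The operator `∑_r (-1)^r s_0 s_1 ⋯ s_{r-1}`. -/
def firstShuffle (k : ℕ) : Matrix (Fin (k + 1) → I) (Fin (k + 1) → I) ℂ :=
  ∑ r : Fin (k + 1), (-1 : ℂ) ^ (r : ℕ) • ((ascWord k r).map (legMat s (k + 1))).prod

lemma prod_map_letterLast {k : ℕ} (w : List (Fin (k - 1))) :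
    ((w.map letterLast).map (legMat s (k + 1))).prod = snocMat k (w.map (legMat s k)).prod := by
  rw [map_list_prod, List.map_map, List.map_map]
  congr 2
  funext m
  exact legMat_castSucc s k m _

lemma prod_map_letterFirst {k : ℕ} (w : List (Fin (k - 1))) :
    ((w.map letterFirst).map (legMat s (k + 1))).prod = consMat k (w.map (legMat s k)).prod := by
  rw [map_list_prod, List.map_map, List.map_map]
  congr 2
  funext m
  exact legMat_succ s k m _

variable {s}

/-- The concatenated word is reduced, because the length of the coset representative adds to that of
`π`. -/
lemma IsBraiding.permMat_embLast_mul (h : IsBraiding s) {k : ℕ} (π : Equiv.Perm (Fin k)) (r : ℕ)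
    (hr : r ≤ k) :
    permMat s (embLast π * wordProd (descWord k r))
      = snocMat k (permMat s π) * ((descWord k r).map (legMat s (k + 1))).prod := by
  obtain ⟨w, hw, hl⟩ := exists_word π
  rw [h.permMat_eq hw hl, ← prod_map_letterLast, ← List.prod_append, ← List.map_append]
  apply h.permMat_eq
  · rw [wordProd_append, wordProd_map_letterLast, hw]
  · rw [List.length_append, List.length_map, hl, length_descWord hr, (embLast_mul_descWord π r hr).1]

lemma IsBraiding.permMat_embFirst_mul (h : IsBraiding s) {k : ℕ} (π : Equiv.Perm (Fin k)) (r : ℕ)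
    (hr : r ≤ k) :
    permMat s (embFirst π * wordProd (ascWord k r))
      = consMat k (permMat s π) * ((ascWord k r).map (legMat s (k + 1))).prod := by
  obtain ⟨w, hw, hl⟩ := exists_word π
  rw [h.permMat_eq hw hl, ← prod_map_letterFirst, ← List.prod_append, ← List.map_append]
  apply h.permMat_eq
  · rw [wordProd_append, wordProd_map_letterFirst, hw]
  · rw [List.length_append, List.length_map, hl, length_ascWord hr, (embFirst_mul_ascWord π r hr).1]

lemma sign_eq_of_invNum {n m : ℕ} (π : Equiv.Perm (Fin n)) (ρ : Equiv.Perm (Fin m)) (r : ℕ)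
    (h : invNum π = invNum ρ + r) :
    ((Equiv.Perm.sign π : ℤ) : ℂ) = ((Equiv.Perm.sign ρ : ℤ) : ℂ) * (-1) ^ r := by
  rw [sign_eq_pow_invNum, sign_eq_pow_invNum, h, pow_add]
  push_cast
  ring

/-- Sum over cosets, with the sign splitting as `sgn(π) (-1)^r`. This factorisation lets the
contraction of the last factor descend to forms. -/
lemma IsBraiding.antisymmetriser_succ_eq_last (h : IsBraiding s) (k : ℕ) :
    antisymmetriser s (k + 1) = snocMat k (antisymmetriser s k) * lastShuffle s k := by
  rw [antisymmetriser, ← (Equiv.ofBijective _ (bijective_embLast_mul (k := k))).sum_comp,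
    Fintype.sum_prod_type, antisymmetriser, map_sum, lastShuffle, Finset.sum_mul_sum]
  refine Finset.sum_congr rfl fun π _ => Finset.sum_congr rfl fun r _ => ?_
  rw [Equiv.ofBijective_apply, h.permMat_embLast_mul π r (by omega),
    sign_eq_of_invNum _ π r (embLast_mul_descWord π r (by omega)).1, map_smul, smul_mul_smul_comm]

lemma IsBraiding.antisymmetriser_succ_eq_first (h : IsBraiding s) (k : ℕ) :
    antisymmetriser s (k + 1) = consMat k (antisymmetriser s k) * firstShuffle s k := by
  rw [antisymmetriser, ← (Equiv.ofBijective _ (bijective_embFirst_mul (k := k))).sum_comp,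
    Fintype.sum_prod_type, antisymmetriser, map_sum, firstShuffle, Finset.sum_mul_sum]
  refine Finset.sum_congr rfl fun π _ => Finset.sum_congr rfl fun r _ => ?_
  rw [Equiv.ofBijective_apply, h.permMat_embFirst_mul π r (by omega),
    sign_eq_of_invNum _ π r (embFirst_mul_ascWord π r (by omega)).1, map_smul, smul_mul_smul_comm]

/-- With `A_k ⊗ id` as right factor, `ρ ∈ ker A_k` implies `ρ ⊗ θ ∈ ker A_{k+1}`; this is needed for
`d` to be well defined. -/
lemma IsBraiding.antisymmetriser_succ_eq_mul_snocMat (h : IsBraiding s) (k : ℕ) :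
    antisymmetriser s (k + 1)
      = (lastShuffle s.transpose k).transpose * snocMat k (antisymmetriser s k) := by
  apply Matrix.transpose_injective
  rw [← h.antisymmetriser_transpose, h.transpose.antisymmetriser_succ_eq_last,
    Matrix.transpose_mul, Matrix.transpose_transpose, ← snocMat_transpose,
    h.antisymmetriser_transpose]

lemma IsBraiding.antisymmetriser_succ_eq_mul_consMat (h : IsBraiding s) (k : ℕ) :
    antisymmetriser s (k + 1)
      = (firstShuffle s.transpose k).transpose * consMat k (antisymmetriser s k) := by
  apply Matrix.transpose_injective
  rw [← h.antisymmetriser_transpose, h.transpose.antisymmetriser_succ_eq_first,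
    Matrix.transpose_mul, Matrix.transpose_transpose, ← consMat_transpose,
    h.antisymmetriser_transpose]

lemma strictMono_iff_eq_one {n : ℕ} (π : Equiv.Perm (Fin n)) : StrictMono π ↔ π = 1 :=
  ⟨perm_eq_one_of_strictMono, fun h => by subst h; exact strictMono_id⟩

/-- The inverse of the coset word preserves the order of the first `k` letters, so the condition
only tests whether `π⁻¹` is increasing. -/
lemma isShuffle_last_iff {k : ℕ} (π : Equiv.Perm (Fin k)) (r : ℕ) (hr : r ≤ k) :
    (∀ a b : Fin (k + 1), a < b → ((b : ℕ) < k ∨ k ≤ (a : ℕ)) →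
      (embLast π * wordProd (descWord k r))⁻¹ a < (embLast π * wordProd (descWord k r))⁻¹ b)
      ↔ π = 1 := by
  have e : ∀ a : Fin k, (((embLast π * wordProd (descWord k r))⁻¹ a.castSucc : Fin (k + 1)) : ℕ)
      = if ((π⁻¹ a : Fin k) : ℕ) < k - r then ((π⁻¹ a : Fin k) : ℕ) else (π⁻¹ a : Fin k) + 1 := by
    intro a
    have : (embLast π)⁻¹ a.castSucc = (π⁻¹ a).castSucc := by
      rw [Equiv.Perm.inv_eq_iff_eq]; simp
    rw [mul_inv_rev, Equiv.Perm.mul_apply, this, descWord_inv_apply r hr]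
  rw [← inv_eq_one, ← strictMono_iff_eq_one]
  constructor
  · intro h a b hab
    have := h a.castSucc b.castSucc hab (Or.inl b.2)
    rw [Fin.lt_def, e, e] at this
    rw [Fin.lt_def]
    split_ifs at this <;> omega
  · intro h a b hab hk
    have hb : (b : ℕ) < k := by rw [Fin.lt_def] at hab; omega
    have ha : (a : ℕ) < k := by rw [Fin.lt_def] at hab; omega
    have h1 := h (show (⟨a, ha⟩ : Fin k) < ⟨b, hb⟩ from hab)
    have e1 := e ⟨a, ha⟩
    have e2 := e ⟨b, hb⟩
    rw [Fin.lt_def] at h1 ⊢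
    rw [show a = (⟨a, ha⟩ : Fin k).castSucc from rfl, show b = (⟨b, hb⟩ : Fin k).castSucc from rfl,
      e1, e2]
    split_ifs <;> omega

lemma isShuffle_first_iff {k : ℕ} (π : Equiv.Perm (Fin k)) (r : ℕ) (hr : r ≤ k) :
    (∀ a b : Fin (k + 1), a < b → ((b : ℕ) < 1 ∨ 1 ≤ (a : ℕ)) →
      (embFirst π * wordProd (ascWord k r))⁻¹ a < (embFirst π * wordProd (ascWord k r))⁻¹ b)
      ↔ π = 1 := by
  have e : ∀ a : Fin k, (((embFirst π * wordProd (ascWord k r))⁻¹ a.succ : Fin (k + 1)) : ℕ)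
      = if ((π⁻¹ a : Fin k) : ℕ) < r then ((π⁻¹ a : Fin k) : ℕ) else (π⁻¹ a : Fin k) + 1 := by
    intro a
    have : (embFirst π)⁻¹ a.succ = (π⁻¹ a).succ := by
      rw [Equiv.Perm.inv_eq_iff_eq]; simp
    rw [mul_inv_rev, Equiv.Perm.mul_apply, this, ascWord_inv_apply r hr]
  rw [← inv_eq_one, ← strictMono_iff_eq_one]
  constructor
  · intro h a b hab
    have := h a.succ b.succ (Fin.succ_lt_succ_iff.mpr hab) (Or.inr (by simp))
    rw [Fin.lt_def, e, e] at this
    rw [Fin.lt_def]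
    split_ifs at this <;> omega
  · intro h a b hab hk
    obtain ⟨a, rfl⟩ := Fin.exists_succ_eq.mpr (show a ≠ 0 by
      rintro rfl; rw [Fin.lt_def] at hab; simp at hk hab; omega)
    obtain ⟨b, rfl⟩ := Fin.exists_succ_eq.mpr (show b ≠ 0 by
      rintro rfl; rw [Fin.lt_def] at hab; simp at hab)
    have h1 := h (Fin.succ_lt_succ_iff.mp hab)
    rw [Fin.lt_def] at h1 ⊢
    rw [e, e]
    split_ifs <;> omega

/-- Among the coset decompositions only those with `π = 1` satisfy the shuffle condition, which
leaves an alternating sum over `r`. -/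
lemma IsBraiding.shuffleOp_last (h : IsBraiding s) (k : ℕ) :
    shuffleOp s (k + 1) k = lastShuffle s k := by
  classical
  rw [shuffleOp, Finset.sum_filter,
    ← (Equiv.ofBijective _ (bijective_embLast_mul (k := k))).sum_comp, Fintype.sum_prod_type]
  rw [Finset.sum_eq_single 1]
  · refine Finset.sum_congr rfl fun r _ => ?_
    rw [Equiv.ofBijective_apply, if_pos ((isShuffle_last_iff 1 r (by omega)).mpr rfl),
      h.permMat_embLast_mul 1 r (by omega), permMat_one, map_one, one_mul,
      sign_eq_of_invNum _ (1 : Equiv.Perm (Fin k)) r (embLast_mul_descWord 1 r (by omega)).1]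
    simp
  · intro π _ hπ
    refine Finset.sum_eq_zero fun r _ => ?_
    rw [Equiv.ofBijective_apply, if_neg fun h => hπ ((isShuffle_last_iff π r (by omega)).mp h)]
  · simp

lemma IsBraiding.shuffleOp_first (h : IsBraiding s) (k : ℕ) :
    shuffleOp s (k + 1) 1 = firstShuffle s k := by
  classical
  rw [shuffleOp, Finset.sum_filter,
    ← (Equiv.ofBijective _ (bijective_embFirst_mul (k := k))).sum_comp, Fintype.sum_prod_type]
  rw [Finset.sum_eq_single 1]
  · refine Finset.sum_congr rfl fun r _ => ?_
    rw [Equiv.ofBijective_apply, if_pos ((isShuffle_first_iff 1 r (by omega)).mpr rfl),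
      h.permMat_embFirst_mul 1 r (by omega), permMat_one, map_one, one_mul,
      sign_eq_of_invNum _ (1 : Equiv.Perm (Fin k)) r (embFirst_mul_ascWord 1 r (by omega)).1]
    simp
  · intro π _ hπ
    refine Finset.sum_eq_zero fun r _ => ?_
    rw [Equiv.ofBijective_apply, if_neg fun h => hπ ((isShuffle_first_iff π r (by omega)).mp h)]
  · simp

variable (s)

lemma lastShuffle_zero : lastShuffle s 0 = 1 := by
  simp [lastShuffle, descWord_zero]

lemma firstShuffle_zero : firstShuffle s 0 = 1 := by
  simp [firstShuffle, ascWord_zero]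

/-- Every nonempty word starts with the letter acting on the last two factors; splitting it off
leaves the words for one factor fewer. -/
lemma lastShuffle_succ (k : ℕ) :
    lastShuffle s (k + 1)
      = 1 - legMat s (k + 2) (Fin.last k) * snocMat (k + 1) (lastShuffle s k) := by
  rw [lastShuffle, Fin.sum_univ_succ, lastShuffle, map_sum, Finset.mul_sum, sub_eq_add_neg,
    ← Finset.sum_neg_distrib]
  congr 1
  · simp [descWord_zero]
  · refine Finset.sum_congr rfl fun r _ => ?_
    rw [Fin.val_succ, descWord_succ_succ, List.map_cons, List.prod_cons, prod_map_letterLast,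
      map_smul, mul_smul_comm, pow_succ, mul_neg_one, neg_smul]

lemma firstShuffle_succ (k : ℕ) :
    firstShuffle s (k + 1)
      = 1 - legMat s (k + 2) (0 : Fin (k + 1)) * consMat (k + 1) (firstShuffle s k) := by
  rw [firstShuffle, Fin.sum_univ_succ, firstShuffle, map_sum, Finset.mul_sum, sub_eq_add_neg,
    ← Finset.sum_neg_distrib]
  congr 1
  · simp [ascWord_zero]
  · refine Finset.sum_congr rfl fun r _ => ?_
    rw [Fin.val_succ, ascWord_succ_succ, List.map_cons, List.prod_cons, prod_map_letterFirst,
      map_smul, mul_smul_comm, pow_succ, mul_neg_one, neg_smul]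

/-- The product `s_{k-1} s_{k-2} ⋯ s_0` acting in `V^{⊗(k+1)}`. -/
def toLast (k : ℕ) : Matrix (Fin (k + 1) → I) (Fin (k + 1) → I) ℂ :=
  ((descWord k k).map (legMat s (k + 1))).prod

/-- The product `s_0 s_1 ⋯ s_{k-1}` acting in `V^{⊗(k+1)}`. -/
def toFirst (k : ℕ) : Matrix (Fin (k + 1) → I) (Fin (k + 1) → I) ℂ :=
  ((ascWord k k).map (legMat s (k + 1))).prod

lemma toLast_zero : toLast s 0 = 1 := rfl

lemma toFirst_zero : toFirst s 0 = 1 := rfl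

lemma toLast_succ (k : ℕ) :
    toLast s (k + 1) = legMat s (k + 2) (Fin.last k) * snocMat (k + 1) (toLast s k) := by
  rw [toLast, descWord_succ_succ, List.map_cons, List.prod_cons, prod_map_letterLast, toLast]

lemma toFirst_succ (k : ℕ) :
    toFirst s (k + 1) = legMat s (k + 2) (0 : Fin (k + 1)) * consMat (k + 1) (toFirst s k) := by
  rw [toFirst, ascWord_succ_succ, List.map_cons, List.prod_cons, prod_map_letterFirst, toFirst]

/-- Only the longest word touches the first tensor factor. This form of the recursion is used when
the first factor is `θ`, `lastShuffle_succ` when the last one is. -/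
lemma lastShuffle_succ' (k : ℕ) :
    lastShuffle s (k + 1)
      = consMat (k + 1) (lastShuffle s k) + (-1 : ℂ) ^ (k + 1) • toLast s (k + 1) := by
  rw [lastShuffle, Fin.sum_univ_castSucc, lastShuffle, map_sum]
  congr 1
  refine Finset.sum_congr rfl fun r _ => ?_
  rw [Fin.val_castSucc, descWord_succ_left (by omega), prod_map_letterFirst, map_smul]

lemma firstShuffle_succ' (k : ℕ) :
    firstShuffle s (k + 1)
      = snocMat (k + 1) (firstShuffle s k) + (-1 : ℂ) ^ (k + 1) • toFirst s (k + 1) := by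
  rw [firstShuffle, Fin.sum_univ_castSucc, firstShuffle, map_sum]
  congr 1
  refine Finset.sum_congr rfl fun r _ => ?_
  rw [Fin.val_castSucc, ascWord_succ_left (by omega), prod_map_letterLast, map_smul]

end Shuffles

end

noncomputable section

/-! ## The Peter-Weyl decomposition -/

section Separation

variable {V B : Type*} [AddCommGroup V] [Module ℂ V] [AddCommGroup B] [Module ℂ B]

/-- Functionals on the second factor separate the elements of a tensor product. -/
lemma tensor_eq_zero_of_forall_right (z : V ⊗[ℂ] B)
    (h : ∀ f : B →ₗ[ℂ] ℂ, TensorProduct.rid ℂ V (f.lTensor V z) = 0) : z = 0 := by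
  classical
  let b := Module.Basis.ofVectorSpace ℂ B
  apply (TensorProduct.equivFinsuppOfBasisRight (M := V) b).injective
  rw [map_zero]
  ext i
  rw [Finsupp.zero_apply, ← h (b.coord i)]
  clear h
  induction z using TensorProduct.induction_on with
  | zero => simp
  | add _ _ h h' => simp only [map_add, Finsupp.add_apply, h, h']
  | tmul v a => simp

lemma tensor_ext_right {z w : V ⊗[ℂ] B}
    (h : ∀ f : B →ₗ[ℂ] ℂ,
      TensorProduct.rid ℂ V (f.lTensor V z) = TensorProduct.rid ℂ V (f.lTensor V w)) : z = w := by
  rw [← sub_eq_zero]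
  apply tensor_eq_zero_of_forall_right
  intro f
  rw [map_sub, map_sub, h, sub_self]

/-- In the quotient `V ⧸ W` membership becomes vanishing, by right exactness of the tensor product,
and functionals detect vanishing. -/
lemma mem_range_rTensor_subtype {W : Submodule ℂ V} {z : V ⊗[ℂ] B}
    (h : ∀ f : B →ₗ[ℂ] ℂ, TensorProduct.rid ℂ V (f.lTensor V z) ∈ W) :
    z ∈ LinearMap.range (W.subtype.rTensor B) := by
  have hex := rTensor_exact B (f := W.subtype) (g := W.mkQ)
    (LinearMap.exact_subtype_mkQ W) (Submodule.mkQ_surjective W)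
  rw [← (LinearMap.exact_iff.mp hex), LinearMap.mem_ker]
  apply tensor_eq_zero_of_forall_right
  intro f
  have e : ∀ z : V ⊗[ℂ] B, TensorProduct.rid ℂ (V ⧸ W) (f.lTensor (V ⧸ W) (W.mkQ.rTensor B z))
      = W.mkQ (TensorProduct.rid ℂ V (f.lTensor V z)) := by
    intro z
    induction z using TensorProduct.induction_on with
    | zero => simp
    | add _ _ h h' => simp only [map_add, h, h']
    | tmul v a => simp
  rw [e, Submodule.mkQ_apply, Submodule.Quotient.mk_eq_zero]
  exact h f

lemma rid_lTensor_mem {W : Submodule ℂ V} {z : V ⊗[ℂ] B}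
    (h : z ∈ LinearMap.range (W.subtype.rTensor B)) (f : B →ₗ[ℂ] ℂ) :
    TensorProduct.rid ℂ V (f.lTensor V z) ∈ W := by
  obtain ⟨y, rfl⟩ := h
  induction y using TensorProduct.induction_on with
  | zero => simp
  | add _ _ h h' => simp only [map_add]; exact W.add_mem h h'
  | tmul v a => simpa using W.smul_mem (f a) v.2

end Separation

/-! ### Coefficient coalgebras and isotypic components of the dual action. -/

section PeterWeyl

open Coalgebra

variable {A : Type*} [Ring A] [HopfAlgebra ℂ A]

lemma functional_ext {a b : A} (h : ∀ f : A →ₗ[ℂ] ℂ, f a = f b) : a = b := by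
  rw [← sub_eq_zero, ← Module.forall_dual_apply_eq_zero_iff ℂ]
  intro f
  rw [map_sub, h, sub_self]

lemma comul_ext {a : A} {z : A ⊗[ℂ] A}
    (h : ∀ f : A →ₗ[ℂ] ℂ, lstar f a = TensorProduct.rid ℂ A (f.lTensor A z)) :
    comul (R := ℂ) a = z :=
  tensor_ext_right h

namespace MatrixCorep

variable (v : MatrixCorep A)

/-- The action of a functional on the space of a corepresentation. -/
def act (f : A →ₗ[ℂ] ℂ) : (Fin v.dim → ℂ) →ₗ[ℂ] (Fin v.dim → ℂ) :=
  Matrix.toLin' (Matrix.of fun i j => f (v.v i j))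

lemma act_apply (f : A →ₗ[ℂ] ℂ) (w : Fin v.dim → ℂ) (i : Fin v.dim) :
    v.act f w i = ∑ j, f (v.v i j) * w j := by
  simp [act, Matrix.mulVec, dotProduct]

lemma rid_lTensor_coaction (f : A →ₗ[ℂ] ℂ) (w : Fin v.dim → ℂ) :
    TensorProduct.rid ℂ _ (f.lTensor _ (v.coaction w)) = v.act f w := by
  ext i
  rw [act_apply]
  simp [coaction, Finset.sum_apply, Pi.single_apply, mul_comm, Finset.smul_sum]

/-- Subspaces invariant under the coaction are those stable under the dual algebra, because
functionals detect membership in `W ⊗ A`. -/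
lemma isIrreducible_iff : v.IsIrreducible ↔ 0 < v.dim ∧
    ∀ W : Submodule ℂ (Fin v.dim → ℂ), (∀ f, ∀ w ∈ W, v.act f w ∈ W) → W = ⊥ ∨ W = ⊤ := by
  refine and_congr_right fun _ => forall_congr' fun W => ?_
  have : (∀ w ∈ W, v.coaction w ∈ LinearMap.range (W.subtype.rTensor A)) ↔
      ∀ f, ∀ w ∈ W, v.act f w ∈ W := by
    constructor
    · intro h f w hw
      rw [← rid_lTensor_coaction]
      exact rid_lTensor_mem (h w hw) f
    · intro h w hw
      apply mem_range_rTensor_subtype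
      intro f
      rw [rid_lTensor_coaction]
      exact h f w hw
  rw [this]

/-- The `i`-th row of matrix elements, as an image of the space of the corepresentation. -/
def row (i : Fin v.dim) : (Fin v.dim → ℂ) →ₗ[ℂ] A := Fintype.linearCombination ℂ (v.v i)

lemma row_apply (i : Fin v.dim) (w : Fin v.dim → ℂ) : v.row i w = ∑ j, w j • v.v i j := rfl

lemma row_single (i j : Fin v.dim) : v.row i (Pi.single j 1) = v.v i j := by
  simp [row_apply, Pi.single_apply]

lemma lstar_v (f : A →ₗ[ℂ] ℂ) (i j : Fin v.dim) :
    lstar f (v.v i j) = ∑ k, f (v.v k j) • v.v i k :=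
  lstar_apply_mul_matrix v.comul_v f i j

lemma rstar_v (f : A →ₗ[ℂ] ℂ) (i j : Fin v.dim) :
    rstar f (v.v i j) = ∑ k, f (v.v i k) • v.v k j :=
  rstar_apply_matrix v.comul_v f i j

/-- A row of matrix elements is an image of the corepresentation space inside `A` on which `f` acts
as `f ∗ ·`. -/
lemma lstar_row (f : A →ₗ[ℂ] ℂ) (i : Fin v.dim) (w : Fin v.dim → ℂ) :
    lstar f (v.row i w) = v.row i (v.act f w) := by
  simp only [row_apply, map_sum, map_smul, lstar_v, act_apply, Finset.smul_sum, Finset.sum_smul,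
    smul_smul]
  rw [Finset.sum_comm]
  simp only [mul_comm]

variable {v}

/-- The kernel is invariant, and it is proper because `ε(v^i_i) = 1`. -/
lemma row_injective (hv : v.IsIrreducible) (i : Fin v.dim) : Function.Injective (v.row i) := by
  rw [← LinearMap.ker_eq_bot]
  refine (((isIrreducible_iff v).mp hv).2 (LinearMap.ker (v.row i)) fun f w hw => ?_).resolve_right ?_
  · rw [LinearMap.mem_ker] at hw ⊢
    rw [← lstar_row, hw, map_zero]
  · intro h
    have h1 : v.row i (Pi.single i 1) = 0 := by
      rw [← LinearMap.mem_ker, h]; trivial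
    rw [row_single] at h1
    have h2 := v.counit_v i i
    rw [h1] at h2
    simp at h2

end MatrixCorep

/-- The algebra of the operators `f ∗ ·`. -/
def dualSubalgebra (A : Type*) [Ring A] [HopfAlgebra ℂ A] : Subalgebra ℂ (Module.End ℂ A) :=
  Algebra.adjoin ℂ (Set.range (lstar (A := A)))

/-- The algebra of the operators `f ∗ ·`, as a type. -/
def dualAct (A : Type*) [Ring A] [HopfAlgebra ℂ A] : Type _ := dualSubalgebra A

instance : Ring (dualAct A) := inferInstanceAs (Ring (dualSubalgebra A))
instance : Algebra ℂ (dualAct A) := inferInstanceAs (Algebra ℂ (dualSubalgebra A))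
instance : Module (dualAct A) A := inferInstanceAs (Module (dualSubalgebra A) A)
instance : IsScalarTower ℂ (dualAct A) A := inferInstanceAs (IsScalarTower ℂ (dualSubalgebra A) A)

/-- The operator `f ∗ ·` as an element of `dualAct A`. -/
def dualAct.of (f : A →ₗ[ℂ] ℂ) : dualAct A := ⟨lstar f, Algebra.subset_adjoin ⟨f, rfl⟩⟩

lemma dualAct.of_smul (f : A →ₗ[ℂ] ℂ) (a : A) : dualAct.of f • a = lstar f a := rfl

lemma dualAct.smul_mem {S : Submodule ℂ A} (h : ∀ f, ∀ a ∈ S, lstar f a ∈ S) (r : dualAct A) :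
    ∀ a ∈ S, r • a ∈ S := by
  obtain ⟨r, hr⟩ := r
  change ∀ a ∈ S, r a ∈ S
  induction hr using Algebra.adjoin_induction with
  | mem x hx => obtain ⟨f, rfl⟩ := hx; exact h f
  | algebraMap c => exact fun a ha => S.smul_mem c ha
  | add x y _ _ hx hy => exact fun a ha => S.add_mem (hx a ha) (hy a ha)
  | mul x y _ _ hx hy => exact fun a ha => hx _ (hy a ha)

/-- A subspace which is stable under the operators `f ∗ ·`, as a submodule. -/
def dualSubmodule (S : Submodule ℂ A) (h : ∀ f, ∀ a ∈ S, lstar f a ∈ S) :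
    Submodule (dualAct A) A where
  carrier := S
  add_mem' := S.add_mem
  zero_mem' := S.zero_mem
  smul_mem' r a ha := dualAct.smul_mem h r a ha

/-- Equivariance spreads from the generators `f ∗ ·` to the algebra they generate. -/
lemma dualAct.exists_linearEquiv {S S' : Submodule (dualAct A) A}
    (e : S ≃ₗ[ℂ] S')
    (he : ∀ f, ∀ a : S, ((e (dualAct.of f • a) : S') : A) = lstar f ((e a : S') : A)) :
    Nonempty (S ≃ₗ[dualAct A] S') := by
  have key : ∀ r : dualAct A, ∀ a : S, ((e (r • a) : S') : A) = r • ((e a : S') : A) := by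
    rintro ⟨r, hr⟩
    induction hr using Algebra.adjoin_induction with
    | mem x hx => obtain ⟨f, rfl⟩ := hx; exact he f
    | algebraMap c =>
      intro a
      exact congrArg Subtype.val (map_smul e c a)
    | add x y hx' hy' hx hy =>
      intro a
      have e1 : (show dualAct A from ⟨x + y, add_mem hx' hy'⟩) • a
          = (show dualAct A from ⟨x, hx'⟩) • a + (show dualAct A from ⟨y, hy'⟩) • a := rfl
      rw [e1]
      refine (congrArg Subtype.val (map_add e _ _)).trans ?_
      refine (congrArg₂ (· + ·) (hx a) (hy a)).trans ?_
      rfl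
    | mul x y hx' hy' hx hy =>
      intro a
      exact (hx ((show dualAct A from ⟨y, hy'⟩) • a)).trans (congrArg x (hy a))
  exact ⟨{ e with map_smul' := fun r a => Subtype.ext (key r a) }⟩

namespace MatrixCorep

variable (v : MatrixCorep A)

/-- The `i`-th row of matrix elements as a submodule. -/
def rowSub (i : Fin v.dim) : Submodule (dualAct A) A :=
  dualSubmodule (LinearMap.range (v.row i)) (by
    rintro f _ ⟨w, rfl⟩
    exact ⟨v.act f w, (v.lstar_row f i w).symm⟩)

/-- The space of matrix elements. -/
def coeff : Submodule ℂ A :=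
  Submodule.span ℂ (Set.range fun p : Fin v.dim × Fin v.dim => v.v p.1 p.2)

lemma v_mem_coeff (i j : Fin v.dim) : v.v i j ∈ v.coeff := Submodule.subset_span ⟨(i, j), rfl⟩

variable {v}

/-- Submodules of a row pull back along `row` to invariant subspaces. -/
lemma isSimpleModule_rowSub (hv : v.IsIrreducible) (i : Fin v.dim) :
    IsSimpleModule (dualAct A) (v.rowSub i) := by
  rw [isSimpleModule_iff_isAtom]
  constructor
  · intro h
    have h1 : v.v i i ∈ v.rowSub i := ⟨_, v.row_single i i⟩
    rw [h, Submodule.mem_bot] at h1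
    have h2 := v.counit_v i i
    rw [h1] at h2
    simp at h2
  · intro b hb
    rcases ((isIrreducible_iff v).mp hv).2 ((b.restrictScalars ℂ).comap (v.row i)) (by
      intro f w hw
      rw [Submodule.mem_comap] at hw ⊢
      rw [← lstar_row, ← dualAct.of_smul]
      exact b.smul_mem _ hw) with h | h
    · rw [eq_bot_iff]
      intro a ha
      obtain ⟨w, rfl⟩ := hb.le ha
      have : w ∈ (b.restrictScalars ℂ).comap (v.row i) := ha
      rw [h, Submodule.mem_bot] at this
      rw [this, map_zero]; exact Submodule.zero_mem _
    · exfalso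
      apply hb.not_ge
      rintro _ ⟨w, rfl⟩
      have : w ∈ (b.restrictScalars ℂ).comap (v.row i) := by rw [h]; trivial
      exact this

/-- A row is isomorphic to the space of the corepresentation. -/
def rowEquiv (hv : v.IsIrreducible) (i : Fin v.dim) :
    (Fin v.dim → ℂ) ≃ₗ[ℂ] v.rowSub i :=
  LinearEquiv.ofInjective (v.row i) (row_injective hv i)

lemma rowEquiv_act (hv : v.IsIrreducible) (i : Fin v.dim) (f : A →ₗ[ℂ] ℂ) (w : Fin v.dim → ℂ) :
    rowEquiv hv i (v.act f w) = dualAct.of f • (rowEquiv hv i w : v.rowSub i) :=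
  Subtype.ext (v.lstar_row f i w).symm

lemma rowEquiv_symm_smul (hv : v.IsIrreducible) (i : Fin v.dim) (f : A →ₗ[ℂ] ℂ)
    (a : v.rowSub i) :
    (rowEquiv hv i).symm (dualAct.of f • a) = v.act f ((rowEquiv hv i).symm a) := by
  rw [LinearEquiv.symm_apply_eq, rowEquiv_act, LinearEquiv.apply_symm_apply]

lemma nonempty_rowSub_equiv (hv : v.IsIrreducible) (i j : Fin v.dim) :
    Nonempty (v.rowSub i ≃ₗ[dualAct A] v.rowSub j) := by
  refine dualAct.exists_linearEquiv ((rowEquiv hv i).symm.trans (rowEquiv hv j)) fun f a => ?_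
  change (rowEquiv hv j ((rowEquiv hv i).symm (dualAct.of f • a)) : A) = _
  rw [rowEquiv_symm_smul, rowEquiv_act]
  rfl

/-- Functionals separate the elements of `A`, so a map commuting with all their actions intertwines
the matrices over `A`. -/
lemma equivalent_of_act {v w : MatrixCorep A} (e : (Fin v.dim → ℂ) ≃ₗ[ℂ] (Fin w.dim → ℂ))
    (he : ∀ f x, e (v.act f x) = w.act f (e x)) : v.Equivalent w := by
  refine ⟨LinearMap.toMatrix' e.toLinearMap, LinearMap.toMatrix' e.symm.toLinearMap, ?_, ?_, ?_⟩
  · rw [← LinearMap.toMatrix'_comp]; simp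
  · rw [← LinearMap.toMatrix'_comp]; simp
  · ext i j
    apply functional_ext
    intro f
    have h : LinearMap.toMatrix' (e.toLinearMap ∘ₗ v.act f)
        = LinearMap.toMatrix' (w.act f ∘ₗ e.toLinearMap) := by
      rw [show e.toLinearMap ∘ₗ v.act f = w.act f ∘ₗ e.toLinearMap from LinearMap.ext (he f)]
    rw [LinearMap.toMatrix'_comp, LinearMap.toMatrix'_comp, act, act, LinearMap.toMatrix'_toLin',
      LinearMap.toMatrix'_toLin'] at h
    have h' := congrFun (congrFun h i) j
    simp only [Matrix.mul_apply, Matrix.of_apply] at h'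
    simp only [Matrix.mul_apply, Matrix.map_apply, map_sum, ← Algebra.smul_def,
      ← Algebra.commutes (R := ℂ) _ (w.v _ _), map_smul, smul_eq_mul, h']
    exact Finset.sum_congr rfl fun _ _ => mul_comm _ _

lemma equivalent_of_rowSub_equiv {v w : MatrixCorep A} (hv : v.IsIrreducible)
    (hw : w.IsIrreducible) {i : Fin v.dim} {j : Fin w.dim}
    (e : v.rowSub i ≃ₗ[dualAct A] w.rowSub j) : v.Equivalent w := by
  let e' : v.rowSub i ≃ₗ[ℂ] w.rowSub j :=
    e.restrictScalars ℂ
  refine equivalent_of_act ((rowEquiv hv i).trans (e'.trans (rowEquiv hw j).symm)) fun f x => ?_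
  change (rowEquiv hw j).symm (e (rowEquiv hv i (v.act f x)))
    = w.act f ((rowEquiv hw j).symm (e (rowEquiv hv i x)))
  rw [← rowEquiv_symm_smul, rowEquiv_act, map_smul]

/-- All rows of one corepresentation are isomorphic modules. -/
lemma coeff_le_isotypicComponent (hv : v.IsIrreducible) (i : Fin v.dim) :
    v.coeff ≤ (isotypicComponent (dualAct A) A (v.rowSub i)).restrictScalars ℂ := by
  rw [coeff, Submodule.span_le]
  rintro _ ⟨⟨j, k⟩, rfl⟩
  have h : v.rowSub j ≤ isotypicComponent (dualAct A) A (v.rowSub i) :=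
    le_sSup (nonempty_rowSub_equiv hv j i)
  exact h ⟨_, v.row_single j k⟩

lemma Equivalent.coeff_le {v w : MatrixCorep A} (h : v.Equivalent w) : w.coeff ≤ v.coeff := by
  obtain ⟨T, T', h1, h2, h3⟩ := h
  have e1 : T.map (algebraMap ℂ A) * T'.map (algebraMap ℂ A) = 1 := by
    rw [← Matrix.map_mul, h1]; simp [Matrix.map_one]
  have e : w.v = T.map (algebraMap ℂ A) * v.v * T'.map (algebraMap ℂ A) := by
    rw [h3, Matrix.mul_assoc, e1, Matrix.mul_one]
  rw [coeff, Submodule.span_le]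
  rintro _ ⟨⟨i, j⟩, rfl⟩
  dsimp only
  rw [e]
  simp only [Matrix.mul_apply, Matrix.map_apply, ← Algebra.smul_def,
    ← Algebra.commutes (R := ℂ) (T' _ _)]
  exact Submodule.sum_mem _ fun k _ => Submodule.smul_mem _ _
    (Submodule.sum_mem _ fun l _ => Submodule.smul_mem _ _ (v.v_mem_coeff l k))

lemma Equivalent.coeff_eq {v w : MatrixCorep A} (h : v.Equivalent w) : v.coeff = w.coeff :=
  le_antisymm h.symm.coeff_le h.coeff_le

/-- Schur's lemma for central functionals. -/
lemma exists_eigenvalue (hv : v.IsIrreducible) {X : A →ₗ[ℂ] ℂ} (hX : IsCentralFunctional X) :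
    ∃ e : ℂ, ∀ a ∈ v.coeff, lstar X a = e • a := by
  have hv' := (isIrreducible_iff v).mp hv
  have : Nonempty (Fin v.dim) := ⟨⟨0, hv'.1⟩⟩
  obtain ⟨e, he⟩ := Module.End.exists_eigenvalue (v.act X)
  -- Centrality of `X` on matrix elements says that the scalar matrix `X(v)` commutes with `v`;
  -- applying `f` gives commuting operators.
  have hcomm : ∀ f w, v.act X (v.act f w) = v.act f (v.act X w) := by
    intro f w
    ext i
    simp only [act_apply, Finset.mul_sum]
    rw [Finset.sum_comm, Finset.sum_comm (s := Finset.univ) (t := Finset.univ)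
      (f := fun j k => f (v.v i j) * (X (v.v j k) * w k))]
    refine Finset.sum_congr rfl fun j _ => ?_
    have := congrArg f (hX (v.v i j))
    rw [lstar_v, rstar_v, map_sum, map_sum] at this
    simp only [map_smul, smul_eq_mul] at this
    simp only [← mul_assoc, ← Finset.sum_mul, ← this]
    congr 1
    exact Finset.sum_congr rfl fun _ _ => mul_comm _ _
  -- A nonzero eigenspace stable under the dual algebra is everything by irreducibility.
  have htop : Module.End.eigenspace (v.act X) e = ⊤ := by
    refine (hv'.2 _ fun f w hw => ?_).resolve_left he
    rw [Module.End.mem_eigenspace_iff] at hw ⊢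
    rw [hcomm, hw, map_smul]
  have hX' : ∀ w, v.act X w = e • w := fun w =>
    Module.End.mem_eigenspace_iff.mp (by rw [htop]; trivial)
  refine ⟨e, fun a ha => ?_⟩
  induction ha using Submodule.span_induction with
  | zero => simp
  | add a b _ _ ha hb => rw [map_add, ha, hb, smul_add]
  | smul c a _ ha => rw [map_smul, ha, smul_comm]
  | mem a ha =>
    obtain ⟨⟨i, j⟩, rfl⟩ := ha
    dsimp only
    rw [← row_single, lstar_row, hX', map_smul]

end MatrixCorep

lemma IsSubcoalgebra.lstar_mem {C : Submodule ℂ A} (hC : IsSubcoalgebra C) (f : A →ₗ[ℂ] ℂ) {a : A}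
    (ha : a ∈ C) : lstar f a ∈ C := by
  obtain ⟨y, hy⟩ := hC a ha
  rw [lstar, LinearMap.comp_apply, LinearMap.comp_apply, ← hy]
  clear hy
  induction y using TensorProduct.induction_on with
  | zero => simp
  | add _ _ h h' => simp only [map_add]; exact C.add_mem h h'
  | tmul b c => simpa using C.smul_mem (f c) b.2

lemma IsSubcoalgebra.rstar_mem {C : Submodule ℂ A} (hC : IsSubcoalgebra C) (f : A →ₗ[ℂ] ℂ) {a : A}
    (ha : a ∈ C) : rstar f a ∈ C := by
  obtain ⟨y, hy⟩ := hC a ha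
  rw [rstar, LinearMap.comp_apply, LinearMap.comp_apply, ← hy]
  clear hy
  induction y using TensorProduct.induction_on with
  | zero => simp
  | add _ _ h h' => simp only [map_add]; exact C.add_mem h h'
  | tmul b c => simpa using C.smul_mem (f b) c.2

lemma MatrixCorep.isSubcoalgebra_coeff (v : MatrixCorep A) : IsSubcoalgebra v.coeff := by
  intro a ha
  induction ha using Submodule.span_induction with
  | zero => rw [map_zero]; exact Submodule.zero_mem _
  | add a b _ _ ha hb => rw [map_add]; exact Submodule.add_mem _ ha hb
  | smul c a _ ha => rw [map_smul]; exact Submodule.smul_mem _ _ ha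
  | mem a ha =>
    obtain ⟨⟨i, j⟩, rfl⟩ := ha
    rw [v.comul_v]
    exact Submodule.sum_mem _ fun k _ =>
      ⟨⟨v.v i k, v.v_mem_coeff i k⟩ ⊗ₜ ⟨v.v k j, v.v_mem_coeff k j⟩, by simp⟩

/-- The subspace `A* ∗ a` is finite-dimensional. -/
lemma finiteDimensional_orbit (a : A) :
    FiniteDimensional ℂ (LinearMap.range (lstarHom.flip a : (A →ₗ[ℂ] ℂ) →ₗ[ℂ] A)) := by
  obtain ⟨s, hs⟩ := TensorProduct.exists_finset (comul (R := ℂ) a)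
  have : FiniteDimensional ℂ (Submodule.span ℂ ((fun p : A × A => p.1) '' (s : Set (A × A)))) :=
    FiniteDimensional.span_of_finite ℂ (s.finite_toSet.image _)
  refine Submodule.finiteDimensional_of_le (S₂ := Submodule.span ℂ
    ((fun p : A × A => p.1) '' (s : Set (A × A)))) ?_
  rintro _ ⟨f, rfl⟩
  change lstar f a ∈ _
  rw [lstar_eq_of_comul (x := fun p : A × A => p.1) (y := fun p => p.2) hs]
  exact Submodule.sum_mem _ fun p hp => Submodule.smul_mem _ _ (Submodule.subset_span ⟨p, hp, rfl⟩)

/-- A nonzero stable subspace contains a minimal one, which is finite-dimensional. -/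
lemma exists_minimal_stable {C : Submodule ℂ A} (hC : ∀ f, ∀ a ∈ C, lstar f a ∈ C) (h0 : C ≠ ⊥) :
    ∃ W : Submodule ℂ A, W ≤ C ∧ W ≠ ⊥ ∧ FiniteDimensional ℂ W ∧ (∀ f, ∀ a ∈ W, lstar f a ∈ W) ∧
      ∀ W' : Submodule ℂ A, W' ≤ W → (∀ f, ∀ a ∈ W', lstar f a ∈ W') → W' = ⊥ ∨ W' = W := by
  classical
  -- The dimension is minimised among finite-dimensional stable subspaces; the orbit `A* ∗ a` of a
  -- nonzero element shows that there are some.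
  have hex : ∃ n, ∃ W : Submodule ℂ A, W ≤ C ∧ W ≠ ⊥ ∧ FiniteDimensional ℂ W ∧
      (∀ f, ∀ a ∈ W, lstar f a ∈ W) ∧ Module.finrank ℂ W = n := by
    obtain ⟨a, ha, ha0⟩ := (Submodule.ne_bot_iff _).mp h0
    refine ⟨_, LinearMap.range (lstarHom.flip a : (A →ₗ[ℂ] ℂ) →ₗ[ℂ] A), ?_, ?_,
      finiteDimensional_orbit a, ?_, rfl⟩
    · rintro _ ⟨f, rfl⟩
      exact hC f a ha
    · rw [Submodule.ne_bot_iff]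
      exact ⟨a, ⟨counit, lstar_counit a⟩, ha0⟩
    · rintro f _ ⟨g, rfl⟩
      exact ⟨convMul f g, (lstar_lstar f g a).symm⟩
  obtain ⟨W, h1, h2, h3, h4, h5⟩ := Nat.find_spec hex
  refine ⟨W, h1, h2, h3, h4, fun W' hW' hs => ?_⟩
  by_contra hne
  push Not at hne
  have hlt := Submodule.finrank_lt_finrank_of_lt (lt_of_le_of_ne hW' hne.2)
  rw [h5] at hlt
  exact Nat.find_min hex hlt ⟨W', hW'.trans h1, hne.1, Submodule.finiteDimensional_of_le hW', hs, rfl⟩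

/-- Every nonzero subcoalgebra contains the matrix elements of an irreducible corepresentation. -/
lemma IsSubcoalgebra.exists_irreducible {C : Submodule ℂ A} (hC : IsSubcoalgebra C) (h0 : C ≠ ⊥) :
    ∃ v : MatrixCorep A, v.IsIrreducible ∧ v.coeff ≤ C := by
  obtain ⟨W, hWC, hW0, hfin, hst, hmin⟩ :=
    exists_minimal_stable (fun f a ha => hC.lstar_mem f ha) h0
  let b := Module.finBasis ℂ W
  -- The coproduct of a basis vector has the form `Δ(b_j) = ∑ b_i ⊗ v_ij`. Coordinates extended to
  -- functionals `φ_i` on `A` extract the coefficients as `v_ij = b_j ∗ φ_i`.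
  have hφ : ∀ i, ∃ φ : A →ₗ[ℂ] ℂ, φ ∘ₗ W.subtype = b.coord i := fun i =>
    LinearMap.exists_extend (b.coord i)
  choose φ hφ using hφ
  have hφ' : ∀ i (a : W), φ i a = b.repr a i := fun i a => LinearMap.congr_fun (hφ i) a
  have hsum : ∀ a ∈ W, a = ∑ i, φ i a • (b i : A) := by
    intro a ha
    have := congrArg Subtype.val (b.sum_repr ⟨a, ha⟩)
    rw [Submodule.coe_sum] at this
    simp only [Submodule.coe_smul, ← hφ'] at this
    exact this.symm
  have key : ∀ f j, lstar f (b j : A) = ∑ i, f (rstar (φ i) (b j)) • (b i : A) := by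
    intro f j
    rw [hsum _ (hst f _ (b j).2)]
    refine Finset.sum_congr rfl fun i _ => ?_
    rw [apply_lstar, apply_rstar]
  let v : MatrixCorep A :=
    { dim := Module.finrank ℂ W
      v := Matrix.of fun i j => rstar (φ i) (b j : A)
      comul_v := fun i j => by
        apply comul_ext
        intro f
        rw [Matrix.of_apply, ← rstar_lstar, key, map_sum, map_sum, map_sum]
        refine Finset.sum_congr rfl fun k _ => ?_
        simp
      counit_v := fun i j => by
        rw [Matrix.of_apply, counit_rstar, hφ', b.repr_self, Finsupp.single_apply]
        simp [eq_comm] }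
  have hrow : ∀ f (w : Fin v.dim → ℂ), lstar f (∑ j, w j • (b j : A))
      = ∑ i, v.act f w i • (b i : A) := by
    intro f w
    simp only [map_sum, map_smul, key, MatrixCorep.act_apply, Finset.smul_sum, Finset.sum_smul,
      smul_smul]
    rw [Finset.sum_comm]
    refine Finset.sum_congr rfl fun i _ => Finset.sum_congr rfl fun j _ => ?_
    rw [mul_comm]
    rfl
  let T : (Fin v.dim → ℂ) →ₗ[ℂ] A := W.subtype ∘ₗ b.equivFun.symm.toLinearMap
  have hT : ∀ w, T w = ∑ j, w j • (b j : A) := by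
    intro w
    simp [T, Module.Basis.equivFun_symm_apply]
    rfl
  have hTi : Function.Injective T := W.injective_subtype.comp b.equivFun.symm.injective
  have hTr : LinearMap.range T = W := by
    rw [LinearMap.range_comp, LinearEquiv.range, Submodule.map_top, Submodule.range_subtype]
  refine ⟨v, (MatrixCorep.isIrreducible_iff v).mpr ⟨?_, fun W' hW' => ?_⟩, ?_⟩
  · exact Module.finrank_pos_iff.mpr ((Submodule.nontrivial_iff_ne_bot).mpr hW0)
  · rcases hmin (W'.map T) (by rw [← hTr]; exact LinearMap.map_le_range) (by
      rintro f _ ⟨w, hw, rfl⟩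
      refine ⟨v.act f w, hW' f w hw, ?_⟩
      rw [hT, hT, hrow]) with h | h
    · left
      exact Submodule.map_injective_of_injective hTi (h.trans (Submodule.map_bot _).symm)
    · right
      rw [← hTr, ← Submodule.map_top] at h
      exact Submodule.map_injective_of_injective hTi h
  · rw [MatrixCorep.coeff, Submodule.span_le]
    rintro _ ⟨⟨i, j⟩, rfl⟩
    exact hC.rstar_mem (φ i) (hWC (b j).2)

namespace Irrep

/-- A representative of a class of irreducible corepresentations. -/
def rep (α : Irrep A) : MatrixCorep A := (Quotient.out α).1

lemma rep_isIrreducible (α : Irrep A) : α.rep.IsIrreducible := (Quotient.out α).2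

lemma eq_of_equivalent {α β : Irrep A} (h : α.rep.Equivalent β.rep) : α = β := by
  rw [← Quotient.out_eq α, ← Quotient.out_eq β]
  exact Quotient.sound h

lemma exists_coeff_eq {v : MatrixCorep A} (hv : v.IsIrreducible) :
    ∃ α : Irrep A, α.coeff = v.coeff := by
  refine ⟨Quotient.mk _ ⟨v, hv⟩, ?_⟩
  exact MatrixCorep.Equivalent.coeff_eq (Quotient.mk_out (⟨v, hv⟩ : {v : MatrixCorep A // _}))

/-- The isotypic component of the dual algebra action belonging to `α`. -/
def isotypic (α : Irrep A) : Submodule (dualAct A) A :=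
  isotypicComponent (dualAct A) A (α.rep.rowSub ⟨0, α.rep_isIrreducible.1⟩)

lemma coeff_le_isotypic (α : Irrep A) : α.coeff ≤ α.isotypic.restrictScalars ℂ :=
  MatrixCorep.coeff_le_isotypicComponent α.rep_isIrreducible _

/-- A simple row lying in the isotypic component of `β` is isomorphic to a row of `β`, and an
isomorphism of rows is an equivalence of corepresentations. -/
lemma isotypic_injective : Function.Injective (isotypic (A := A)) := by
  intro α β h
  have := MatrixCorep.isSimpleModule_rowSub α.rep_isIrreducible ⟨0, α.rep_isIrreducible.1⟩
  have := MatrixCorep.isSimpleModule_rowSub β.rep_isIrreducible ⟨0, β.rep_isIrreducible.1⟩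
  have hle : α.rep.rowSub ⟨0, α.rep_isIrreducible.1⟩ ≤ β.isotypic := by
    rw [← h]; exact Submodule.le_isotypicComponent _
  have ⟨e⟩ := isIsotypicOfType_submodule_iff.mp
    (IsIsotypicOfType.isotypicComponent (dualAct A) A
      (β.rep.rowSub ⟨0, β.rep_isIrreducible.1⟩)) _ hle
  exact eq_of_equivalent (MatrixCorep.equivalent_of_rowSub_equiv α.rep_isIrreducible
    β.rep_isIrreducible e)

/-- Distinct isotypic components are independent, and each coefficient space lies in its own. -/
lemma disjoint_coeff (α : Irrep A) :
    Disjoint α.coeff (⨆ β ∈ {β : Irrep A | β ≠ α}, β.coeff) := by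
  have hmem : ∀ β : Irrep A, β.isotypic ∈ isotypicComponents (dualAct A) A := fun β =>
    ⟨_, MatrixCorep.isSimpleModule_rowSub β.rep_isIrreducible _, rfl⟩
  have hd := sSupIndep_isotypicComponents (dualAct A) A (hmem α)
  rw [Submodule.disjoint_def] at hd ⊢
  intro a ha ha'
  refine hd a (α.coeff_le_isotypic ha) ?_
  have hle : (⨆ β ∈ {β : Irrep A | β ≠ α}, β.coeff)
      ≤ (sSup (isotypicComponents (dualAct A) A \ {α.isotypic})).restrictScalars ℂ := by
    refine iSup₂_le fun β hβ => β.coeff_le_isotypic.trans fun x hx => ?_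
    have : β.isotypic ≤ sSup (isotypicComponents (dualAct A) A \ {α.isotypic}) :=
      le_sSup ⟨hmem β, fun h => hβ (isotypic_injective h)⟩
    exact this hx
  exact hle ha'

/-- Each simple subcoalgebra contains the coefficients of some irreducible corepresentation and,
being simple, equals their span. -/
lemma iSup_coeff (hA : IsCosemisimple A) : ⨆ α : Irrep A, α.coeff = ⊤ := by
  rw [eq_top_iff, ← (hA : _ = _)]
  refine iSup_le fun C => ?_
  obtain ⟨C, hC, h0, hmin⟩ := C
  obtain ⟨v, hv, hle⟩ := hC.exists_irreducible h0
  obtain ⟨α, hα⟩ := exists_coeff_eq hv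
  have hne : v.coeff ≠ ⊥ := by
    intro h
    have h1 := v.v_mem_coeff ⟨0, hv.1⟩ ⟨0, hv.1⟩
    rw [h, Submodule.mem_bot] at h1
    have h2 := v.counit_v ⟨0, hv.1⟩ ⟨0, hv.1⟩
    rw [h1] at h2
    simp at h2
  have := (hmin v.coeff v.isSubcoalgebra_coeff hle).resolve_left hne
  change C ≤ _
  rw [← this, ← hα]
  exact le_iSup (fun α : Irrep A => α.coeff) α

/-- This is the condition under which `Irrep.proj` is an actual projection and not the default value
`0`. -/
lemma isCompl_coeff (hA : IsCosemisimple A) (α : Irrep A) :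
    IsCompl α.coeff (⨆ β ∈ {β : Irrep A | β ≠ α}, β.coeff) := by
  refine ⟨disjoint_coeff α, codisjoint_iff.mpr ?_⟩
  rw [eq_top_iff, ← iSup_coeff hA]
  refine iSup_le fun β => ?_
  by_cases h : β = α
  · subst h; exact le_sup_left
  · exact le_sup_of_le_right (le_iSup₂_of_le β h le_rfl)

lemma proj_of_mem (hA : IsCosemisimple A) {α : Irrep A} {a : A} (ha : a ∈ α.coeff) :
    α.proj a = a := by
  rw [proj, dif_pos (isCompl_coeff hA α)]
  exact Submodule.projection_apply_left _ ⟨a, ha⟩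

lemma proj_of_mem_ne (hA : IsCosemisimple A) {α β : Irrep A} (h : β ≠ α) {a : A}
    (ha : a ∈ β.coeff) : α.proj a = 0 := by
  rw [proj, dif_pos (isCompl_coeff hA α)]
  exact Submodule.projection_apply_right _
    ⟨a, (le_iSup₂_of_le (f := fun β (_ : β ∈ {β : Irrep A | β ≠ α}) => β.coeff) β h le_rfl) ha⟩

lemma induction_coeff (hA : IsCosemisimple A) {p : A → Prop} (a : A)
    (h : ∀ α : Irrep A, ∀ a ∈ α.coeff, p a) (h0 : p 0) (hadd : ∀ a b, p a → p b → p (a + b)) :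
    p a := by
  have : a ∈ ⨆ α : Irrep A, α.coeff := by rw [iSup_coeff hA]; trivial
  exact Submodule.iSup_induction _ (motive := p) this h h0 hadd

lemma proj_mem (hA : IsCosemisimple A) (α : Irrep A) (a : A) : α.proj a ∈ α.coeff := by
  induction a using induction_coeff hA with
  | h β a ha =>
    by_cases hβ : β = α
    · subst hβ; rw [proj_of_mem hA ha]; exact ha
    · rw [proj_of_mem_ne hA hβ ha]; exact Submodule.zero_mem _
  | h0 => rw [map_zero]; exact Submodule.zero_mem _
  | hadd a b ha hb => rw [map_add]; exact Submodule.add_mem _ ha hb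

lemma h_of_mem (hA : IsCosemisimple A) {α : Irrep A} {a : A} (ha : a ∈ α.coeff) :
    α.h a = counit (R := ℂ) a := by
  rw [Irrep.h, LinearMap.comp_apply, proj_of_mem hA ha]

lemma h_of_mem_ne (hA : IsCosemisimple A) {α β : Irrep A} (h : β ≠ α) {a : A}
    (ha : a ∈ β.coeff) : α.h a = 0 := by
  rw [Irrep.h, LinearMap.comp_apply, proj_of_mem_ne hA h ha, map_zero]

lemma h_v (hA : IsCosemisimple A) (α β : Irrep A) [Decidable (β = α)] (i j : Fin β.rep.dim) :
    α.h (β.rep.v i j) = if β = α then (if i = j then 1 else 0) else 0 := by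
  split_ifs with h h'
  · rw [h_of_mem hA (by rw [← h]; exact β.rep.v_mem_coeff i j), β.rep.counit_v, if_pos h']
  · rw [h_of_mem hA (by rw [← h]; exact β.rep.v_mem_coeff i j), β.rep.counit_v, if_neg h']
  · exact h_of_mem_ne hA h (β.rep.v_mem_coeff i j)

lemma induction_v (hA : IsCosemisimple A) {p : A → Prop} (a : A)
    (h : ∀ α : Irrep A, ∀ i j, p (α.rep.v i j)) (h0 : p 0) (hadd : ∀ a b, p a → p b → p (a + b))
    (hs : ∀ (c : ℂ) a, p a → p (c • a)) : p a := by
  refine induction_coeff hA a (fun α a ha => ?_) h0 hadd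
  induction ha using Submodule.span_induction with
  | zero => exact h0
  | add a b _ _ ha hb => exact hadd a b ha hb
  | smul c a _ ha => exact hs c a ha
  | mem a ha => obtain ⟨⟨i, j⟩, rfl⟩ := ha; exact h α i j

/-- On matrix elements `h^α` is `δ_{αβ} δ_{ij}`, so convolution with it keeps the coefficients of
`α` and kills the others. With `rstar_h` this makes `h^α` central. -/
lemma lstar_h (hA : IsCosemisimple A) (α : Irrep A) (a : A) : lstar α.h a = α.proj a := by
  classical
  induction a using induction_v hA with
  | h β i j =>
    simp only [MatrixCorep.lstar_v, h_v hA]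
    by_cases h : β = α
    · rw [proj_of_mem hA (h ▸ β.rep.v_mem_coeff i j)]
      simp [h]
    · rw [proj_of_mem_ne hA h (β.rep.v_mem_coeff i j)]
      simp [h]
  | h0 => simp
  | hadd a b ha hb => simp only [map_add, ha, hb]
  | hs c a ha => simp only [map_smul, ha]

lemma rstar_h (hA : IsCosemisimple A) (α : Irrep A) (a : A) : rstar α.h a = α.proj a := by
  classical
  induction a using induction_v hA with
  | h β i j =>
    simp only [MatrixCorep.rstar_v, h_v hA]
    by_cases h : β = α
    · rw [proj_of_mem hA (h ▸ β.rep.v_mem_coeff i j)]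
      simp [h]
    · rw [proj_of_mem_ne hA h (β.rep.v_mem_coeff i j)]
      simp [h]
  | h0 => simp
  | hadd a b ha hb => simp only [map_add, ha, hb]
  | hs c a ha => simp only [map_smul, ha]

/-- The Peter-Weyl decomposition of an element. -/
lemma exists_finset_proj (hA : IsCosemisimple A) (a : A) :
    ∃ S : Finset (Irrep A), ∀ T : Finset (Irrep A), S ⊆ T →
      (∀ α ∉ T, α.proj a = 0) ∧ ∑ α ∈ T, α.proj a = a := by
  classical
  induction a using induction_coeff hA with
  | h β a ha =>
    refine ⟨{β}, fun T hT => ⟨fun α hα => proj_of_mem_ne hA ?_ ha, ?_⟩⟩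
    · rintro rfl; exact hα (hT (Finset.mem_singleton_self _))
    · rw [Finset.sum_eq_single_of_mem β (hT (Finset.mem_singleton_self _)), proj_of_mem hA ha]
      exact fun α _ hα => proj_of_mem_ne hA hα.symm ha
  | h0 => exact ⟨∅, fun T _ => by simp⟩
  | hadd a b ha hb =>
    obtain ⟨S, hS⟩ := ha
    obtain ⟨S', hS'⟩ := hb
    refine ⟨S ∪ S', fun T hT => ?_⟩
    have h1 := hS T (Finset.union_subset_left hT)
    have h2 := hS' T (Finset.union_subset_right hT)
    refine ⟨fun α hα => ?_, ?_⟩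
    · rw [map_add, h1.1 α hα, h2.1 α hα, add_zero]
    · simp only [map_add, Finset.sum_add_distrib, h1.2, h2.2]

end Irrep

end PeterWeyl

end

noncomputable section

/-! ## Bicovariant bimodules and their forms -/

/-! ### Testing tensors by functionals and evaluating induced maps on quotients. -/

section TestMaps

variable {V B : Type*} [AddCommGroup V] [Module ℂ V] [AddCommGroup B] [Module ℂ B]

/-- The map `B ⊗ V → V` given by a functional on `B`. -/
def testL (V : Type*) [AddCommGroup V] [Module ℂ V] (f : B →ₗ[ℂ] ℂ) : B ⊗[ℂ] V →ₗ[ℂ] V :=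
  (TensorProduct.lid ℂ V).toLinearMap ∘ₗ f.rTensor V

/-- The map `V ⊗ B → V` given by a functional on `B`. -/
def testR (V : Type*) [AddCommGroup V] [Module ℂ V] (f : B →ₗ[ℂ] ℂ) : V ⊗[ℂ] B →ₗ[ℂ] V :=
  (TensorProduct.rid ℂ V).toLinearMap ∘ₗ f.lTensor V

@[simp] lemma testL_tmul (f : B →ₗ[ℂ] ℂ) (b : B) (v : V) : testL V f (b ⊗ₜ v) = f b • v := by
  simp [testL]

@[simp] lemma testR_tmul (f : B →ₗ[ℂ] ℂ) (b : B) (v : V) : testR V f (v ⊗ₜ b) = f b • v := by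
  simp [testR]

lemma eq_of_testR {z w : V ⊗[ℂ] B} (h : ∀ f, testR V f z = testR V f w) : z = w :=
  tensor_ext_right h

lemma eq_of_testL {z w : B ⊗[ℂ] V} (h : ∀ f, testL V f z = testL V f w) : z = w := by
  apply (TensorProduct.comm ℂ B V).injective
  apply eq_of_testR
  have e : ∀ f (z : B ⊗[ℂ] V), testR V f (TensorProduct.comm ℂ B V z) = testL V f z := by
    intro f z
    induction z using TensorProduct.induction_on with
    | zero => simp
    | add _ _ h h' => simp only [map_add, h, h']
    | tmul v a => simp
  intro f
  rw [e, e, h]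

lemma testL_lTensor {V' : Type*} [AddCommGroup V'] [Module ℂ V'] (T : V →ₗ[ℂ] V')
    (f : B →ₗ[ℂ] ℂ) (z : B ⊗[ℂ] V) : testL V' f (T.lTensor B z) = T (testL V f z) := by
  induction z using TensorProduct.induction_on with
  | zero => simp
  | add _ _ h h' => simp only [map_add, h, h']
  | tmul v a => simp

lemma testR_rTensor {V' : Type*} [AddCommGroup V'] [Module ℂ V'] (T : V →ₗ[ℂ] V')
    (f : B →ₗ[ℂ] ℂ) (z : V ⊗[ℂ] B) : testR V' f (T.rTensor B z) = T (testR V f z) := by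
  induction z using TensorProduct.induction_on with
  | zero => simp
  | add _ _ h h' => simp only [map_add, h, h']
  | tmul v a => simp

end TestMaps

/-- The hypothesis excludes the default value in `descend`. Each map induced on forms has to pass
through this check once. -/
lemma descend_mk {M M' : Type*} [AddCommGroup M] [Module ℂ M] [AddCommGroup M'] [Module ℂ M']
    {p : Submodule ℂ M} {f : M →ₗ[ℂ] M'} (h : ∀ x ∈ p, f x = 0) (x : M) :
    descend p f (p.mkQ x) = f x := by
  have h' : p ≤ LinearMap.ker f := h
  rw [descend, dif_pos h']
  exact p.liftQ_apply f x

/-! ### Equivariance of braid operators under a coaction matrix. -/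

section LegEntries

variable {I : Type*} [Fintype I] [DecidableEq I] (s : Matrix (I × I) (I × I) ℂ)

lemma legMat_zero_cons (k : ℕ) (a b c d : I) (K J : Fin k → I) :
    legMat s (k + 2) (0 : Fin (k + 1)) (Fin.cons a (Fin.cons b K)) (Fin.cons c (Fin.cons d J))
      = if K = J then s (a, b) (c, d) else 0 := by
  rw [legMat, Matrix.of_apply]
  have : (∀ x : Fin (k + 2), (x : ℕ) ≠ ((0 : Fin (k + 1)) : ℕ) →
      (x : ℕ) ≠ ((0 : Fin (k + 1)) : ℕ) + 1 →
      (Fin.cons a (Fin.cons b K : Fin (k + 1) → I) : Fin (k + 2) → I) x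
        = (Fin.cons c (Fin.cons d J : Fin (k + 1) → I) : Fin (k + 2) → I) x) ↔ K = J := by
    constructor
    · intro h
      funext x
      have := h x.succ.succ (by simp) (by simp)
      simpa using this
    · rintro rfl x hx hx'
      induction x using Fin.cases with
      | zero => simp at hx
      | succ x =>
        induction x using Fin.cases with
        | zero => simp at hx'
        | succ x => simp
  simp only [this]
  rfl

lemma legMat_last_snoc (k : ℕ) (a b c d : I) (K J : Fin k → I) :
    legMat s (k + 2) (Fin.last k)
        (Fin.snoc (α := fun _ => I) (Fin.snoc (α := fun _ => I) K a) b)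
        (Fin.snoc (α := fun _ => I) (Fin.snoc (α := fun _ => I) J c) d)
      = if K = J then s (a, b) (c, d) else 0 := by
  rw [legMat, Matrix.of_apply]
  have : (∀ x : Fin (k + 2), (x : ℕ) ≠ ((Fin.last k : Fin (k + 1)) : ℕ) →
      (x : ℕ) ≠ ((Fin.last k : Fin (k + 1)) : ℕ) + 1 →
      Fin.snoc (α := fun _ => I) (Fin.snoc (α := fun _ => I) K a) b x
        = Fin.snoc (α := fun _ => I) (Fin.snoc (α := fun _ => I) J c) d x) ↔ K = J := by
    constructor
    · intro h
      funext x
      have := h x.castSucc.castSucc (by simp; omega) (by simp; omega)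
      simpa using this
    · rintro rfl x hx hx'
      induction x using Fin.lastCases with
      | last => simp at hx'
      | cast x =>
        induction x using Fin.lastCases with
        | last => simp at hx
        | cast x => simp
  simp only [this]
  have e1 : (⟨((Fin.last k : Fin (k + 1)) : ℕ), by simp⟩ : Fin (k + 2)) = (Fin.last k).castSucc := rfl
  have e2 : (⟨((Fin.last k : Fin (k + 1)) : ℕ) + 1, by simp⟩ : Fin (k + 2)) = Fin.last (k + 1) := rfl
  simp only [e1, e2, Fin.snoc_last, Fin.snoc_castSucc]

variable {B : Type*} [Ring B] [Algebra ℂ B] {s}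

/-- In the first two factors this is the hypothesis; for later ones the first factor of `v^{⊗n}` is
stripped off and induction applies. -/
lemma legMat_comm_tensorPow {v : Matrix I I B}
    (h : s.map (algebraMap ℂ B) * pairMat v = pairMat v * s.map (algebraMap ℂ B)) (n : ℕ)
    (m : Fin (n - 1)) :
    (legMat s n m).map (algebraMap ℂ B) * tensorPow v n
      = tensorPow v n * (legMat s n m).map (algebraMap ℂ B) := by
  induction n with
  | zero => exact m.elim0
  | succ n ih =>
    cases n with
    | zero => exact m.elim0
    | succ k =>
      change Fin (k + 1) at m
      ext K J
      rw [← Fin.cons_self_tail K, ← Fin.cons_self_tail J]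
      generalize K 0 = a
      generalize J 0 = c
      generalize Fin.tail K = K
      generalize Fin.tail J = J
      induction m using Fin.cases with
      | zero =>
        rw [← Fin.cons_self_tail K, ← Fin.cons_self_tail J]
        generalize K 0 = b
        generalize J 0 = d
        generalize Fin.tail K = K
        generalize Fin.tail J = J
        have h' := congrFun (congrFun h (a, b)) (c, d)
        simp only [Matrix.mul_apply, Fintype.sum_prod_type, Matrix.map_apply, pairMat,
          Matrix.of_apply] at h'
        simp only [Matrix.mul_apply, sum_cons, Matrix.map_apply, legMat_zero_cons, tensorPow_succ,
          Fin.cons_zero, Fin.tail_cons]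
        have e1 : ∀ x y, ∑ L : Fin k → I, algebraMap ℂ B (if K = L then s (a, b) (x, y) else 0)
            * (v x c * (v y d * tensorPow v k L J))
            = algebraMap ℂ B (s (a, b) (x, y)) * (v x c * v y d) * tensorPow v k K J := by
          intro x y
          rw [Finset.sum_eq_single K]
          · rw [if_pos rfl]; simp only [mul_assoc]
          · intro L _ hL; rw [if_neg hL.symm]; simp
          · simp
        have e2 : ∀ x y, ∑ L : Fin k → I, (v a x * (v b y * tensorPow v k K L))
            * algebraMap ℂ B (if L = J then s (x, y) (c, d) else 0)
            = v a x * v b y * algebraMap ℂ B (s (x, y) (c, d)) * tensorPow v k K J := by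
          intro x y
          rw [Finset.sum_eq_single J]
          · rw [if_pos rfl]
            simp only [mul_assoc, Algebra.commutes]
          · intro L _ hL; rw [if_neg hL]; simp
          · simp
        simp only [e1, e2, ← Finset.sum_mul, h']
      | succ m =>
        have ih' := congrFun (congrFun (ih m) K) J
        have e : legMat s (k + 2) m.succ = consMat (k + 1) (legMat s (k + 1) m) :=
          legMat_succ s (k + 1) m (by simp)
        rw [e]
        simp only [Matrix.mul_apply, Matrix.map_apply] at ih'
        simp only [Matrix.mul_apply, sum_cons (k + 1), Matrix.map_apply, consMat_apply, tensorPow_succ (n := k + 1),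
          Fin.cons_zero, Fin.tail_cons]
        rw [Finset.sum_eq_single a, Finset.sum_eq_single c]
        · have e' : ∀ (x : ℂ) (t : B), algebraMap ℂ B x * (v a c * t)
              = v a c * (algebraMap ℂ B x * t) := fun x t => by
            rw [← mul_assoc, Algebra.commutes, mul_assoc]
          simp only [if_true, e', mul_assoc, ← Finset.mul_sum, ih']
        · intro x _ hx; simp [hx]
        · simp
        · intro x _ hx; simp [hx.symm]
        · simp

lemma permMat_comm_tensorPow {v : Matrix I I B}
    (h : s.map (algebraMap ℂ B) * pairMat v = pairMat v * s.map (algebraMap ℂ B)) {n : ℕ}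
    (π : Equiv.Perm (Fin n)) :
    (permMat s π).map (algebraMap ℂ B) * tensorPow v n
      = tensorPow v n * (permMat s π).map (algebraMap ℂ B) := by
  rw [permMat]
  generalize reducedWord π = w
  induction w with
  | nil => simp [Matrix.map_one]
  | cons m w ih =>
    rw [List.map_cons, List.prod_cons, Matrix.map_mul, Matrix.mul_assoc, ih, ← Matrix.mul_assoc,
      legMat_comm_tensorPow h, Matrix.mul_assoc]

lemma antisymmetriser_comm_tensorPow {v : Matrix I I B}
    (h : s.map (algebraMap ℂ B) * pairMat v = pairMat v * s.map (algebraMap ℂ B)) (n : ℕ) :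
    (antisymmetriser s n).map (algebraMap ℂ B) * tensorPow v n
      = tensorPow v n * (antisymmetriser s n).map (algebraMap ℂ B) := by
  have e : (antisymmetriser s n).map (algebraMap ℂ B)
      = ∑ π : Equiv.Perm (Fin n), ((Equiv.Perm.sign π : ℤ) : ℂ) • (permMat s π).map (algebraMap ℂ B) := by
    ext K J
    simp only [antisymmetriser, Matrix.map_apply, Matrix.sum_apply, map_sum, Matrix.smul_apply]
    simp only [smul_eq_mul, map_mul, Algebra.smul_def]
  rw [e, Finset.sum_mul, Finset.mul_sum]
  refine Finset.sum_congr rfl fun π _ => ?_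
  rw [smul_mul_assoc, mul_smul_comm, permMat_comm_tensorPow h]

end LegEntries

namespace HopfBimod

open Coalgebra

variable {A : Type*} [Ring A] [HopfAlgebra ℂ A] {I : Type*} [Fintype I] [DecidableEq I]

/-- The conditions on `(v, f)` under which `Γ` is a Hopf bimodule with invertible braiding. -/
structure IsBicovariant (Γ : HopfBimod A I) : Prop where
  comul_v : ∀ i j, comul (R := ℂ) (Γ.v i j) = ∑ k, Γ.v i k ⊗ₜ[ℂ] Γ.v k j
  counit_v : ∀ i j, counit (R := ℂ) (Γ.v i j) = if i = j then 1 else 0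
  f_mul : ∀ i j a b, Γ.f i j (a * b) = ∑ k, Γ.f i k a * Γ.f k j b
  f_one : ∀ i j, Γ.f i j 1 = if i = j then 1 else 0
  compat : ∀ i k a, ∑ j, lstar (Γ.f i j) a * Γ.v k j = ∑ m, Γ.v m i * rstar (Γ.f m k) a
  exists_inv : ∃ f' : I → I → A →ₗ[ℂ] ℂ, ∀ k l,
    ∑ j, convMul (Γ.f j k) (f' l j) = if k = l then counit else 0

variable {Γ : HopfBimod A I}

lemma sigma_apply (k l i j : I) : Γ.sigma (k, l) (i, j) = Γ.f i l (Γ.v k j) := rfl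

namespace IsBicovariant

lemma sum_apply_v_mul_apply_v (h : Γ.IsBicovariant) (f g : A →ₗ[ℂ] ℂ) (i j : I) :
    ∑ k, f (Γ.v i k) * g (Γ.v k j) = convMul f g (Γ.v i j) :=
  (convMul_eq_of_comul (h.comul_v i j) f g).symm

/-- This is the compatibility of action and coaction evaluated at a matrix element of `v`; it says
that `σ` is right-colinear. -/
lemma sigma_comm (h : Γ.IsBicovariant) :
    Γ.sigma.map (algebraMap ℂ A) * pairMat Γ.v = pairMat Γ.v * Γ.sigma.map (algebraMap ℂ A) := by
  ext ⟨a, b⟩ ⟨i, j⟩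
  have e := h.compat i b (Γ.v a j)
  simp only [lstar_apply_mul_matrix h.comul_v, rstar_apply_matrix h.comul_v, Finset.sum_mul,
    Finset.mul_sum] at e
  simp only [Matrix.mul_apply, Matrix.map_apply, pairMat, Matrix.of_apply, Fintype.sum_prod_type,
    sigma_apply]
  rw [Finset.sum_comm] at e
  simp only [smul_mul_assoc, mul_smul_comm] at e
  simp only [← Algebra.commutes (R := ℂ), ← Algebra.smul_def]
  exact e.symm

/-- Apply `f` to the compatibility condition at a matrix element. Multiplicativity of `f` and the
corepresentation property of `v` turn it into the three-factor braid relation. -/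
lemma isBraiding (h : Γ.IsBicovariant) : IsBraiding Γ.sigma := by
  apply isBraiding_of_entries
  intro x y z a b c
  simp only [Fintype.sum_prod_type, sigma_apply]
  have e := congrArg (Γ.f a z) (h.compat b y (Γ.v x c))
  simp only [map_sum, h.f_mul, apply_lstar, apply_rstar] at e
  simp only [← h.sum_apply_v_mul_apply_v] at e
  have e1 : ∑ p, ∑ q, ∑ d, Γ.f p y (Γ.v x q) * Γ.f d z (Γ.v q c) * Γ.f a d (Γ.v p b)
      = ∑ p, ∑ d, Γ.f a d (Γ.v p b) * ∑ q, Γ.f p y (Γ.v x q) * Γ.f d z (Γ.v q c) := by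
    refine Finset.sum_congr rfl fun p _ => ?_
    rw [Finset.sum_comm]
    refine Finset.sum_congr rfl fun d _ => ?_
    rw [Finset.mul_sum]
    exact Finset.sum_congr rfl fun q _ => mul_comm _ _
  rw [e1, ← e, Finset.sum_comm]
  refine Finset.sum_congr rfl fun p _ => Finset.sum_congr rfl fun q _ => ?_
  rw [Finset.sum_mul]
  exact Finset.sum_congr rfl fun d _ => by ring

/-- The convolution inverse of `f`, evaluated on matrix elements of `v`, provides the inverse of
`σ`. -/
lemma exists_sigma_mul_eq_one (h : Γ.IsBicovariant) : ∃ s, Γ.sigma * s = 1 := by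
  obtain ⟨f', hf'⟩ := h.exists_inv
  refine ⟨Matrix.of fun p r => f' r.2 p.1 (Γ.v p.2 r.1), ?_⟩
  ext ⟨a, b⟩ ⟨k, l⟩
  simp only [Matrix.mul_apply, Fintype.sum_prod_type, sigma_apply, Matrix.of_apply,
    h.sum_apply_v_mul_apply_v]
  have := LinearMap.congr_fun (hf' b l) (Γ.v a k)
  rw [LinearMap.sum_apply] at this
  rw [this]
  simp only [Matrix.one_apply, Prod.mk.injEq]
  by_cases hb : b = l
  · rw [if_pos hb, h.counit_v]; simp [hb]
  · rw [if_neg hb]; simp [hb]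

lemma sigma_mul_inv (h : Γ.IsBicovariant) : Γ.sigma * Γ.sigma⁻¹ = 1 := by
  obtain ⟨s, hs⟩ := h.exists_sigma_mul_eq_one
  rwa [Matrix.inv_eq_right_inv hs]

lemma inv_mul_sigma (h : Γ.IsBicovariant) : Γ.sigma⁻¹ * Γ.sigma = 1 :=
  mul_eq_one_comm.mp h.sigma_mul_inv

lemma isBraiding_sigmaPow (h : Γ.IsBicovariant) (s : Sgn) : IsBraiding (Γ.sigmaPow s) := by
  cases s with
  | plus => exact h.isBraiding
  | minus => exact h.isBraiding.of_mul_eq_one h.sigma_mul_inv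

end IsBicovariant

/-! ### The action of functionals on tensors -/

lemma ext_apply {k l : ℕ} (M : Matrix (Fin l → I) (Fin k → I) ℂ) (ρ : Γ.Tens k) (K : Fin l → I) :
    Γ.ext M ρ K = ∑ J, M K J • ρ J := by
  simp [ext]

lemma ext_mul {k l m : ℕ} (M : Matrix (Fin m → I) (Fin l → I) ℂ)
    (M' : Matrix (Fin l → I) (Fin k → I) ℂ) (ρ : Γ.Tens k) :
    Γ.ext (M * M') ρ = Γ.ext M (Γ.ext M' ρ) := by
  funext K
  simp only [ext_apply, Matrix.mul_apply, Finset.sum_smul, Finset.smul_sum, smul_smul]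
  exact Finset.sum_comm

lemma ext_one {k : ℕ} (ρ : Γ.Tens k) : Γ.ext (1 : Matrix (Fin k → I) (Fin k → I) ℂ) ρ = ρ := by
  funext K
  simp [ext_apply, Matrix.one_apply]

lemma ext_add {k l : ℕ} (M M' : Matrix (Fin l → I) (Fin k → I) ℂ) (ρ : Γ.Tens k) :
    Γ.ext (M + M') ρ = Γ.ext M ρ + Γ.ext M' ρ := by
  funext K
  simp only [ext_apply, Matrix.add_apply, add_smul, Finset.sum_add_distrib, Pi.add_apply]

lemma ext_sub {k l : ℕ} (M M' : Matrix (Fin l → I) (Fin k → I) ℂ) (ρ : Γ.Tens k) :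
    Γ.ext (M - M') ρ = Γ.ext M ρ - Γ.ext M' ρ := by
  funext K
  simp only [ext_apply, Matrix.sub_apply, sub_smul, Finset.sum_sub_distrib, Pi.sub_apply]

lemma ext_smul {k l : ℕ} (c : ℂ) (M : Matrix (Fin l → I) (Fin k → I) ℂ) (ρ : Γ.Tens k) :
    Γ.ext (c • M) ρ = c • Γ.ext M ρ := by
  funext K
  simp only [ext_apply, Matrix.smul_apply, smul_assoc, Finset.smul_sum, Pi.smul_apply]

lemma mem_kerA {k : ℕ} {ρ : Γ.Tens k} :
    ρ ∈ Γ.kerA k ↔ Γ.ext (antisymmetriser Γ.sigma k) ρ = 0 := LinearMap.mem_ker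

variable (Γ)

/-- `ρ ↦ f(ρ_(-1)) ρ_(0)`. -/
def actL (f : A →ₗ[ℂ] ℂ) (k : ℕ) : Γ.Tens k →ₗ[ℂ] Γ.Tens k := (rstar f).compLeft _

/-- `ρ ↦ ρ_(0) f(ρ_(1))`. -/
def actR (f : A →ₗ[ℂ] ℂ) (k : ℕ) : Γ.Tens k →ₗ[ℂ] Γ.Tens k :=
  LinearMap.pi fun K => ∑ J,
    lstar (f ∘ₗ LinearMap.mulRight ℂ (tensorPow Γ.v k K J)) ∘ₗ LinearMap.proj J

variable {Γ}

lemma actL_apply (f : A →ₗ[ℂ] ℂ) (k : ℕ) (ρ : Γ.Tens k) (K : Fin k → I) :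
    Γ.actL f k ρ K = rstar f (ρ K) := rfl

lemma actR_apply (f : A →ₗ[ℂ] ℂ) (k : ℕ) (ρ : Γ.Tens k) (K : Fin k → I) :
    Γ.actR f k ρ K = ∑ J, lstar (f ∘ₗ LinearMap.mulRight ℂ (tensorPow Γ.v k K J)) (ρ J) := by
  simp [actR]

/-- Identities between coactions are reduced to identities between the operators `actL` and `actR`;
`eq_of_testL` and `eq_of_testR` lead back. -/
lemma testL_coactL (f : A →ₗ[ℂ] ℂ) (k : ℕ) (ρ : Γ.Tens k) :
    testL _ f (Γ.coactL k ρ) = Γ.actL f k ρ := by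
  rw [coactL, LinearMap.sum_apply, map_sum]
  have e : ∀ J, testL _ f ((TensorProduct.map LinearMap.id
      (LinearMap.single ℂ (fun _ : Fin k → I => A) J) ∘ₗ comul ∘ₗ LinearMap.proj J) ρ)
      = Pi.single J (rstar f (ρ J)) := by
    intro J
    simp only [LinearMap.comp_apply, LinearMap.proj_apply, rstar]
    generalize comul (R := ℂ) (ρ J) = z
    induction z using TensorProduct.induction_on with
    | zero => simp
    | add _ _ h h' =>
      simp only [map_add, Pi.single_add, h, h', LinearEquiv.coe_coe] at *
    | tmul a b => simp [Pi.single_smul]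
  simp only [e]
  funext K
  simp [actL_apply, Finset.sum_apply, Pi.single_apply]

lemma testR_coactR (f : A →ₗ[ℂ] ℂ) (k : ℕ) (ρ : Γ.Tens k) :
    testR _ f (Γ.coactR k ρ) = Γ.actR f k ρ := by
  simp only [coactR, LinearMap.sum_apply, map_sum]
  have e : ∀ J K, testR _ f ((TensorProduct.map (LinearMap.single ℂ (fun _ : Fin k → I => A) K)
    (LinearMap.mulRight ℂ (tensorPow Γ.v k K J)) ∘ₗ comul ∘ₗ LinearMap.proj J) ρ)
      = Pi.single K (lstar (f ∘ₗ LinearMap.mulRight ℂ (tensorPow Γ.v k K J)) (ρ J)) := by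
    intro J K
    simp only [LinearMap.comp_apply, LinearMap.proj_apply, lstar]
    generalize comul (R := ℂ) (ρ J) = z
    induction z using TensorProduct.induction_on with
    | zero => simp
    | add _ _ h h' =>
      simp only [map_add, Pi.single_add, h, h', LinearEquiv.coe_coe] at *
    | tmul a b => simp [Pi.single_smul]
  simp only [e]
  funext K
  simp [actR_apply, Finset.sum_apply, Pi.single_apply]

lemma actL_actL (f g : A →ₗ[ℂ] ℂ) (k : ℕ) (ρ : Γ.Tens k) :
    Γ.actL f k (Γ.actL g k ρ) = Γ.actL (convMul g f) k ρ := by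
  funext K; simp only [actL_apply, rstar_rstar]

lemma actL_counit (k : ℕ) (ρ : Γ.Tens k) : Γ.actL counit k ρ = ρ := by
  funext K; simp only [actL_apply, rstar_counit]

lemma actL_actR (f g : A →ₗ[ℂ] ℂ) (k : ℕ) (ρ : Γ.Tens k) :
    Γ.actL f k (Γ.actR g k ρ) = Γ.actR g k (Γ.actL f k ρ) := by
  funext K; simp only [actL_apply, actR_apply, map_sum, rstar_lstar]

lemma actL_ext (f : A →ₗ[ℂ] ℂ) {k l : ℕ} (M : Matrix (Fin l → I) (Fin k → I) ℂ) (ρ : Γ.Tens k) :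
    Γ.actL f l (Γ.ext M ρ) = Γ.ext M (Γ.actL f k ρ) := by
  funext K; simp only [actL_apply, ext_apply, map_sum, map_smul]

/-- A scalar matrix commuting with `v^{⊗k}` is an endomorphism of the right comodule. -/
lemma actR_ext (f : A →ₗ[ℂ] ℂ) {k : ℕ} {M : Matrix (Fin k → I) (Fin k → I) ℂ}
    (hM : M.map (algebraMap ℂ A) * tensorPow Γ.v k = tensorPow Γ.v k * M.map (algebraMap ℂ A))
    (ρ : Γ.Tens k) : Γ.actR f k (Γ.ext M ρ) = Γ.ext M (Γ.actR f k ρ) := by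
  funext K
  simp only [actR_apply, ext_apply, map_sum, map_smul, Finset.smul_sum]
  rw [Finset.sum_comm]
  rw [Finset.sum_comm (s := Finset.univ (α := Fin k → I)) (γ := Fin k → I)
    (f := fun J L => M K J • _)]
  refine Finset.sum_congr rfl fun J _ => ?_
  simp only [← lstar_smul, ← lstar_sum]
  congr 2
  ext a
  have e := congrFun (congrFun hM K) J
  simp only [Matrix.mul_apply, Matrix.map_apply, ← Algebra.commutes (R := ℂ) _ (tensorPow _ _ _ _),
    ← Algebra.smul_def] at e
  have e' := congrArg (fun b => f (a * b)) e
  simp only [Finset.mul_sum, map_sum, mul_smul_comm, map_smul] at e'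
  simp only [LinearMap.sum_apply, LinearMap.smul_apply, LinearMap.comp_apply,
    LinearMap.mulRight_apply]
  exact e'.symm

namespace IsBicovariant

variable (h : Γ.IsBicovariant)
include h

lemma comul_tensorPow (k : ℕ) (K J : Fin k → I) :
    comul (R := ℂ) (tensorPow Γ.v k K J)
      = ∑ L, tensorPow Γ.v k K L ⊗ₜ[ℂ] tensorPow Γ.v k L J := by
  induction k with
  | zero =>
    simp [tensorPow_zero, Algebra.TensorProduct.one_def]
  | succ k ih =>
    simp only [tensorPow_succ, Bialgebra.comul_mul, ih, h.comul_v, sum_cons, Fin.cons_zero,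
      Fin.tail_cons, Finset.sum_mul_sum, Algebra.TensorProduct.tmul_mul_tmul]

lemma counit_tensorPow (k : ℕ) (K J : Fin k → I) :
    counit (R := ℂ) (tensorPow Γ.v k K J) = if K = J then 1 else 0 := by
  induction k with
  | zero => simp [tensorPow_zero, Subsingleton.elim K J]
  | succ k ih =>
    rw [tensorPow_succ, Bialgebra.counit_mul, ih, h.counit_v]
    have : K = J ↔ K 0 = J 0 ∧ Fin.tail K = Fin.tail J := by
      constructor
      · rintro rfl; exact ⟨rfl, rfl⟩
      · rintro ⟨h0, h1⟩
        rw [← Fin.cons_self_tail K, ← Fin.cons_self_tail J, h0, h1]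
    simp only [this, ite_and]
    split_ifs <;> simp

lemma actR_counit (k : ℕ) (ρ : Γ.Tens k) : Γ.actR counit k ρ = ρ := by
  funext K
  have e : ∀ J, counit (R := ℂ) ∘ₗ LinearMap.mulRight ℂ (tensorPow Γ.v k K J)
      = (if K = J then (1 : ℂ) else 0) • counit (R := ℂ) (A := A) := by
    intro J
    ext a
    simp only [LinearMap.comp_apply, LinearMap.mulRight_apply, Bialgebra.counit_mul,
      h.counit_tensorPow, LinearMap.smul_apply, smul_eq_mul]
    ring
  simp only [actR_apply, e, lstar_smul, lstar_counit]
  simp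

/-- Coassociativity of the right coaction: both `a` and the matrix elements of `v^{⊗k}` are
comultiplied. -/
lemma actR_actR (f g : A →ₗ[ℂ] ℂ) (k : ℕ) (ρ : Γ.Tens k) :
    Γ.actR f k (Γ.actR g k ρ) = Γ.actR (convMul f g) k ρ := by
  funext K
  simp only [actR_apply, map_sum, lstar_lstar]
  rw [Finset.sum_comm]
  refine Finset.sum_congr rfl fun J _ => ?_
  rw [← lstar_sum]
  congr 2
  ext a
  simp only [LinearMap.sum_apply, LinearMap.comp_apply, LinearMap.mulRight_apply, convMul,
    Bialgebra.comul_mul, h.comul_tensorPow, Finset.mul_sum, map_sum]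
  refine Finset.sum_congr rfl fun L _ => ?_
  generalize comul (R := ℂ) a = z
  induction z using TensorProduct.induction_on with
  | zero => simp
  | add _ _ h h' => simp only [map_add, add_mul, h, h']
  | tmul a b => simp

lemma antisymmetriser_comm (k : ℕ) :
    (antisymmetriser Γ.sigma k).map (algebraMap ℂ A) * tensorPow Γ.v k
      = tensorPow Γ.v k * (antisymmetriser Γ.sigma k).map (algebraMap ℂ A) :=
  antisymmetriser_comm_tensorPow h.sigma_comm k

/-- Right-colinearity of `σ` passes to `A_k`. This is what lets the right coaction descend to forms.
-/
lemma actR_mem_kerA (f : A →ₗ[ℂ] ℂ) {k : ℕ} {ρ : Γ.Tens k} (hρ : ρ ∈ Γ.kerA k) :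
    Γ.actR f k ρ ∈ Γ.kerA k := by
  rw [mem_kerA] at hρ ⊢
  rw [← actR_ext f (h.antisymmetriser_comm k), hρ, map_zero]

omit h in
lemma _root_.HopfBimod.actL_mem_kerA (f : A →ₗ[ℂ] ℂ) {k : ℕ} {ρ : Γ.Tens k} (hρ : ρ ∈ Γ.kerA k) :
    Γ.actL f k ρ ∈ Γ.kerA k := by
  rw [mem_kerA] at hρ ⊢
  rw [← actL_ext f, hρ, map_zero]

omit h in
lemma _root_.HopfBimod.formsCoactL_mk (k : ℕ) (ρ : Γ.Tens k) :
    Γ.formsCoactL k ((Γ.kerA k).mkQ ρ) = (Γ.kerA k).mkQ.lTensor A (Γ.coactL k ρ) := by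
  rw [formsCoactL, descend_mk]
  · rfl
  · intro ρ hρ
    apply eq_of_testL
    intro f
    rw [LinearMap.comp_apply, testL_lTensor, testL_coactL, map_zero, Submodule.mkQ_apply,
      Submodule.Quotient.mk_eq_zero]
    exact actL_mem_kerA f hρ

lemma formsCoactR_mk (k : ℕ) (ρ : Γ.Tens k) :
    Γ.formsCoactR k ((Γ.kerA k).mkQ ρ) = (Γ.kerA k).mkQ.rTensor A (Γ.coactR k ρ) := by
  rw [formsCoactR, descend_mk]
  · rfl
  · intro ρ hρ
    apply eq_of_testR
    intro f
    rw [LinearMap.comp_apply, testR_rTensor, testR_coactR, map_zero, Submodule.mkQ_apply,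
      Submodule.Quotient.mk_eq_zero]
    exact h.actR_mem_kerA f hρ

end IsBicovariant

/-! ### The action of functionals on forms -/

/-- The map `ξ ↦ f(ξ_(-1)) ξ_(0) g(ξ_(1))` on forms. -/
def formsAct (Γ : HopfBimod A I) (f g : A →ₗ[ℂ] ℂ) (k : ℕ) : Γ.Forms k →ₗ[ℂ] Γ.Forms k :=
  testL _ f ∘ₗ testR _ g ∘ₗ Γ.coactLR k

lemma IsBicovariant.formsAct_mk (h : Γ.IsBicovariant) (f g : A →ₗ[ℂ] ℂ) (k : ℕ) (ρ : Γ.Tens k) :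
    Γ.formsAct f g k ((Γ.kerA k).mkQ ρ) = (Γ.kerA k).mkQ (Γ.actL f k (Γ.actR g k ρ)) := by
  rw [formsAct, LinearMap.comp_apply, LinearMap.comp_apply, coactLR, LinearMap.comp_apply,
    testR_rTensor, h.formsCoactR_mk, testR_rTensor, testR_coactR, formsCoactL_mk, testL_lTensor,
    testL_coactL]

lemma hForms_eq_formsAct (α β : Irrep A) (k : ℕ) : Γ.hForms α β k = Γ.formsAct α.h β.h k := by
  have e : ∀ z : (A ⊗[ℂ] Γ.Forms k) ⊗[ℂ] A, TensorProduct.rid ℂ (Γ.Forms k)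
      (TensorProduct.map ((TensorProduct.lid ℂ (Γ.Forms k)).toLinearMap ∘ₗ
      TensorProduct.map α.h LinearMap.id) β.h z) = testL _ α.h (testR _ β.h z) := by
    intro z
    induction z using TensorProduct.induction_on with
    | zero => simp
    | add _ _ h h' => simp only [map_add, h, h']
    | tmul y b =>
      induction y using TensorProduct.induction_on with
      | zero => simp
      | add _ _ h h' => simp only [map_add, h, h', TensorProduct.add_tmul]
      | tmul a y => simp
  exact LinearMap.ext fun ξ => e _

lemma eq_of_testL_testR {V B : Type*} [AddCommGroup V] [Module ℂ V] [AddCommGroup B] [Module ℂ B]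
    {z w : (B ⊗[ℂ] V) ⊗[ℂ] B}
    (h : ∀ f g, testL V f (testR _ g z) = testL V f (testR _ g w)) : z = w :=
  eq_of_testR fun g => eq_of_testL fun f => h f g

namespace IsBicovariant

variable (h : Γ.IsBicovariant)
include h

/-- The bicomodule axioms in terms of functionals; on the left coaction the order of composition is
reversed. -/
lemma formsAct_formsAct (f g f' g' : A →ₗ[ℂ] ℂ) (k : ℕ) (ξ : Γ.Forms k) :
    Γ.formsAct f g k (Γ.formsAct f' g' k ξ) = Γ.formsAct (convMul f' f) (convMul g g') k ξ := by
  obtain ⟨ρ, rfl⟩ := Submodule.mkQ_surjective _ ξ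
  rw [h.formsAct_mk, h.formsAct_mk, h.formsAct_mk, ← actL_actR, h.actR_actR, actL_actL]

lemma formsAct_counit (k : ℕ) (ξ : Γ.Forms k) : Γ.formsAct counit counit k ξ = ξ := by
  obtain ⟨ρ, rfl⟩ := Submodule.mkQ_surjective _ ξ
  rw [h.formsAct_mk, actL_counit, h.actR_counit]

/-- Convolution with `h^α` is composition with `P^α`. Hence the two-sided coaction of `h^{αβ}(ξ)` is
the image under `P^α ⊗ id ⊗ P^β` of that of `ξ`. -/
lemma hForms_mem_component (hA : IsCosemisimple A) (α β : Irrep A) (k : ℕ) (ξ : Γ.Forms k) :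
    Γ.hForms α β k ξ ∈ Γ.component α β k := by
  have hα : ∀ a, α.proj a ∈ α.coeff := Irrep.proj_mem hA α
  have hβ : ∀ a, β.proj a ∈ β.coeff := Irrep.proj_mem hA β
  rw [component, Submodule.mem_comap]
  have e : Γ.coactLR k (Γ.hForms α β k ξ)
      = TensorProduct.map (TensorProduct.map α.coeff.subtype LinearMap.id) β.coeff.subtype
        (TensorProduct.map (TensorProduct.map (α.proj.codRestrict _ hα) LinearMap.id)
          (β.proj.codRestrict _ hβ) (Γ.coactLR k ξ)) := by
    apply eq_of_testL_testR
    intro f g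
    change Γ.formsAct f g k _ = _
    rw [hForms_eq_formsAct, h.formsAct_formsAct]
    have e1 : convMul α.h f = f ∘ₗ α.proj := by
      ext a; rw [← apply_rstar, Irrep.rstar_h hA]; rfl
    have e2 : convMul g β.h = g ∘ₗ β.proj := by
      ext a; rw [← apply_lstar, Irrep.lstar_h hA]; rfl
    rw [e1, e2, formsAct, LinearMap.comp_apply, LinearMap.comp_apply]
    generalize Γ.coactLR k ξ = z
    induction z using TensorProduct.induction_on with
    | zero => simp
    | add _ _ h h' => simp only [map_add, h, h']
    | tmul y b =>
      induction y using TensorProduct.induction_on with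
      | zero => simp
      | add _ _ h h' => simp only [map_add, h, h', TensorProduct.add_tmul]
      | tmul a y => simp
  rw [e]
  exact ⟨_, rfl⟩

-- On `Γ^{∧k}(α, β)` only the restrictions of the functionals to the coefficient coalgebras matter.
-- With `f' = g' = ε` this turns scalars on coalgebras into eigenvalues on forms.
omit h in
lemma _root_.HopfBimod.formsAct_eq_smul_of_mem_component {α β : Irrep A} {k : ℕ} {ξ : Γ.Forms k}
    (hξ : ξ ∈ Γ.component α β k) {f f' g g' : A →ₗ[ℂ] ℂ} (c : ℂ)
    (hc : ∀ a ∈ α.coeff, ∀ b ∈ β.coeff, f a * g b = c * (f' a * g' b)) :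
    Γ.formsAct f g k ξ = c • Γ.formsAct f' g' k ξ := by
  rw [component, Submodule.mem_comap] at hξ
  obtain ⟨z, hz⟩ := hξ
  simp only [formsAct, LinearMap.comp_apply, ← hz]
  clear hz
  induction z using TensorProduct.induction_on with
  | zero => simp
  | add _ _ h h' => simp only [map_add, h, h', smul_add]
  | tmul y b =>
    induction y using TensorProduct.induction_on with
    | zero => simp
    | add _ _ h h' => simp only [map_add, h, h', smul_add, TensorProduct.add_tmul]
    | tmul a y =>
      have := hc a a.2 b b.2
      simp only [TensorProduct.map_tmul, testR_tmul, map_smul, testL_tmul, smul_smul,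
        Submodule.subtype_apply, LinearMap.id_apply]
      rw [mul_comm (g _), this]
      congr 1
      ring

lemma hForms_of_mem_component (hA : IsCosemisimple A) {α β : Irrep A} {k : ℕ} {ξ : Γ.Forms k}
    (hξ : ξ ∈ Γ.component α β k) : Γ.hForms α β k ξ = ξ := by
  rw [hForms_eq_formsAct, formsAct_eq_smul_of_mem_component hξ (f' := counit) (g' := counit) 1,
    one_smul, h.formsAct_counit]
  intro a ha b hb
  rw [Irrep.h_of_mem hA ha, Irrep.h_of_mem hA hb, one_mul]

omit h in
lemma _root_.HopfBimod.hForms_of_mem_component_ne (hA : IsCosemisimple A) {α β α' β' : Irrep A}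
    {k : ℕ} {ξ : Γ.Forms k} (hξ : ξ ∈ Γ.component α' β' k) (hne : (α', β') ≠ (α, β)) :
    Γ.hForms α β k ξ = 0 := by
  rw [hForms_eq_formsAct, formsAct_eq_smul_of_mem_component hξ (f' := counit) (g' := counit) 0,
    zero_smul]
  intro a ha b hb
  by_cases h1 : α' = α
  · have h2 : β' ≠ β := fun h2 => hne (by rw [h1, h2])
    rw [Irrep.h_of_mem_ne hA h2 hb, mul_zero, zero_mul]
  · rw [Irrep.h_of_mem_ne hA h1 ha, zero_mul, zero_mul]

/-- The two-sided coaction is a finite sum of pure tensors whose outer legs have finitely many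
Peter-Weyl components. Quantifying over all `T ⊇ S` makes the statement stable under addition. -/
lemma exists_finset_hForms (hA : IsCosemisimple A) (k : ℕ) (ξ : Γ.Forms k) :
    ∃ S : Finset (Irrep A × Irrep A), ∀ T, S ⊆ T →
      (∀ p ∉ T, Γ.hForms p.1 p.2 k ξ = 0) ∧ ∑ p ∈ T, Γ.hForms p.1 p.2 k ξ = ξ := by
  classical
  have key : ∀ z : (A ⊗[ℂ] Γ.Forms k) ⊗[ℂ] A, ∃ S : Finset (Irrep A × Irrep A), ∀ T, S ⊆ T →
      (∀ p ∉ T, testL _ p.1.h (testR _ p.2.h z) = 0) ∧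
        ∑ p ∈ T, testL _ p.1.h (testR _ p.2.h z) = testL _ counit (testR _ counit z) := by
    intro z
    have hadd : ∀ z w : (A ⊗[ℂ] Γ.Forms k) ⊗[ℂ] A,
        (∃ S : Finset (Irrep A × Irrep A), ∀ T, S ⊆ T →
      (∀ p ∉ T, testL _ p.1.h (testR _ p.2.h z) = 0) ∧
        ∑ p ∈ T, testL _ p.1.h (testR _ p.2.h z) = testL _ counit (testR _ counit z)) →
      (∃ S : Finset (Irrep A × Irrep A), ∀ T, S ⊆ T →
      (∀ p ∉ T, testL _ p.1.h (testR _ p.2.h w) = 0) ∧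
        ∑ p ∈ T, testL _ p.1.h (testR _ p.2.h w) = testL _ counit (testR _ counit w)) →
      (∃ S : Finset (Irrep A × Irrep A), ∀ T, S ⊆ T →
      (∀ p ∉ T, testL _ p.1.h (testR _ p.2.h (z + w)) = 0) ∧
        ∑ p ∈ T, testL _ p.1.h (testR _ p.2.h (z + w))
          = testL _ counit (testR _ counit (z + w))) := by
      rintro z w ⟨S, hS⟩ ⟨S', hS'⟩
      refine ⟨S ∪ S', fun T hT => ?_⟩
      have h1 := hS T (Finset.union_subset_left hT)
      have h2 := hS' T (Finset.union_subset_right hT)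
      refine ⟨fun p hp => ?_, ?_⟩
      · rw [map_add, map_add, h1.1 p hp, h2.1 p hp, add_zero]
      · simp only [map_add, Finset.sum_add_distrib, h1.2, h2.2]
    induction z using TensorProduct.induction_on with
    | zero => exact ⟨∅, fun T _ => by simp⟩
    | add z w hz hw => exact hadd z w hz hw
    | tmul y b =>
      induction y using TensorProduct.induction_on with
      | zero => exact ⟨∅, fun T _ => by simp⟩
      | add y y' hy hy' =>
        rw [TensorProduct.add_tmul]
        exact hadd _ _ hy hy'
      | tmul a ζ =>
        obtain ⟨S, hS⟩ := Irrep.exists_finset_proj hA a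
        obtain ⟨S', hS'⟩ := Irrep.exists_finset_proj hA b
        have h1 := hS S subset_rfl
        have h2 := hS' S' subset_rfl
        have hz : ∀ p ∉ S ×ˢ S', testL _ p.1.h (testR _ p.2.h ((a ⊗ₜ[ℂ] ζ) ⊗ₜ[ℂ] b)) = 0 := by
          intro p hp
          rw [Finset.mem_product, not_and_or] at hp
          simp only [testR_tmul, map_smul, testL_tmul, Irrep.h, LinearMap.comp_apply]
          rcases hp with hp | hp
          · rw [h1.1 _ hp]; simp
          · rw [h2.1 _ hp]; simp
        refine ⟨S ×ˢ S', fun T hT => ⟨fun p hp => hz p fun h' => hp (hT h'), ?_⟩⟩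
        rw [← Finset.sum_subset hT fun p _ hp => hz p hp, Finset.sum_product]
        simp only [testR_tmul, map_smul, testL_tmul, ← Finset.sum_smul, ← Finset.smul_sum,
          Irrep.h, LinearMap.comp_apply]
        rw [← map_sum, ← map_sum, h1.2, h2.2]
  obtain ⟨S, hS⟩ := key (Γ.coactLR k ξ)
  refine ⟨S, fun T hT => ?_⟩
  simp only [hForms_eq_formsAct]
  exact ⟨(hS T hT).1, (hS T hT).2.trans (h.formsAct_counit k ξ)⟩

lemma exists_finset_hExt (hA : IsCosemisimple A) (ξ : Γ.ExtAlg) :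
    ∃ S : Finset (Irrep A × Irrep A), ∀ T, S ⊆ T →
      (∀ p ∉ T, Γ.hExt p.1 p.2 ξ = 0) ∧ ∑ p ∈ T, Γ.hExt p.1 p.2 ξ = ξ := by
  classical
  induction ξ using DirectSum.induction_on with
  | zero => exact ⟨∅, fun T _ => by simp⟩
  | of k ξ =>
    obtain ⟨S, hS⟩ := h.exists_finset_hForms hA k ξ
    refine ⟨S, fun T hT => ?_⟩
    have e : ∀ p : Irrep A × Irrep A, Γ.hExt p.1 p.2 (DirectSum.of Γ.Forms k ξ)
        = DirectSum.of Γ.Forms k (Γ.hForms p.1 p.2 k ξ) := fun p =>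
      DirectSum.lmap_lof (R := ℂ) (Γ.hForms p.1 p.2) k ξ
    refine ⟨fun p hp => ?_, ?_⟩
    · rw [e, (hS T hT).1 p hp, map_zero]
    · simp only [e]
      rw [← map_sum, (hS T hT).2]
  | add z w hz hw =>
    obtain ⟨S, hS⟩ := hz
    obtain ⟨S', hS'⟩ := hw
    refine ⟨S ∪ S', fun T hT => ?_⟩
    have h1 := hS T (Finset.union_subset_left hT)
    have h2 := hS' T (Finset.union_subset_right hT)
    refine ⟨fun p hp => ?_, ?_⟩
    · rw [map_add, h1.1 p hp, h2.1 p hp, add_zero]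
    · simp only [map_add, Finset.sum_add_distrib, h1.2, h2.2]

lemma finite_hExt (hA : IsCosemisimple A) (ξ : Γ.ExtAlg) :
    {p : Irrep A × Irrep A | Γ.hExt p.1 p.2 ξ ≠ 0}.Finite ∧
      ξ = ∑ᶠ p : Irrep A × Irrep A, Γ.hExt p.1 p.2 ξ := by
  obtain ⟨S, hS⟩ := h.exists_finset_hExt hA ξ
  obtain ⟨h1, h2⟩ := hS S subset_rfl
  have hsub : {p : Irrep A × Irrep A | Γ.hExt p.1 p.2 ξ ≠ 0} ⊆ S := fun p hp => by
    by_contra hn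
    exact hp (h1 p hn)
  refine ⟨S.finite_toSet.subset hsub, ?_⟩
  rw [finsum_eq_sum_of_support_subset _ hsub, h2]

lemma iSupIndep_component (hA : IsCosemisimple A) :
    iSupIndep fun p : ℕ × Irrep A × Irrep A =>
      (Γ.component p.2.1 p.2.2 p.1).map (DirectSum.lof ℂ ℕ Γ.Forms p.1) := by
  intro p
  rw [Submodule.disjoint_def]
  intro ξ hξ hξ'
  -- The degree component followed by `h^{αβ}` is injective on the chosen summand and kills all
  -- others.
  let P : Γ.ExtAlg →ₗ[ℂ] Γ.Forms p.1 :=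
    Γ.hForms p.2.1 p.2.2 p.1 ∘ₗ DirectSum.component ℂ ℕ Γ.Forms p.1
  have hP : (⨆ p', ⨆ (_ : p' ≠ p), (Γ.component p'.2.1 p'.2.2 p'.1).map
      (DirectSum.lof ℂ ℕ Γ.Forms p'.1)) ≤ LinearMap.ker P := by
    refine iSup₂_le fun p' hp' => ?_
    rintro _ ⟨ζ, hζ, rfl⟩
    rw [LinearMap.mem_ker, LinearMap.comp_apply]
    obtain ⟨k, α, β⟩ := p
    obtain ⟨k', α', β'⟩ := p'
    by_cases hk : k' = k
    · subst hk
      rw [DirectSum.component.lof_self]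
      refine hForms_of_mem_component_ne hA hζ fun h' => hp' ?_
      rw [h']
    · rw [DirectSum.component.of, dif_neg hk, map_zero]
  obtain ⟨ζ, hζ, rfl⟩ := hξ
  have h1 : P (DirectSum.lof ℂ ℕ Γ.Forms p.1 ζ) = 0 := hP hξ'
  rw [LinearMap.comp_apply, DirectSum.component.lof_self, h.hForms_of_mem_component hA hζ] at h1
  rw [h1, map_zero]

lemma iSup_component (hA : IsCosemisimple A) :
    (⨆ p : ℕ × Irrep A × Irrep A,
      (Γ.component p.2.1 p.2.2 p.1).map (DirectSum.lof ℂ ℕ Γ.Forms p.1)) = ⊤ := by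
  rw [eq_top_iff]
  rintro ξ -
  induction ξ using DirectSum.induction_on with
  | zero => exact Submodule.zero_mem _
  | add z w hz hw => exact Submodule.add_mem _ hz hw
  | of k ξ =>
    obtain ⟨S, hS⟩ := h.exists_finset_hForms hA k ξ
    rw [← (hS S subset_rfl).2, map_sum]
    refine Submodule.sum_mem _ fun p _ => ?_
    refine Submodule.mem_iSup_of_mem (p := fun p : ℕ × Irrep A × Irrep A =>
      (Γ.component p.2.1 p.2.2 p.1).map (DirectSum.lof ℂ ℕ Γ.Forms p.1)) (k, p.1, p.2) ?_
    exact ⟨_, h.hForms_mem_component hA p.1 p.2 k ξ, rfl⟩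

end IsBicovariant

end HopfBimod

end

noncomputable section

/-! ## Laplace operators of a pair of bimodules with an invariant metric -/

namespace HopfBimod

open Coalgebra

variable {A : Type*} [Ring A] [HopfAlgebra ℂ A] {I : Type*} [Fintype I] [DecidableEq I]

/-- The functionals `q_j` with `θ ◁ a = ∑ q_j(a) ω_j` for `θ = ∑ c_i ω_i`. -/
def coinvFun (Γ : HopfBimod A I) (c : I → ℂ) (j : I) : A →ₗ[ℂ] ℂ := ∑ i, c i • Γ.f i j

/-- The functional `a ↦ e(θ ◁ a)` for `θ = ∑ c_i ω_i`. -/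
def casimir (Γ : HopfBimod A I) (c e : I → ℂ) : A →ₗ[ℂ] ℂ := ∑ j, e j • Γ.coinvFun c j

/-- The covector `ω_j ↦ g(ω_j, θ)` for `θ = ∑ c_i ω_i`. -/
def contr (g : I → I → ℂ) (c : I → ℂ) (j : I) : ℂ := ∑ i, c i * g j i

/-- The functional `a ↦ g(θ ◁ a, ω_j)` for `θ = ∑ c_i ω_i`. -/
def contrFun (Γ : HopfBimod A I) (g : I → I → ℂ) (c : I → ℂ) (j : I) : A →ₗ[ℂ] ℂ :=
  ∑ i, g i j • Γ.coinvFun c i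

/-- A metric which is invariant under the right coactions and the right actions. -/
structure IsInvariantMetric (Γ Γ' : HopfBimod A I) (g : I → I → ℂ) : Prop where
  cov : ∀ i j, ∑ k, ∑ l, g k l • (Γ.v k i * Γ'.v l j) = g i j • (1 : A)
  inv : ∀ i j, ∑ k, ∑ l, g k l • convMul (Γ.f i k) (Γ'.f j l) = g i j • counit (R := ℂ)

/-- The element `∑ c_i ω_i` is right-coinvariant. -/
def IsCoinvariant (Γ : HopfBimod A I) (c : I → ℂ) : Prop := ∀ i, ∑ j, c j • Γ.v i j = c i • (1 : A)

variable {Γ Γ' : HopfBimod A I}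

lemma coinvMul_apply (c : I → ℂ) (j : I) (a : A) :
    Γ.coinvMul c j a = lstar (Γ.coinvFun c j) a := by
  simp [coinvMul, coinvFun, lstar_sum, lstar_smul]

lemma tensLeft_apply (c : I → ℂ) (k : ℕ) (ρ : Γ.Tens k) (j : I) (K : Fin k → I) :
    Γ.tensLeft c k ρ (Fin.cons j K) = lstar (Γ.coinvFun c j) (ρ K) := by
  simp [tensLeft, coinvMul_apply]

lemma tensRight_apply (c : I → ℂ) (k : ℕ) (ρ : Γ.Tens k) (j : I) (K : Fin k → I) :
    Γ.tensRight c k ρ (Fin.snoc K j) = c j • ρ K := by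
  simp [tensRight]

lemma gRight_apply (g : I → I → ℂ) (c : I → ℂ) (k : ℕ) (ρ : Γ.Tens (k + 1)) (K : Fin k → I) :
    Γ.gRight g c k ρ K = ∑ j, contr g c j • ρ (Fin.snoc K j) := by
  simp [gRight, contr]

lemma gLeft_apply (g : I → I → ℂ) (c : I → ℂ) (k : ℕ) (ρ : Γ.Tens (k + 1)) (K : Fin k → I) :
    Γ.gLeft Γ' g c k ρ K = ∑ j, lstar (Γ'.contrFun g c j) (ρ (Fin.cons j K)) := by
  simp [gLeft, contrFun, lstar_sum, lstar_smul, coinvMul_apply]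

lemma tens_ext_cons {k : ℕ} {ρ ρ' : Γ.Tens (k + 1)}
    (h : ∀ j K, ρ (Fin.cons j K) = ρ' (Fin.cons j K)) : ρ = ρ' := by
  funext K
  rw [← Fin.cons_self_tail K, h]

lemma tens_ext_snoc {k : ℕ} {ρ ρ' : Γ.Tens (k + 1)}
    (h : ∀ j (K : Fin k → I), ρ (Fin.snoc K j) = ρ' (Fin.snoc K j)) : ρ = ρ' := by
  funext K
  rw [← Fin.snoc_init_self K]
  exact h _ _

/-! ### Compatibility with left linear maps -/

section Linear

variable (c : I → ℂ) (g : I → I → ℂ) {k : ℕ} (M : Matrix (Fin k → I) (Fin k → I) ℂ)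

lemma ext_consMat_cons (ρ : Γ.Tens (k + 1)) (j : I) (K : Fin k → I) :
    Γ.ext (consMat k M) ρ (Fin.cons j K) = ∑ J, M K J • ρ (Fin.cons j J) := by
  rw [ext_apply, sum_cons, Finset.sum_eq_single j]
  · simp [consMat_apply]
  · intro i _ hi; simp [consMat_apply, hi.symm]
  · simp

lemma ext_snocMat_snoc (ρ : Γ.Tens (k + 1)) (j : I) (K : Fin k → I) :
    Γ.ext (snocMat k M) ρ (Fin.snoc K j) = ∑ J : Fin k → I, M K J • ρ (Fin.snoc J j) := by
  rw [ext_apply, sum_snoc, Finset.sum_eq_single j]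
  · simp [snocMat_apply]
  · intro i _ hi; simp [snocMat_apply, hi.symm]
  · simp

lemma ext_consMat_tensLeft (ρ : Γ.Tens k) :
    Γ.ext (consMat k M) (Γ.tensLeft c k ρ) = Γ.tensLeft c k (Γ.ext M ρ) := by
  apply tens_ext_cons
  intro j K
  rw [ext_consMat_cons]
  simp only [tensLeft_apply, ext_apply, map_sum, map_smul]

lemma ext_snocMat_tensRight (ρ : Γ.Tens k) :
    Γ.ext (snocMat k M) (Γ.tensRight c k ρ) = Γ.tensRight c k (Γ.ext M ρ) := by
  apply tens_ext_snoc
  intro j K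
  rw [ext_snocMat_snoc]
  simp only [tensRight_apply, ext_apply, Finset.smul_sum, smul_smul, mul_comm]

/-- The contraction affects the last factor only. Together with `A_{k+1} = (A_k ⊗ id) B_{k,1}` this
shows that it respects the kernels of the antisymmetrisers. -/
lemma gRight_ext_snocMat (ρ : Γ.Tens (k + 1)) :
    Γ.gRight g c k (Γ.ext (snocMat k M) ρ) = Γ.ext M (Γ.gRight g c k ρ) := by
  funext K
  rw [gRight_apply, ext_apply]
  simp only [ext_snocMat_snoc, gRight_apply, Finset.smul_sum, smul_smul]
  rw [Finset.sum_comm]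
  simp only [mul_comm]

lemma gLeft_ext_consMat (ρ : Γ.Tens (k + 1)) :
    Γ.gLeft Γ' g c k (Γ.ext (consMat k M) ρ) = Γ.ext M (Γ.gLeft Γ' g c k ρ) := by
  funext K
  rw [gLeft_apply, ext_apply]
  simp only [ext_consMat_cons, gLeft_apply, Finset.smul_sum, map_sum, map_smul]
  rw [Finset.sum_comm]

lemma gRight_tensRight (c' : I → ℂ) (ρ : Γ.Tens k) :
    Γ.gRight g c k (Γ.tensRight c' k ρ) = (∑ j, contr g c j * c' j) • ρ := by
  funext K
  simp only [gRight_apply, tensRight_apply, smul_smul, Finset.sum_smul, Pi.smul_apply]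

lemma gRight_tensLeft (c' : I → ℂ) (ρ : Γ.Tens (k + 1)) :
    Γ.gRight g c (k + 1) (Γ.tensLeft c' (k + 1) ρ) = Γ.tensLeft c' k (Γ.gRight g c k ρ) := by
  apply tens_ext_cons
  intro j K
  simp only [gRight_apply, tensLeft_apply, map_sum, map_smul, ← Fin.cons_snoc_eq_snoc_cons]

lemma gLeft_tensRight (c' : I → ℂ) (ρ : Γ.Tens (k + 1)) :
    Γ.gLeft Γ' g c (k + 1) (Γ.tensRight c' (k + 1) ρ)
      = Γ.tensRight c' k (Γ.gLeft Γ' g c k ρ) := by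
  apply tens_ext_snoc
  intro j K
  simp only [gLeft_apply, tensRight_apply, map_smul, Fin.cons_snoc_eq_snoc_cons, Finset.smul_sum]

lemma gLeft_tensLeft (c' : I → ℂ) (ρ : Γ.Tens k) (K : Fin k → I) :
    Γ.gLeft Γ' g c k (Γ.tensLeft c' k ρ) K
      = lstar (∑ j, convMul (Γ'.contrFun g c j) (Γ.coinvFun c' j)) (ρ K) := by
  simp only [gLeft_apply, tensLeft_apply, lstar_lstar, lstar_sum]

end Linear

/-! ### The commutation relations with the shuffle operators -/

section Shuffle

variable {s : Matrix (I × I) (I × I) ℂ} {c c' : I → ℂ} {g g' : I → I → ℂ} {k : ℕ}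

lemma ext_legMat_zero (ρ : Γ.Tens (k + 2)) (a b : I) (K : Fin k → I) :
    Γ.ext (legMat s (k + 2) (0 : Fin (k + 1))) ρ (Fin.cons a (Fin.cons b K))
      = ∑ x, ∑ y, s (a, b) (x, y) • ρ (Fin.cons x (Fin.cons y K)) := by
  rw [ext_apply, sum_cons]
  refine Finset.sum_congr rfl fun x _ => ?_
  rw [sum_cons]
  refine Finset.sum_congr rfl fun y _ => ?_
  rw [Finset.sum_eq_single K]
  · rw [legMat_zero_cons, if_pos rfl]
  · intro L _ hL; rw [legMat_zero_cons, if_neg hL.symm, zero_smul]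
  · simp

lemma ext_legMat_last (ρ : Γ.Tens (k + 2)) (a b : I) (K : Fin k → I) :
    Γ.ext (legMat s (k + 2) (Fin.last k)) ρ
        (Fin.snoc (α := fun _ => I) (Fin.snoc (α := fun _ => I) K a) b)
      = ∑ x, ∑ y, s (a, b) (x, y) •
        ρ (Fin.snoc (α := fun _ => I) (Fin.snoc (α := fun _ => I) K x) y) := by
  rw [ext_apply, sum_snoc]
  simp only [sum_snoc k]
  rw [Finset.sum_comm]
  refine Finset.sum_congr rfl fun x _ => Finset.sum_congr rfl fun y _ => ?_
  rw [Finset.sum_eq_single K]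
  · rw [legMat_last_snoc, if_pos rfl]
  · intro L _ hL; rw [legMat_last_snoc, if_neg hL.symm, zero_smul]
  · simp

/-- If `(id ⊗ e) s (α ⊗ θ) = e(α) θ`, then `⟨ρ ⊗ θ, θ'⟩ = e(θ) ρ - ⟨ρ, θ'⟩ ⊗ θ`. -/
lemma gRight_lastShuffle_tensRight
    (hs : ∀ a i, ∑ l, ∑ j, contr g c' l * s (a, l) (i, j) * c j = contr g c' i * c a)
    (ρ : Γ.Tens (k + 1)) :
    Γ.gRight g c' (k + 1) (Γ.ext (lastShuffle s (k + 1)) (Γ.tensRight c (k + 1) ρ))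
      = (∑ j, contr g c' j * c j) • ρ
        - Γ.tensRight c k (Γ.gRight g c' k (Γ.ext (lastShuffle s k) ρ)) := by
  rw [lastShuffle_succ, ext_sub, ext_one, ext_mul, ext_snocMat_tensRight, map_sub,
    gRight_tensRight]
  congr 1
  apply tens_ext_snoc
  intro a K
  generalize Γ.ext (lastShuffle s k) ρ = y
  simp only [gRight_apply, ext_legMat_last, tensRight_apply, Finset.smul_sum, smul_smul]
  rw [Finset.sum_comm]
  refine Finset.sum_congr rfl fun i _ => ?_
  simp only [← Finset.sum_smul]
  rw [mul_comm (c a), ← hs a i]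
  congr 1
  exact Finset.sum_congr rfl fun l _ => Finset.sum_congr rfl fun j _ => by ring

/-- All words but the longest leave `θ` in front and contract within `ρ`; the longest word carries
`θ` through `ρ` into the last place, where it is contracted. -/
lemma gRight_lastShuffle_tensLeft (ρ : Γ.Tens (k + 1)) :
    Γ.gRight g c' (k + 1) (Γ.ext (lastShuffle s (k + 1)) (Γ.tensLeft c (k + 1) ρ))
      = Γ.tensLeft c k (Γ.gRight g c' k (Γ.ext (lastShuffle s k) ρ)) + (-1 : ℂ) ^ (k + 1) •
        Γ.gRight g c' (k + 1) (Γ.ext (toLast s (k + 1)) (Γ.tensLeft c (k + 1) ρ)) := by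
  rw [lastShuffle_succ', ext_add, ext_smul, map_add, map_smul, ext_consMat_tensLeft,
    gRight_tensLeft]

/-- The empty word contracts `θ'` with `θ`, which gives the constant. Every other word ends its
action with `σ^{±1}` in the first two factors, and `hs` lets `θ` step out in front of the
contraction. -/
lemma gLeft_firstShuffle_tensLeft
    (h0 : ∑ j, convMul (Γ'.contrFun g' c' j) (Γ.coinvFun c j)
      = (∑ j, contr g' c j * c' j) • counit)
    (hs : ∀ l m, ∑ j, ∑ i, s (j, l) (i, m) • convMul (Γ'.contrFun g' c' j) (Γ.coinvFun c i)
      = convMul (Γ.coinvFun c l) (Γ'.contrFun g' c' m))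
    (ρ : Γ.Tens (k + 1)) :
    Γ.gLeft Γ' g' c' (k + 1) (Γ.ext (firstShuffle s (k + 1)) (Γ.tensLeft c (k + 1) ρ))
      = (∑ j, contr g' c j * c' j) • ρ
        - Γ.tensLeft c k (Γ.gLeft Γ' g' c' k (Γ.ext (firstShuffle s k) ρ)) := by
  rw [firstShuffle_succ, ext_sub, ext_one, ext_mul, ext_consMat_tensLeft, map_sub]
  congr 1
  · funext K
    rw [gLeft_tensLeft, h0, lstar_smul, lstar_counit]; rfl
  apply tens_ext_cons
  intro l K
  generalize Γ.ext (firstShuffle s k) ρ = y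
  simp only [gLeft_apply, ext_legMat_zero, tensLeft_apply, map_sum, map_smul, lstar_lstar]
  have e : ∀ m, lstar (convMul (Γ.coinvFun c l) (Γ'.contrFun g' c' m)) (y (Fin.cons m K))
      = ∑ j, ∑ i, s (j, l) (i, m) •
        lstar (convMul (Γ'.contrFun g' c' j) (Γ.coinvFun c i)) (y (Fin.cons m K)) := by
    intro m
    rw [← hs]
    simp only [lstar_sum, lstar_smul]
  simp only [e]
  rw [Finset.sum_comm (s := Finset.univ (α := I)) (f := fun m j => ∑ i, s (j, l) (i, m) • _)]
  exact Finset.sum_congr rfl fun j _ => Finset.sum_comm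

lemma gLeft_firstShuffle_tensRight (ρ : Γ.Tens (k + 1)) :
    Γ.gLeft Γ' g' c' (k + 1) (Γ.ext (firstShuffle s (k + 1)) (Γ.tensRight c (k + 1) ρ))
      = Γ.tensRight c k (Γ.gLeft Γ' g' c' k (Γ.ext (firstShuffle s k) ρ)) + (-1 : ℂ) ^ (k + 1) •
        Γ.gLeft Γ' g' c' (k + 1) (Γ.ext (toFirst s (k + 1)) (Γ.tensRight c (k + 1) ρ)) := by
  rw [firstShuffle_succ', ext_add, ext_smul, map_add, map_smul, ext_snocMat_tensRight,
    gLeft_tensRight]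

end Shuffle

/-! ### Consequences of invariance -/

section Invariance

variable {c c' : I → ℂ} {g g' : I → I → ℂ}

/-- Pairing with a coinvariant element in the second slot turns invariance of the metric into
invariance of a covector. -/
lemma IsInvariantMetric.contr_v (hg : IsInvariantMetric Γ Γ' g) (hc : Γ'.IsCoinvariant c') (j : I) :
    ∑ k, contr g c' k • Γ.v k j = contr g c' j • (1 : A) := by
  have e : ∀ k i, (c' i * g k i) • Γ.v k j
      = ∑ m, c' m • (g k i • (Γ.v k j * Γ'.v i m)) := by
    intro k i
    have e1 : ∑ m, c' m • (g k i • (Γ.v k j * Γ'.v i m))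
        = g k i • (Γ.v k j * ∑ m, c' m • Γ'.v i m) := by
      simp only [Finset.mul_sum, Finset.smul_sum, mul_smul_comm]
      exact Finset.sum_congr rfl fun m _ => smul_comm _ _ _
    rw [e1, hc i, mul_smul_comm, mul_one, smul_smul, mul_comm]
  simp only [contr, Finset.sum_smul, e]
  have e2 : ∀ m, (c' m * g j m) • (1 : A)
      = c' m • ∑ k, ∑ i, g k i • (Γ.v k j * Γ'.v i m) := by
    intro m
    rw [hg.cov, smul_smul]
  simp only [e2, Finset.smul_sum]
  rw [Finset.sum_comm (s := Finset.univ (α := I)) (f := fun m k => ∑ i, c' m • _)]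
  exact Finset.sum_congr rfl fun k _ => Finset.sum_comm

variable (h : Γ.IsBicovariant)
include h

lemma IsBicovariant.coinvFun_mul (c : I → ℂ) (j : I) (a b : A) :
    Γ.coinvFun c j (a * b) = ∑ k, Γ.coinvFun c k a * Γ.f k j b := by
  simp only [coinvFun, LinearMap.sum_apply, LinearMap.smul_apply, h.f_mul, smul_eq_mul,
    Finset.mul_sum, Finset.sum_mul]
  rw [Finset.sum_comm]
  simp only [mul_assoc]

lemma IsBicovariant.coinvFun_one (c : I → ℂ) (j : I) : Γ.coinvFun c j 1 = c j := by
  simp [coinvFun, h.f_one]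

lemma IsBicovariant.casimir_one (c e : I → ℂ) : Γ.casimir c e 1 = ∑ j, e j * c j := by
  simp [casimir, h.coinvFun_one]

/-- The compatibility condition summed against `c`; coinvariance of `θ` absorbs the matrix elements
on the other side. -/
lemma IsBicovariant.lstar_coinvFun (hc : Γ.IsCoinvariant c) (l : I) (a : A) :
    ∑ i, lstar (Γ.coinvFun c i) a * Γ.v l i = rstar (Γ.coinvFun c l) a := by
  simp only [coinvFun, lstar_sum, lstar_smul, Finset.sum_mul, smul_mul_assoc]
  rw [Finset.sum_comm]
  simp only [← Finset.smul_sum, h.compat]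
  simp only [Finset.smul_sum, ← smul_mul_assoc]
  rw [Finset.sum_comm]
  simp only [← Finset.sum_mul, hc _]
  simp only [smul_mul_assoc, one_mul, rstar_sum, rstar_smul]

/-- Passing from `a ∗ q_l` to the `q_i ∗ a` costs a factor `v^l_i`, which the invariant covector `e`
absorbs. -/
lemma IsBicovariant.isCentral_casimir (hc : Γ.IsCoinvariant c) {e : I → ℂ}
    (he : ∀ j, ∑ k, e k • Γ.v k j = e j • (1 : A)) : IsCentralFunctional (Γ.casimir c e) := by
  intro a
  rw [casimir, rstar_sum, lstar_sum]
  simp only [lstar_smul, rstar_smul, ← h.lstar_coinvFun hc, Finset.smul_sum, ← mul_smul_comm]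
  rw [Finset.sum_comm]
  simp only [← Finset.mul_sum, he]
  simp only [mul_smul_comm, mul_one]

/-- In other words `σ(α ⊗ θ) = θ ⊗ α`, because `Δ_R(θ) = θ ⊗ 1` and `1` acts trivially. -/
lemma IsBicovariant.sigma_coinvariant (hc : Γ.IsCoinvariant c) (k l i : I) :
    ∑ j, Γ.sigma (k, l) (i, j) * c j = if l = i then c k else 0 := by
  have e := congrArg (Γ.f i l) (hc k)
  simp only [map_sum, map_smul, smul_eq_mul, h.f_one] at e
  simp only [sigma_apply, mul_comm _ (c _), e]
  simp [eq_comm]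

/-- In other words `(e ⊗ id) σ(α ⊗ β) = e(β) α`: invariance of `e` leaves only the action of `1`. -/
lemma IsBicovariant.contr_sigma {e : I → ℂ} (he : ∀ j, ∑ k, e k • Γ.v k j = e j • (1 : A))
    (l i j : I) : ∑ k, e k * Γ.sigma (k, l) (i, j) = if l = i then e j else 0 := by
  have e' := congrArg (Γ.f i l) (he j)
  simp only [map_sum, map_smul, smul_eq_mul, h.f_one] at e'
  simp only [sigma_apply, e']
  simp [eq_comm]

/-- The previous identity composed with `σ⁻¹`, that is, `(id ⊗ e) σ⁻¹(α ⊗ β) = e(α) β`. -/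
lemma IsBicovariant.contr_sigma_inv {e : I → ℂ} (he : ∀ j, ∑ k, e k • Γ.v k j = e j • (1 : A))
    (a i j : I) : ∑ l, e l * Γ.sigma⁻¹ (a, l) (i, j) = if a = j then e i else 0 := by
  have h1 : ∀ l (p : I × I), ∑ k, e k * Γ.sigma (k, l) p = if l = p.1 then e p.2 else 0 :=
    fun l p => h.contr_sigma he l p.1 p.2
  have h2 : ∑ p : I × I, (∑ k, e k * Γ.sigma (k, a) p) * Γ.sigma⁻¹ p (i, j)
      = if a = j then e i else 0 := by
    simp only [Finset.sum_mul, mul_assoc]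
    rw [Finset.sum_comm]
    simp only [← Finset.mul_sum, ← Matrix.mul_apply, h.sigma_mul_inv, Matrix.one_apply,
      Prod.mk.injEq, ite_and]
    simp
  rw [← h2]
  simp only [h1, Fintype.sum_prod_type]
  symm
  rw [Finset.sum_eq_single a]
  · simp
  · intro b _ hb; simp [hb.symm]
  · simp

variable (h' : Γ'.IsBicovariant)
include h'

/-- Invariance under the right action: `g(θ' ◁ a₁, θ ◁ a₂) = ε(a) g(θ', θ)`. -/
lemma IsInvariantMetric.sum_contrFun_convMul (hg : IsInvariantMetric Γ' Γ g') :
    ∑ j, convMul (Γ'.contrFun g' c' j) (Γ.coinvFun c j)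
      = (∑ j, contr g' c j * c' j) • counit := by
  simp only [contrFun, coinvFun, convMul_sum, sum_convMul, convMul_smul, smul_convMul, contr,
    Finset.smul_sum, Finset.sum_mul, Finset.sum_smul]
  have e : ∀ m n, (c n * g' m n * c' m) • counit (R := ℂ) (A := A)
      = ∑ k, ∑ l, c n • g' k l • c' m • convMul (Γ'.f m k) (Γ.f n l) := by
    intro m n
    rw [show c n * g' m n * c' m = (c n * c' m) * g' m n by ring, ← smul_smul, ← hg.inv]
    simp only [Finset.smul_sum, smul_smul]
    exact Finset.sum_congr rfl fun k _ => Finset.sum_congr rfl fun l _ => by congr 1; ring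
  simp only [e]
  calc _ = ∑ l, ∑ n, ∑ k, ∑ m, c n • g' k l • c' m • convMul (Γ'.f m k) (Γ.f n l) := rfl
    _ = ∑ n, ∑ l, ∑ k, ∑ m, c n • g' k l • c' m • convMul (Γ'.f m k) (Γ.f n l) := Finset.sum_comm
    _ = ∑ n, ∑ k, ∑ l, ∑ m, c n • g' k l • c' m • convMul (Γ'.f m k) (Γ.f n l) :=
      Finset.sum_congr rfl fun n _ => Finset.sum_comm
    _ = ∑ n, ∑ k, ∑ m, ∑ l, c n • g' k l • c' m • convMul (Γ'.f m k) (Γ.f n l) :=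
      Finset.sum_congr rfl fun n _ => Finset.sum_congr rfl fun k _ => Finset.sum_comm
    _ = ∑ n, ∑ m, ∑ k, ∑ l, c n • g' k l • c' m • convMul (Γ'.f m k) (Γ.f n l) :=
      Finset.sum_congr rfl fun n _ => Finset.sum_comm
    _ = _ := Finset.sum_comm

/-- `∑_j P_j(a₁) a₂ v^j_x = a₁ P_x(a₂)`. -/
lemma IsInvariantMetric.rstar_contrFun (hg : IsInvariantMetric Γ' Γ g')
    (hc : Γ'.IsCoinvariant c') (x : I) (a : A) :
    ∑ j, rstar (Γ'.contrFun g' c' j) a * Γ.v j x = lstar (Γ'.contrFun g' c' x) a := by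
  simp only [contrFun, rstar_sum, rstar_smul, lstar_sum, lstar_smul, ← h'.lstar_coinvFun hc,
    Finset.sum_mul, smul_mul_assoc, Finset.smul_sum, mul_assoc]
  have e : ∀ y, g' y x • lstar (Γ'.coinvFun c' y) a
      = ∑ i, ∑ j, g' i j • (lstar (Γ'.coinvFun c' y) a * (Γ'.v i y * Γ.v j x)) := by
    intro y
    have e' := congrArg (lstar (Γ'.coinvFun c' y) a * ·) (hg.cov y x)
    simp only [Finset.mul_sum, mul_smul_comm, mul_one] at e'
    exact e'.symm
  simp only [e]
  calc _ = ∑ i, ∑ j, ∑ y, g' i j • (lstar (Γ'.coinvFun c' y) a * (Γ'.v i y * Γ.v j x)) :=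
        Finset.sum_comm
    _ = ∑ i, ∑ y, ∑ j, g' i j • (lstar (Γ'.coinvFun c' y) a * (Γ'.v i y * Γ.v j x)) :=
      Finset.sum_congr rfl fun i _ => Finset.sum_comm
    _ = _ := Finset.sum_comm

/-- Multiplicativity absorbs the entries of `σ` into the argument as matrix elements of `v`;
`rstar_contrFun`, where coinvariance of `θ'` enters, then carries the contraction past `a`. -/
lemma IsInvariantMetric.sigma_contrFun (hg : IsInvariantMetric Γ' Γ g')
    (hc : Γ'.IsCoinvariant c') (l m : I) :
    ∑ j, ∑ i, Γ.sigma (j, l) (i, m) • convMul (Γ'.contrFun g' c' j) (Γ.coinvFun c i)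
      = convMul (Γ.coinvFun c l) (Γ'.contrFun g' c' m) := by
  ext a
  rw [← apply_lstar, ← hg.rstar_contrFun h h' hc, map_sum]
  simp only [h.coinvFun_mul, apply_rstar, LinearMap.sum_apply, LinearMap.smul_apply, smul_eq_mul,
    sigma_apply, mul_comm]

lemma IsInvariantMetric.contrFun_mul (a b : A) (x : I) :
    Γ'.contrFun g' c' x (a * b) = ∑ t, Γ'.coinvFun c' t a * ∑ n, g' n x * Γ'.f t n b := by
  simp only [contrFun, LinearMap.sum_apply, LinearMap.smul_apply, h'.coinvFun_mul, smul_eq_mul,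
    Finset.mul_sum]
  rw [Finset.sum_comm]
  exact Finset.sum_congr rfl fun t _ => Finset.sum_congr rfl fun n _ => by ring

/-- The two copies of `f` meet on matrix elements of `v`, where invariance of the metric under the
action contracts them to the counit. -/
lemma IsInvariantMetric.contrFun_sigma (hg : IsInvariantMetric Γ' Γ g') (a : A) (l p r : I) :
    ∑ i, ∑ x, Γ'.contrFun g' c' x (a * Γ.v l i) * Γ.sigma (i, x) (p, r)
      = if l = r then Γ'.contrFun g' c' p a else 0 := by
  simp only [contrFun_mul h h', sigma_apply]
  have e : ∀ t, ∑ i, ∑ x, (∑ n, g' n x * Γ'.f t n (Γ.v l i)) * Γ.f p x (Γ.v i r)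
      = g' t p * (if l = r then 1 else 0) := by
    intro t
    have e' := LinearMap.congr_fun (hg.inv t p) (Γ.v l r)
    simp only [LinearMap.sum_apply, LinearMap.smul_apply, ← h.sum_apply_v_mul_apply_v,
      h.counit_v, smul_eq_mul] at e'
    rw [← e']
    simp only [Finset.sum_mul, Finset.mul_sum, mul_assoc]
    calc _ = ∑ i, ∑ n, ∑ x, g' n x * (Γ'.f t n (Γ.v l i) * Γ.f p x (Γ.v i r)) :=
          Finset.sum_congr rfl fun i _ => Finset.sum_comm
      _ = ∑ n, ∑ i, ∑ x, g' n x * (Γ'.f t n (Γ.v l i) * Γ.f p x (Γ.v i r)) := Finset.sum_comm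
      _ = _ := Finset.sum_congr rfl fun n _ => Finset.sum_comm
  have e2 : ∑ i, ∑ x, (∑ t, Γ'.coinvFun c' t a * ∑ n, g' n x * Γ'.f t n (Γ.v l i))
      * Γ.f p x (Γ.v i r) = ∑ t, Γ'.coinvFun c' t a *
        ∑ i, ∑ x, (∑ n, g' n x * Γ'.f t n (Γ.v l i)) * Γ.f p x (Γ.v i r) := by
    calc _ = ∑ i, ∑ x, ∑ t, Γ'.coinvFun c' t a *
          ((∑ n, g' n x * Γ'.f t n (Γ.v l i)) * Γ.f p x (Γ.v i r)) := by
          refine Finset.sum_congr rfl fun i _ => Finset.sum_congr rfl fun x _ => ?_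
          rw [Finset.sum_mul]
          exact Finset.sum_congr rfl fun t _ => mul_assoc _ _ _
      _ = ∑ i, ∑ t, ∑ x, Γ'.coinvFun c' t a *
          ((∑ n, g' n x * Γ'.f t n (Γ.v l i)) * Γ.f p x (Γ.v i r)) :=
        Finset.sum_congr rfl fun i _ => Finset.sum_comm
      _ = ∑ t, ∑ i, ∑ x, Γ'.coinvFun c' t a *
          ((∑ n, g' n x * Γ'.f t n (Γ.v l i)) * Γ.f p x (Γ.v i r)) := Finset.sum_comm
      _ = _ := by
        refine Finset.sum_congr rfl fun t _ => ?_
        rw [Finset.mul_sum]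
        exact Finset.sum_congr rfl fun i _ => (Finset.mul_sum _ _ _).symm
  rw [e2]
  simp only [e, contrFun, LinearMap.sum_apply, LinearMap.smul_apply, smul_eq_mul]
  split_ifs
  · exact Finset.sum_congr rfl fun t _ => by ring
  · simp

/-- `∑_j P_j(a) (σ⁻¹)^{jl}_{ix} = P_x(a v^l_i)`. -/
lemma IsInvariantMetric.contrFun_sigma_inv (hg : IsInvariantMetric Γ' Γ g') (a : A) (l i x : I) :
    ∑ j, Γ'.contrFun g' c' j a * Γ.sigma⁻¹ (j, l) (i, x) = Γ'.contrFun g' c' x (a * Γ.v l i) := by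
  have h1 : ∀ p : I × I, ∑ q : I × I, Γ'.contrFun g' c' q.2 (a * Γ.v l q.1) * Γ.sigma q p
      = if l = p.2 then Γ'.contrFun g' c' p.1 a else 0 := fun p => by
    rw [Fintype.sum_prod_type]
    exact hg.contrFun_sigma h h' a l p.1 p.2
  have h2 : ∑ p : I × I, (∑ q : I × I, Γ'.contrFun g' c' q.2 (a * Γ.v l q.1) * Γ.sigma q p)
      * Γ.sigma⁻¹ p (i, x) = Γ'.contrFun g' c' x (a * Γ.v l i) := by
    simp only [Finset.sum_mul, mul_assoc]
    rw [Finset.sum_comm]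
    simp only [← Finset.mul_sum, ← Matrix.mul_apply, h.sigma_mul_inv, Matrix.one_apply]
    simp
  rw [← h2]
  simp only [h1, Fintype.sum_prod_type]
  refine Finset.sum_congr rfl fun j _ => ?_
  rw [Finset.sum_eq_single l]
  · simp
  · intro b _ hb; simp [hb.symm]
  · simp

/-- The exchange rule of `sigma_contrFun` for `σ⁻¹`. Here coinvariance of `θ` is used instead of
that of `θ'`. -/
lemma IsInvariantMetric.sigma_inv_contrFun (hg : IsInvariantMetric Γ' Γ g')
    (hc : Γ.IsCoinvariant c) (l m : I) :
    ∑ j, ∑ i, Γ.sigma⁻¹ (j, l) (i, m) • convMul (Γ'.contrFun g' c' j) (Γ.coinvFun c i)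
      = convMul (Γ.coinvFun c l) (Γ'.contrFun g' c' m) := by
  ext a
  rw [← apply_rstar, ← h.lstar_coinvFun hc, map_sum]
  simp only [← hg.contrFun_sigma_inv h h', LinearMap.sum_apply, LinearMap.smul_apply, smul_eq_mul,
    ← apply_lstar]
  rw [Finset.sum_comm]
  simp only [mul_comm]

end Invariance

/-! ### Moving a leg past the others -/

section Moving

variable {c c' : I → ℂ} {g g' : I → I → ℂ}

lemma mul_snocMat_apply {k : ℕ} (M' : Matrix (Fin (k + 1) → I) (Fin (k + 1) → I) ℂ)
    (M : Matrix (Fin k → I) (Fin k → I) ℂ) (K : Fin (k + 1) → I) (J : Fin k → I) (b : I) :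
    (M' * snocMat k M) K (Fin.snoc J b)
      = ∑ L : Fin k → I, M' K (Fin.snoc (α := fun _ => I) L b) * M L J := by
  rw [Matrix.mul_apply, sum_snoc, Finset.sum_eq_single b]
  · simp [snocMat_apply]
  · intro x _ hx; simp [snocMat_apply, hx]
  · simp

lemma mul_consMat_apply {k : ℕ} (M' : Matrix (Fin (k + 1) → I) (Fin (k + 1) → I) ℂ)
    (M : Matrix (Fin k → I) (Fin k → I) ℂ) (K : Fin (k + 1) → I) (J : Fin k → I) (b : I) :
    (M' * consMat k M) K (Fin.cons b J)
      = ∑ L : Fin k → I, M' K (Fin.cons b L) * M L J := by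
  rw [Matrix.mul_apply, sum_cons, Finset.sum_eq_single b]
  · simp [consMat_apply]
  · intro x _ hx; simp [consMat_apply, hx]
  · simp

variable (s : Matrix (I × I) (I × I) ℂ)

lemma toLast_succ_apply (k : ℕ) (K J : Fin k → I) (a l i b : I) :
    toLast s (k + 1) (Fin.snoc (α := fun _ => I) (Fin.snoc (α := fun _ => I) K a) l)
        (Fin.cons (α := fun _ => I) i (Fin.snoc (α := fun _ => I) J b))
      = ∑ x, s (a, l) (x, b) * toLast s k (Fin.snoc (α := fun _ => I) K x) (Fin.cons i J) := by
  rw [toLast_succ, Fin.cons_snoc_eq_snoc_cons, mul_snocMat_apply, sum_snoc]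
  refine Finset.sum_congr rfl fun x _ => ?_
  rw [Finset.sum_eq_single K]
  · rw [legMat_last_snoc, if_pos rfl]
  · intro L _ hL; rw [legMat_last_snoc, if_neg hL.symm, zero_mul]
  · simp

lemma toFirst_succ_apply (k : ℕ) (K J : Fin k → I) (j l i b : I) :
    toFirst s (k + 1) (Fin.cons (α := fun _ => I) j (Fin.cons (α := fun _ => I) l K))
        (Fin.snoc (α := fun _ => I) (Fin.cons (α := fun _ => I) i J) b)
      = ∑ x, s (j, l) (i, x) * toFirst s k (Fin.cons x K) (Fin.snoc (α := fun _ => I) J b) := by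
  rw [toFirst_succ, ← Fin.cons_snoc_eq_snoc_cons, mul_consMat_apply, sum_cons]
  refine Finset.sum_congr rfl fun x _ => ?_
  rw [Finset.sum_eq_single K]
  · rw [legMat_zero_cons, if_pos rfl]
  · intro L _ hL; rw [legMat_zero_cons, if_neg hL.symm, zero_mul]
  · simp

lemma snoc_eq_cons_zero (K : Fin 0 → I) (a : I) :
    (Fin.snoc K a : Fin 1 → I) = Fin.cons a (default : Fin 0 → I) := by
  funext x
  obtain rfl : x = 0 := Fin.fin_one_eq_zero x
  simp [Fin.snoc]

lemma cons_inj_zero (a b : I) (K J : Fin 0 → I) :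
    (Fin.cons a K : Fin 1 → I) = Fin.cons b J ↔ a = b := by
  constructor
  · intro h; exact congrFun h 0
  · rintro rfl; rw [Subsingleton.elim K J]

/-- Each crossing acts on the moving form by a matrix element of the coaction; multiplicativity of
`f` collects these into one element of `v^{⊗k}`. -/
lemma IsBicovariant.toLast_sigma (h : Γ.IsBicovariant) (k : ℕ) (K J : Fin k → I) (l i : I) :
    toLast Γ.sigma k (Fin.snoc (α := fun _ => I) K l) (Fin.cons i J)
      = Γ.f i l (tensorPow Γ.v k K J) := by
  induction k generalizing l with
  | zero =>
    rw [toLast_zero, tensorPow_zero, h.f_one, snoc_eq_cons_zero, Matrix.one_apply]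
    simp only [cons_inj_zero, eq_comm]
  | succ k ih =>
    rw [← Fin.snoc_init_self K, ← Fin.snoc_init_self J]
    generalize Fin.init K = K'
    generalize Fin.init J = J'
    generalize K (Fin.last k) = a
    generalize J (Fin.last k) = b
    refine (toLast_succ_apply _ k K' J' a l i b).trans ?_
    simp only [ih, sigma_apply]
    rw [tensorPow_succ_last, h.f_mul]
    simp [mul_comm]

/-- By `contr_sigma_inv` an invariant covector slides back through each `σ⁻¹`, so the passage leaves
no trace on the other factors. -/
lemma IsBicovariant.contr_toLast_sigma_inv (h : Γ.IsBicovariant) {e : I → ℂ}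
    (he : ∀ j, ∑ k, e k • Γ.v k j = e j • (1 : A)) (k : ℕ) (K J : Fin k → I) (i : I) :
    ∑ l, e l * toLast Γ.sigma⁻¹ k (Fin.snoc (α := fun _ => I) K l) (Fin.cons i J)
      = if K = J then e i else 0 := by
  induction k with
  | zero =>
    simp only [toLast_zero, snoc_eq_cons_zero, Matrix.one_apply, cons_inj_zero,
      Subsingleton.elim K J]
    simp
  | succ k ih =>
    rw [← Fin.snoc_init_self K, ← Fin.snoc_init_self J]
    generalize Fin.init K = K'
    generalize Fin.init J = J'
    generalize K (Fin.last k) = a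
    generalize J (Fin.last k) = b
    have e1 : ∀ l, toLast Γ.sigma⁻¹ (k + 1)
        (Fin.snoc (α := fun _ => I) (Fin.snoc (α := fun _ => I) K' a) l)
        (Fin.cons (α := fun _ => I) i (Fin.snoc (α := fun _ => I) J' b)) = _ := fun l =>
      toLast_succ_apply _ k K' J' a l i b
    refine (Finset.sum_congr rfl fun l _ => congrArg (e l * ·) (e1 l)).trans ?_
    simp only [Finset.mul_sum, ← mul_assoc]
    rw [Finset.sum_comm]
    simp only [← Finset.sum_mul, h.contr_sigma_inv he]
    have e2 : (Fin.snoc (α := fun _ => I) K' a : Fin (k + 1) → I) = Fin.snoc (α := fun _ => I) J' b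
        ↔ K' = J' ∧ a = b := Fin.snoc_inj
    simp only [e2]
    by_cases hab : a = b
    · simp only [hab, if_true, ih, and_true]
    · simp [hab]

/-- A coinvariant element crosses each factor by a mere flip. -/
lemma IsBicovariant.toFirst_sigma_coinvariant (h : Γ.IsBicovariant) (hc : Γ.IsCoinvariant c)
    (k : ℕ) (K J : Fin k → I) (j : I) :
    ∑ x, toFirst Γ.sigma k (Fin.cons j K) (Fin.snoc (α := fun _ => I) J x) * c x
      = if K = J then c j else 0 := by
  induction k generalizing j with
  | zero =>
    simp only [toFirst_zero, snoc_eq_cons_zero, Matrix.one_apply, cons_inj_zero,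
      Subsingleton.elim K J]
    simp
  | succ k ih =>
    rw [← Fin.cons_self_tail K, ← Fin.cons_self_tail J]
    generalize Fin.tail K = K'
    generalize Fin.tail J = J'
    generalize K 0 = a
    generalize J 0 = b
    have e1 : ∀ x, toFirst Γ.sigma (k + 1)
        (Fin.cons (α := fun _ => I) j (Fin.cons (α := fun _ => I) a K'))
        (Fin.snoc (α := fun _ => I) (Fin.cons (α := fun _ => I) b J') x) = _ := fun x =>
      toFirst_succ_apply _ k K' J' j a b x
    refine (Finset.sum_congr rfl fun x _ => congrArg (· * c x) (e1 x)).trans ?_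
    simp only [Finset.sum_mul, mul_assoc]
    rw [Finset.sum_comm]
    simp only [← Finset.mul_sum, ih]
    have e2 : (Fin.cons (α := fun _ => I) a K' : Fin (k + 1) → I) = Fin.cons (α := fun _ => I) b J'
        ↔ a = b ∧ K' = J' := Fin.cons_inj
    simp only [e2]
    by_cases hK : K' = J'
    · simp only [hK, if_true, h.sigma_coinvariant hc, and_true]
    · simp [hK]

/-- Each crossing with `σ⁻¹` multiplies the argument of the contraction by one more matrix element
of `v`, so the induction has to let `a` vary. -/
lemma IsInvariantMetric.contrFun_toFirst (h : Γ.IsBicovariant) (h' : Γ'.IsBicovariant)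
    (hg : IsInvariantMetric Γ' Γ g') (k : ℕ) (K J : Fin k → I) (x : I) (a : A) :
    ∑ j, Γ'.contrFun g' c' j a
        * toFirst Γ.sigma⁻¹ k (Fin.cons j K) (Fin.snoc (α := fun _ => I) J x)
      = Γ'.contrFun g' c' x (a * tensorPow Γ.v k K J) := by
  induction k generalizing a with
  | zero =>
    simp only [toFirst_zero, snoc_eq_cons_zero, Matrix.one_apply, cons_inj_zero, tensorPow_zero]
    simp
  | succ k ih =>
    rw [← Fin.cons_self_tail K, ← Fin.cons_self_tail J]
    generalize Fin.tail K = K'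
    generalize Fin.tail J = J'
    generalize K 0 = l
    generalize J 0 = i
    have e1 : ∀ j, toFirst Γ.sigma⁻¹ (k + 1)
        (Fin.cons (α := fun _ => I) j (Fin.cons (α := fun _ => I) l K'))
        (Fin.snoc (α := fun _ => I) (Fin.cons (α := fun _ => I) i J') x) = _ := fun j =>
      toFirst_succ_apply _ k K' J' j l i x
    refine (Finset.sum_congr rfl fun j _ => congrArg (Γ'.contrFun g' c' j a * ·) (e1 j)).trans ?_
    simp only [Finset.mul_sum, ← mul_assoc]
    rw [Finset.sum_comm]
    simp only [← Finset.sum_mul, hg.contrFun_sigma_inv h h', ih]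
    rw [tensorPow_succ]
    simp [mul_assoc]

end Moving

end HopfBimod

end

noncomputable section

/-! ### The Laplace operator as a sum of two central actions. -/

namespace HopfBimod

open Coalgebra

variable {A : Type*} [Ring A] [HopfAlgebra ℂ A] {I : Type*} [Fintype I] [DecidableEq I]
variable {Γ Γ' : HopfBimod A I} {c c' : I → ℂ} {g g' : I → I → ℂ}

lemma sum_smul_contrFun : ∑ j, c j • Γ'.contrFun g' c' j = Γ'.casimir c' (contr g' c) := by
  simp only [contrFun, casimir, contr, Finset.smul_sum, Finset.sum_smul, smul_smul]
  exact Finset.sum_comm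

lemma lstar_casimir (c e : I → ℂ) (a : A) :
    lstar (Γ.casimir c e) a = ∑ j, e j • lstar (Γ.coinvFun c j) a := by
  simp only [casimir, lstar_sum, lstar_smul]

section Moved

variable (h : Γ.IsBicovariant) {k : ℕ}
include h

/-- For `σ` the form `θ` picks up the full right coaction of `ρ` on its way, so its contraction
evaluates the Casimir functional on `ρ_(1)`. -/
lemma gRight_toLast_plus (ρ : Γ.Tens k) :
    Γ.gRight g c' k (Γ.ext (toLast Γ.sigma k) (Γ.tensLeft c k ρ))
      = Γ.actR (Γ.casimir c (contr g c')) k ρ := by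
  funext K
  simp only [gRight_apply, ext_apply, sum_cons, tensLeft_apply, actR_apply,
    h.toLast_sigma]
  have e : ∀ J, (Γ.casimir c (contr g c')) ∘ₗ LinearMap.mulRight ℂ (tensorPow Γ.v k K J)
      = ∑ l, contr g c' l • ∑ i, Γ.f i l (tensorPow Γ.v k K J) • Γ.coinvFun c i := by
    intro J
    ext a
    simp only [casimir, LinearMap.sum_apply, LinearMap.smul_apply, LinearMap.comp_apply,
      LinearMap.mulRight_apply, h.coinvFun_mul, smul_eq_mul, mul_comm]
  simp only [e, lstar_sum, lstar_smul, Finset.smul_sum]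
  calc _ = ∑ l, ∑ J, ∑ i, contr g c' l • Γ.f i l (tensorPow Γ.v k K J) •
        lstar (Γ.coinvFun c i) (ρ J) := Finset.sum_congr rfl fun l _ => Finset.sum_comm
    _ = _ := Finset.sum_comm

/-- For `σ⁻¹` the crossings are invisible to the contraction, and `θ` has only acted on the
coefficients of `ρ` in `A`. -/
lemma gRight_toLast_minus (hv : ∀ j, ∑ k, contr g c' k • Γ.v k j = contr g c' j • (1 : A))
    (ρ : Γ.Tens k) (K : Fin k → I) :
    Γ.gRight g c' k (Γ.ext (toLast Γ.sigma⁻¹ k) (Γ.tensLeft c k ρ)) K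
      = lstar (Γ.casimir c (contr g c')) (ρ K) := by
  simp only [gRight_apply, ext_apply, sum_cons, tensLeft_apply, lstar_casimir, Finset.smul_sum,
    smul_smul]
  rw [Finset.sum_comm]
  refine Finset.sum_congr rfl fun i _ => ?_
  rw [Finset.sum_comm]
  simp only [← Finset.sum_smul, h.contr_toLast_sigma_inv hv]
  simp

/-- Here `σ` is the transparent case: `θ` crosses by flips, and only the coefficients of `ρ`, which
stand between `θ'` and `θ`, are felt. -/
lemma gLeft_toFirst_plus (hc : Γ.IsCoinvariant c) (ρ : Γ.Tens k) (K : Fin k → I) :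
    Γ.gLeft Γ' g' c' k (Γ.ext (toFirst Γ.sigma k) (Γ.tensRight c k ρ)) K
      = lstar (Γ'.casimir c' (contr g' c)) (ρ K) := by
  rw [← sum_smul_contrFun, lstar_sum]
  rw [gLeft_apply]
  refine Finset.sum_congr rfl fun j _ => ?_
  simp only [ext_apply, sum_snoc, tensRight_apply, smul_smul]
  rw [Finset.sum_comm]
  simp only [← Finset.sum_smul, h.toFirst_sigma_coinvariant hc, ite_smul, zero_smul,
    Finset.sum_ite_eq, Finset.mem_univ, if_true, map_smul, lstar_smul]

/-- With `σ⁻¹` the contraction collects all of `v^{⊗k}` besides the coefficients, which amounts to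
the right coaction. -/
lemma gLeft_toFirst_minus (h' : Γ'.IsBicovariant) (hg : IsInvariantMetric Γ' Γ g')
    (ρ : Γ.Tens k) :
    Γ.gLeft Γ' g' c' k (Γ.ext (toFirst Γ.sigma⁻¹ k) (Γ.tensRight c k ρ))
      = Γ.actR (Γ'.casimir c' (contr g' c)) k ρ := by
  funext K
  simp only [gLeft_apply, ext_apply, sum_snoc, tensRight_apply, actR_apply, map_sum, map_smul,
    smul_smul]
  have e : ∀ J, (Γ'.casimir c' (contr g' c)) ∘ₗ LinearMap.mulRight ℂ (tensorPow Γ.v k K J)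
      = ∑ x, ∑ j, (toFirst Γ.sigma⁻¹ k (Fin.cons j K) (Fin.snoc (α := fun _ => I) J x) * c x) •
        Γ'.contrFun g' c' j := by
    intro J
    ext a
    rw [← sum_smul_contrFun]
    simp only [LinearMap.sum_apply, LinearMap.smul_apply, LinearMap.comp_apply,
      LinearMap.mulRight_apply, ← hg.contrFun_toFirst h h', smul_eq_mul, Finset.mul_sum]
    exact Finset.sum_congr rfl fun x _ => Finset.sum_congr rfl fun j _ => by ring
  simp only [e, lstar_sum, lstar_smul]
  calc _ = ∑ j, ∑ J, ∑ x, (toFirst Γ.sigma⁻¹ k (Fin.cons j K)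
        (Fin.snoc (α := fun _ => I) J x) * c x) • lstar (Γ'.contrFun g' c' j) (ρ J) :=
        Finset.sum_congr rfl fun j _ => Finset.sum_comm
    _ = ∑ J, ∑ j, ∑ x, (toFirst Γ.sigma⁻¹ k (Fin.cons j K)
        (Fin.snoc (α := fun _ => I) J x) * c x) • lstar (Γ'.contrFun g' c' j) (ρ J) :=
        Finset.sum_comm
    _ = _ := Finset.sum_congr rfl fun J _ => Finset.sum_comm

end Moved

/-! ### The operators on forms -/

/-- The operator `ρ ↦ g̃(B_{k,1} ρ, θ)`. -/
def contrRight (Γ : HopfBimod A I) (g : I → I → ℂ) (c' : I → ℂ) (s : Sgn) (k : ℕ) :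
    Γ.Tens (k + 1) →ₗ[ℂ] Γ.Tens k :=
  Γ.gRight g c' k ∘ₗ Γ.ext (shuffleOp (Γ.sigmaPow s) (k + 1) k)

/-- The operator `ρ ↦ g̃(θ, B_{1,k} ρ)`. -/
def contrLeft (Γ Γ' : HopfBimod A I) (g' : I → I → ℂ) (c' : I → ℂ) (s : Sgn) (k : ℕ) :
    Γ.Tens (k + 1) →ₗ[ℂ] Γ.Tens k :=
  Γ.gLeft Γ' g' c' k ∘ₗ Γ.ext (shuffleOp (Γ.sigmaPow s) (k + 1) 1)

/-- The codifferential given by the metrics `g`, `g'` and `θ = ∑ c'_i ω'_i`. -/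
def codiff (Γ Γ' : HopfBimod A I) (g g' : I → I → ℂ) (c' : I → ℂ) (s : Sgn) (k : ℕ) :
    Γ.Forms (k + 1) →ₗ[ℂ] Γ.Forms k :=
  descend _ ((Γ.kerA k).mkQ ∘ₗ
    (Γ.contrRight g c' s k + (-1 : ℂ) ^ (k + 1) • Γ.contrLeft Γ' g' c' s k))

/-- The Laplace operator `-d∂ + ∂d`. -/
def laplace (Γ Γ' : HopfBimod A I) (g g' : I → I → ℂ) (c c' : I → ℂ) (s : Sgn) :
    (k : ℕ) → Γ.Forms k →ₗ[ℂ] Γ.Forms k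
  | 0 => codiff Γ Γ' g g' c' s 0 ∘ₗ Γ.diff c 0
  | k + 1 => -(Γ.diff c k ∘ₗ codiff Γ Γ' g g' c' s k)
      + codiff Γ Γ' g g' c' s (k + 1) ∘ₗ Γ.diff c (k + 1)

/-- The operator which `⟨θ ⊗ ·, θ'⟩` adds. -/
def rightPart (Γ : HopfBimod A I) (F : A →ₗ[ℂ] ℂ) (s : Sgn) (k : ℕ) :
    Γ.Tens k →ₗ[ℂ] Γ.Tens k :=
  match s with
  | .plus => Γ.actR F k
  | .minus => Γ.actL F k

/-- The operator which `⟨θ', · ⊗ θ⟩` adds. -/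
def leftPart (Γ : HopfBimod A I) (F : A →ₗ[ℂ] ℂ) (s : Sgn) (k : ℕ) :
    Γ.Tens k →ₗ[ℂ] Γ.Tens k :=
  match s with
  | .plus => Γ.actL F k
  | .minus => Γ.actR F k

section OnForms

variable (h : Γ.IsBicovariant)
include h

/-- The antisymmetrisers of `σ` and `σ⁻¹` are obtained from each other by multiplication from the
left, up to sign. Hence the operators built from `σ⁻¹` live on the same quotient. -/
lemma IsBicovariant.mem_kerA_iff (s : Sgn) {k : ℕ} {ρ : Γ.Tens k} :
    ρ ∈ Γ.kerA k ↔ Γ.ext (antisymmetriser (Γ.sigmaPow s) k) ρ = 0 := by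
  rw [mem_kerA]
  cases s with
  | plus => rfl
  | minus =>
    have hsgn : ∀ m : ℕ, ((Equiv.Perm.sign (Fin.revPerm : Equiv.Perm (Fin m)) : ℤ) : ℂ) ≠ 0 := by
      intro m
      rcases Int.units_eq_one_or (Equiv.Perm.sign (Fin.revPerm : Equiv.Perm (Fin m))) with e | e <;>
        simp [e]
    have key : ∀ s s' : Sgn, Γ.sigmaPow s * Γ.sigmaPow s' = 1 →
        Γ.ext (antisymmetriser (Γ.sigmaPow s') k) ρ = 0 →
        Γ.ext (antisymmetriser (Γ.sigmaPow s) k) ρ = 0 := by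
      intro s s' hs h0
      have e := (h.isBraiding_sigmaPow s).permMat_rev_mul_antisymmetriser hs k
      have e' := congrArg (fun M => Γ.ext M ρ) e
      simp only [ext_mul, h0, map_zero, ext_smul] at e'
      exact (smul_eq_zero.mp e'.symm).resolve_left (hsgn k)
    exact ⟨key .minus .plus h.inv_mul_sigma, key .plus .minus h.sigma_mul_inv⟩

/-- The two halves of `d` descend through different factorisations: `id ⊗ A_k` is a right factor of
`A_{k+1}` for `θ ⊗ ρ`, and `A_k ⊗ id` for `ρ ⊗ θ`. -/
lemma IsBicovariant.diff_mk (c : I → ℂ) (k : ℕ) (ρ : Γ.Tens k) :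
    Γ.diff c k ((Γ.kerA k).mkQ ρ)
      = (Γ.kerA (k + 1)).mkQ (Γ.tensLeft c k ρ - (-1 : ℂ) ^ k • Γ.tensRight c k ρ) := by
  rw [diff, descend_mk]
  · rfl
  · intro ρ hρ
    rw [LinearMap.comp_apply, Submodule.mkQ_apply, Submodule.Quotient.mk_eq_zero, mem_kerA]
    rw [mem_kerA] at hρ
    rw [LinearMap.sub_apply, map_sub, LinearMap.smul_apply, map_smul]
    conv_lhs => enter [1]; rw [h.isBraiding.antisymmetriser_succ_eq_mul_consMat]
    rw [h.isBraiding.antisymmetriser_succ_eq_mul_snocMat, ext_mul, ext_mul,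
      ext_consMat_tensLeft, ext_snocMat_tensRight, hρ]
    simp

lemma IsBicovariant.contrRight_eq (s : Sgn) (k : ℕ) (ρ : Γ.Tens (k + 1)) :
    Γ.contrRight g c' s k ρ = Γ.gRight g c' k (Γ.ext (lastShuffle (Γ.sigmaPow s) k) ρ) := by
  rw [contrRight, LinearMap.comp_apply, (h.isBraiding_sigmaPow s).shuffleOp_last]

lemma IsBicovariant.contrLeft_eq (s : Sgn) (k : ℕ) (ρ : Γ.Tens (k + 1)) :
    Γ.contrLeft Γ' g' c' s k ρ
      = Γ.gLeft Γ' g' c' k (Γ.ext (firstShuffle (Γ.sigmaPow s) k) ρ) := by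
  rw [contrLeft, LinearMap.comp_apply, (h.isBraiding_sigmaPow s).shuffleOp_first]

/-- Applying `A_k` after a contraction is contracting `A_{k+1} ρ`, by the factorisations with
`B_{k,1}` and `B_{1,k}`. -/
lemma IsBicovariant.codiff_mk (g g' : I → I → ℂ) (c' : I → ℂ) (s : Sgn) (k : ℕ)
    (ρ : Γ.Tens (k + 1)) :
    Γ.codiff Γ' g g' c' s k ((Γ.kerA (k + 1)).mkQ ρ) = (Γ.kerA k).mkQ
      (Γ.contrRight g c' s k ρ + (-1 : ℂ) ^ (k + 1) • Γ.contrLeft Γ' g' c' s k ρ) := by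
  rw [codiff, descend_mk]
  · rfl
  · intro ρ hρ
    rw [LinearMap.comp_apply, Submodule.mkQ_apply, Submodule.Quotient.mk_eq_zero,
      h.mem_kerA_iff s]
    rw [h.mem_kerA_iff s] at hρ
    rw [LinearMap.add_apply, map_add, LinearMap.smul_apply, map_smul, h.contrRight_eq,
      h.contrLeft_eq, ← gRight_ext_snocMat, ← gLeft_ext_consMat, ← ext_mul, ← ext_mul,
      ← (h.isBraiding_sigmaPow s).antisymmetriser_succ_eq_last,
      ← (h.isBraiding_sigmaPow s).antisymmetriser_succ_eq_first, hρ]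
    simp

variable (h' : Γ'.IsBicovariant) (hc : Γ.IsCoinvariant c) (hc' : Γ'.IsCoinvariant c')
  (hg : IsInvariantMetric Γ Γ' g) (hg' : IsInvariantMetric Γ' Γ g')
include h' hc hc' hg hg'

/-- For `σ` this rests on coinvariance of `θ`, for `σ⁻¹` on invariance of the covector `g(·, θ')`.
-/
lemma contr_sigmaPow_coinvariant (s : Sgn) (a i : I) :
    ∑ l, ∑ j, contr g c' l * Γ.sigmaPow s (a, l) (i, j) * c j = contr g c' i * c a := by
  cases s with
  | plus =>
    change ∑ l, ∑ j, contr g c' l * Γ.sigma (a, l) (i, j) * c j = _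
    simp only [mul_assoc, ← Finset.mul_sum, h.sigma_coinvariant hc]
    simp
  | minus =>
    change ∑ l, ∑ j, contr g c' l * Γ.sigma⁻¹ (a, l) (i, j) * c j = _
    rw [Finset.sum_comm]
    simp only [← Finset.sum_mul, h.contr_sigma_inv (hg.contr_v hc')]
    simp

lemma gRight_toLast (s : Sgn) {k : ℕ} (ρ : Γ.Tens k) :
    Γ.gRight g c' k (Γ.ext (toLast (Γ.sigmaPow s) k) (Γ.tensLeft c k ρ))
      = Γ.rightPart (Γ.casimir c (contr g c')) s k ρ := by
  cases s with
  | plus => exact gRight_toLast_plus h ρ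
  | minus =>
    funext K
    refine (gRight_toLast_minus h (hg.contr_v hc') ρ K).trans ?_
    -- The computation yields `F ∗ ρ_K`; centrality turns it into `ρ_K ∗ F`, which is the action
    -- through the left coaction.
    exact h.isCentral_casimir hc (hg.contr_v hc') (ρ K)

lemma gLeft_toFirst (s : Sgn) {k : ℕ} (ρ : Γ.Tens k) :
    Γ.gLeft Γ' g' c' k (Γ.ext (toFirst (Γ.sigmaPow s) k) (Γ.tensRight c k ρ))
      = Γ.leftPart (Γ'.casimir c' (contr g' c)) s k ρ := by
  cases s with
  | plus =>
    funext K
    refine (gLeft_toFirst_plus h hc ρ K).trans ?_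
    exact h'.isCentral_casimir hc' (hg'.contr_v hc) (ρ K)
  | minus => exact gLeft_toFirst_minus h h' hg' ρ

lemma sigmaPow_contrFun (s : Sgn) (l m : I) :
    ∑ j, ∑ i, Γ.sigmaPow s (j, l) (i, m) • convMul (Γ'.contrFun g' c' j) (Γ.coinvFun c i)
      = convMul (Γ.coinvFun c l) (Γ'.contrFun g' c' m) := by
  cases s with
  | plus => exact hg'.sigma_contrFun h h' hc' l m
  | minus => exact hg'.sigma_inv_contrFun h h' hc l m

/-- The Laplace operator in terms of the actions of two central functionals. -/
lemma laplace_mk (s : Sgn) (k : ℕ) (ρ : Γ.Tens k) :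
    Γ.laplace Γ' g g' c c' s k ((Γ.kerA k).mkQ ρ) = (-1 : ℂ) ^ k • (Γ.kerA k).mkQ
      (Γ.rightPart (Γ.casimir c (contr g c')) s k ρ - Γ.casimir c (contr g c') 1 • ρ
        + (Γ.leftPart (Γ'.casimir c' (contr g' c)) s k ρ
          - Γ'.casimir c' (contr g' c) 1 • ρ)) := by
  have hs1 := contr_sigmaPow_coinvariant h h' hc hc' hg hg' s
  have hs2 := sigmaPow_contrFun h h' hc hc' hg hg' s
  rw [h.casimir_one, h'.casimir_one]
  cases k with
  | zero =>
    rw [laplace, LinearMap.comp_apply, h.diff_mk, h.codiff_mk]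
    refine (congrArg _ ?_).trans (map_smul (Γ.kerA 0).mkQ _ _)
    -- In degree `0` there is no term `d∂` and the shuffle operators are trivial, but `θ` still acts
    -- on the coefficient, so invariance under the action is needed for the constant.
    have e0 : Γ.gLeft Γ' g' c' 0 (Γ.tensLeft c 0 ρ) = (∑ j, contr g' c j * c' j) • ρ := by
      funext K
      rw [gLeft_tensLeft, hg'.sum_contrFun_convMul h h', lstar_smul, lstar_counit]; rfl
    have e1 := gRight_toLast h h' hc hc' hg hg' s ρ
    have e2 := gLeft_toFirst h h' hc hc' hg hg' s ρ
    rw [toLast_zero, ext_one] at e1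
    rw [toFirst_zero, ext_one] at e2
    rw [h.contrRight_eq, h.contrLeft_eq, lastShuffle_zero, firstShuffle_zero, ext_one, map_sub,
      map_sub, map_smul, map_smul, gRight_tensRight, e0, e1, e2]
    simp only [pow_zero, pow_succ]
    module
  | succ k =>
    rw [laplace, LinearMap.add_apply, LinearMap.neg_apply, LinearMap.comp_apply,
      LinearMap.comp_apply, h.codiff_mk, h.diff_mk, h.diff_mk, h.codiff_mk, ← map_neg, ← map_add]
    refine (congrArg _ ?_).trans (map_smul (Γ.kerA (k + 1)).mkQ _ _)
    have e1 := gRight_toLast h h' hc hc' hg hg' s ρ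
    have e2 := gLeft_toFirst h h' hc hc' hg hg' s ρ
    have r1 := gRight_lastShuffle_tensRight (k := k) hs1 ρ
    have r2 := gRight_lastShuffle_tensLeft (s := Γ.sigmaPow s) (g := g) (c := c) (c' := c') ρ
    have l1 := gLeft_firstShuffle_tensLeft (k := k) (hg'.sum_contrFun_convMul h h') hs2 ρ
    have l2 := gLeft_firstShuffle_tensRight (Γ' := Γ') (s := Γ.sigmaPow s) (g' := g') (c := c)
      (c' := c') ρ
    rw [e1] at r2
    rw [e2] at l2
    simp only [h.contrRight_eq, h.contrLeft_eq, map_sub, map_smul, map_add, r1, r2, l1, l2]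
    -- Once the sign is fixed, all terms in which `θ` multiplies a contraction of `ρ` cancel between
    -- `∂d` and `d∂`.
    rcases neg_one_pow_eq_or ℂ k with hk | hk
    · simp only [pow_succ, hk]
      module
    · simp only [pow_succ, hk]
      module

/-- The constants are actions of multiples of the counit and are absorbed into the functionals,
which then vanish at `1`. -/
lemma laplace_plus (k : ℕ) (ξ : Γ.Forms k) :
    Γ.laplace Γ' g g' c c' .plus k ξ = (-1 : ℂ) ^ k •
      (Γ.formsAct counit (Γ.casimir c (contr g c') - Γ.casimir c (contr g c') 1 • counit) k ξ
        + Γ.formsAct (Γ'.casimir c' (contr g' c) - Γ'.casimir c' (contr g' c) 1 • counit)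
          counit k ξ) := by
  obtain ⟨ρ, rfl⟩ := Submodule.mkQ_surjective _ ξ
  rw [laplace_mk h h' hc hc' hg hg', h.formsAct_mk, h.formsAct_mk, ← map_add, h.actR_counit,
    actL_counit]
  congr 3
  · funext K
    have e : ∀ (F : A →ₗ[ℂ] ℂ) (x : ℂ) J, (F - x • counit (R := ℂ)) ∘ₗ
        LinearMap.mulRight ℂ (tensorPow Γ.v k K J) = F ∘ₗ LinearMap.mulRight ℂ (tensorPow Γ.v k K J)
          - x • (counit ∘ₗ LinearMap.mulRight ℂ (tensorPow Γ.v k K J)) := fun F x J => rfl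
    have e' := congrFun (h.actR_counit k ρ) K
    rw [actR_apply] at e'
    simp only [rightPart, Pi.sub_apply, Pi.smul_apply, actR_apply, e, lstar_sub, lstar_smul,
      Finset.sum_sub_distrib, ← Finset.smul_sum, e']
  · funext K
    simp only [leftPart, Pi.sub_apply, Pi.smul_apply, actL_apply, rstar_sub, rstar_smul,
      rstar_counit]

lemma laplace_minus (k : ℕ) (ξ : Γ.Forms k) :
    Γ.laplace Γ' g g' c c' .minus k ξ = (-1 : ℂ) ^ k •
      (Γ.formsAct (Γ.casimir c (contr g c') - Γ.casimir c (contr g c') 1 • counit) counit k ξ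
        + Γ.formsAct counit (Γ'.casimir c' (contr g' c) - Γ'.casimir c' (contr g' c) 1 • counit)
          k ξ) := by
  obtain ⟨ρ, rfl⟩ := Submodule.mkQ_surjective _ ξ
  rw [laplace_mk h h' hc hc' hg hg', h.formsAct_mk, h.formsAct_mk, ← map_add, h.actR_counit,
    actL_counit]
  congr 3
  · funext K
    simp only [rightPart, Pi.sub_apply, Pi.smul_apply, actL_apply, rstar_sub, rstar_smul,
      rstar_counit]
  · funext K
    have e : ∀ (F : A →ₗ[ℂ] ℂ) (x : ℂ) J, (F - x • counit (R := ℂ)) ∘ₗ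
        LinearMap.mulRight ℂ (tensorPow Γ.v k K J) = F ∘ₗ LinearMap.mulRight ℂ (tensorPow Γ.v k K J)
          - x • (counit ∘ₗ LinearMap.mulRight ℂ (tensorPow Γ.v k K J)) := fun F x J => rfl
    have e' := congrFun (h.actR_counit k ρ) K
    rw [actR_apply] at e'
    simp only [leftPart, Pi.sub_apply, Pi.smul_apply, actR_apply, e, lstar_sub, lstar_smul,
      Finset.sum_sub_distrib, ← Finset.smul_sum, e']

/-- The eigenvalues of the Laplace operators. -/
lemma laplace_eigenvalues {α β : Irrep A} {k : ℕ} {ξ : Γ.Forms k}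
    (hξ : ξ ∈ Γ.component α β k) :
    (∀ a b : ℂ,
      (∀ x ∈ α.coeff, (Γ'.casimir c' (contr g' c) - Γ'.casimir c' (contr g' c) 1 • counit : A →ₗ[ℂ] ℂ) x
        = a * counit (R := ℂ) x) →
      (∀ x ∈ β.coeff, (Γ.casimir c (contr g c') - Γ.casimir c (contr g c') 1 • counit : A →ₗ[ℂ] ℂ) x
        = b * counit (R := ℂ) x) →
      Γ.laplace Γ' g g' c c' .plus k ξ = ((-1) ^ k * (a + b)) • ξ) ∧
    (∀ a b : ℂ,
      (∀ x ∈ α.coeff, (Γ.casimir c (contr g c') - Γ.casimir c (contr g c') 1 • counit : A →ₗ[ℂ] ℂ) x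
        = a * counit (R := ℂ) x) →
      (∀ x ∈ β.coeff, (Γ'.casimir c' (contr g' c) - Γ'.casimir c' (contr g' c) 1 • counit : A →ₗ[ℂ] ℂ) x
        = b * counit (R := ℂ) x) →
      Γ.laplace Γ' g g' c c' .minus k ξ = ((-1) ^ k * (a + b)) • ξ) := by
  have eL : ∀ (F : A →ₗ[ℂ] ℂ) (a : ℂ), (∀ x ∈ α.coeff, F x = a * counit (R := ℂ) x) →
      Γ.formsAct F counit k ξ = a • ξ := by
    intro F a hF
    rw [formsAct_eq_smul_of_mem_component hξ (f' := counit) (g' := counit) a, h.formsAct_counit]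
    intro x hx y _
    rw [hF x hx, mul_assoc]
  have eR : ∀ (F : A →ₗ[ℂ] ℂ) (a : ℂ), (∀ x ∈ β.coeff, F x = a * counit (R := ℂ) x) →
      Γ.formsAct counit F k ξ = a • ξ := by
    intro F a hF
    rw [formsAct_eq_smul_of_mem_component hξ (f' := counit) (g' := counit) a, h.formsAct_counit]
    intro x _ y hy
    rw [hF y hy]; ring
  refine ⟨fun a b ha hb => ?_, fun a b ha hb => ?_⟩
  · rw [laplace_plus h h' hc hc' hg hg', eL _ a ha, eR _ b hb]
    module
  · rw [laplace_minus h h' hc hc' hg hg', eL _ a ha, eR _ b hb]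
    module

end OnForms

end HopfBimod

end

noncomputable section

/-! ## Bimodules attached to universal r-forms -/

section RForm

open Coalgebra HopfAlgebra

variable {A : Type*} [Ring A] [HopfAlgebra ℂ A]

lemma lift_comulPair {ι κ V : Type*} [AddCommGroup V] [Module ℂ V] {s : Finset ι} {t : Finset κ}
    {a b : A} {x y : ι → A} {z w : κ → A}
    (ha : comul (R := ℂ) a = ∑ i ∈ s, x i ⊗ₜ[ℂ] y i)
    (hb : comul (R := ℂ) b = ∑ i ∈ t, z i ⊗ₜ[ℂ] w i) (T : (A ⊗[ℂ] A) ⊗[ℂ] (A ⊗[ℂ] A) →ₗ[ℂ] V) :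
    T (comulPair a b) = ∑ i ∈ s, ∑ j ∈ t, T ((x i ⊗ₜ z j) ⊗ₜ (y i ⊗ₜ w j)) := by
  simp [comulPair, ha, hb, TensorProduct.sum_tmul, TensorProduct.tmul_sum]
  exact Finset.sum_comm

lemma exists_comul (a : A) : ∃ (s : Finset (A × A)), comul (R := ℂ) a = ∑ i ∈ s, i.1 ⊗ₜ[ℂ] i.2 := by
  exact TensorProduct.exists_finset _

namespace UniversalRForm

variable (r : UniversalRForm A)

lemma convMul_form (a b : A) : convMul (r.form a) (r.form b) = r.form (a * b) := by
  ext c; rw [r.mul_left]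

lemma convMul_flip (a b : A) : convMul (r.form.flip a) (r.form.flip b) = r.form.flip (b * a) := by
  ext c; simp [r.mul_right]

/-- The functional `r(1, ·)` is idempotent for convolution and invertible. -/
lemma form_one : r.form 1 = counit := by
  obtain ⟨s, hs⟩ := r.exists_inv
  have h1 : convMul (r.form 1) (s 1) = counit := by
    ext b
    obtain ⟨S, hS⟩ := exists_comul b
    have h := (hs 1 b).1
    have h1 : comul (R := ℂ) (1 : A) = ∑ i ∈ ({()} : Finset Unit), (1 : A) ⊗ₜ[ℂ] (1 : A) := by
      simp [Algebra.TensorProduct.one_def]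
    rw [← LinearMap.comp_apply, lift_comulPair h1 hS] at h
    simpa [convMul_eq_of_comul hS] using h
  have h2 : convMul (r.form 1) (r.form 1) = r.form 1 := by rw [convMul_form, one_mul]
  calc r.form 1 = convMul (r.form 1) (convMul (r.form 1) (s 1)) := by rw [h1, convMul_counit]
    _ = _ := by rw [← convMul_assoc, h2, h1]

lemma flip_one : r.form.flip 1 = counit := by
  obtain ⟨s, hs⟩ := r.exists_inv
  have h1 : convMul (r.form.flip 1) (s.flip 1) = counit := by
    ext b
    obtain ⟨S, hS⟩ := exists_comul b
    have h := (hs b 1).1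
    have h1 : comul (R := ℂ) (1 : A) = ∑ i ∈ ({()} : Finset Unit), (1 : A) ⊗ₜ[ℂ] (1 : A) := by
      simp [Algebra.TensorProduct.one_def]
    rw [← LinearMap.comp_apply, lift_comulPair hS h1] at h
    simpa [convMul_eq_of_comul hS] using h
  have h2 : convMul (r.form.flip 1) (r.form.flip 1) = r.form.flip 1 := by
    rw [convMul_flip, one_mul]
  calc r.form.flip 1 = convMul (r.form.flip 1) (convMul (r.form.flip 1) (s.flip 1)) := by
        rw [h1, convMul_counit]
    _ = _ := by rw [← convMul_assoc, h2, h1]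

end UniversalRForm

/-- The matrix `w` is a matrix corepresentation. -/
structure IsCorepMatrix {I : Type*} [Fintype I] [DecidableEq I] (w : Matrix I I A) : Prop where
  comul : ∀ i j, comul (R := ℂ) (w i j) = ∑ k, w i k ⊗ₜ[ℂ] w k j
  counit : ∀ i j, counit (R := ℂ) (w i j) = if i = j then 1 else 0

namespace IsCorepMatrix

variable {I : Type*} [Fintype I] [DecidableEq I] {w : Matrix I I A}

lemma antipode_mul (hw : IsCorepMatrix w) (i j : I) :
    ∑ k, antipode ℂ (w i k) * w k j = if i = j then 1 else 0 := by
  have h := mul_antipode_rTensor_comul_apply (R := ℂ) (w i j)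
  rw [hw.comul, hw.counit] at h
  simp only [map_sum, LinearMap.rTensor_tmul, LinearMap.mul'_apply] at h
  rw [h]; split_ifs <;> simp

lemma mul_antipode (hw : IsCorepMatrix w) (i j : I) :
    ∑ k, w i k * antipode ℂ (w k j) = if i = j then 1 else 0 := by
  have h := mul_antipode_lTensor_comul_apply (R := ℂ) (w i j)
  rw [hw.comul, hw.counit] at h
  simp only [map_sum, LinearMap.lTensor_tmul, LinearMap.mul'_apply] at h
  rw [h]; split_ifs <;> simp

lemma map_antipode_mul (hw : IsCorepMatrix w) : w.map (antipode ℂ) * w = 1 := by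
  ext i j
  simp [Matrix.mul_apply, hw.antipode_mul, Matrix.one_apply]

lemma mul_map_antipode (hw : IsCorepMatrix w) : w * w.map (antipode ℂ) = 1 := by
  ext i j
  simp [Matrix.mul_apply, hw.mul_antipode, Matrix.one_apply]

/-- The two matrices over `A ⊗ A` are inverses of `Δ(w)`, one on the left and one on the right, and
hence coincide. -/
lemma comul_antipode (hw : IsCorepMatrix w) (i j : I) :
    Coalgebra.comul (R := ℂ) (antipode ℂ (w i j))
      = ∑ k, antipode ℂ (w k j) ⊗ₜ[ℂ] antipode ℂ (w i k) := by
  let D : A →ₐ[ℂ] A ⊗[ℂ] A := Bialgebra.comulAlgHom ℂ A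
  let M : Matrix I I (A ⊗[ℂ] A) :=
    Matrix.of fun i j => ∑ k, antipode ℂ (w k j) ⊗ₜ[ℂ] antipode ℂ (w i k)
  have h1 : w.map D * (w.map (antipode ℂ)).map D = 1 := by
    rw [← Matrix.map_mul, hw.mul_map_antipode, Matrix.map_one _ (map_zero _) (map_one _)]
  have h2 : M * w.map D = 1 := by
    ext i l
    have e : ∀ j, D (w j l) = ∑ m, w j m ⊗ₜ[ℂ] w m l := fun j => hw.comul j l
    simp only [Matrix.mul_apply, M, Matrix.of_apply, Matrix.map_apply, e, Finset.sum_mul_sum,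
      Algebra.TensorProduct.tmul_mul_tmul]
    rw [Finset.sum_comm]
    have : ∀ k, ∑ j, ∑ m, (antipode ℂ (w k j) * w j m) ⊗ₜ[ℂ] (antipode ℂ (w i k) * w m l)
        = (1 : A) ⊗ₜ[ℂ] (antipode ℂ (w i k) * w k l) := by
      intro k
      rw [Finset.sum_comm]
      simp only [← TensorProduct.sum_tmul, hw.antipode_mul, TensorProduct.ite_tmul]
      simp
    simp only [this, ← TensorProduct.tmul_sum, hw.antipode_mul, Matrix.one_apply]
    split_ifs <;> simp [Algebra.TensorProduct.one_def]
  have h3 : M = (w.map (antipode ℂ)).map D := by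
    calc M = M * (w.map D * (w.map (antipode ℂ)).map D) := by rw [h1, mul_one]
      _ = _ := by rw [← mul_assoc, h2, one_mul]
  exact (congrFun (congrFun h3 i) j).symm

/-- The contragredient of a matrix corepresentation. -/
lemma contragredient (hw : IsCorepMatrix w) :
    IsCorepMatrix (Matrix.of fun i j => antipode ℂ (w j i)) where
  comul i j := by simpa using hw.comul_antipode j i
  counit i j := by simp [hw.counit, eq_comm]

end IsCorepMatrix

namespace HopfBimod

variable {I J : Type*} [Fintype I] [DecidableEq I] [Fintype J] [DecidableEq J]

/-- The bimodule with right coaction `w` and right action `r(w^j_i, ·)`. -/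
def ofLeft (r : UniversalRForm A) (w : Matrix I I A) : HopfBimod A I where
  v := w
  f i j := r.form (w j i)

/-- The bimodule with right coaction `S(w)ᵗ` and right action `r(·, w^i_j)`. -/
def ofRight (r : UniversalRForm A) (w : Matrix I I A) : HopfBimod A I where
  v := Matrix.of fun i j => antipode ℂ (w j i)
  f i j := r.form.flip (w i j)

/-- The tensor product (over `ℂ`) of the spaces of left-coinvariant elements of two bimodules. -/
def prod (Γ : HopfBimod A I) (Γ' : HopfBimod A J) : HopfBimod A (I × J) where
  v := Matrix.of fun p r => Γ.v p.1 r.1 * Γ'.v p.2 r.2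
  f r p := convMul (Γ.f r.1 p.1) (Γ'.f r.2 p.2)

/-- The axioms translate those of the r-form: `mul_right` gives multiplicativity of the action,
`quasi_comm` the compatibility, and the convolution inverse of `r` the inverse action. -/
lemma isBicovariant_ofLeft (r : UniversalRForm A) {w : Matrix I I A} (hw : IsCorepMatrix w) :
    (ofLeft r w).IsBicovariant where
  comul_v := hw.comul
  counit_v := hw.counit
  f_mul i j a b := by
    simp only [ofLeft, r.mul_right]
    rw [convMul_eq_of_comul (hw.comul j i)]
    simp [mul_comm]
  f_one i j := by
    change r.form.flip 1 (w j i) = _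
    rw [r.flip_one, hw.counit]; simp [eq_comm]
  compat i k a := by
    obtain ⟨S, hS⟩ := exists_comul a
    have h := r.quasi_comm (w k i) a
    change ((TensorProduct.lid ℂ A).toLinearMap ∘ₗ _) _
      = ((TensorProduct.rid ℂ A).toLinearMap ∘ₗ _) _ at h
    rw [lift_comulPair (hw.comul k i) hS, lift_comulPair (hw.comul k i) hS] at h
    simp only [LinearMap.comp_apply, TensorProduct.map_tmul, TensorProduct.lift.tmul,
      LinearMap.mul'_apply, LinearEquiv.coe_coe, TensorProduct.lid_tmul, TensorProduct.rid_tmul,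
      TensorProduct.comm_tmul] at h
    simp only [ofLeft, lstar_eq_of_comul hS, rstar_eq_of_comul hS, Finset.sum_mul, Finset.mul_sum,
      smul_mul_assoc, mul_smul_comm]
    exact h.symm
  exists_inv := by
    obtain ⟨s, hs⟩ := r.exists_inv
    refine ⟨fun l j => s (w j l), fun k l => ?_⟩
    ext b
    obtain ⟨S, hS⟩ := exists_comul b
    have h := (hs (w k l) b).1
    rw [← LinearMap.comp_apply, lift_comulPair (hw.comul k l) hS] at h
    simp only [LinearMap.comp_apply, TensorProduct.map_tmul, TensorProduct.lift.tmul,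
      LinearMap.mul'_apply, hw.counit] at h
    simp only [LinearMap.sum_apply, convMul_eq_of_comul hS, ofLeft, h]
    split_ifs <;> simp

/-- The same with the arguments of `r` exchanged. Quasi-commutativity now yields `X w = w Y`, and
multiplying by `S(w)` on both sides gives the compatibility for the contragredient coaction. -/
lemma isBicovariant_ofRight (r : UniversalRForm A) {w : Matrix I I A} (hw : IsCorepMatrix w) :
    (ofRight r w).IsBicovariant where
  comul_v := hw.contragredient.comul
  counit_v := hw.contragredient.counit
  f_mul i j a b := by
    simp only [ofRight, LinearMap.flip_apply, r.mul_left]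
    rw [convMul_eq_of_comul (hw.comul i j)]
  f_one i j := by
    change r.form 1 (w i j) = _
    rw [r.form_one, hw.counit]
  compat i k a := by
    have h : ∀ i k, ∑ m, rstar (r.form.flip (w i m)) a * w m k
        = ∑ m, w i m * lstar (r.form.flip (w m k)) a := by
      intro i k
      obtain ⟨S, hS⟩ := exists_comul a
      have h := r.quasi_comm a (w i k)
      change ((TensorProduct.lid ℂ A).toLinearMap ∘ₗ _) _
        = ((TensorProduct.rid ℂ A).toLinearMap ∘ₗ _) _ at h
      rw [lift_comulPair hS (hw.comul i k), lift_comulPair hS (hw.comul i k)] at h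
      simp only [LinearMap.comp_apply, TensorProduct.map_tmul, TensorProduct.lift.tmul,
        LinearMap.mul'_apply, LinearEquiv.coe_coe, TensorProduct.lid_tmul, TensorProduct.rid_tmul,
        TensorProduct.comm_tmul] at h
      simp only [lstar_eq_of_comul hS, rstar_eq_of_comul hS, Finset.sum_mul, Finset.mul_sum,
        smul_mul_assoc, mul_smul_comm, LinearMap.flip_apply]
      rw [Finset.sum_comm, h, Finset.sum_comm]
    let X : Matrix I I A := Matrix.of fun i m => rstar (r.form.flip (w i m)) a
    let Y : Matrix I I A := Matrix.of fun i m => lstar (r.form.flip (w i m)) a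
    have e : X * w = w * Y := by
      ext i k; simpa [Matrix.mul_apply, X, Y] using h i k
    have e' : Y * w.map (antipode ℂ) = w.map (antipode ℂ) * X := by
      calc _ = (w.map (antipode ℂ) * w) * Y * w.map (antipode ℂ) := by
            rw [hw.map_antipode_mul, one_mul]
        _ = w.map (antipode ℂ) * (X * w) * w.map (antipode ℂ) := by rw [e]; simp only [mul_assoc]
        _ = _ := by rw [mul_assoc, mul_assoc, hw.mul_map_antipode, mul_one]
    have e2 := congrFun (congrFun e' i) k
    simp only [Matrix.mul_apply, X, Y, Matrix.of_apply, Matrix.map_apply] at e2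
    exact e2
  exists_inv := by
    refine ⟨fun l j => r.form.flip (antipode ℂ (w l j)), fun k l => ?_⟩
    simp only [ofRight, r.convMul_flip, ← map_sum, hw.antipode_mul]
    by_cases hkl : k = l
    · simp [hkl, r.flip_one]
    · simp [hkl, Ne.symm hkl]

/-- The compatibility is used for one factor after the other, and the convolution inverses are
multiplied in reversed order. -/
lemma IsBicovariant.prod {Γ : HopfBimod A I} {Γ' : HopfBimod A J} (h : Γ.IsBicovariant)
    (h' : Γ'.IsBicovariant) : (Γ.prod Γ').IsBicovariant where
  comul_v i j := by
    simp only [HopfBimod.prod, Matrix.of_apply, Bialgebra.comul_mul, h.comul_v, h'.comul_v,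
      Finset.sum_mul_sum, Algebra.TensorProduct.tmul_mul_tmul, Fintype.sum_prod_type]
  counit_v i j := by
    simp only [HopfBimod.prod, Matrix.of_apply, Bialgebra.counit_mul, h.counit_v, h'.counit_v,
      Prod.ext_iff, mul_ite, mul_one, mul_zero, ite_and]
    split_ifs <;> rfl
  f_mul i j a b := by
    simp only [HopfBimod.prod, Fintype.sum_prod_type]
    exact convMul_apply_mul (h.f_mul _ _) (h'.f_mul _ _) a b
  f_one i j := by
    simp only [HopfBimod.prod, convMul_one, h.f_one, h'.f_one,
      Prod.ext_iff, mul_ite, mul_one, mul_zero, ite_and]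
    split_ifs <;> rfl
  compat i k a := by
    simp only [HopfBimod.prod, Matrix.of_apply, Fintype.sum_prod_type, ← lstar_lstar,
      ← rstar_rstar]
    have e1 : ∀ j2, ∑ j1, lstar (Γ.f i.1 j1) (lstar (Γ'.f i.2 j2) a) * (Γ.v k.1 j1 * Γ'.v k.2 j2)
        = ∑ m, Γ.v m i.1 * (lstar (Γ'.f i.2 j2) (rstar (Γ.f m k.1) a) * Γ'.v k.2 j2) := by
      intro j2
      simp only [← mul_assoc, ← Finset.sum_mul, h.compat, rstar_lstar]
    rw [Finset.sum_comm]
    simp only [e1]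
    rw [Finset.sum_comm]
    simp only [← Finset.mul_sum, h'.compat, mul_assoc]
  exists_inv := by
    obtain ⟨f, hf⟩ := h.exists_inv
    obtain ⟨f', hf'⟩ := h'.exists_inv
    refine ⟨fun l j => convMul (f' l.2 j.2) (f l.1 j.1), fun k l => ?_⟩
    simp only [HopfBimod.prod, Fintype.sum_prod_type]
    have e : ∀ j1, ∑ j2, convMul (convMul (Γ.f j1 k.1) (Γ'.f j2 k.2))
        (convMul (f' l.2 j2) (f l.1 j1))
        = if k.2 = l.2 then convMul (Γ.f j1 k.1) (f l.1 j1) else 0 := by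
      intro j1
      have : ∀ j2, convMul (convMul (Γ.f j1 k.1) (Γ'.f j2 k.2)) (convMul (f' l.2 j2) (f l.1 j1))
          = convMul (Γ.f j1 k.1) (convMul (convMul (Γ'.f j2 k.2) (f' l.2 j2)) (f l.1 j1)) := by
        intro j2; simp only [convMul_assoc]
      simp only [this, ← convMul_sum, ← sum_convMul, hf']
      split_ifs
      · rw [counit_convMul]
      · rw [show (0 : A →ₗ[ℂ] ℂ) = (0 : ℂ) • 0 by simp, smul_convMul, zero_smul, ← zero_smul ℂ (0 : A →ₗ[ℂ] ℂ),
          convMul_smul, zero_smul, zero_smul]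
    simp only [e]
    by_cases h2 : k.2 = l.2 <;> simp [h2, hf, Prod.ext_iff]

end HopfBimod

end RForm

end

noncomputable section

/-! ## The numbers `d_i` and the square of the antipode -/

namespace QuantumGroup

open HopfAlgebra Coalgebra

/-! ### The scalars `d_i` and the trace of `D`. -/

section Scalars

variable (G : QuantumGroup)

/-- After clearing denominators a vanishing sum would make `q` a root of a polynomial with rational
coefficients, nonzero because its value at `1` is the number of terms. -/
lemma sum_zpow_ne_zero {ι : Type*} [Fintype ι] [Nonempty ι] (n : ι → ℤ) :
    ∑ i, G.q ^ n i ≠ 0 := by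
  intro h
  obtain ⟨M, hM⟩ : ∃ M : ℕ, ∀ i, 0 ≤ n i + M := by
    refine ⟨∑ i, (n i).natAbs, fun i => ?_⟩
    have := Finset.single_le_sum (f := fun i => (n i).natAbs) (fun _ _ => Nat.zero_le _)
      (Finset.mem_univ i)
    omega
  refine G.transcendental_q ⟨∑ i, Polynomial.X ^ (n i + M).toNat, fun h0 => ?_, ?_⟩
  · have := congrArg (Polynomial.eval 1) h0
    simp [Polynomial.eval_finsetSum] at this
  · have e : ∀ i, G.q ^ (n i + M).toNat = G.q ^ n i * G.q ^ M := by
      intro i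
      rw [← zpow_natCast, Int.toNat_of_nonneg (hM i), zpow_add₀ G.q_ne_zero, zpow_natCast]
    simp [e, ← Finset.sum_mul, h]

/-- The nonzero entries of `C`. -/
def cEntry (i : Fin G.N) : ℂ := G.epsAt i * G.sqrtq ^ (-G.twoRho i)

lemma Cmat_apply (i j : Fin G.N) : G.Cmat i j = if j = i.rev then G.cEntry i else 0 := rfl

lemma even_of_kind_eq_Sp (h : G.kind = .Sp) : Even G.N := by
  have := G.validRank
  rw [h] at this
  exact this.2

lemma twoRho_rev (i : Fin G.N) : G.twoRho i.rev = -G.twoRho i := by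
  have hi := i.isLt
  unfold twoRho
  rw [Fin.val_rev]
  by_cases h : G.kind = .Sp
  · obtain ⟨m, hm⟩ := G.even_of_kind_eq_Sp h
    simp only [h, if_true]
    split_ifs <;> omega
  · simp only [h, if_false]
    split_ifs <;> omega

lemma epsAt_mul_epsAt_rev (i : Fin G.N) : G.epsAt i * G.epsAt i.rev = G.eps := by
  have hi := i.isLt
  unfold epsAt eps
  rw [Fin.val_rev]
  by_cases h : G.kind = .Sp
  · obtain ⟨m, hm⟩ := G.even_of_kind_eq_Sp h
    simp only [h, if_true, true_and]
    split_ifs <;> first | (exfalso; omega) | norm_num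
  · simp [h]

lemma eps_mul_eps : G.eps * G.eps = 1 := by unfold eps; split_ifs <;> norm_num

lemma epsAt_mul_epsAt (i : Fin G.N) : G.epsAt i * G.epsAt i = 1 := by
  unfold epsAt; split_ifs <;> norm_num

lemma cEntry_mul_cEntry_rev (i : Fin G.N) : G.cEntry i * G.cEntry i.rev = G.eps := by
  unfold cEntry
  rw [mul_mul_mul_comm, epsAt_mul_epsAt_rev, ← zpow_add₀ G.sqrtq_ne_zero, twoRho_rev]
  simp

/-- `C` is antidiagonal, and opposite entries multiply to `ε`. -/
lemma Cmat_inv : G.Cmat⁻¹ = G.eps • G.Cmat := by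
  apply Matrix.inv_eq_right_inv
  ext i k
  rw [Matrix.mul_apply, Finset.sum_eq_single i.rev]
  · by_cases h : k = i
    · subst h
      simp only [Matrix.smul_apply, Cmat_apply, Fin.rev_rev, if_true, smul_eq_mul,
        Matrix.one_apply_eq]
      rw [mul_left_comm, cEntry_mul_cEntry_rev, eps_mul_eps]
    · simp [Cmat_apply, h, Ne.symm h]
  · intro b _ hb
    simp [Cmat_apply, hb]
  · simp

lemma d_inv_of_typeA (h : G.IsTypeA) (i : Fin G.N) :
    (G.d i)⁻¹ = G.q ^ (2 * (i : ℤ) + 1 - G.N) := by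
  simp only [d, h, if_true]
  rw [← zpow_neg]; congr 1; ring

lemma d_of_not_typeA (h : ¬ G.IsTypeA) (i : Fin G.N) :
    G.d i = G.eps * (G.cEntry i.rev * G.cEntry i.rev) := by
  simp only [d, h, if_false, Cmat_inv]
  rw [Matrix.mul_apply, Finset.sum_eq_single i.rev]
  · simp [Cmat_apply]; ring
  · intro b _ hb
    have : i ≠ b.rev := fun h => hb (by rw [h, Fin.rev_rev])
    simp [Cmat_apply, this]
  · simp

lemma d_inv_of_not_typeA (h : ¬ G.IsTypeA) (i : Fin G.N) :
    (G.d i)⁻¹ = G.eps * (G.cEntry i * G.cEntry i) := by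
  apply inv_eq_of_mul_eq_one_right
  rw [d_of_not_typeA G h]
  calc _ = (G.eps * G.eps) * ((G.cEntry i * G.cEntry i.rev) * (G.cEntry i * G.cEntry i.rev)) := by
        ring
    _ = 1 := by rw [cEntry_mul_cEntry_rev, eps_mul_eps, one_mul]

/-- In the types B, C, D one has `d_i = ε q^{2ρ_i}`: the square roots of `q` occur squared. A common
factor times integral powers of `q` is what `sum_zpow_ne_zero` needs. -/
lemma exists_d_eq : ∃ (s : ℂ) (n : Fin G.N → ℤ), s ≠ 0 ∧ ∀ i, G.d i = s * G.q ^ n i := by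
  by_cases h : G.IsTypeA
  · exact ⟨1, fun i => (G.N : ℤ) - 1 - 2 * (i : ℕ), one_ne_zero, fun i => by simp [d, h]⟩
  · refine ⟨G.eps, fun i => G.twoRho i, fun h0 => ?_, fun i => ?_⟩
    · have := G.eps_mul_eps
      simp [h0] at this
    · rw [d_of_not_typeA G h, cEntry, mul_mul_mul_comm, epsAt_mul_epsAt, one_mul, twoRho_rev,
        neg_neg, ← mul_zpow, ← sq, G.sqrtq_sq]

lemma d_ne_zero (i : Fin G.N) : G.d i ≠ 0 := by
  obtain ⟨s, n, hs, hn⟩ := G.exists_d_eq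
  rw [hn]
  exact mul_ne_zero hs (zpow_ne_zero _ G.q_ne_zero)

lemma trD_ne_zero : G.trD ≠ 0 := by
  obtain ⟨s, n, hs, hn⟩ := G.exists_d_eq
  have : Nonempty (Fin G.N) := ⟨⟨0, N_pos⟩⟩
  simp only [trD, hn, ← Finset.mul_sum]
  exact mul_ne_zero hs (G.sum_zpow_ne_zero n)

end Scalars

/-! ### Antipode relations for the fundamental matrix. -/

section Matrices

variable {G : QuantumGroup}

lemma isCorepMatrix_u : IsCorepMatrix G.u where
  comul i j := by rw [comul_eq, comulHom_u]
  counit i j := by rw [counit_eq, counitHom_u]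

lemma antipode_eq_of_mul_eq_one {V : Matrix (Fin G.N) (Fin G.N) G.Alg} (h : G.u * V = 1) :
    G.u.map (antipode ℂ) = V := by
  calc _ = G.u.map (antipode ℂ) * (G.u * V) := by rw [h, mul_one]
    _ = V := by rw [← mul_assoc, isCorepMatrix_u.map_antipode_mul, one_mul]

lemma sum_cEntry_u_mul_u (h : ¬ G.IsTypeA) (i j : Fin G.N) :
    ∑ k, G.cEntry k • (G.u i k * G.u j k.rev) = if j = i.rev then G.cEntry i • 1 else 0 := by
  have e := sat_u _ _ (Rel.metric h i j)
  simp only [Cmat_apply, ite_smul, zero_smul, Finset.sum_ite_eq', Finset.sum_ite_eq,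
    Finset.mem_univ, if_true] at e
  rw [e, Algebra.algebraMap_eq_smul_one]
  split_ifs <;> simp

lemma sum_cEntry_u_mul_u' (h : ¬ G.IsTypeA) (k l : Fin G.N) :
    ∑ i, G.cEntry i • (G.u i k * G.u i.rev l) = if l = k.rev then G.cEntry k • 1 else 0 := by
  have e := sat_u _ _ (Rel.metric' h k l)
  have e2 := congrArg (G.eps • ·) e
  simp only [Cmat_inv, Matrix.smul_apply, Cmat_apply, smul_eq_mul, mul_ite, mul_zero, ite_smul,
    zero_smul, Finset.sum_ite_eq', Finset.sum_ite_eq, Finset.mem_univ, if_true, Finset.smul_sum,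
    smul_smul, ← mul_assoc, eps_mul_eps, one_mul] at e2
  rw [e2, Algebra.algebraMap_eq_smul_one, smul_smul]
  split_ifs
  · rw [← mul_assoc, eps_mul_eps, one_mul]
  · simp

/-- This is `S(u) = C uᵗ C⁻¹` in entries. It suffices that the right-hand side is a right inverse of
`u`. -/
lemma antipode_u_of_not_typeA (h : ¬ G.IsTypeA) (l i : Fin G.N) :
    antipode ℂ (G.u l i) = (G.eps * (G.cEntry l * G.cEntry i.rev)) • G.u i.rev l.rev := by
  have e : G.u * Matrix.of (fun l i : Fin G.N => (G.eps * (G.cEntry l * G.cEntry i.rev)) • G.u i.rev l.rev)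
      = 1 := by
    ext m i
    have : ∀ l, G.u m l * ((G.eps * (G.cEntry l * G.cEntry i.rev)) • G.u i.rev l.rev)
        = (G.eps * G.cEntry i.rev) • (G.cEntry l • (G.u m l * G.u i.rev l.rev)) := by
      intro l
      rw [mul_smul_comm, smul_smul]; congr 1; ring
    simp only [Matrix.mul_apply, Matrix.of_apply, this, ← Finset.smul_sum, sum_cEntry_u_mul_u h,
      Fin.rev_inj, Matrix.one_apply]
    by_cases hi : i = m
    · subst hi
      simp only [if_true, smul_smul]
      rw [mul_assoc, mul_comm (G.cEntry i.rev), cEntry_mul_cEntry_rev, eps_mul_eps, one_smul]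
    · simp [hi, Ne.symm hi]
  exact congrFun (congrFun (antipode_eq_of_mul_eq_one e) l) i

/-- As `S(u)` is `u` with reversed indices and scalar weights, the factors `d_i⁻¹ = ε c_i²` reduce
the sum to the second metric relation. -/
lemma sum_d_inv_u_mul_antipode_of_not_typeA (h : ¬ G.IsTypeA) (k l : Fin G.N) :
    ∑ i, (G.d i)⁻¹ • (G.u i k * antipode ℂ (G.u l i)) = if k = l then (G.d k)⁻¹ • 1 else 0 := by
  have : ∀ i, (G.d i)⁻¹ • (G.u i k * antipode ℂ (G.u l i))
      = (G.eps * G.cEntry l) • (G.cEntry i • (G.u i k * G.u i.rev l.rev)) := by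
    intro i
    rw [antipode_u_of_not_typeA h, d_inv_of_not_typeA G h, mul_smul_comm, smul_smul, smul_smul]
    congr 1
    calc _ = (G.eps * G.eps) * (G.cEntry i * G.cEntry l) * (G.cEntry i * G.cEntry i.rev) := by ring
      _ = _ := by rw [cEntry_mul_cEntry_rev, eps_mul_eps]; ring
  simp only [this, ← Finset.smul_sum, sum_cEntry_u_mul_u' h, Fin.rev_inj]
  by_cases hk : k = l
  · subst hk
    simp only [if_true, smul_smul, d_inv_of_not_typeA G h, mul_assoc]
  · simp [hk, Ne.symm hk]

/-- A row of `R̂` has at most two nonzero entries, which keeps the type A relations manageable. -/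
lemma sum_Rhat_left_of_typeA (h : G.IsTypeA) {M : Type*} [AddCommGroup M] [Module ℂ M]
    (F : Fin G.N × Fin G.N → M) (i j : Fin G.N) :
    ∑ p, G.Rhat (i, j) p • F p
      = (if i = j then G.q else 1) • F (j, i) + (if i < j then G.q - G.q⁻¹ else 0) • F (i, j) := by
  have e : ∀ p, G.Rhat (i, j) p = (if p = (j, i) then (if i = j then G.q else 1) else 0)
      + (if p = (i, j) then (if i < j then G.q - G.q⁻¹ else 0) else 0) := by
    rintro ⟨a, b⟩
    simp only [Rhat, Matrix.of_apply, Rmat, h, if_true, Prod.mk.injEq]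
    congr 1
    · exact if_congr (and_congr eq_comm eq_comm) (if_congr eq_comm rfl rfl) rfl
    · rw [← ite_and]
      refine if_congr ?_ rfl rfl
      constructor
      · rintro ⟨h1, rfl, rfl⟩; exact ⟨⟨rfl, rfl⟩, h1⟩
      · rintro ⟨⟨rfl, rfl⟩, h1⟩; exact ⟨h1, rfl, rfl⟩
  simp [e, add_smul, Finset.sum_add_distrib, ite_smul]

lemma sum_Rhat_right_of_typeA (h : G.IsTypeA) {M : Type*} [AddCommGroup M] [Module ℂ M]
    (F : Fin G.N × Fin G.N → M) (k l : Fin G.N) :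
    ∑ p, G.Rhat p (k, l) • F p
      = (if k = l then G.q else 1) • F (l, k) + (if k < l then G.q - G.q⁻¹ else 0) • F (k, l) := by
  have e : ∀ p, G.Rhat p (k, l) = (if p = (l, k) then (if k = l then G.q else 1) else 0)
      + (if p = (k, l) then (if k < l then G.q - G.q⁻¹ else 0) else 0) := by
    rintro ⟨a, b⟩
    simp only [Rhat, Matrix.of_apply, Rmat, h, if_true, Prod.mk.injEq]
    congr 1
    · by_cases hab : b = k ∧ a = l
      · obtain ⟨rfl, rfl⟩ := hab; simp
      · rw [if_neg hab, if_neg (by rwa [and_comm])]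
    · rw [← ite_and]
      refine if_congr ?_ rfl rfl
      constructor
      · rintro ⟨h1, rfl, rfl⟩; exact ⟨⟨rfl, rfl⟩, h1⟩
      · rintro ⟨⟨rfl, rfl⟩, h1⟩; exact ⟨h1, rfl, rfl⟩
  simp [e, add_smul, Finset.sum_add_distrib, ite_smul]

lemma rtt_of_typeA (h : G.IsTypeA) (i j k l : Fin G.N) :
    (if i = j then G.q else 1) • (G.u j k * G.u i l)
        + (if i < j then G.q - G.q⁻¹ else 0) • (G.u i k * G.u j l)
      = (if k = l then G.q else 1) • (G.u i l * G.u j k)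
        + (if k < l then G.q - G.q⁻¹ else 0) • (G.u i k * G.u j l) := by
  have e := sat_u _ _ (Rel.rtt (G := G) (u := G.u) (t := G.t) (i, j) (k, l))
  simp only [Matrix.mul_apply, Matrix.map_apply, ← Algebra.commutes (R := ℂ),
    ← Algebra.smul_def] at e
  rw [sum_Rhat_left_of_typeA h (fun p => pairMat G.u p (k, l)),
    sum_Rhat_right_of_typeA h (fun p => pairMat G.u (i, j) p)] at e
  exact e

/-- The exchange relation between `u` and `S(u)` in type A. -/
lemma antipode_mul_u_exchange_of_typeA (h : G.IsTypeA) (x j k y : Fin G.N) :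
    (if y = j then G.q else 1) • (antipode ℂ (G.u x y) * G.u j k)
        + (if y = j then ∑ i, (if i < j then G.q - G.q⁻¹ else 0) • (antipode ℂ (G.u x i) * G.u i k)
          else 0)
      = (if k = x then G.q else 1) • (G.u j k * antipode ℂ (G.u x y))
        + (if k = x then ∑ l, (if k < l then G.q - G.q⁻¹ else 0) • (G.u j l * antipode ℂ (G.u l y))
          else 0) := by
  -- Multiply the `R̂uu` relation by `S(u^x_i)` on the left and `S(u^l_y)` on the right and sum. In
  -- every term one of the two cancels a factor `u`.
  have e : ∑ i, ∑ l, antipode ℂ (G.u x i) * ((if i = j then G.q else 1) • (G.u j k * G.u i l)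
        + (if i < j then G.q - G.q⁻¹ else 0) • (G.u i k * G.u j l)) * antipode ℂ (G.u l y)
      = ∑ l, ∑ i, antipode ℂ (G.u x i) * ((if k = l then G.q else 1) • (G.u i l * G.u j k)
        + (if k < l then G.q - G.q⁻¹ else 0) • (G.u i k * G.u j l)) * antipode ℂ (G.u l y) := by
    rw [Finset.sum_comm]
    simp only [rtt_of_typeA h]
  have uS : ∀ i, ∑ l, G.u i l * antipode ℂ (G.u l y) = if i = y then 1 else 0 :=
    fun i => isCorepMatrix_u.mul_antipode i y
  have Su : ∀ l, ∑ i, antipode ℂ (G.u x i) * G.u i l = if x = l then 1 else 0 :=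
    fun l => isCorepMatrix_u.antipode_mul x l
  have e1 : ∀ i, ∑ l, antipode ℂ (G.u x i) * ((if i = j then G.q else 1) • (G.u j k * G.u i l)
        + (if i < j then G.q - G.q⁻¹ else 0) • (G.u i k * G.u j l)) * antipode ℂ (G.u l y)
      = (if i = y then (if i = j then G.q else 1) • (antipode ℂ (G.u x i) * G.u j k) else 0)
        + (if j = y then (if i < j then G.q - G.q⁻¹ else 0) • (antipode ℂ (G.u x i) * G.u i k)
          else 0) := by
    intro i
    have : ∀ l, antipode ℂ (G.u x i) * ((if i = j then G.q else 1) • (G.u j k * G.u i l)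
        + (if i < j then G.q - G.q⁻¹ else 0) • (G.u i k * G.u j l)) * antipode ℂ (G.u l y)
        = (if i = j then G.q else 1) • (antipode ℂ (G.u x i) * G.u j k)
            * (G.u i l * antipode ℂ (G.u l y))
          + (if i < j then G.q - G.q⁻¹ else 0) • (antipode ℂ (G.u x i) * G.u i k)
            * (G.u j l * antipode ℂ (G.u l y)) := by
      intro l
      simp only [mul_add, add_mul, mul_smul_comm, smul_mul_assoc, mul_assoc]
    simp only [this, Finset.sum_add_distrib, ← Finset.mul_sum, uS, mul_ite, mul_one, mul_zero]
  have e2 : ∀ l, ∑ i, antipode ℂ (G.u x i) * ((if k = l then G.q else 1) • (G.u i l * G.u j k)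
        + (if k < l then G.q - G.q⁻¹ else 0) • (G.u i k * G.u j l)) * antipode ℂ (G.u l y)
      = (if x = l then (if k = l then G.q else 1) • (G.u j k * antipode ℂ (G.u l y)) else 0)
        + (if x = k then (if k < l then G.q - G.q⁻¹ else 0) • (G.u j l * antipode ℂ (G.u l y))
          else 0) := by
    intro l
    have : ∀ i, antipode ℂ (G.u x i) * ((if k = l then G.q else 1) • (G.u i l * G.u j k)
        + (if k < l then G.q - G.q⁻¹ else 0) • (G.u i k * G.u j l)) * antipode ℂ (G.u l y)
        = (antipode ℂ (G.u x i) * G.u i l) *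
            (if k = l then G.q else 1) • (G.u j k * antipode ℂ (G.u l y))
          + (antipode ℂ (G.u x i) * G.u i k) *
            (if k < l then G.q - G.q⁻¹ else 0) • (G.u j l * antipode ℂ (G.u l y)) := by
      intro i
      simp only [mul_add, add_mul, mul_smul_comm, smul_mul_assoc, mul_assoc]
    simp only [this, Finset.sum_add_distrib, ← Finset.sum_mul, Su, ite_mul, one_mul, zero_mul]
  simp only [e1, e2, Finset.sum_add_distrib, Finset.sum_ite_eq, Finset.sum_ite_eq',
    Finset.mem_univ, if_true] at e
  have e3 : ∀ (P : Prop) [Decidable P] (f : Fin G.N → G.Alg),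
      ∑ i, (if P then f i else 0) = if P then ∑ i, f i else 0 := by
    intro P _ f; split_ifs <;> simp
  simp only [e3] at e
  simp only [eq_comm (a := j) (b := y), eq_comm (a := x) (b := k)] at e
  exact e

lemma sum_d_inv_of_typeA (h : G.IsTypeA) (k : Fin G.N) :
    G.q * (G.d k)⁻¹ + ∑ j, (if k < j then G.q - G.q⁻¹ else 0) * (G.d j)⁻¹
      = G.q ^ (G.N : ℤ) := by
  have hq := G.q_ne_zero
  -- The sum telescopes: `q^{2j+1-N} (q - q⁻¹)` is the increment of `q^{2j-N}`. Below `k + 1` the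
  -- function is constant, with the value `q d_k⁻¹`.
  let F : ℕ → ℂ := fun j => if (k : ℕ) < j then G.q ^ (2 * (j : ℤ) - G.N) else
    G.q ^ (2 * ((k : ℕ) + 1 : ℤ) - G.N)
  have e : ∀ j : Fin G.N, (if k < j then G.q - G.q⁻¹ else 0) * (G.d j)⁻¹ = F (j + 1) - F j := by
    intro j
    rw [d_inv_of_typeA G h]
    simp only [F]
    rcases lt_trichotomy (k : ℕ) (j : ℕ) with hkj | hkj | hkj
    · rw [if_pos (Fin.lt_def.mpr hkj), if_pos (by omega), if_pos hkj]
      have h1 : (2 * ((j : ℕ) + 1 : ℕ) - G.N : ℤ) = (2 * (j : ℤ) + 1 - G.N) + 1 := by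
        push_cast; ring
      have h2 : (2 * ((j : ℕ) : ℤ) - G.N : ℤ) = (2 * (j : ℤ) + 1 - G.N) - 1 := by ring
      rw [h1, h2, zpow_add_one₀ hq, zpow_sub_one₀ hq]; ring
    · have : k = j := Fin.ext hkj
      subst this
      simp
    · rw [if_neg (by rw [Fin.lt_def]; omega), if_neg (by omega), if_neg (by omega)]; simp
  simp only [e]
  rw [Fin.sum_univ_eq_sum_range (fun j => F (j + 1) - F j), Finset.sum_range_sub,
    d_inv_of_typeA G h]
  have hk := k.isLt
  simp only [F]
  rw [if_pos hk, if_neg (by omega), ← zpow_one_add₀ hq]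
  have h1 : (1 + (2 * ((k : ℕ) : ℤ) + 1 - G.N) : ℤ) = 2 * ((k : ℕ) + 1 : ℤ) - G.N := by ring
  have h2 : (2 * (G.N : ℤ) - G.N : ℤ) = G.N := by ring
  rw [h1, h2]; ring

lemma sum_d_inv_u_mul_antipode_of_typeA (h : G.IsTypeA) (k x : Fin G.N) :
    ∑ i, (G.d i)⁻¹ • (G.u i k * antipode ℂ (G.u x i)) = if k = x then (G.d k)⁻¹ • 1 else 0 := by
  have hq := G.q_ne_zero
  let Y : Fin G.N → Fin G.N → G.Alg :=
    fun k x => ∑ i, (G.d i)⁻¹ • (G.u i k * antipode ℂ (G.u x i))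
  -- The exchange relation with `y = j`, weighted by `d_j⁻¹` and summed over `j`. On the left the
  -- antipode axiom and the telescoping sum leave `δ_{kx} q^N`; on the right a triangular system for
  -- `Y` appears.
  have key : ∀ k x, (if k = x then G.q else 1) • Y k x
      + (if k = x then ∑ l, (if k < l then G.q - G.q⁻¹ else 0) • Y l l else 0)
      = if k = x then G.q ^ (G.N : ℤ) • 1 else 0 := by
    intro k x
    have e := Finset.sum_congr (rfl : Finset.univ = Finset.univ) fun j _ =>
      congrArg ((G.d j)⁻¹ • ·) (antipode_mul_u_exchange_of_typeA h x j k j)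
    simp only [if_true, smul_add, Finset.sum_add_distrib] at e
    have r1 : ∑ j, (G.d j)⁻¹ • (if k = x then G.q else 1) • (G.u j k * antipode ℂ (G.u x j))
        = (if k = x then G.q else 1) • Y k x := by
      simp only [Y, Finset.smul_sum, smul_smul, mul_comm]
    have r2 : ∑ j, (G.d j)⁻¹ • (if k = x then ∑ l, (if k < l then G.q - G.q⁻¹ else 0) •
        (G.u j l * antipode ℂ (G.u l j)) else 0)
        = if k = x then ∑ l, (if k < l then G.q - G.q⁻¹ else 0) • Y l l else 0 := by
      split_ifs
      · simp only [Y, Finset.smul_sum]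
        rw [Finset.sum_comm]
        refine Finset.sum_congr rfl fun l _ => Finset.sum_congr rfl fun j _ => ?_
        rw [smul_comm]
      · simp
    have l1 : ∑ j, (G.d j)⁻¹ • G.q • (antipode ℂ (G.u x j) * G.u j k)
        + ∑ j, (G.d j)⁻¹ • ∑ i, (if i < j then G.q - G.q⁻¹ else 0) •
          (antipode ℂ (G.u x i) * G.u i k)
        = if k = x then G.q ^ (G.N : ℤ) • 1 else 0 := by
      simp only [Finset.smul_sum]
      rw [Finset.sum_comm (γ := Fin G.N), ← Finset.sum_add_distrib]
      simp only [smul_smul, ← Finset.sum_smul, ← add_smul]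
      have : ∀ i, ((G.d i)⁻¹ * G.q + ∑ j, (G.d j)⁻¹ * (if i < j then G.q - G.q⁻¹ else 0))
          = G.q ^ (G.N : ℤ) := by
        intro i
        rw [← sum_d_inv_of_typeA h i]
        simp only [mul_comm]
      simp only [this, ← Finset.smul_sum, isCorepMatrix_u.antipode_mul]
      simp only [eq_comm (a := x)]
      split_ifs <;> simp
    rw [r1, r2, l1] at e
    exact e.symm
  change Y k x = _
  by_cases hkx : k = x
  · subst hkx
    simp only [if_true]
    -- The equation for `Y k k` involves only `Y l l` with `l > k`, so the system is solved from the
    -- last index downwards; the numbers `d_k⁻¹` solve the same system by `sum_d_inv_of_typeA`.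
    induction' hn : G.N - (k : ℕ) using Nat.strong_induction_on with n ih generalizing k
    have e := key k k
    simp only [if_true] at e
    have e2 : ∑ l, (if k < l then G.q - G.q⁻¹ else 0) • Y l l
        = (∑ l, (if k < l then G.q - G.q⁻¹ else 0) * (G.d l)⁻¹) • (1 : G.Alg) := by
      rw [Finset.sum_smul]
      refine Finset.sum_congr rfl fun l _ => ?_
      split_ifs with hl
      · have hl' := Fin.lt_def.mp hl
        have := l.isLt
        rw [ih (G.N - (l : ℕ)) (by omega) l rfl, smul_smul]
      · simp
    rw [e2, ← sum_d_inv_of_typeA h k, add_smul] at e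
    have e3 := add_right_cancel e
    rw [mul_smul] at e3
    exact smul_right_injective _ hq e3
  · have e := key k x
    simp only [hkx, if_false, add_zero, one_smul] at e
    simp only [hkx, if_false, e]

lemma sum_d_inv_u_mul_antipode (k l : Fin G.N) :
    ∑ i, (G.d i)⁻¹ • (G.u i k * antipode ℂ (G.u l i)) = if k = l then (G.d k)⁻¹ • 1 else 0 := by
  by_cases h : G.IsTypeA
  · exact sum_d_inv_u_mul_antipode_of_typeA h k l
  · exact sum_d_inv_u_mul_antipode_of_not_typeA h k l

/-- The square of the antipode is implemented by `D`. -/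
lemma antipode_antipode_u (i j : Fin G.N) :
    antipode ℂ (antipode ℂ (G.u i j)) = (G.d j * (G.d i)⁻¹) • G.u i j := by
  let w : Matrix (Fin G.N) (Fin G.N) G.Alg := Matrix.of fun i j => antipode ℂ (G.u j i)
  have hw : IsCorepMatrix w := isCorepMatrix_u.contragredient
  -- `P` is the claimed value of `S²(u)`, transposed. It is a left inverse of the contragredient
  -- matrix `w`, whose inverse is `S(w)`.
  let P : Matrix (Fin G.N) (Fin G.N) G.Alg := Matrix.of fun k i => (G.d k * (G.d i)⁻¹) • G.u i k
  have h1 : P * w = 1 := by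
    ext k l
    simp only [Matrix.mul_apply, P, w, Matrix.of_apply, smul_mul_assoc, mul_smul,
      ← Finset.smul_sum, sum_d_inv_u_mul_antipode, Matrix.one_apply]
    split_ifs
    · rw [smul_smul, mul_inv_cancel₀ (G.d_ne_zero k), one_smul]
    · simp
  have h2 : P = w.map (antipode ℂ) := by
    calc P = P * (w * w.map (antipode ℂ)) := by rw [hw.mul_map_antipode, mul_one]
      _ = _ := by rw [← mul_assoc, h1, one_mul]
  exact (congrFun (congrFun h2 j) i).symm

end Matrices

end QuantumGroup

end

noncomputable section

/-! ## The bimodules `Γ_±` and their metrics -/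

namespace QuantumGroup

open HopfAlgebra Coalgebra

variable {G : QuantumGroup} {x y : ℂ} (rx : G.RForm x) (ry : G.RForm y)

/-- The contragredient of the fundamental corepresentation. -/
def uContra (G : QuantumGroup) : Matrix (Fin G.N) (Fin G.N) G.Alg :=
  Matrix.of fun i j => antipode ℂ (G.u j i)

lemma isCorepMatrix_uContra : IsCorepMatrix G.uContra := isCorepMatrix_u.contragredient

/-- Splitting into two one-sided bimodules reduces all bimodule axioms to those of the two r-forms.
-/
lemma Gamma_plus : Gamma rx ry .plus
    = (HopfBimod.ofLeft ry.toUniversalRForm G.u).prod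
        (HopfBimod.ofRight rx.toUniversalRForm G.u) := rfl

lemma Gamma_minus : Gamma rx ry .minus
    = (HopfBimod.ofRight rx.toUniversalRForm G.uContra).prod
        (HopfBimod.ofLeft ry.toUniversalRForm G.uContra) := rfl

lemma isBicovariant_Gamma (τ : Sgn) : (Gamma rx ry τ).IsBicovariant := by
  cases τ with
  | plus =>
    rw [Gamma_plus]
    exact (HopfBimod.isBicovariant_ofLeft _ isCorepMatrix_u).prod
      (HopfBimod.isBicovariant_ofRight _ isCorepMatrix_u)
  | minus =>
    rw [Gamma_minus]
    exact (HopfBimod.isBicovariant_ofRight _ isCorepMatrix_uContra).prod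
      (HopfBimod.isBicovariant_ofLeft _ isCorepMatrix_uContra)

/-- The antipode axiom of the contragredient matrix, with `S²` replaced by conjugation with `D`. -/
lemma sum_d_antipode_mul_u (k l : Fin G.N) :
    ∑ n, G.d n • (antipode ℂ (G.u n k) * G.u l n) = if k = l then G.d k • 1 else 0 := by
  have h := isCorepMatrix_uContra.mul_antipode k l
  simp only [uContra, Matrix.of_apply, antipode_antipode_u, mul_smul_comm, mul_comm (G.d _),
    mul_smul, ← Finset.smul_sum] at h
  have h2 := congrArg (G.d l • ·) h
  simp only [smul_smul, mul_inv_cancel₀ (G.d_ne_zero l), one_smul] at h2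
  rw [h2]
  split_ifs with hkl
  · rw [hkl]
  · simp

/-- For `ω₀⁺` this is `u S(u) = 1`; for `ω₀⁻` the weights `d_i⁻¹` cancel the scalars coming from
`S²`, with the same outcome. -/
lemma isCoinvariant_omega0 (τ : Sgn) : (Gamma rx ry τ).IsCoinvariant (G.omega0 τ) := by
  rintro ⟨i, j⟩
  cases τ with
  | plus =>
    simp only [Gamma, omega0, Matrix.of_apply, Fintype.sum_prod_type, ite_smul, one_smul,
      zero_smul, Finset.sum_ite_eq, Finset.mem_univ, if_true, isCorepMatrix_u.mul_antipode]
  | minus =>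
    have e : ∀ a, (G.d a)⁻¹ • (antipode ℂ (antipode ℂ (G.u i a)) * antipode ℂ (G.u a j))
        = (G.d i)⁻¹ • (G.u i a * antipode ℂ (G.u a j)) := by
      intro a
      rw [antipode_antipode_u, smul_mul_assoc, smul_smul, ← mul_assoc,
        inv_mul_cancel₀ (G.d_ne_zero a), one_mul]
    simp only [Gamma, omega0, Matrix.of_apply, Fintype.sum_prod_type, ite_smul,
      zero_smul, Finset.sum_ite_eq, Finset.mem_univ, if_true, e, ← Finset.smul_sum,
      isCorepMatrix_u.mul_antipode]
    split_ifs <;> simp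

/-- Sums weighted by the metrics. -/
lemma sum_metric {M : Type*} [AddCommGroup M] [Module ℂ M] (c : Fin G.N → Fin G.N → ℂ)
    (F : Fin G.N × Fin G.N → Fin G.N × Fin G.N → M) :
    ∑ p : Fin G.N × Fin G.N, ∑ r : Fin G.N × Fin G.N,
      (if p.2 = r.1 ∧ r.2 = p.1 then c p.1 p.2 else 0) • F p r
      = ∑ a, ∑ b, c a b • F (a, b) (b, a) := by
  rw [Fintype.sum_prod_type]
  refine Finset.sum_congr rfl fun a _ => Finset.sum_congr rfl fun b _ => ?_
  rw [Finset.sum_eq_single (b, a)]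
  · simp
  · rintro ⟨r, s⟩ _ hrs
    rw [if_neg, zero_smul]
    intro h
    exact hrs (Prod.ext h.1.symm h.2)
  · simp

/-- For the coaction the inner pair collapses by `S(u) u = 1` and the outer one by the `d`-weighted
identity. For the action, multiplicativity of the r-forms moves the same collapses into their
arguments. -/
lemma isInvariantMetric_minus :
    (Gamma rx ry .minus).IsInvariantMetric (Gamma rx ry .plus) (G.metric .minus) where
  cov := by
    rintro ⟨i, i'⟩ ⟨j, j'⟩
    simp only [metric]
    rw [sum_metric (fun _ _ => 1)]
    simp only [one_smul, Gamma, Matrix.of_apply]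
    have e : ∀ a, ∑ b, antipode ℂ (antipode ℂ (G.u a i)) * antipode ℂ (G.u i' b) *
        (G.u b j * antipode ℂ (G.u j' a))
        = if i' = j then (G.d i) • ((G.d a)⁻¹ • (G.u a i * antipode ℂ (G.u j' a))) else 0 := by
      intro a
      have : ∀ b, antipode ℂ (antipode ℂ (G.u a i)) * antipode ℂ (G.u i' b) *
          (G.u b j * antipode ℂ (G.u j' a)) = antipode ℂ (antipode ℂ (G.u a i)) *
          (antipode ℂ (G.u i' b) * G.u b j) * antipode ℂ (G.u j' a) := by
        intro b; simp only [mul_assoc]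
      simp only [this, ← Finset.sum_mul, ← Finset.mul_sum, isCorepMatrix_u.antipode_mul]
      split_ifs
      · rw [mul_one, antipode_antipode_u, smul_mul_assoc, smul_smul]
      · simp
    simp only [e]
    by_cases hij : i' = j
    · simp only [hij, if_true, ← Finset.smul_sum, sum_d_inv_u_mul_antipode, true_and]
      by_cases hji : i = j'
      · simp [hji, smul_smul, G.d_ne_zero]
      · simp [hji, Ne.symm hji]
    · simp [hij]
  inv := by
    rintro ⟨i, i'⟩ ⟨j, j'⟩
    simp only [metric]
    rw [sum_metric (fun _ _ => 1)]
    simp only [one_smul, Gamma]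
    have e : ∀ a, ∑ b, convMul (convMul (rx.form.flip (antipode ℂ (G.u a i)))
        (ry.form (antipode ℂ (G.u i' b)))) (convMul (ry.form (G.u b j)) (rx.form.flip (G.u j' a)))
        = if i' = j then rx.form.flip (G.u j' a * antipode ℂ (G.u a i)) else 0 := by
      intro a
      have : ∀ b, convMul (convMul (rx.form.flip (antipode ℂ (G.u a i)))
          (ry.form (antipode ℂ (G.u i' b)))) (convMul (ry.form (G.u b j))
            (rx.form.flip (G.u j' a)))
          = convMul (rx.form.flip (antipode ℂ (G.u a i)))
            (convMul (ry.form (antipode ℂ (G.u i' b) * G.u b j)) (rx.form.flip (G.u j' a))) := by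
        intro b
        simp only [← ry.convMul_form, convMul_assoc]
      simp only [this, ← convMul_sum, ← sum_convMul, ← map_sum, isCorepMatrix_u.antipode_mul]
      split_ifs
      · rw [ry.form_one, counit_convMul, rx.convMul_flip]
      · rw [map_zero, ← zero_smul ℂ (0 : G.Alg →ₗ[ℂ] ℂ), smul_convMul, zero_smul, ← zero_smul ℂ
          (0 : G.Alg →ₗ[ℂ] ℂ), convMul_smul, zero_smul, zero_smul]
    simp only [e]
    by_cases hij : i' = j
    · simp only [hij, if_true, ← map_sum, isCorepMatrix_u.mul_antipode, true_and]
      by_cases hji : j' = i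
      · simp [hji, rx.flip_one]
      · simp [hji]
    · simp [hij]

/-- The weights of the metric compensate `S²` in the coaction. In the action the inner product
appears as `S(u^b_j) u^{i'}_b`, so it needs the `d`-weighted identity `sum_d_antipode_mul_u`. -/
lemma isInvariantMetric_plus :
    (Gamma rx ry .plus).IsInvariantMetric (Gamma rx ry .minus) (G.metric .plus) where
  cov := by
    rintro ⟨i, i'⟩ ⟨j, j'⟩
    simp only [metric]
    rw [sum_metric (fun a b => G.d b * (G.d a)⁻¹)]
    simp only [Gamma, Matrix.of_apply]
    have e : ∀ a, ∑ b, (G.d b * (G.d a)⁻¹) • (G.u a i * antipode ℂ (G.u i' b) *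
        (antipode ℂ (antipode ℂ (G.u b j)) * antipode ℂ (G.u j' a)))
        = if i' = j then (G.d j) • ((G.d a)⁻¹ • (G.u a i * antipode ℂ (G.u j' a))) else 0 := by
      intro a
      have : ∀ b, (G.d b * (G.d a)⁻¹) • (G.u a i * antipode ℂ (G.u i' b) *
          (antipode ℂ (antipode ℂ (G.u b j)) * antipode ℂ (G.u j' a)))
          = (G.d j * (G.d a)⁻¹) • (G.u a i * (antipode ℂ (G.u i' b) * G.u b j) *
            antipode ℂ (G.u j' a)) := by
        intro b
        rw [antipode_antipode_u, smul_mul_assoc, mul_smul_comm, smul_smul]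
        simp only [mul_assoc]
        congr 1
        field_simp [G.d_ne_zero]
      simp only [this, ← Finset.smul_sum, ← Finset.sum_mul, ← Finset.mul_sum,
        isCorepMatrix_u.antipode_mul]
      split_ifs
      · rw [mul_one, smul_smul]
      · simp
    simp only [e]
    by_cases hij : i' = j
    · simp only [hij, if_true, ← Finset.smul_sum, sum_d_inv_u_mul_antipode, true_and]
      by_cases hji : i = j'
      · simp [hji, smul_smul]
      · simp [hji, Ne.symm hji]
    · simp [hij]
  inv := by
    rintro ⟨i, i'⟩ ⟨j, j'⟩
    simp only [metric]
    rw [sum_metric (fun a b => G.d b * (G.d a)⁻¹)]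
    simp only [Gamma]
    have e : ∀ a, ∑ b, (G.d b * (G.d a)⁻¹) • convMul (convMul (ry.form (G.u a i))
        (rx.form.flip (G.u i' b))) (convMul (rx.form.flip (antipode ℂ (G.u b j)))
          (ry.form (antipode ℂ (G.u j' a))))
        = if i' = j then G.d j • ry.form ((G.d a)⁻¹ • (G.u a i * antipode ℂ (G.u j' a)))
          else 0 := by
      intro a
      have : ∀ b, (G.d b * (G.d a)⁻¹) • convMul (convMul (ry.form (G.u a i))
          (rx.form.flip (G.u i' b))) (convMul (rx.form.flip (antipode ℂ (G.u b j)))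
            (ry.form (antipode ℂ (G.u j' a))))
          = (G.d a)⁻¹ • convMul (ry.form (G.u a i))
            (convMul (rx.form.flip (G.d b • (antipode ℂ (G.u b j) * G.u i' b)))
              (ry.form (antipode ℂ (G.u j' a)))) := by
        intro b
        rw [map_smul, ← rx.convMul_flip, smul_convMul, convMul_smul, smul_smul, mul_comm]
        simp only [convMul_assoc]
      simp only [this, ← Finset.smul_sum, ← convMul_sum, ← sum_convMul, ← map_sum,
        sum_d_antipode_mul_u]
      by_cases hij : j = i'
      · rw [if_pos hij, if_pos hij.symm, map_smul, rx.flip_one, smul_convMul, counit_convMul,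
          convMul_smul, ry.convMul_form, map_smul, smul_comm]
      · rw [if_neg hij, if_neg (Ne.symm hij), map_zero, ← zero_smul ℂ (0 : G.Alg →ₗ[ℂ] ℂ),
          smul_convMul, zero_smul, ← zero_smul ℂ (0 : G.Alg →ₗ[ℂ] ℂ), convMul_smul, zero_smul,
          zero_smul, smul_zero]
    simp only [e]
    by_cases hij : i' = j
    · simp only [hij, if_true, ← Finset.smul_sum, ← map_sum, sum_d_inv_u_mul_antipode, true_and]
      by_cases hji : i = j'
      · simp [hji, smul_smul, ry.form_one]
      · simp [hji, Ne.symm hji]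
    · simp [hij]

lemma isInvariantMetric_metric (τ : Sgn) :
    (Gamma rx ry τ).IsInvariantMetric (Gamma rx ry (-τ)) (G.metric τ) := by
  cases τ with
  | plus => exact isInvariantMetric_plus rx ry
  | minus => exact isInvariantMetric_minus rx ry

/-- The covector `g(·, ω₀^{-τ})` has exactly the coefficients with which `X₀^τ` is formed; this
links the Casimir functional with `𝔰 X₀^τ`. -/
lemma contr_metric (τ : Sgn) (p : Fin G.N × Fin G.N) :
    HopfBimod.contr (G.metric τ) (G.omega0 (-τ)) p
      = if p.1 = p.2 then (match τ with | .plus => (G.d p.1)⁻¹ | .minus => 1) else 0 := by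
  obtain ⟨a, b⟩ := p
  rw [HopfBimod.contr, Finset.sum_eq_single (b, a)]
  · by_cases hab : a = b
    · subst hab
      cases τ
      · change G.omega0 .minus (a, a) * G.metric .plus (a, a) (a, a) = _
        simp [omega0, metric, G.d_ne_zero]
      · change G.omega0 .plus (a, a) * G.metric .minus (a, a) (a, a) = _
        simp [omega0, metric]
    · rw [if_neg hab]
      cases τ
      · change G.omega0 .minus (b, a) * _ = _
        simp [omega0, Ne.symm hab]
      · change G.omega0 .plus (b, a) * _ = _
        simp [omega0, Ne.symm hab]
  · rintro ⟨r, s⟩ _ hrs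
    have : ¬ (b = r ∧ s = a) := by
      rintro ⟨rfl, rfl⟩; exact hrs rfl
    cases τ <;> simp [metric, this]
  · simp

/-- The functional `𝔰 X₀^τ`. -/
lemma trD_smul_X0 (τ : Sgn) :
    G.trD • X0 rx ry τ
      = (Gamma rx ry τ).casimir (G.omega0 τ) (HopfBimod.contr (G.metric τ) (G.omega0 (-τ)))
        - (Gamma rx ry τ).casimir (G.omega0 τ) (HopfBimod.contr (G.metric τ) (G.omega0 (-τ))) 1
          • counit := by
  have e : ∀ c, (Gamma rx ry τ).casimir (G.omega0 τ) c
      - (Gamma rx ry τ).casimir (G.omega0 τ) c 1 • counit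
      = ∑ j, c j • (Gamma rx ry τ).X (G.omega0 τ) j := by
    intro c
    rw [(isBicovariant_Gamma rx ry τ).casimir_one]
    simp only [HopfBimod.casimir, HopfBimod.X, HopfBimod.coinvFun, smul_sub,
      Finset.sum_sub_distrib, smul_smul, Finset.sum_smul]
  rw [e]
  simp only [contr_metric, Fintype.sum_prod_type, ite_smul, zero_smul, Finset.sum_ite_eq,
    Finset.mem_univ, if_true]
  cases τ <;> simp [X0, smul_smul, mul_inv_cancel₀ G.trD_ne_zero]

lemma isCentral_casimir (τ : Sgn) : IsCentralFunctional ((Gamma rx ry τ).casimir (G.omega0 τ)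
    (HopfBimod.contr (G.metric τ) (G.omega0 (-τ)))) :=
  (isBicovariant_Gamma rx ry τ).isCentral_casimir (isCoinvariant_omega0 rx ry τ)
    ((isInvariantMetric_metric rx ry τ).contr_v (isCoinvariant_omega0 rx ry (-τ)))

/-- The eigenvalue equation which determines `E^τ_α`. -/
lemma E_spec (τ : Sgn) (α : Irrep G.Alg) {a : G.Alg} (ha : a ∈ α.coeff) :
    G.trD • lstar (X0 rx ry τ) a = E rx ry τ α • a := by
  -- The Casimir functional is central, so Schur's lemma provides the scalar and excludes the
  -- default value `0` of `E`.
  have h : ∃ e : ℂ, ∀ a ∈ α.coeff, G.trD • lstar (X0 rx ry τ) a = e • a := by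
    obtain ⟨e, he⟩ := MatrixCorep.exists_eigenvalue α.rep_isIrreducible
      (isCentral_casimir rx ry τ)
    refine ⟨e - (Gamma rx ry τ).casimir (G.omega0 τ)
      (HopfBimod.contr (G.metric τ) (G.omega0 (-τ))) 1, fun a ha => ?_⟩
    rw [← lstar_smul, trD_smul_X0, lstar_sub, lstar_smul, lstar_counit, he a ha, sub_smul]
  rw [E, dif_pos h]
  exact h.choose_spec a ha

/-- Applying the counit to the eigenvalue equation expresses the functional itself, restricted to
one coalgebra, as a multiple of `ε`. -/
lemma casimir_sub_apply (τ : Sgn) (α : Irrep G.Alg) {a : G.Alg} (ha : a ∈ α.coeff) :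
    ((Gamma rx ry τ).casimir (G.omega0 τ) (HopfBimod.contr (G.metric τ) (G.omega0 (-τ)))
        - (Gamma rx ry τ).casimir (G.omega0 τ) (HopfBimod.contr (G.metric τ) (G.omega0 (-τ))) 1
          • counit : G.Alg →ₗ[ℂ] ℂ) a = E rx ry τ α * counit (R := ℂ) a := by
  have h := congrArg (counit (R := ℂ)) (E_spec rx ry τ α ha)
  rw [← lstar_smul, trD_smul_X0, counit_lstar, map_smul] at h
  exact h

lemma laplace_eq (τ s : Sgn) (k : ℕ) :
    laplace rx ry τ s k = (Gamma rx ry τ).laplace (Gamma rx ry (-τ)) (G.metric τ) (G.metric (-τ))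
      (G.omega0 τ) (G.omega0 (-τ)) s k := by
  cases k <;> rfl

lemma laplace_of_mem_component (τ : Sgn) {α β : Irrep G.Alg} {k : ℕ}
    {ρ : (Gamma rx ry τ).Forms k} (hρ : ρ ∈ (Gamma rx ry τ).component α β k) :
    laplace rx ry τ .plus k ρ = ((-1) ^ k * (E rx ry (-τ) α + E rx ry τ β)) • ρ ∧
    laplace rx ry τ .minus k ρ = ((-1) ^ k * (E rx ry τ α + E rx ry (-τ) β)) • ρ := by
  -- The double sign is not definitional for a variable `τ`; the facts about `-τ` must be rewritten
  -- before they can be paired with those about `τ`.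
  have hτ : - -τ = τ := by cases τ <;> rfl
  have hg' := isInvariantMetric_metric rx ry (-τ)
  have hE' : ∀ (α : Irrep G.Alg), ∀ a ∈ α.coeff, _ := fun α a ha => casimir_sub_apply rx ry (-τ) α ha
  rw [hτ] at hg'
  simp only [hτ] at hE'
  have h := HopfBimod.laplace_eigenvalues (isBicovariant_Gamma rx ry τ)
    (isBicovariant_Gamma rx ry (-τ)) (isCoinvariant_omega0 rx ry τ)
    (isCoinvariant_omega0 rx ry (-τ)) (isInvariantMetric_metric rx ry τ) hg' hρ
  rw [laplace_eq, laplace_eq]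
  exact ⟨h.1 _ _ (hE' α) fun a ha => casimir_sub_apply rx ry τ β ha,
    h.2 _ _ (fun a ha => casimir_sub_apply rx ry τ α ha) (hE' β)⟩

end QuantumGroup

end

theorem proposition5p4 (G : QuantumGroup) (hG : IsCosemisimple G.Alg)
    (x y : ℂ) (hx : G.Admissible x) (hy : G.Admissible y) (rx : G.RForm x) (ry : G.RForm y)
    (τ : Sgn) :
    -- the numbers `E^τ_α`: `𝔰 X₀^τ ∗ h^α ∗ a = E^τ_α h^α ∗ a`
    (∀ (s : Sgn) (α : Irrep G.Alg) (a : G.Alg),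
      G.trD • lstar (QuantumGroup.X0 rx ry s) (lstar α.h a)
        = QuantumGroup.E rx ry s α • lstar α.h a) ∧
    -- `h^{αβ}` maps `Γ^{∧k}` to `Γ^{∧k}(α, β)` and is the identity there
    (∀ (α β : Irrep G.Alg) (k : ℕ) (ρ : (QuantumGroup.Gamma rx ry τ).Forms k),
      (QuantumGroup.Gamma rx ry τ).hForms α β k ρ
        ∈ (QuantumGroup.Gamma rx ry τ).component α β k) ∧
    (∀ (α β : Irrep G.Alg) (k : ℕ), ∀ ρ ∈ (QuantumGroup.Gamma rx ry τ).component α β k,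
      (QuantumGroup.Gamma rx ry τ).hForms α β k ρ = ρ) ∧
    -- `ρ = ∑ h^{αβ}(ρ)`, a finite sum, for all `ρ ∈ Γ^∧`
    (∀ ρ : (QuantumGroup.Gamma rx ry τ).ExtAlg,
      {p : Irrep G.Alg × Irrep G.Alg |
        (QuantumGroup.Gamma rx ry τ).hExt p.1 p.2 ρ ≠ 0}.Finite ∧
      ρ = ∑ᶠ p : Irrep G.Alg × Irrep G.Alg, (QuantumGroup.Gamma rx ry τ).hExt p.1 p.2 ρ) ∧
    -- `Γ^∧` is the direct sum of the subspaces `Γ^{∧k}(α, β)`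
    (iSupIndep fun p : ℕ × Irrep G.Alg × Irrep G.Alg =>
      ((QuantumGroup.Gamma rx ry τ).component p.2.1 p.2.2 p.1).map
        (DirectSum.lof ℂ ℕ (QuantumGroup.Gamma rx ry τ).Forms p.1)) ∧
    (⨆ p : ℕ × Irrep G.Alg × Irrep G.Alg,
      ((QuantumGroup.Gamma rx ry τ).component p.2.1 p.2.2 p.1).map
        (DirectSum.lof ℂ ℕ (QuantumGroup.Gamma rx ry τ).Forms p.1)) = ⊤ ∧
    -- the Laplace-Beltrami operators on `Γ^{∧k}(α, β)`
    (∀ (α β : Irrep G.Alg) (k : ℕ), ∀ ρ ∈ (QuantumGroup.Gamma rx ry τ).component α β k,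
      QuantumGroup.laplace rx ry τ .plus k ρ
          = ((-1) ^ k * (QuantumGroup.E rx ry (-τ) α + QuantumGroup.E rx ry τ β)) • ρ ∧
      QuantumGroup.laplace rx ry τ .minus k ρ
          = ((-1) ^ k * (QuantumGroup.E rx ry τ α + QuantumGroup.E rx ry (-τ) β)) • ρ) := by
  have h := QuantumGroup.isBicovariant_Gamma rx ry τ
  refine ⟨fun s α a => ?_, fun α β k ρ => h.hForms_mem_component hG α β k ρ,
    fun α β k ρ hρ => h.hForms_of_mem_component hG hρ, fun ρ => h.finite_hExt hG ρ,
    h.iSupIndep_component hG, h.iSup_component hG,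
    fun α β k ρ hρ => QuantumGroup.laplace_of_mem_component rx ry τ hρ⟩
  -- Since `h^α ∗ a = P^α(a)` lies in the coefficient coalgebra of `α`, the eigenvalue equation
  -- there applies.
  rw [Irrep.lstar_h hG]
  exact QuantumGroup.E_spec rx ry s α (Irrep.proj_mem hG α a)
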